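/- **Setting.** Minkowski space $M=\mathbb R^4$ has signature $(+,-,-,-)$. Let $C_+$ be the future lightcone without its vertex, $L_{ab}=l_a\partial_b-l_b\partial_a$ (tangential derivatives on $C_+$), and $d^2l$ the spherical angle measure on the section $l^0=1$ (total mass $4\pi$). Homogeneity of degree $d$ means $f(\mu s,\mu l)=\mu^d f(s,l)$ (resp. $f(\mu l)=\mu^d f(l)$) for $\mu>0$. Dots denote $\partial_s$; $\tilde u(\omega,l)=\frac1{2\pi}\int u(s,l)e^{i\omega s}ds$; $(T_xu)(s,l)=u(s-x\cdot l,l)$; $\epsilon(\cdot)$ is the sign function; $t$ is the time axis, so $t\cdot l=l^0$. *The algebra CCR.* Let $e>0$. Let $\mathcal V$ be the additive group of real smooth $V_a(s,l)$ on $\mathbb R\times C_+$, homogeneous of degree $-1$, with $l\cdot V=0$; with, for every $k$, a bound $|L_{b_1c_1}\cdots L_{b_kc_k}\dot V_a|\le \mathrm{const}(k)\,(t\cdot l)^{-2}(1+|s|/t\cdot l)^{-1-\varepsilon}$ for some $\varepsilon>0$ depending on $V$ and $k$; with $V(+\infty,l)=0$; and with $L_{[ab}V_{c]}(-\infty,l)=0$.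 Put $\{V_1,V_2\}=\frac1{4\pi}\int(\dot V_1\cdot V_2-\dot V_2\cdot V_1)\,ds\,d^2l$. Let $L=\mathcal V/\!\sim$, where $V_1\sim V_2$ iff $V_2-V_1=l\,\alpha(s,l)$ with $\frac1{4\pi}\int\alpha(-\infty,l)\,d^2l\in\frac{2\pi}e\mathbb Z$. CCR is the completion in its largest $C^*$-norm of the $*$-algebra with basis $W(V)$, $V\in L$, and $W(V_1)W(V_2)=e^{-\frac i2\{V_1,V_2\}}W(V_1+V_2)$, $W(V)^*=W(-V)$, $W(0)=1$. Translations act by $\alpha_xW(V)=W(T_xV)$. A representation $\pi$ of CCR on a Hilbert space satisfies *Borchers' criterion* iff there is a strongly continuous unitary representation $U$ of the translation group $M$ on that space, with spectrum in the closed forward lightcone $\overline{V_+}$, that implements translations: $\pi(\alpha_xA)=U(x)\pi(A)U(-x)$ for all $A$. The spectrum is the support of the spectral measure $E$ in $U(x)=\int e^{ip\cdot x}dE(p)$. *The extended free field.* Let $\mathcal T$ be the space of classes $[u]$, modulo functions $\alpha(s,l)l_a$ (and null sets), of real measurable $u_a(s,l)$ homogeneous of degree $-2$ with $l\cdot u=0$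 and, for some $\varepsilon>0$, $\int_{l^0=1}u_a(s,l)^2(1+|s|)^{1+\varepsilon}ds\,d^2l<\infty$ for each component; its symplectic form is $\{[u_1],[u_2]\}=\frac1{4\pi}\int d^2l\int u_{1a}(\tau,l)\,\epsilon(\tau-s)\,u_2^a(s,l)\,d\tau\,ds$. Let $\mathcal H_0$ be the Hilbert space of classes $[f]$, modulo $\beta(l)l_a$, of real measurable $f_a(l)$ homogeneous of degree $-1$, with $l\cdot f=0$ and square-integrable components, with scalar product $-\int f_1\cdot f_2\,d^2l$. Let $\mathcal H_{IR}\subset\mathcal H_0$ be the closed span of the gradient classes $[\partial_a\varphi]$, $\varphi$ smooth and homogeneous of degree $0$, and let $\mathcal C^\infty_{IR}$ be the set of elements of $\mathcal H_{IR}$ with a smooth representative. Put $p([u])=[\tilde u(0,\cdot)]\in\mathcal H_0$ and $\hat L=p^{-1}(\mathcal H_{IR})\subset\mathcal T$. On the Weyl algebra over $\hat L$, with generators $\hat W([u])$, consider the state with $\hat\omega(\hat W([u]))=0$ if $p([u])\ne0$ and $=e^{-\frac12F(u,u)}$ if $p([u])=0$, where $F(u_1,u_2)=\int_{\omega\ge0}\big[-\overline{\tilde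 u_1}\cdot\tilde u_2\big]\frac{d\omega}{\omega}\,d^2l$. Let $(\hat{\mathcal H},\hat\pi,\hat\Omega)$ be its GNS representation, let $\hat U(x)$ be the unitaries with $\hat U(x)\hat\pi(\hat W([u]))\hat\Omega=\hat\pi(\hat W([T_xu]))\hat\Omega$, and let $\hat{\mathcal H}_{[f]}$ be the closed span of the vectors $\hat\pi(\hat W([u]))\hat\Omega$ with $p([u])=[f]$. Each $\hat{\mathcal H}_{[f]}$ is invariant under $\hat U(x)$; let $\hat U_{[f]}(x)$ be the restriction. *The direct integral.* Let $h(s,l)$ be any real smooth function, homogeneous of degree $-1$, with $\tilde h(0,l)=1$ and, for some $\varepsilon>0$ and all $k$, $|L_{b_1c_1}\cdots L_{b_kc_k}h|\le\mathrm{const}(k)(1+|s|)^{-1-\varepsilon}$ on $l^0=1$. Let $\mu$ be a nonzero $\sigma$-finite Borel measure on $\mathcal H_{IR}$. Then $\mathcal H=\int_\oplus\hat{\mathcal H}_{[f]}\,d\mu([f])$ consists of the square-integrable (classes of) fields $\Psi([f])=\hat\pi(\hat W([fh]))\psi([f])\in\hat{\mathcal H}_{[f]}$, with $\psi:\mathcal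 H_{IR}\to\hat{\mathcal H}_{[0]}$ measurable. **Theorem.** Suppose that $\mu$ is quasi-invariant under $\mathcal C^\infty_{IR}$: with $\mu_k(B)=\mu(B-k)$, $\mu_k(B)=0\iff\mu(B)=0$ for all Borel $B$ and all $k\in\mathcal C^\infty_{IR}$. Then for each $V\in\mathcal V$ one has $[\dot V]\in\hat L$ and $p([\dot V])\in\mathcal C^\infty_{IR}$, and the formula $$[\pi_r(W(V))\Psi]([f])=\Big(\frac{d\mu_{p([\dot V])}}{d\mu}([f])\Big)^{1/2}\hat\pi(\hat W([\dot V]))\,\Psi([f]-p([\dot V]))$$ defines a (unique) representation $\pi_r$ of CCR on $\mathcal H$. It satisfies Borchers' criterion. The formula $[U_r(x)\Psi]([f])=\hat U_{[f]}(x)\Psi([f])$ defines a (unique) family of bounded operators on $\mathcal H$, which is a strongly continuous unitary representation of the translation group, implements translations in $\pi_r$, and has energy-momentum spectrum $\operatorname{Spec}U_r=\overline{V_+}$, the whole closed forward lightcone. -/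

import Mathlib

open MeasureTheory Filter Topology
open scoped ENNReal ComplexConjugate

noncomputable section
namespace IRQED

/-! ### Weyl algebras -/

/-- An additive group with a real-valued biadditive alternating (possibly degenerate) form. -/
structure SymplecticForm (G : Type) [AddCommGroup G] where
  form : G →+ G →+ ℝ
  alt : ∀ x, form x x = 0

theorem SymplecticForm.swap {G : Type} [AddCommGroup G] (σ : SymplecticForm G) (x y : G) :
    σ.form y x = -σ.form x y := by
  have h := σ.alt (x + y)
  simp only [map_add, AddMonoidHom.add_apply, σ.alt] at h
  linarith

/-- The phase `exp(-i r / 2)`. -/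
def phase (r : ℝ) : ℂ := Complex.exp (-(Complex.I / 2) * r)

theorem phase_add (r s : ℝ) : phase (r + s) = phase r * phase s := by
  rw [phase, phase, phase, ← Complex.exp_add]; push_cast; ring_nf

theorem phase_zero : phase 0 = 1 := by simp [phase]

theorem conj_phase (r : ℝ) : conj (phase r) = phase (-r) := by
  rw [phase, phase, ← Complex.exp_conj]
  simp [Complex.conj_ofNat]
  ring_nf

/-- The *-algebra with basis `W x`, `x ∈ G`, and the relations `W x * W y = e^{-i{x,y}/2} W (x+y)`,
`(W x)^* = W (-x)`, `W 0 = 1`. -/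
def WeylStar {G : Type} [AddCommGroup G] (_σ : SymplecticForm G) : Type := G →₀ ℂ

section Weyl
variable {G : Type} [AddCommGroup G] (σ : SymplecticForm G)

namespace WeylStar

instance : AddCommGroup (WeylStar σ) := inferInstanceAs (AddCommGroup (G →₀ ℂ))
instance : Module ℂ (WeylStar σ) := inferInstanceAs (Module ℂ (G →₀ ℂ))

variable {σ} in
/-- The multiple `c W(x)` of a Weyl generator. -/
def single (x : G) (c : ℂ) : WeylStar σ := Finsupp.single x c

theorem single_add (x : G) (c d : ℂ) :
    (single x (c + d) : WeylStar σ) = single x c + single x d := Finsupp.single_add x c d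

theorem smul_single (x : G) (c d : ℂ) :
    c • (single x d : WeylStar σ) = single x (c * d) := Finsupp.smul_single c x d

theorem induction {p : WeylStar σ → Prop} (a : WeylStar σ) (h0 : p 0)
    (ha : ∀ a b, p a → p b → p (a + b)) (hs : ∀ x c, p (single x c)) : p a :=
  Finsupp.induction_linear a h0 ha hs

/-- Linear extension of a map on Weyl generators. -/
def lift {M : Type} [AddCommGroup M] [Module ℂ M] (f : G → M) : WeylStar σ →ₗ[ℂ] M :=
  Finsupp.linearCombination ℂ f

@[simp] theorem lift_single {M : Type} [AddCommGroup M] [Module ℂ M] (f : G → M) (x : G) (c : ℂ) :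
    lift σ f (single x c) = c • f x := Finsupp.linearCombination_single ℂ c x

/-- The product as a bilinear map. -/
def mulMap : WeylStar σ →ₗ[ℂ] WeylStar σ →ₗ[ℂ] WeylStar σ :=
  lift σ fun x => lift σ fun y => single (x + y) (phase (σ.form x y))

instance : Mul (WeylStar σ) := ⟨fun a b => mulMap σ a b⟩
instance : One (WeylStar σ) := ⟨single 0 1⟩

theorem mul_def (a b : WeylStar σ) : a * b = mulMap σ a b := rfl
theorem one_def : (1 : WeylStar σ) = single 0 1 := rfl

theorem single_mul_single (x y : G) (c d : ℂ) :
    (single x c * single y d : WeylStar σ) = single (x + y) (c * d * phase (σ.form x y)) := by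
  rw [mul_def, mulMap, lift_single, LinearMap.smul_apply, lift_single, smul_single, smul_single]
  congr 1; ring

instance : Ring (WeylStar σ) :=
  { (inferInstance : AddCommGroup (WeylStar σ)),
    (inferInstance : Mul (WeylStar σ)), (inferInstance : One (WeylStar σ)) with
    left_distrib := fun a b c => by simp only [mul_def, map_add]
    right_distrib := fun a b c => by simp only [mul_def, map_add, LinearMap.add_apply]
    zero_mul := fun a => by simp only [mul_def, map_zero, LinearMap.zero_apply]
    mul_zero := fun a => by simp only [mul_def, map_zero]
    mul_assoc := fun a b c => by
      have hadd : ∀ u v w : WeylStar σ, (u + v) * w = u * w + v * w := fun u v w => by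
        simp only [mul_def, map_add, LinearMap.add_apply]
      have hadd' : ∀ u v w : WeylStar σ, u * (v + w) = u * v + u * w := fun u v w => by
        simp only [mul_def, map_add]
      have h0 : ∀ u : WeylStar σ, 0 * u = 0 := fun u => by
        simp only [mul_def, map_zero, LinearMap.zero_apply]
      have h0' : ∀ u : WeylStar σ, u * 0 = 0 := fun u => by simp only [mul_def, map_zero]
      induction a using WeylStar.induction with
      | h0 => simp only [h0]
      | ha a a' h h' => simp only [hadd, h, h']
      | hs x k =>
        induction b using WeylStar.induction with
        | h0 => simp only [h0, h0']
        | ha a a' h h' => simp only [hadd, hadd', h, h']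
        | hs y l =>
          induction c using WeylStar.induction with
          | h0 => simp only [h0']
          | ha a a' h h' => simp only [hadd', h, h']
          | hs z m =>
            rw [single_mul_single, single_mul_single, single_mul_single, single_mul_single,
              add_assoc]
            congr 1
            simp only [map_add, AddMonoidHom.add_apply, phase_add]
            ring
    one_mul := fun a => by
      induction a using WeylStar.induction with
      | h0 => simp only [mul_def, map_zero]
      | ha a b h h' => rw [mul_def] at *; rw [map_add, h, h']
      | hs x c => rw [one_def, single_mul_single]; simp [phase_zero]
    mul_one := fun a => by
      induction a using WeylStar.induction with
      | h0 => simp only [mul_def, map_zero, LinearMap.zero_apply]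
      | ha a b h h' => rw [mul_def] at *; rw [map_add, LinearMap.add_apply, h, h']
      | hs x c => rw [one_def, single_mul_single]; simp [phase_zero] }

instance : Algebra ℂ (WeylStar σ) :=
  Algebra.ofModule (fun r a b => by simp only [mul_def, map_smul, LinearMap.smul_apply])
    (fun r a b => by simp only [mul_def, map_smul])

instance : Star (WeylStar σ) :=
  ⟨fun a => Finsupp.mapDomain (fun x : G => -x)
    (Finsupp.mapRange (starRingEnd ℂ) (map_zero _) (a : G →₀ ℂ))⟩

theorem star_single (x : G) (c : ℂ) :
    star (single x c : WeylStar σ) = single (-x) (conj c) := by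
  change Finsupp.mapDomain _ (Finsupp.mapRange _ _ (Finsupp.single x c)) = Finsupp.single _ _
  rw [Finsupp.mapRange_single, Finsupp.mapDomain_single]

theorem star_add' (a b : WeylStar σ) : star (a + b) = star a + star b := by
  exact (congrArg (Finsupp.mapDomain fun x : G => -x) (Finsupp.mapRange_add
    (hf := map_zero (starRingEnd ℂ)) (map_add (starRingEnd ℂ)) (a : G →₀ ℂ) b)).trans
    Finsupp.mapDomain_add

theorem star_zero' : star (0 : WeylStar σ) = 0 := by
  change Finsupp.mapDomain _ (Finsupp.mapRange _ _ (0 : G →₀ ℂ)) = (0 : G →₀ ℂ)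
  rw [Finsupp.mapRange_zero, Finsupp.mapDomain_zero]

instance : StarRing (WeylStar σ) where
  star_involutive := fun a => by
    induction a using WeylStar.induction with
    | h0 => rw [star_zero', star_zero']
    | ha a b h h' => rw [star_add', star_add', h, h']
    | hs x c => rw [star_single, star_single]; simp
  star_add := star_add' σ
  star_mul := fun a b => by
    induction a using WeylStar.induction with
    | h0 => rw [zero_mul, star_zero', mul_zero]
    | ha a b h h' => rw [add_mul, star_add', h, h', star_add', mul_add]
    | hs x c =>
      induction b using WeylStar.induction with
      | h0 => rw [mul_zero, star_zero', zero_mul]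
      | ha a b h h' => rw [mul_add, star_add', h, h', star_add', add_mul]
      | hs y d =>
        rw [single_mul_single, star_single, star_single, star_single, single_mul_single, neg_add_rev]
        congr 1
        simp only [map_mul, conj_phase, map_neg, AddMonoidHom.neg_apply, neg_neg]
        rw [σ.swap x y]; ring

instance : StarModule ℂ (WeylStar σ) where
  star_smul := fun r a => by
    induction a using WeylStar.induction with
    | h0 => rw [smul_zero, star_zero', smul_zero]
    | ha a b h h' => rw [smul_add, star_add', h, h', star_add', smul_add]
    | hs x c => rw [smul_single, star_single, star_single, smul_single]; simp

end WeylStar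

/-- A C*-seminorm on a complex *-algebra. -/
structure CStarSeminorm (A : Type) [Ring A] [StarRing A] [Algebra ℂ A] extends Seminorm ℂ A where
  mul_le' : ∀ a b, toFun (a * b) ≤ toFun a * toFun b
  star_mul_self' : ∀ a, toFun (star a * a) = toFun a ^ 2

instance {A : Type} [Ring A] [StarRing A] [Algebra ℂ A] :
    CoeFun (CStarSeminorm A) (fun _ => A → ℝ) := ⟨fun p => p.toSeminorm⟩

instance {A : Type} [Ring A] [StarRing A] [Algebra ℂ A] : Nonempty (CStarSeminorm A) :=
  ⟨{ (0 : Seminorm ℂ A) with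
      mul_le' := fun a b => by change (0:ℝ) ≤ 0 * 0; simp
      star_mul_self' := fun a => by change (0:ℝ) = 0 ^ 2; simp }⟩

namespace CStarSeminorm
variable {A : Type} [Ring A] [StarRing A] [Algebra ℂ A] (p : CStarSeminorm A)

theorem mul_le (a b : A) : p (a * b) ≤ p a * p b := p.mul_le' a b
theorem star_mul_self (a : A) : p (star a * a) = p a ^ 2 := p.star_mul_self' a

theorem le_one {a : A} (h : star a * a = 1) : p a ≤ 1 := by
  have h1 := p.star_mul_self (1 : A)
  have h2 := p.star_mul_self a
  rw [star_one, one_mul] at h1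
  rw [h] at h2
  have h3 : 0 ≤ p a := apply_nonneg p.toSeminorm a
  nlinarith [sq_nonneg (p (1:A) - 1)]

/-- Pull-back of a C*-seminorm along a *-homomorphism. -/
def comp {B : Type} [Ring B] [StarRing B] [Algebra ℂ B] (φ : B →⋆ₐ[ℂ] A) : CStarSeminorm B :=
  { p.toSeminorm.comp (φ : B →ₐ[ℂ] A).toLinearMap with
    mul_le' := fun a b => by
      change p (φ (a * b)) ≤ p (φ a) * p (φ b); rw [map_mul]; exact p.mul_le _ _
    star_mul_self' := fun a => by
      change p (φ (star a * a)) = p (φ a) ^ 2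
      rw [map_mul, map_star]; exact p.star_mul_self _ }

end CStarSeminorm

namespace WeylStar

theorem star_single_mul_single (x : G) :
    star (single x 1 : WeylStar σ) * single x 1 = 1 := by
  rw [star_single, single_mul_single, one_def]
  simp [σ.alt, phase_zero]

theorem bddAbove (a : WeylStar σ) :
    BddAbove (Set.range fun p : CStarSeminorm (WeylStar σ) => p a) := by
  induction a using WeylStar.induction with
  | h0 => exact ⟨0, by rintro _ ⟨p, rfl⟩; exact (map_zero p.toSeminorm).le⟩
  | ha a b h h' =>
    obtain ⟨C, hC⟩ := h
    obtain ⟨D, hD⟩ := h'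
    refine ⟨C + D, ?_⟩
    rintro _ ⟨p, rfl⟩
    exact (map_add_le_add p.toSeminorm a b).trans (add_le_add (hC ⟨p, rfl⟩) (hD ⟨p, rfl⟩))
  | hs x c =>
    refine ⟨‖c‖ * 1, ?_⟩
    rintro _ ⟨p, rfl⟩
    have : (single x c : WeylStar σ) = c • single x 1 := by rw [smul_single, mul_one]
    change p.toSeminorm (single x c) ≤ _
    rw [this, map_smul_eq_mul]
    exact mul_le_mul_of_nonneg_left (p.le_one (star_single_mul_single σ x)) (norm_nonneg c)

/-- The largest C*-seminorm of the Weyl *-algebra. -/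
def maxNorm : RingSeminorm (WeylStar σ) where
  toFun a := ⨆ p : CStarSeminorm (WeylStar σ), p a
  map_zero' := by
    have : (fun p : CStarSeminorm (WeylStar σ) => p 0) = fun _ => 0 :=
      funext fun p => map_zero p.toSeminorm
    rw [this]; exact ciSup_const
  add_le' a b := ciSup_le fun p => (map_add_le_add p.toSeminorm a b).trans
    (add_le_add (le_ciSup (bddAbove σ a) p) (le_ciSup (bddAbove σ b) p))
  neg' a := by
    have : (fun p : CStarSeminorm (WeylStar σ) => p (-a)) = fun p => p a :=
      funext fun p => map_neg_eq_map p.toSeminorm a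
    rw [this]
  mul_le' a b := ciSup_le fun p => (p.mul_le a b).trans
    (mul_le_mul (le_ciSup (bddAbove σ a) p) (le_ciSup (bddAbove σ b) p)
      (apply_nonneg p.toSeminorm b)
      ((apply_nonneg p.toSeminorm a).trans (le_ciSup (bddAbove σ a) p)))

instance : SeminormedRing (WeylStar σ) := (maxNorm σ).toSeminormedRing

theorem norm_def (a : WeylStar σ) : ‖a‖ = ⨆ p : CStarSeminorm (WeylStar σ), p a := rfl

theorem le_norm (p : CStarSeminorm (WeylStar σ)) (a : WeylStar σ) : p a ≤ ‖a‖ :=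
  le_ciSup (bddAbove σ a) p

instance : NormedAlgebra ℂ (WeylStar σ) where
  norm_smul_le r a := ciSup_le fun p => by
    change p.toSeminorm (r • a) ≤ _
    rw [map_smul_eq_mul]
    exact mul_le_mul_of_nonneg_left (le_norm σ p a) (norm_nonneg r)

theorem norm_sq_le (a : WeylStar σ) : ‖a‖ * ‖a‖ ≤ ‖star a * a‖ := by
  have h : ‖a‖ ≤ √‖star a * a‖ := ciSup_le fun p => by
    refine Real.le_sqrt_of_sq_le ?_
    rw [← p.star_mul_self]
    exact le_norm σ p _
  calc ‖a‖ * ‖a‖ ≤ √‖star a * a‖ * √‖star a * a‖ := by gcongr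
    _ = _ := Real.mul_self_sqrt (norm_nonneg _)

instance : NormedStarGroup (WeylStar σ) where
  norm_star_le a := by
    have h1 := norm_sq_le σ (star a)
    rw [star_star] at h1
    have h2 := h1.trans (norm_mul_le a (star a))
    rcases (norm_nonneg (star a)).eq_or_lt with h | h
    · rw [← h]; exact norm_nonneg a
    · exact le_of_mul_le_mul_right h2 h

end WeylStar

/-- The Weyl algebra over `(G, σ)`: the completion of the *-algebra generated by the Weyl elements
in its largest C*-norm. -/
def WeylCStar : Type := UniformSpace.Completion (WeylStar σ)

namespace WeylCStar
open UniformSpace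

instance : NormedRing (WeylCStar σ) := inferInstanceAs (NormedRing (Completion (WeylStar σ)))
instance : Algebra ℂ (WeylCStar σ) := inferInstanceAs (Algebra ℂ (Completion (WeylStar σ)))
instance : NormedAlgebra ℂ (WeylCStar σ) where
  norm_smul_le r a := norm_smul_le (α := ℂ) (β := Completion (WeylStar σ)) r a
instance : CompleteSpace (WeylCStar σ) :=
  inferInstanceAs (CompleteSpace (Completion (WeylStar σ)))

/-- The canonical map of the Weyl *-algebra to its completion. -/
def coe (a : WeylStar σ) : WeylCStar σ := (a : Completion (WeylStar σ))

theorem coe_add (a b : WeylStar σ) : coe σ (a + b) = coe σ a + coe σ b := Completion.coe_add a b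
theorem coe_mul (a b : WeylStar σ) : coe σ (a * b) = coe σ a * coe σ b := Completion.coe_mul a b
theorem coe_smul (r : ℂ) (a : WeylStar σ) : coe σ (r • a) = r • coe σ a := Completion.coe_smul r a
theorem norm_coe (a : WeylStar σ) : ‖coe σ a‖ = ‖a‖ := Completion.norm_coe a

theorem induction {p : WeylCStar σ → Prop} (a : WeylCStar σ) (hp : IsClosed {a | p a})
    (h : ∀ a, p (coe σ a)) : p a := Completion.induction_on a hp h

instance : Star (WeylCStar σ) := ⟨Completion.map (star : WeylStar σ → WeylStar σ)⟩

theorem coe_star (a : WeylStar σ) : coe σ (star a) = star (coe σ a) :=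
  (Completion.map_coe star_isometry.uniformContinuous a).symm

theorem continuous_star' : Continuous (star : WeylCStar σ → WeylCStar σ) :=
  Completion.continuous_map

instance : StarRing (WeylCStar σ) where
  star_involutive a := by
    induction a using WeylCStar.induction with
    | hp => exact isClosed_eq ((continuous_star' σ).comp (continuous_star' σ)) continuous_id
    | h a => rw [← coe_star, ← coe_star, star_star]
  star_add a b := by
    induction a using WeylCStar.induction with
    | hp =>
      exact isClosed_eq ((continuous_star' σ).comp (continuous_id.add continuous_const))
        ((continuous_star' σ).add continuous_const)
    | h a =>
      induction b using WeylCStar.induction with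
      | hp =>
        exact isClosed_eq ((continuous_star' σ).comp (continuous_const.add continuous_id))
          (continuous_const.add (continuous_star' σ))
      | h b => rw [← coe_add, ← coe_star, ← coe_star, ← coe_star, ← coe_add, star_add]
  star_mul a b := by
    induction a using WeylCStar.induction with
    | hp =>
      exact isClosed_eq ((continuous_star' σ).comp (continuous_id.mul continuous_const))
        (continuous_const.mul (continuous_star' σ))
    | h a =>
      induction b using WeylCStar.induction with
      | hp =>
        exact isClosed_eq ((continuous_star' σ).comp (continuous_const.mul continuous_id))
          ((continuous_star' σ).mul continuous_const)
      | h b => rw [← coe_mul, ← coe_star, ← coe_star, ← coe_star, ← coe_mul, star_mul]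

instance : StarModule ℂ (WeylCStar σ) where
  star_smul r a := by
    induction a using WeylCStar.induction with
    | hp =>
      exact isClosed_eq ((continuous_star' σ).comp (continuous_const_smul r))
        ((continuous_star' σ).const_smul (star r))
    | h a => rw [← coe_smul, ← coe_star, ← coe_star, ← coe_smul, star_smul]

instance : CStarRing (WeylCStar σ) where
  norm_mul_self_le a := by
    induction a using WeylCStar.induction with
    | hp =>
      exact isClosed_le (continuous_norm.mul continuous_norm)
        (continuous_norm.comp ((continuous_star' σ).mul continuous_id))
    | h a => rw [← coe_star, ← coe_mul, norm_coe, norm_coe]; exact WeylStar.norm_sq_le σ a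

instance : CStarAlgebra (WeylCStar σ) where

/-- The Weyl element `W(x)`. -/
def W (x : G) : WeylCStar σ := coe σ (WeylStar.single x 1)

end WeylCStar

variable {σ} in
/-- The *-homomorphism `W(x) ↦ W(T x)` for an additive map `T` preserving the form. -/
def WeylStar.map (T : G →+ G) (hT : ∀ x y, σ.form (T x) (T y) = σ.form x y) :
    WeylStar σ →⋆ₐ[ℂ] WeylStar σ :=
  { AlgHom.ofLinearMap (WeylStar.lift σ fun x => WeylStar.single (T x) 1)
      (by rw [WeylStar.one_def, WeylStar.lift_single, WeylStar.smul_single, map_zero, mul_one])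
      (fun a b => by
        induction a using WeylStar.induction with
        | h0 => simp
        | ha a b h h' => rw [add_mul, map_add, h, h', map_add, add_mul]
        | hs x c =>
          induction b using WeylStar.induction with
          | h0 => simp
          | ha a b h h' => rw [mul_add, map_add, h, h', map_add, mul_add]
          | hs y d =>
            simp only [WeylStar.single_mul_single, WeylStar.lift_single, WeylStar.smul_single,
              map_add, hT, mul_one]) with
    map_star' := fun a => by
      change WeylStar.lift σ _ (star a) = star (WeylStar.lift σ _ a)
      induction a using WeylStar.induction with
      | h0 => simp
      | ha a b h h' => rw [star_add, map_add, h, h', map_add, star_add]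
      | hs x c =>
        simp only [WeylStar.star_single, WeylStar.lift_single, WeylStar.smul_single, map_neg,
          mul_one] }

theorem WeylStar.map_single (T : G →+ G) (hT : ∀ x y, σ.form (T x) (T y) = σ.form x y)
    (x : G) (c : ℂ) : WeylStar.map T hT (WeylStar.single x c) = WeylStar.single (T x) c := by
  change WeylStar.lift σ _ (WeylStar.single x c) = _
  rw [WeylStar.lift_single, WeylStar.smul_single, mul_one]

theorem WeylStar.norm_map_le (φ : WeylStar σ →⋆ₐ[ℂ] WeylStar σ) (a : WeylStar σ) :
    ‖φ a‖ ≤ ‖a‖ :=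
  ciSup_le fun p => WeylStar.le_norm σ (p.comp φ) a

theorem WeylStar.continuous_map (φ : WeylStar σ →⋆ₐ[ℂ] WeylStar σ) : Continuous φ :=
  AddMonoidHomClass.continuous_of_bound φ 1 fun a => by
    rw [one_mul]; exact WeylStar.norm_map_le σ φ a

namespace WeylCStar
open UniformSpace

variable {σ} in
/-- The continuous extension of a *-endomorphism as a ring homomorphism. -/
def mapRing (φ : WeylStar σ →⋆ₐ[ℂ] WeylStar σ) : WeylCStar σ →+* WeylCStar σ :=
  Completion.mapRingHom (φ : WeylStar σ →+* WeylStar σ)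
    (show Continuous ⇑(φ : WeylStar σ →+* WeylStar σ) from WeylStar.continuous_map σ φ)

theorem mapRing_coe (φ : WeylStar σ →⋆ₐ[ℂ] WeylStar σ) (a : WeylStar σ) :
    mapRing φ (coe σ a) = coe σ (φ a) :=
  Completion.mapRingHom_coe (f := (φ : WeylStar σ →+* WeylStar σ)) (WeylStar.continuous_map σ φ) a

theorem continuous_mapRing (φ : WeylStar σ →⋆ₐ[ℂ] WeylStar σ) : Continuous (mapRing φ) :=
  Completion.continuous_map

variable {σ} in
/-- The *-endomorphism `W(x) ↦ W(T x)` of the Weyl algebra. -/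
def map (T : G →+ G) (hT : ∀ x y, σ.form (T x) (T y) = σ.form x y) :
    WeylCStar σ →⋆ₐ[ℂ] WeylCStar σ :=
  { mapRing (WeylStar.map T hT) with
    commutes' := fun r => by
      change mapRing _ (coe σ (algebraMap ℂ (WeylStar σ) r)) = _
      rw [mapRing_coe, AlgHomClass.commutes]; rfl
    map_star' := fun a => by
      change mapRing _ (star a) = star (mapRing _ a)
      induction a using WeylCStar.induction with
      | hp =>
        exact isClosed_eq ((continuous_mapRing σ _).comp (continuous_star' σ))
          ((continuous_star' σ).comp (continuous_mapRing σ _))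
      | h a => rw [← coe_star, mapRing_coe, mapRing_coe, ← coe_star, map_star] }

theorem map_W (T : G →+ G) (hT : ∀ x y, σ.form (T x) (T y) = σ.form x y) (x : G) :
    map T hT (W σ x) = W σ (T x) := by
  change mapRing _ (coe σ _) = _
  rw [mapRing_coe, WeylStar.map_single]; rfl

end WeylCStar

/-! ### GNS representation of a functional on the Weyl *-algebra -/

/-- The linear functional on the Weyl *-algebra with values `ω x` on `W(x)`. -/
def functional (ω : G → ℂ) : WeylStar σ →ₗ[ℂ] ℂ := WeylStar.lift σ ω

/-- The functional `W(x) ↦ ω x` is hermitian and positive. -/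
def IsPositive (ω : G → ℂ) : Prop :=
  (∀ a, functional σ ω (star a) = conj (functional σ ω a)) ∧
    ∀ a, 0 ≤ (functional σ ω (star a * a)).re

open Classical in
/-- The sesquilinear form `(a, b) ↦ ω(a^* b)` of a positive functional (zero if the functional is
not positive, a case in which there is no GNS representation). -/
def gnsInner (ω : G → ℂ) (a b : WeylStar σ) : ℂ :=
  if IsPositive σ ω then functional σ ω (star a * b) else 0

/-- The Weyl *-algebra with the semi-inner product of a positive functional. -/
def PreGNS (_ω : G → ℂ) : Type := WeylStar σ

namespace PreGNS
variable (ω : G → ℂ)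

instance : AddCommGroup (PreGNS σ ω) := inferInstanceAs (AddCommGroup (WeylStar σ))
instance : Module ℂ (PreGNS σ ω) := inferInstanceAs (Module ℂ (WeylStar σ))

/-- The semi-inner product of the GNS construction. -/
abbrev core : PreInnerProductSpace.Core ℂ (PreGNS σ ω) where
  inner a b := gnsInner σ ω a b
  conj_inner_symm (a b : WeylStar σ) := by
    change conj (gnsInner σ ω b a) = gnsInner σ ω a b
    unfold gnsInner
    split_ifs with h
    · rw [← h.1, star_mul, star_star]
    · exact map_zero _
  re_inner_nonneg (a : WeylStar σ) := by
    change 0 ≤ (gnsInner σ ω a a).re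
    unfold gnsInner
    split_ifs with h
    · exact h.2 a
    · exact le_rfl
  add_left (a b c : WeylStar σ) := by
    change gnsInner σ ω (a + b) c = gnsInner σ ω a c + gnsInner σ ω b c
    unfold gnsInner
    split_ifs with h
    · rw [star_add, add_mul, map_add]
    · exact (add_zero _).symm
  smul_left (a b : WeylStar σ) r := by
    change gnsInner σ ω (r • a) b = conj r * gnsInner σ ω a b
    unfold gnsInner
    split_ifs with h
    · rw [star_smul, smul_mul_assoc, map_smul]; rfl
    · exact (mul_zero _).symm

instance : SeminormedAddCommGroup (PreGNS σ ω) :=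
  InnerProductSpace.Core.toSeminormedAddCommGroup (c := core σ ω)
instance : InnerProductSpace ℂ (PreGNS σ ω) := InnerProductSpace.ofCore (core σ ω)

variable {σ ω} in
/-- An operator on the pre-Hilbert space preserving the semi-inner product. -/
def isometry (φ : WeylStar σ →ₗ[ℂ] WeylStar σ)
    (h : ∀ a, functional σ ω (star (φ a) * φ a) = functional σ ω (star a * a)) :
    PreGNS σ ω →ₗᵢ[ℂ] PreGNS σ ω where
  toLinearMap := φ
  norm_map' (a : WeylStar σ) := by
    have key : gnsInner σ ω (φ a) (φ a) = gnsInner σ ω a a := by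
      unfold gnsInner
      split_ifs
      · exact h a
      · rfl
    exact congrArg (fun z : ℂ => √z.re) key

/-- The identity map from the Weyl *-algebra. -/
def of : WeylStar σ ≃ₗ[ℂ] PreGNS σ ω := LinearEquiv.refl ℂ _

end PreGNS

/-- The GNS Hilbert space. -/
abbrev GNS (ω : G → ℂ) : Type := UniformSpace.Completion (PreGNS σ ω)

namespace GNS
variable (ω : G → ℂ)

/-- The vector of the GNS space given by an element of the Weyl *-algebra. -/
def vec (a : WeylStar σ) : GNS σ ω := (PreGNS.of σ ω a : UniformSpace.Completion (PreGNS σ ω))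

/-- The cyclic vector. -/
def Ω : GNS σ ω := vec σ ω 1

/-- The GNS representation of the Weyl element `W(x)`. -/
def W (x : G) : GNS σ ω →L[ℂ] GNS σ ω :=
  (PreGNS.isometry (ω := ω) (LinearMap.mulLeft ℂ (WeylStar.single x 1 : WeylStar σ)) (fun a => by
    simp only [LinearMap.mulLeft_apply, star_mul]
    rw [mul_assoc, ← mul_assoc (star (WeylStar.single x 1 : WeylStar σ)),
      WeylStar.star_single_mul_single, one_mul])).toContinuousLinearMap.completion

/-- The operator `π(W(x))Ω ↦ π(W(T x))Ω` implementing a symmetry of the functional. -/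
def symm (T : G →+ G) (hT : ∀ x y, σ.form (T x) (T y) = σ.form x y) (hω : ∀ x, ω (T x) = ω x) :
    GNS σ ω →L[ℂ] GNS σ ω :=
  (PreGNS.isometry (ω := ω) (WeylStar.map T hT : WeylStar σ →ₐ[ℂ] WeylStar σ).toLinearMap
    (fun a => by
      have h : ∀ b, functional σ ω (WeylStar.map T hT b) = functional σ ω b := fun b => by
        induction b using WeylStar.induction with
        | h0 => simp
        | ha a b h h' => rw [map_add, map_add, h, h', map_add]
        | hs x c => rw [WeylStar.map_single, functional, WeylStar.lift_single,
            WeylStar.lift_single, hω]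
      change functional σ ω (star (WeylStar.map T hT a) * WeylStar.map T hT a) = _
      rw [← map_star, ← map_mul, h])).toContinuousLinearMap.completion

end GNS

end Weyl

/-! ### Minkowski space and the future lightcone -/

/-- Minkowski space, with contravariant components. -/
abbrev Mink : Type := Fin 4 → ℝ

/-- The Minkowski product, signature `(+,-,-,-)`. -/
def η (x y : Mink) : ℝ := x 0 * y 0 - x 1 * y 1 - x 2 * y 2 - x 3 * y 3

/-- The diagonal metric coefficients, used to lower indices. -/
def metric (a : Fin 4) : ℝ := if a = 0 then 1 else -1

theorem η_add_left (x y z : Mink) : η (x + y) z = η x z + η y z := by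
  simp only [η, Pi.add_apply]; ring
theorem η_add_right (x y z : Mink) : η x (y + z) = η x y + η x z := by
  simp only [η, Pi.add_apply]; ring
theorem η_smul_left (c : ℝ) (x y : Mink) : η (c • x) y = c * η x y := by
  simp only [η, Pi.smul_apply, smul_eq_mul]; ring
theorem η_smul_right (c : ℝ) (x y : Mink) : η x (c • y) = c * η x y := by
  simp only [η, Pi.smul_apply, smul_eq_mul]; ring
theorem η_comm (x y : Mink) : η x y = η y x := by simp only [η]; ring
theorem η_zero_right (x : Mink) : η x 0 = 0 := by simp [η]

theorem continuous_η : Continuous fun p : Mink × Mink => η p.1 p.2 := by unfold η; fun_prop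

/-- The closed forward lightcone (in momentum space). -/
def closedForwardCone : Set Mink := {p | 0 ≤ p 0 ∧ 0 ≤ η p p}

/-- The future lightcone without its vertex. -/
abbrev Cone : Type := {l : Mink // 0 < l 0 ∧ η l l = 0}

/-- The unit sphere of directions. -/
abbrev S2 : Type := Metric.sphere (0 : EuclideanSpace ℝ (Fin 3)) 1

/-- The measure `d²l` on the section `l⁰ = 1` of the cone: the spherical angle measure, of total
mass `4π`. -/
def dl : Measure S2 := (volume : Measure (EuclideanSpace ℝ (Fin 3))).toSphere

instance : IsFiniteMeasure dl := inferInstanceAs (IsFiniteMeasure (Measure.toSphere _))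

theorem S2.sq_sum (n : S2) : n.1 0 ^ 2 + n.1 1 ^ 2 + n.1 2 ^ 2 = 1 := by
  have h : ‖n.1‖ = 1 := by simp
  have h2 := EuclideanSpace.real_norm_sq_eq n.1
  rw [h, Fin.sum_univ_three] at h2
  linarith

/-- The null vector `(1, n)` in the direction `n`. -/
def sec (n : S2) : Cone := ⟨![1, n.1 0, n.1 1, n.1 2], by
  have := n.sq_sum
  refine ⟨by simp, ?_⟩
  simp only [η, Matrix.cons_val]
  linarith⟩

theorem sec_zero (n : S2) : (sec n).1 0 = 1 := by simp [sec]

theorem continuous_sec : Continuous sec := by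
  unfold sec
  refine Continuous.subtype_mk ?_ _
  refine continuous_pi fun i => ?_
  fin_cases i <;> simp <;> fun_prop

theorem abs_sec_le (n : S2) (a : Fin 4) : |(sec n).1 a| ≤ 1 := by
  have h := n.sq_sum
  rw [abs_le_one_iff_mul_self_le_one]
  fin_cases a <;> simp [sec] <;> nlinarith [sq_nonneg (n.1 0), sq_nonneg (n.1 1), sq_nonneg (n.1 2)]

/-- A vector orthogonal to a null vector is spacelike or null; if null, it is proportional. -/
theorem neg_η_nonneg (n : S2) {f : Mink} (h : η (sec n) f = 0) : 0 ≤ -η f f := by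
  have hn := n.sq_sum
  simp only [η, sec, Matrix.cons_val] at h ⊢
  set a := n.1 0; set b := n.1 1; set c := n.1 2
  have h0 : f 0 = a * f 1 + b * f 2 + c * f 3 := by linarith
  have : -(f 0 * f 0 - f 1 * f 1 - f 2 * f 2 - f 3 * f 3)
      = (f 1 - f 0 * a) ^ 2 + (f 2 - f 0 * b) ^ 2 + (f 3 - f 0 * c) ^ 2 := by
    have : (f 1 - f 0 * a) ^ 2 + (f 2 - f 0 * b) ^ 2 + (f 3 - f 0 * c) ^ 2 =
      f 1 ^ 2 + f 2 ^ 2 + f 3 ^ 2 - 2 * f 0 * (a * f 1 + b * f 2 + c * f 3)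
        + f 0 ^ 2 * (a ^ 2 + b ^ 2 + c ^ 2) := by ring
    rw [this, hn, ← h0]; ring
  rw [this]; positivity

/-- `f(μ s, μ l) = μ^d f(s, l)` for `μ > 0`. -/
def Homogeneous {E : Type} [SMul ℝ E] (d : ℤ) (f : ℝ → Cone → E) : Prop :=
  ∀ (μ : ℝ) (l l' : Cone), 0 < μ → l'.1 = μ • l.1 → ∀ s, f (μ * s) l' = μ ^ d • f s l

/-- `f(μ l) = μ^d f(l)` for `μ > 0`. -/
def ConeHomogeneous {E : Type} [SMul ℝ E] (d : ℤ) (f : Cone → E) : Prop :=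
  ∀ (μ : ℝ) (l l' : Cone), 0 < μ → l'.1 = μ • l.1 → f l' = μ ^ d • f l

/-! ### The extended space of field test functions -/

/-- The weight of the norm of `L²_{ε,t}`. -/
def weight (ε s : ℝ) : ℝ := (1 + |s|) ^ (1 + ε)

theorem weight_pos (ε s : ℝ) : 0 < weight ε s := by unfold weight; positivity

theorem weight_mono {ε ε' : ℝ} (h : ε ≤ ε') (s : ℝ) : weight ε s ≤ weight ε' s :=
  Real.rpow_le_rpow_of_exponent_le (by linarith [abs_nonneg s]) (by linarith)

theorem continuous_weight (ε : ℝ) : Continuous (weight ε) := by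
  unfold weight
  refine Continuous.rpow_const (by fun_prop) fun s => Or.inl ?_
  positivity

theorem integrable_inv_weight {ε : ℝ} (h : 0 < ε) : Integrable fun s => (weight ε s)⁻¹ := by
  have := integrable_one_add_norm (E := ℝ) (μ := volume) (r := 1 + ε) (by simp; exact h)
  refine this.congr (Eventually.of_forall fun s => ?_)
  simp only [weight, Real.norm_eq_abs]
  rw [Real.rpow_neg (by positivity)]

/-- Finiteness of the norm of `L²_{ε,t}` for the components, on the section `l⁰ = 1`. -/
def FiniteNorm (ε : ℝ) (u : ℝ → Cone → Mink) : Prop :=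
  ∀ a, Integrable (fun p : S2 × ℝ => (u p.2 (sec p.1) a) ^ 2 * weight ε p.2) (dl.prod volume)

/-- Restriction of a function to the section `l⁰ = 1` of the cone. -/
def onSec {E : Type} (u : ℝ → Cone → E) : S2 × ℝ → E := fun p => u p.2 (sec p.1)

theorem measurable_comp_onSec {u : ℝ → Cone → Mink} (hu : Measurable (onSec u)) (a : Fin 4) :
    Measurable fun p : S2 × ℝ => u p.2 (sec p.1) a := (measurable_pi_apply a).comp hu

theorem FiniteNorm.mono {ε ε' : ℝ} (h : ε ≤ ε') {u : ℝ → Cone → Mink}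
    (hu : Measurable (onSec u)) (H : FiniteNorm ε' u) : FiniteNorm ε u := fun a => by
  refine (H a).mono' ?_ (Eventually.of_forall fun p => ?_)
  · exact (((measurable_comp_onSec hu a).pow_const 2).mul
      ((continuous_weight ε).measurable.comp measurable_snd)).aestronglyMeasurable
  · rw [Real.norm_eq_abs, abs_of_nonneg (mul_nonneg (sq_nonneg _) (weight_pos _ _).le)]
    exact mul_le_mul_of_nonneg_left (weight_mono h _) (sq_nonneg _)

theorem FiniteNorm.add {ε : ℝ} {u v : ℝ → Cone → Mink} (hu : Measurable (onSec u))
    (hv : Measurable (onSec v)) (H : FiniteNorm ε u) (H' : FiniteNorm ε v) :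
    FiniteNorm ε (u + v) := fun a => by
  refine (((H a).const_mul 2).add ((H' a).const_mul 2)).mono' ?_ (Eventually.of_forall fun p => ?_)
  · exact ((((measurable_comp_onSec hu a).add (measurable_comp_onSec hv a)).pow_const 2).mul
      ((continuous_weight ε).measurable.comp measurable_snd)).aestronglyMeasurable
  · rw [Real.norm_eq_abs, abs_of_nonneg (mul_nonneg (sq_nonneg _) (weight_pos _ _).le)]
    simp only [Pi.add_apply]
    have := weight_pos ε p.2
    nlinarith [mul_nonneg (sq_nonneg (u p.2 (sec p.1) a - v p.2 (sec p.1) a)) this.le]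

/-- Real measurable vector functions `u_a(s,l)`, homogeneous of degree `-2`, orthogonal to `l`, with
components in `L²_{ε,t}` for some `ε > 0`, where `t` is the time axis. -/
def preT : Submodule ℝ (ℝ → Cone → Mink) where
  carrier := {u | Homogeneous (-2) u ∧ Measurable (onSec u) ∧
    (∀ s l, η l.1 (u s l) = 0) ∧ ∃ ε > 0, FiniteNorm ε u}
  zero_mem' := ⟨fun μ l l' _ _ s => by simp, measurable_const, fun s l => η_zero_right _,
    1, one_pos, fun a => by simp⟩
  add_mem' := by
    rintro u v ⟨h1, h2, h3, ε, hε, h4⟩ ⟨k1, k2, k3, δ, hδ, k4⟩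
    refine ⟨fun μ l l' hμ hl s => ?_, h2.add k2, fun s l => ?_, min ε δ, lt_min hε hδ,
      (h4.mono (min_le_left _ _) h2).add h2 k2 (k4.mono (min_le_right _ _) k2)⟩
    · simp only [Pi.add_apply, h1 μ l l' hμ hl s, k1 μ l l' hμ hl s, smul_add]
    · simp only [Pi.add_apply, η_add_right, h3, k3, add_zero]
  smul_mem' := by
    rintro c u ⟨h1, h2, h3, ε, hε, h4⟩
    refine ⟨fun μ l l' hμ hl s => ?_, h2.const_smul c, fun s l => ?_, ε, hε, fun a => ?_⟩
    · simp only [Pi.smul_apply, h1 μ l l' hμ hl s, smul_comm c]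
    · simp only [Pi.smul_apply, η_smul_right, h3, mul_zero]
    · refine ((h4 a).const_mul (c ^ 2)).congr (Eventually.of_forall fun p => ?_)
      simp only [Pi.smul_apply, smul_eq_mul]; ring

/-- The functions of the form `α(s,l) l_a`, up to null sets. -/
def nullT : Submodule ℝ preT where
  carrier := {u | ∀ᵐ p ∂(dl.prod volume), ∃ c : ℝ, onSec u.1 p = c • (sec p.1).1}
  zero_mem' := by
    change ∀ᵐ p ∂(dl.prod volume), ∃ c : ℝ, _
    exact Eventually.of_forall fun p => ⟨0, by simp [onSec]⟩
  add_mem' := by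
    intro u v hu hv
    change ∀ᵐ p ∂(dl.prod volume), ∃ c : ℝ, _
    have hu' : ∀ᵐ p ∂(dl.prod volume), ∃ c : ℝ, onSec u.1 p = c • (sec p.1).1 := hu
    have hv' : ∀ᵐ p ∂(dl.prod volume), ∃ c : ℝ, onSec v.1 p = c • (sec p.1).1 := hv
    filter_upwards [hu', hv'] with p ⟨c, hc⟩ ⟨d, hd⟩
    exact ⟨c + d, by rw [add_smul, ← hc, ← hd]; rfl⟩
  smul_mem' := by
    intro c u hu
    change ∀ᵐ p ∂(dl.prod volume), ∃ c : ℝ, _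
    have hu' : ∀ᵐ p ∂(dl.prod volume), ∃ c : ℝ, onSec u.1 p = c • (sec p.1).1 := hu
    filter_upwards [hu'] with p ⟨d, hd⟩
    exact ⟨c * d, by rw [mul_smul, ← hd]; rfl⟩

/-- The space `𝒯` of classes `[u]`, `u` modulo functions `α(s,l) l_a`. -/
abbrev T : Type := preT ⧸ nullT

/-- The class `[u]`. -/
def T.mk (u : preT) : T := Submodule.Quotient.mk u

theorem preT.measurable (u : preT) : Measurable (onSec u.1) := u.2.2.1

/-- Products of components of elements of `𝒯` at different values of `s` are integrable. -/
theorem preT.integrable_mul (u v : preT) (a b : Fin 4) :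
    Integrable (fun p : S2 × ℝ × ℝ => u.1 p.2.1 (sec p.1) a * v.1 p.2.2 (sec p.1) b)
      (dl.prod (volume.prod volume)) := by
  obtain ⟨ε, hε, h⟩ := u.2.2.2.2
  obtain ⟨δ, hδ, k⟩ := v.2.2.2.2
  have mu := measurable_comp_onSec (preT.measurable u) a
  have mv := measurable_comp_onSec (preT.measurable v) b
  have e1 : MeasurePreserving (fun p : S2 × ℝ × ℝ => ((p.1, p.2.1), p.2.2))
      (dl.prod (volume.prod volume)) ((dl.prod volume).prod volume) :=
    (measurePreserving_prodAssoc dl volume volume).symm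
  have e2 : MeasurePreserving (fun p : S2 × ℝ × ℝ => (p.1, p.2.2, p.2.1))
      (dl.prod (volume.prod volume)) (dl.prod (volume.prod volume)) :=
    (MeasurePreserving.id dl).prod Measure.measurePreserving_swap
  have i1 := e1.integrable_comp_of_integrable ((h a).mul_prod (integrable_inv_weight hδ))
  have i2 := (e1.comp e2).integrable_comp_of_integrable
    ((k b).mul_prod (integrable_inv_weight hε))
  refine (i1.add i2).mono' ?_ (Eventually.of_forall fun p => ?_)
  · refine Measurable.aestronglyMeasurable ?_
    exact (mu.comp (measurable_fst.prodMk (measurable_fst.comp measurable_snd))).mul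
      (mv.comp (measurable_fst.prodMk (measurable_snd.comp measurable_snd)))
  · simp only [Pi.add_apply, Function.comp_apply]
    set x := u.1 p.2.1 (sec p.1) a
    set y := v.1 p.2.2 (sec p.1) b
    have w1 := weight_pos ε p.2.1
    have w2 := weight_pos δ p.2.2
    set r := weight ε p.2.1
    set t := weight δ p.2.2
    rw [Real.norm_eq_abs, abs_le]
    have e : x ^ 2 * r * t⁻¹ + y ^ 2 * t * r⁻¹ = (x ^ 2 * r ^ 2 + y ^ 2 * t ^ 2) / (r * t) := by
      field_simp
    rw [e]
    constructor
    · rw [neg_le_iff_add_nonneg, ← sub_nonneg]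
      have : x * y + (x ^ 2 * r ^ 2 + y ^ 2 * t ^ 2) / (r * t) - 0 =
        ((x * r + y * t) ^ 2 - x * r * (y * t)) / (r * t) := by field_simp; ring
      rw [this]
      refine div_nonneg ?_ (by positivity)
      nlinarith [sq_nonneg (x * r), sq_nonneg (y * t), sq_nonneg (x * r + y * t)]
    · rw [le_div_iff₀ (by positivity)]
      nlinarith [sq_nonneg (x * r - y * t), sq_nonneg (x * r), sq_nonneg (y * t)]

theorem integral_congr_zero {X : Type} [MeasurableSpace X] {m : Measure X} {f : X → ℝ}
    (h : ∀ᵐ x ∂m, f x = 0) : ∫ x, f x ∂m = 0 := by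
  rw [integral_congr_ae (g := fun _ => (0 : ℝ)) h, integral_zero]

theorem measurable_sign : Measurable Real.sign := by
  unfold Real.sign
  exact Measurable.ite measurableSet_Iio measurable_const
    (Measurable.ite measurableSet_Ioi measurable_const measurable_const)

theorem abs_sign_le (r : ℝ) : |Real.sign r| ≤ 1 := by
  rcases Real.sign_apply_eq r with h | h | h <;> simp [h]

/-- The integrand `u₁(τ,l)·u₂(s,l) ε(τ - s)` of the symplectic form, at the point `(l, τ, s)`. -/
def symKer (u v : preT) (p : S2 × ℝ × ℝ) : ℝ :=
  η (u.1 p.2.1 (sec p.1)) (v.1 p.2.2 (sec p.1)) * Real.sign (p.2.1 - p.2.2)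

theorem symKer_integrable (u v : preT) :
    Integrable (symKer u v) (dl.prod (volume.prod volume)) := by
  have h := (((preT.integrable_mul u v 0 0).sub (preT.integrable_mul u v 1 1)).sub
    (preT.integrable_mul u v 2 2)).sub (preT.integrable_mul u v 3 3)
  refine h.mul_bdd (c := 1) ?_ (Eventually.of_forall fun p => abs_sign_le _)
  exact (measurable_sign.comp (by fun_prop)).aestronglyMeasurable

/-- The symplectic form on representatives. -/
def symPre : preT →ₗ[ℝ] preT →ₗ[ℝ] ℝ :=
  LinearMap.mk₂ ℝ (fun u v => 1 / (4 * Real.pi) *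
      ∫ p, symKer u v p ∂(dl.prod (volume.prod volume)))
    (fun u u' v => by
      rw [← mul_add, ← integral_add (symKer_integrable u v) (symKer_integrable u' v)]
      congr 2; ext p
      simp only [symKer, Submodule.coe_add, Pi.add_apply, η_add_left, add_mul])
    (fun c u v => by
      rw [smul_eq_mul, mul_left_comm, ← integral_const_mul c]
      congr 1
      refine integral_congr_ae (Eventually.of_forall fun p => ?_)
      simp only [symKer, Submodule.coe_smul, Pi.smul_apply, η_smul_left, mul_assoc])
    (fun u v v' => by
      rw [← mul_add, ← integral_add (symKer_integrable u v) (symKer_integrable u v')]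
      congr 2; ext p
      simp only [symKer, Submodule.coe_add, Pi.add_apply, η_add_right, add_mul])
    (fun c u v => by
      rw [smul_eq_mul, mul_left_comm, ← integral_const_mul c]
      congr 1
      refine integral_congr_ae (Eventually.of_forall fun p => ?_)
      simp only [symKer, Submodule.coe_smul, Pi.smul_apply, η_smul_right, mul_assoc])

theorem symPre_apply (u v : preT) : symPre u v = 1 / (4 * Real.pi) *
    ∫ p, symKer u v p ∂(dl.prod (volume.prod volume)) := rfl

theorem swap_mp : MeasurePreserving (fun p : S2 × ℝ × ℝ => (p.1, p.2.2, p.2.1))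
    (dl.prod (volume.prod volume)) (dl.prod (volume.prod volume)) :=
  (MeasurePreserving.id dl).prod Measure.measurePreserving_swap

theorem symPre_swap (u v : preT) : symPre v u = -symPre u v := by
  have e : MeasurableEquiv (S2 × ℝ × ℝ) (S2 × ℝ × ℝ) :=
    MeasurableEquiv.prodCongr (MeasurableEquiv.refl _) MeasurableEquiv.prodComm
  rw [symPre_apply, symPre_apply, ← mul_neg, ← integral_neg]
  congr 1
  rw [← (swap_mp.integral_comp (MeasurableEquiv.prodCongr (MeasurableEquiv.refl S2)
    (MeasurableEquiv.prodComm (α := ℝ) (β := ℝ))).measurableEmbedding (symKer v u))]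
  congr 1; ext p
  simp only [symKer]
  rw [η_comm, ← neg_sub, Real.sign_neg, mul_neg]

theorem nullT_iff (u : preT) : u ∈ nullT ↔
    ∀ᵐ p ∂(dl.prod volume), ∃ c : ℝ, onSec u.1 p = c • (sec p.1).1 := Iff.rfl

theorem proj_qmp : Measure.QuasiMeasurePreserving (fun p : S2 × ℝ × ℝ => (p.1, p.2.1))
    (dl.prod (volume.prod volume)) (dl.prod volume) := by
  have e1 : MeasurePreserving (fun p : S2 × ℝ × ℝ => ((p.1, p.2.1), p.2.2))
      (dl.prod (volume.prod volume)) ((dl.prod volume).prod volume) :=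
    (measurePreserving_prodAssoc dl volume volume).symm
  exact Measure.quasiMeasurePreserving_fst.comp e1.quasiMeasurePreserving

theorem symPre_null {u : preT} (hu : u ∈ nullT) (v : preT) : symPre u v = 0 := by
  rw [symPre_apply, integral_congr_zero, mul_zero]
  filter_upwards [proj_qmp.ae hu] with p ⟨c, hc⟩
  have hc' : u.1 p.2.1 (sec p.1) = c • (sec p.1).1 := hc
  simp only [symKer]
  rw [hc', η_smul_left, v.2.2.2.1]
  simp

/-- The symplectic form `{[u₁],[u₂]} = (1/4π) ∫ u₁(τ,l)·u₂(s,l) ε(τ-s) dτ ds d²l` on `𝒯`. -/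
def symT : T →ₗ[ℝ] T →ₗ[ℝ] ℝ :=
  symPre.liftQ₂ nullT nullT
    (fun u hu => by
      rw [LinearMap.mem_ker]; ext v; exact symPre_null hu v)
    (fun u hu => by
      rw [LinearMap.mem_ker]; ext v
      rw [LinearMap.flip_apply, symPre_swap, symPre_null hu]; simp)

theorem symT_mk (u v : preT) : symT (T.mk u) (T.mk v) = symPre u v := rfl

theorem T.ind {p : T → Prop} (u : T) (h : ∀ u, p (T.mk u)) : p u :=
  Submodule.Quotient.induction_on _ u h

theorem symT_self (u : T) : symT u u = 0 := by
  induction u using T.ind with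
  | h u => rw [symT_mk]; have := symPre_swap u u; linarith

/-! ### Translations -/

theorem abs_η_sec_le (x : Mink) (n : S2) : |η x (sec n).1| ≤ |x 0| + |x 1| + |x 2| + |x 3| := by
  have h : ∀ a, |x a * (sec n).1 a| ≤ |x a| := fun a => by
    rw [abs_mul]; exact mul_le_of_le_one_right (abs_nonneg _) (abs_sec_le n a)
  unfold η
  refine (abs_sub _ _).trans (add_le_add ((abs_sub _ _).trans (add_le_add
    ((abs_sub _ _).trans (add_le_add (h 0) (h 1))) (h 2))) (h 3))

/-- `(T_x u)(s,l) = u(s - x·l, l)`. -/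
def shift {E : Type} (x : Mink) (u : ℝ → Cone → E) : ℝ → Cone → E := fun s l => u (s - η x l.1) l

/-- The shear map `(l, s) ↦ (l, s - x·l)`. -/
def shear (x : Mink) (p : S2 × ℝ) : S2 × ℝ := (p.1, p.2 - η x (sec p.1).1)

theorem measurable_η_sec (x : Mink) : Measurable fun n : S2 => η x (sec n).1 :=
  (continuous_η.comp (continuous_const.prodMk
    (continuous_subtype_val.comp continuous_sec))).measurable

theorem shear_mp (x : Mink) : MeasurePreserving (shear x) (dl.prod volume) (dl.prod volume) := by
  refine (MeasurePreserving.id dl).skew_product (g := fun n s => s - η x (sec n).1) ?_ ?_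
  · exact measurable_snd.sub ((measurable_η_sec x).comp measurable_fst)
  · exact Eventually.of_forall fun n => (measurePreserving_sub_right volume (η x (sec n).1)).map_eq

theorem weight_shift (ε : ℝ) (hε : 0 < ε) (K : ℝ) (s k : ℝ) (hk : |k| ≤ K) :
    weight ε s ≤ (1 + K) ^ (1 + ε) * weight ε (s - k) := by
  have hK : 0 ≤ K := (abs_nonneg k).trans hk
  unfold weight
  rw [← Real.mul_rpow (by positivity) (by positivity)]
  refine Real.rpow_le_rpow (by positivity) ?_ (by positivity)
  have : |s| ≤ |s - k| + |k| := by simpa using abs_add_le (s - k) k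
  nlinarith [mul_nonneg hK (abs_nonneg (s - k))]

theorem shift_mem (x : Mink) {u : ℝ → Cone → Mink} (hu : u ∈ preT) : shift x u ∈ preT := by
  obtain ⟨h1, h2, h3, ε, hε, h4⟩ := hu
  refine ⟨fun μ l l' hμ hl s => ?_, h2.comp (shear_mp x).measurable, fun s l => h3 _ _,
    ε, hε, fun a => ?_⟩
  · simp only [shift]
    rw [hl, η_smul_right, ← mul_sub]
    exact h1 μ l l' hμ hl _
  · have i := ((shear_mp x).integrable_comp_of_integrable (h4 a)).const_mul
      ((1 + (|x 0| + |x 1| + |x 2| + |x 3|)) ^ (1 + ε))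
    have hm : Measurable (onSec (shift x u)) := h2.comp (shear_mp x).measurable
    refine i.mono' ?_ (Eventually.of_forall fun p => ?_)
    · exact (((measurable_comp_onSec hm a).pow_const 2).mul
        ((continuous_weight ε).measurable.comp measurable_snd)).aestronglyMeasurable
    · rw [Real.norm_eq_abs, abs_of_nonneg (mul_nonneg (sq_nonneg _) (weight_pos _ _).le)]
      simp only [shift, shear, Function.comp_apply]
      rw [mul_left_comm]
      exact mul_le_mul_of_nonneg_left (weight_shift ε hε _ _ _ (abs_η_sec_le x _)) (sq_nonneg _)

/-- Translations on representatives. -/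
def shiftPre (x : Mink) : preT →ₗ[ℝ] preT where
  toFun u := ⟨shift x u.1, shift_mem x u.2⟩
  map_add' _ _ := rfl
  map_smul' _ _ := rfl

/-- The translation `T_x` on `𝒯`. -/
def shiftT (x : Mink) : T →ₗ[ℝ] T :=
  nullT.mapQ nullT (shiftPre x) fun _u hu => (shear_mp x).quasiMeasurePreserving.ae hu

theorem shiftT_mk (x : Mink) (u : preT) : shiftT x (T.mk u) = T.mk (shiftPre x u) := rfl

theorem symPre_shift (x : Mink) (u v : preT) :
    symPre (shiftPre x u) (shiftPre x v) = symPre u v := by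
  have hm : Measurable fun p : S2 × ℝ × ℝ => η x (sec p.1).1 :=
    (measurable_η_sec x).comp measurable_fst
  have mp : MeasurePreserving
      (fun p : S2 × ℝ × ℝ => (p.1, p.2.1 - η x (sec p.1).1, p.2.2 - η x (sec p.1).1))
      (dl.prod (volume.prod volume)) (dl.prod (volume.prod volume)) := by
    refine (MeasurePreserving.id dl).skew_product
      (g := fun n (s : ℝ × ℝ) => (s.1 - η x (sec n).1, s.2 - η x (sec n).1)) ?_ ?_
    · exact (((measurable_fst.comp measurable_snd).sub hm).prodMk
        ((measurable_snd.comp measurable_snd).sub hm))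
    · exact Eventually.of_forall fun n =>
        ((measurePreserving_sub_right volume (η x (sec n).1)).prod
          (measurePreserving_sub_right volume (η x (sec n).1))).map_eq
  rw [symPre_apply, symPre_apply]
  congr 1
  have h := integral_map mp.aemeasurable (f := symKer u v) (by
    rw [mp.map_eq]; exact (symKer_integrable u v).aestronglyMeasurable)
  rw [mp.map_eq] at h
  rw [h]
  congr 1; ext p
  simp only [symKer, sub_sub_sub_cancel_right]
  rfl

theorem symT_shift (x : Mink) (u v : T) : symT (shiftT x u) (shiftT x v) = symT u v := by
  induction u using T.ind with
  | h u =>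
    induction v using T.ind with
    | h v => exact symPre_shift x u v

/-! ### The form `F` -/

/-- `ũ_a(ω, l) = (1/2π) ∫ u_a(s,l) e^{iωs} ds`. -/
def fourier (u : preT) (w : ℝ) (l : Cone) (a : Fin 4) : ℂ :=
  (1 / (2 * Real.pi) : ℝ) * ∫ s : ℝ, (u.1 s l a : ℂ) * Complex.exp (Complex.I * w * s)

/-- The Minkowski product of complex vectors, conjugate linear on the left. -/
def ηC (x y : Fin 4 → ℂ) : ℂ :=
  conj (x 0) * y 0 - conj (x 1) * y 1 - conj (x 2) * y 2 - conj (x 3) * y 3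

/-- `F(u₁,u₂) = ∫_{ω ≥ 0} (- conj ũ₁(ω,l) · ũ₂(ω,l)) (dω/ω) d²l` on representatives. -/
def FPre (u v : preT) : ℂ :=
  ∫ p : S2 × ℝ, -ηC (fourier u p.2 (sec p.1)) (fourier v p.2 (sec p.1)) / (p.2 : ℂ)
    ∂(dl.prod (volume.restrict (Set.Ioi 0)))

/-- The form `F` on `𝒯`. -/
def F (u v : T) : ℂ := FPre (Quotient.out u) (Quotient.out v)

theorem preT.integrable_slice (u : preT) : ∀ᵐ n ∂dl, ∀ a, Integrable fun s => u.1 s (sec n) a := by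
  obtain ⟨ε, hε, h⟩ := u.2.2.2.2
  rw [ae_all_iff]
  intro a
  filter_upwards [(h a).prod_right_ae] with n hn
  have m : Measurable fun s => u.1 s (sec n) a :=
    (measurable_comp_onSec (preT.measurable u) a).comp (measurable_const.prodMk measurable_id)
  refine (hn.add (integrable_inv_weight hε)).mono' m.aestronglyMeasurable
    (Eventually.of_forall fun s => ?_)
  simp only [Pi.add_apply, Real.norm_eq_abs]
  have w := weight_pos ε s
  have : u.1 s (sec n) a ^ 2 * weight ε s + (weight ε s)⁻¹
      = ((|u.1 s (sec n) a| * weight ε s) ^ 2 + 1) * (weight ε s)⁻¹ := by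
    rw [mul_pow, sq_abs]; field_simp
  rw [this, ← div_eq_mul_inv, le_div_iff₀ w]
  nlinarith [sq_nonneg (|u.1 s (sec n) a| * weight ε s - 1)]

theorem η_fourier (u : preT) : ∀ᵐ n ∂dl, ∀ w,
    ηC (fun a => ((sec n).1 a : ℂ)) (fourier u w (sec n)) = 0 := by
  filter_upwards [preT.integrable_slice u] with n hn w
  have hi : ∀ a, Integrable fun s : ℝ => (u.1 s (sec n) a : ℂ) * Complex.exp (Complex.I * w * s) :=
    fun a => by
      refine (hn a).ofReal.mul_bdd (c := 1) ?_ (Eventually.of_forall fun s => ?_)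
      · exact Continuous.aestronglyMeasurable (by fun_prop)
      · rw [show Complex.I * w * s = ((w * s : ℝ) : ℂ) * Complex.I by push_cast; ring,
          Complex.norm_exp_ofReal_mul_I]
  have e : ηC (fun a => ((sec n).1 a : ℂ)) (fourier u w (sec n)) =
      (1 / (2 * Real.pi) : ℝ) * ∫ s : ℝ, ((η (sec n).1 (u.1 s (sec n)) : ℝ) : ℂ) *
        Complex.exp (Complex.I * w * s) := by
    have : ∀ s : ℝ, ((η (sec n).1 (u.1 s (sec n)) : ℝ) : ℂ) * Complex.exp (Complex.I * w * s) =
        (sec n).1 0 * (u.1 s (sec n) 0 * Complex.exp (Complex.I * w * s)) -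
        (sec n).1 1 * (u.1 s (sec n) 1 * Complex.exp (Complex.I * w * s)) -
        (sec n).1 2 * (u.1 s (sec n) 2 * Complex.exp (Complex.I * w * s)) -
        (sec n).1 3 * (u.1 s (sec n) 3 * Complex.exp (Complex.I * w * s)) := fun s => by
      simp only [η]; push_cast; ring
    simp only [this]
    have j := fun a => (hi a).const_mul ((sec n).1 a : ℂ)
    rw [integral_sub (by exact ((j 0).sub (j 1)).sub (j 2)) (j 3),
      integral_sub (by exact (j 0).sub (j 1)) (j 2), integral_sub (j 0) (j 1)]
    simp only [integral_const_mul, ηC, fourier, Complex.conj_ofReal]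
    ring
  rw [e]
  simp [u.2.2.2.1]

theorem fourier_congr {u v : preT} (h : T.mk u = T.mk v) : ∀ᵐ n ∂dl, ∀ w, ∃ c : ℂ,
    ∀ a, fourier u w (sec n) a = fourier v w (sec n) a + c * ((sec n).1 a : ℂ) := by
  have h' : ∀ᵐ p ∂(dl.prod volume), ∃ c : ℝ, onSec (u - v).1 p = c • (sec p.1).1 :=
    (Submodule.Quotient.eq nullT).1 h
  filter_upwards [preT.integrable_slice u, preT.integrable_slice v,
    Measure.ae_ae_of_ae_prod h'] with n hu hv hn w
  have hi : ∀ f : ℝ → ℝ, Integrable f →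
      Integrable fun s : ℝ => (f s : ℂ) * Complex.exp (Complex.I * w * s) :=
    fun f hf => by
      refine hf.ofReal.mul_bdd (c := 1) ?_ (Eventually.of_forall fun s => ?_)
      · exact Continuous.aestronglyMeasurable (by fun_prop)
      · rw [show Complex.I * w * s = ((w * s : ℝ) : ℂ) * Complex.I by push_cast; ring,
          Complex.norm_exp_ofReal_mul_I]
  refine ⟨fourier u w (sec n) 0 - fourier v w (sec n) 0, fun a => ?_⟩
  have key : ∀ a, fourier u w (sec n) a - fourier v w (sec n) a = (1 / (2 * Real.pi) : ℝ) *
      ∫ s : ℝ, ((u.1 s (sec n) a - v.1 s (sec n) a : ℝ) : ℂ) *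
        Complex.exp (Complex.I * w * s) := fun a => by
    rw [fourier, fourier, ← mul_sub, ← integral_sub (hi _ (hu a)) (hi _ (hv a))]
    congr 2; ext s; push_cast; ring
  rw [key 0, mul_assoc, ← integral_mul_const, ← sub_eq_iff_eq_add', key a]
  congr 1
  refine integral_congr_ae ?_
  filter_upwards [hn] with s ⟨c, hc⟩
  have hc' : ∀ a, u.1 s (sec n) a - v.1 s (sec n) a = c * (sec n).1 a := fun a => congrFun hc a
  rw [hc', hc', sec_zero]
  push_cast; ring

theorem ηC_sec (n : S2) : ηC (fun a => ((sec n).1 a : ℂ)) (fun a => ((sec n).1 a : ℂ)) = 0 := by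
  have := (sec n).2.2
  simp only [ηC, Complex.conj_ofReal]
  rw [η] at this
  exact_mod_cast this

theorem ηC_conj (x y : Fin 4 → ℂ) : ηC x y = conj (ηC y x) := by
  simp only [ηC, map_sub, map_mul, Complex.conj_conj]; ring

theorem FPre_congr {u u' v v' : preT} (h : T.mk u = T.mk u') (k : T.mk v = T.mk v') :
    FPre u v = FPre u' v' := by
  refine integral_congr_ae ?_
  have := Measure.quasiMeasurePreserving_fst (μ := dl) (ν := volume.restrict (Set.Ioi (0 : ℝ)))
  filter_upwards [this.ae (fourier_congr h), this.ae (fourier_congr k), this.ae (η_fourier u'),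
    this.ae (η_fourier v')] with p h1 h2 h3 h4
  obtain ⟨c, hc⟩ := h1 p.2
  obtain ⟨d, hd⟩ := h2 p.2
  have e1 := h3 p.2
  rw [ηC_conj, map_eq_zero] at e1
  have e2 := h4 p.2
  have e3 := ηC_sec p.1
  congr 2
  simp only [ηC, hc, hd, map_add, map_mul, Complex.conj_ofReal] at e1 e2 e3 ⊢
  linear_combination d * e1 + conj c * e2 + conj c * d * e3

theorem F_mk (u v : preT) : F (T.mk u) (T.mk v) = FPre u v :=
  FPre_congr (Quotient.out_eq' (T.mk u)) (Quotient.out_eq' (T.mk v))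

theorem fourier_shift (x : Mink) (u : preT) (w : ℝ) (l : Cone) (a : Fin 4) :
    fourier (shiftPre x u) w l a = Complex.exp (Complex.I * w * η x l.1) * fourier u w l a := by
  rw [fourier, fourier, mul_left_comm, ← integral_const_mul (Complex.exp _)]
  congr 1
  rw [← integral_sub_right_eq_self (fun s : ℝ => Complex.exp (Complex.I * w * η x l.1) *
    ((u.1 s l a : ℂ) * Complex.exp (Complex.I * w * s))) (η x l.1)]
  congr 1; ext s
  change (u.1 (s - η x l.1) l a : ℂ) * _ = _
  rw [mul_left_comm, ← Complex.exp_add]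
  congr 2; push_cast; ring

theorem F_shift (x : Mink) (u v : T) : F (shiftT x u) (shiftT x v) = F u v := by
  induction u using T.ind with
  | h u =>
    induction v using T.ind with
    | h v =>
      rw [shiftT_mk, shiftT_mk, F_mk, F_mk]
      unfold FPre
      congr 1; ext p
      have : conj (Complex.exp (Complex.I * p.2 * η x (sec p.1).1)) *
          Complex.exp (Complex.I * p.2 * η x (sec p.1).1) = 1 := by
        rw [← Complex.exp_conj, ← Complex.exp_add]; simp
      congr 2
      simp only [ηC, fourier_shift, map_mul]
      linear_combination (conj (fourier u p.2 (sec p.1) 0) * fourier v p.2 (sec p.1) 0 -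
        conj (fourier u p.2 (sec p.1) 1) * fourier v p.2 (sec p.1) 1 -
        conj (fourier u p.2 (sec p.1) 2) * fourier v p.2 (sec p.1) 2 -
        conj (fourier u p.2 (sec p.1) 3) * fourier v p.2 (sec p.1) 3) * this

/-! ### Differentiation on the cone -/

/-- The length of the spatial part. -/
def spatial (y : Mink) : ℝ := √(y 1 ^ 2 + y 2 ^ 2 + y 3 ^ 2)

/-- The vector of the future lightcone with the same nonvanishing spatial part (some fixed vector,
if the spatial part vanishes). -/
def toCone (y : Mink) : Cone :=
  if h : 0 < spatial y then ⟨![spatial y, y 1, y 2, y 3], by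
    refine ⟨by simpa using h, ?_⟩
    have : spatial y ^ 2 = y 1 ^ 2 + y 2 ^ 2 + y 3 ^ 2 := Real.sq_sqrt (by positivity)
    simp only [η, Matrix.cons_val]
    linarith⟩
  else ⟨![1, 1, 0, 0], by simp [η]⟩

theorem spatial_cone (l : Cone) : spatial l.1 = l.1 0 := by
  have h := l.2.2
  rw [η] at h
  rw [spatial, Real.sqrt_eq_iff_mul_self_eq_of_pos l.2.1]
  linarith

theorem toCone_coe (l : Cone) : toCone l.1 = l := by
  have h : 0 < spatial l.1 := by rw [spatial_cone]; exact l.2.1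
  rw [toCone, dif_pos h]
  ext i
  fin_cases i <;> simp [spatial_cone]

section Differentiation
variable {E : Type} [NormedAddCommGroup E] [NormedSpace ℝ E]

/-- The extension of a function on the cone to Minkowski space that is independent of time. -/
def coneExt (f : Cone → E) (y : Mink) : E := f (toCone y)

/-- `∂_a f`, for the extension of `f` independent of time. Tangential derivatives do not depend on
the choice of extension. -/
def pd (a : Fin 4) (f : Cone → E) (l : Cone) : E := fderiv ℝ (coneExt f) l.1 (Pi.single a 1)

/-- The tangential derivative `L_{ab} = l_a ∂_b - l_b ∂_a`. -/
def Lop (a b : Fin 4) (f : Cone → E) (l : Cone) : E :=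
  (metric a * l.1 a) • pd b f l - (metric b * l.1 b) • pd a f l

/-- `L_{a₁b₁} ⋯ L_{aₖbₖ} f`. -/
def iterL (I : List (Fin 4 × Fin 4)) (f : Cone → E) : Cone → E :=
  I.foldr (fun p g => Lop p.1 p.2 g) f

/-- Infinitely differentiable functions on the cone. -/
def SmoothCone (f : Cone → E) : Prop :=
  ContDiffOn ℝ ((⊤ : ℕ∞) : WithTop ℕ∞) (coneExt f) {y | 0 < spatial y}

/-- Infinitely differentiable functions on `ℝ × Cone`. -/
def Smooth (f : ℝ → Cone → E) : Prop :=
  ContDiffOn ℝ ((⊤ : ℕ∞) : WithTop ℕ∞) (fun q : ℝ × Mink => coneExt (f q.1) q.2)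
    {q | 0 < spatial q.2}

end Differentiation

/-! ### The space of infrared characteristics -/

/-- Real vector functions `f_a(l)`, homogeneous of degree `-1`, orthogonal to `l`, with
square-integrable components. -/
def preH0 : Submodule ℝ (Cone → Mink) where
  carrier := {f | ConeHomogeneous (-1) f ∧ Measurable (fun n => f (sec n)) ∧
    (∀ l, η l.1 (f l) = 0) ∧ ∀ a, MemLp (fun n => f (sec n) a) 2 dl}
  zero_mem' := ⟨fun μ l l' _ _ => by simp, measurable_const, fun l => η_zero_right _,
    fun a => by simp⟩
  add_mem' := by
    rintro u v ⟨h1, h2, h3, h4⟩ ⟨k1, k2, k3, k4⟩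
    refine ⟨fun μ l l' hμ hl => ?_, h2.add k2, fun l => ?_, fun a => (h4 a).add (k4 a)⟩
    · simp only [Pi.add_apply, h1 μ l l' hμ hl, k1 μ l l' hμ hl, smul_add]
    · simp only [Pi.add_apply, η_add_right, h3, k3, add_zero]
  smul_mem' := by
    rintro c u ⟨h1, h2, h3, h4⟩
    refine ⟨fun μ l l' hμ hl => ?_, h2.const_smul c, fun l => ?_, fun a => (h4 a).const_mul c⟩
    · simp only [Pi.smul_apply, h1 μ l l' hμ hl, smul_comm c]
    · simp only [Pi.smul_apply, η_smul_right, h3, mul_zero]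

/-- The representatives of elements of `𝓗₀`, with the scalar product `-∫ f₁·f₂ d²l`. -/
def PreH0 : Type := preH0

namespace PreH0

instance : AddCommGroup PreH0 := inferInstanceAs (AddCommGroup preH0)
instance : Module ℝ PreH0 := inferInstanceAs (Module ℝ preH0)

/-- The underlying function. -/
def fn (f : PreH0) : Cone → Mink := f.1

theorem hom (f : PreH0) : ConeHomogeneous (-1) f.fn := f.2.1
theorem orth (f : PreH0) (l : Cone) : η l.1 (f.fn l) = 0 := f.2.2.2.1 l

theorem integrable_η (f g : PreH0) : Integrable (fun n => -η (f.fn (sec n)) (g.fn (sec n))) dl := by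
  have h : ∀ a, Integrable (fun n => f.fn (sec n) a * g.fn (sec n) a) dl := fun a =>
    (f.2.2.2.2 a).integrable_mul (g.2.2.2.2 a)
  exact (((h 0).sub (h 1)).sub ((h 2)) |>.sub (h 3)).neg

/-- The scalar product. -/
abbrev core : PreInnerProductSpace.Core ℝ PreH0 where
  inner f g := ∫ n, -η (f.fn (sec n)) (g.fn (sec n)) ∂dl
  conj_inner_symm f g := by
    simp only [conj_trivial]
    congr 1; ext n; rw [η_comm]
  re_inner_nonneg f := integral_nonneg fun n => neg_η_nonneg n (f.2.2.2.1 _)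
  add_left f g k := by
    rw [← integral_add (integrable_η f k) (integrable_η g k)]
    congr 1; ext n
    change -η (f.fn (sec n) + g.fn (sec n)) _ = _
    rw [η_add_left, neg_add]
  smul_left f g r := by
    simp only [conj_trivial]
    rw [← integral_const_mul]
    congr 1; ext n
    change -η (r • f.fn (sec n)) _ = _
    rw [η_smul_left, mul_neg]

instance : SeminormedAddCommGroup PreH0 :=
  InnerProductSpace.Core.toSeminormedAddCommGroup (c := core)
instance : InnerProductSpace ℝ PreH0 := InnerProductSpace.ofCore core

theorem inner_def (f g : PreH0) :
    inner ℝ f g = ∫ n, -η (f.fn (sec n)) (g.fn (sec n)) ∂dl := rfl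

theorem norm_eq_zero_of_ae {f : PreH0} (h : ∀ᵐ n ∂dl, f.fn (sec n) = 0) : ‖f‖ = 0 := by
  have : inner ℝ f f = 0 := by
    rw [inner_def]
    refine integral_congr_zero ?_
    filter_upwards [h] with n hn
    rw [hn, η_zero_right, neg_zero]
  rw [real_inner_self_eq_norm_sq] at this
  exact pow_eq_zero_iff two_ne_zero |>.1 this

end PreH0

/-- The space `𝓗₀` of the classes `[f]`, `f` modulo functions `β(l) l_a`. -/
abbrev H0 : Type := SeparationQuotient PreH0

instance : MeasurableSpace H0 := borel H0
instance : BorelSpace H0 := ⟨rfl⟩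

/-- The class `[f]`. -/
def H0.mk (f : PreH0) : H0 := SeparationQuotient.mk f

theorem H0.mk_eq_of_ae {f g : PreH0} (h : ∀ᵐ n ∂dl, f.fn (sec n) = g.fn (sec n)) :
    H0.mk f = H0.mk g := by
  refine SeparationQuotient.mk_eq_mk.2 (Metric.inseparable_iff.2 ?_)
  rw [dist_eq_norm]
  refine PreH0.norm_eq_zero_of_ae ?_
  filter_upwards [h] with n hn
  change f.fn (sec n) - g.fn (sec n) = 0
  rw [hn, sub_self]

theorem H0.mk_eq_zero_of_ae {f : PreH0} (h : ∀ᵐ n ∂dl, ∃ c : ℝ, f.fn (sec n) = c • (sec n).1) :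
    H0.mk f = 0 := by
  refine SeparationQuotient.mk_eq_mk.2 (Metric.inseparable_iff.2 ?_)
  rw [dist_zero_right]
  have : inner ℝ f f = 0 := by
    rw [PreH0.inner_def]
    refine integral_congr_zero ?_
    filter_upwards [h] with n ⟨c, hn⟩
    rw [hn, η_smul_left, η_smul_right, (sec n).2.2]
    simp
  rw [real_inner_self_eq_norm_sq] at this
  exact pow_eq_zero_iff two_ne_zero |>.1 this

/-- The class of the gradient `∂_a φ` of a smooth function, homogeneous of degree `0`. -/
def IsGradient (x : H0) : Prop :=
  ∃ φ : Cone → ℝ, SmoothCone φ ∧ ConeHomogeneous 0 φ ∧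
    ∃ f : PreH0, H0.mk f = x ∧ ∀ l a, f.fn l a = metric a * pd a φ l

/-- The space `𝓗_IR`, the closure of the space of classes of gradients. -/
def HIRsub : Submodule ℝ H0 := (Submodule.span ℝ {x | IsGradient x}).topologicalClosure

/-- The space `𝓗_IR` as a Hilbert space. -/
abbrev HIR : Type := HIRsub

/-- The elements of `𝓗_IR` with a smooth representative. -/
def IsSmoothIR (k : HIR) : Prop := ∃ f : PreH0, H0.mk f = k.1 ∧ SmoothCone f.fn

/-! ### The zero-frequency part -/

/-- `ũ(0,l) = (1/2π) ∫ u(s,l) ds`. -/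
def zeroMode (u : ℝ → Cone → Mink) (l : Cone) : Mink := (1 / (2 * Real.pi)) • ∫ s, u s l

theorem integral_comp_eval {u : ℝ → Mink} (h : ∀ a, Integrable fun s => u s a) (a : Fin 4) :
    (∫ s, u s) a = ∫ s, u s a :=
  ((ContinuousLinearMap.proj (R := ℝ) (φ := fun _ : Fin 4 => ℝ) a).integral_comp_comm
    (Integrable.of_eval h)).symm

theorem zeroMode_mem (u : preT) : zeroMode u.1 ∈ preH0 := by
  refine ⟨fun μ l l' hμ hl => ?_, ?_, fun l => ?_, fun a => ?_⟩
  · have h := Measure.integral_comp_mul_left (fun s => u.1 s l') μ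
    have h2 : ∀ s, u.1 (μ * s) l' = μ ^ (-2 : ℤ) • u.1 s l := fun s => u.2.1 μ l l' hμ hl s
    simp only [h2, abs_of_pos (inv_pos.2 hμ)] at h
    rw [integral_smul] at h
    rw [zeroMode, zeroMode, smul_comm]
    congr 1
    have h3 := congrArg (fun z => μ • z) h
    simp only [smul_smul, mul_inv_cancel₀ hμ.ne', one_smul] at h3
    rw [← h3]
    congr 1
    rw [zpow_neg, zpow_neg, zpow_one, zpow_ofNat]
    field_simp
  · have : StronglyMeasurable (onSec u.1) := (preT.measurable u).stronglyMeasurable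
    exact (this.integral_prod_right'.measurable).const_smul (1 / (2 * Real.pi))
  · rw [zeroMode, η_smul_right]
    by_cases hi : Integrable fun s => u.1 s l
    · have hc : ∀ a, (∫ s, u.1 s l) a = ∫ s, u.1 s l a :=
        integral_comp_eval fun a => hi.eval a
      have hz : ∫ s, η l.1 (u.1 s l) = η l.1 (∫ s, u.1 s l) := by
        have j := fun a => (hi.eval a).const_mul (l.1 a)
        simp only [η, hc]
        rw [integral_sub (by exact ((j 0).sub (j 1)).sub (j 2)) (j 3),
          integral_sub (by exact (j 0).sub (j 1)) (j 2), integral_sub (j 0) (j 1)]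
        simp only [integral_const_mul]
      rw [← hz]
      simp [u.2.2.2.1]
    · rw [integral_undef hi, η_zero_right, mul_zero]
  · have hm : Measurable fun n => zeroMode u.1 (sec n) a := by
      have : StronglyMeasurable (onSec u.1) := (preT.measurable u).stronglyMeasurable
      exact (measurable_pi_apply a).comp
        ((this.integral_prod_right'.measurable).const_smul (1 / (2 * Real.pi)))
    rw [memLp_two_iff_integrable_sq hm.aestronglyMeasurable]
    have i := ((preT.integrable_mul u u a a).integral_prod_left).const_mul
      ((1 / (2 * Real.pi)) ^ 2)
    refine i.congr ?_
    filter_upwards [preT.integrable_slice u] with n hn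
    have := integral_prod_mul (μ := (volume : Measure ℝ)) (ν := (volume : Measure ℝ))
      (fun s => u.1 s (sec n) a) (fun s => u.1 s (sec n) a)
    simp only [zeroMode, Pi.smul_apply, smul_eq_mul]
    rw [this, integral_comp_eval hn]
    ring

/-- `ũ(0,·)` on representatives. -/
def pPre : preT →ₗ[ℝ] H0 where
  toFun u := H0.mk ⟨zeroMode u.1, zeroMode_mem u⟩
  map_add' u v := by
    refine (H0.mk_eq_of_ae (g := (⟨zeroMode u.1, zeroMode_mem u⟩ : PreH0) +
      (⟨zeroMode v.1, zeroMode_mem v⟩ : PreH0)) ?_)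
    filter_upwards [preT.integrable_slice u, preT.integrable_slice v] with n hu hv
    change zeroMode _ _ = zeroMode _ _ + zeroMode _ _
    rw [zeroMode, zeroMode, zeroMode, ← smul_add, ← integral_add (Integrable.of_eval hu)
      (Integrable.of_eval hv)]
    rfl
  map_smul' c u := by
    refine (H0.mk_eq_of_ae (g := c • (⟨zeroMode u.1, zeroMode_mem u⟩ : PreH0)) ?_)
    refine Eventually.of_forall fun n => ?_
    change zeroMode _ _ = c • zeroMode _ _
    rw [zeroMode, zeroMode, smul_comm c, ← integral_smul c]
    rfl

theorem pPre_null {u : preT} (hu : u ∈ nullT) : pPre u = 0 := by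
  refine H0.mk_eq_zero_of_ae ?_
  filter_upwards [Measure.ae_ae_of_ae_prod ((nullT_iff u).1 hu), preT.integrable_slice u]
    with n hn hi
  refine ⟨zeroMode u.1 (sec n) 0, ?_⟩
  change zeroMode u.1 (sec n) = _
  ext a
  simp only [zeroMode, Pi.smul_apply, smul_eq_mul]
  rw [integral_comp_eval hi, integral_comp_eval hi, mul_assoc, ← integral_mul_const]
  congr 1
  refine integral_congr_ae ?_
  filter_upwards [hn] with s ⟨c, hc⟩
  have hc' : ∀ a, u.1 s (sec n) a = c * (sec n).1 a := fun a => congrFun hc a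
  simp only [hc', sec_zero, mul_one]

/-- The map `p : 𝒯 → 𝓗₀`, `p([u]) = [ũ(0,·)]`. -/
def p : T →ₗ[ℝ] H0 := nullT.liftQ pPre fun _u hu => LinearMap.mem_ker.2 (pPre_null hu)

theorem p_mk (u : preT) : p (T.mk u) = H0.mk ⟨zeroMode u.1, zeroMode_mem u⟩ := rfl

theorem p_shift (x : Mink) (u : T) : p (shiftT x u) = p u := by
  induction u using T.ind with
  | h u =>
    rw [shiftT_mk, p_mk, p_mk]
    refine H0.mk_eq_of_ae (Eventually.of_forall fun n => ?_)
    change zeroMode (shift x u.1) (sec n) = zeroMode u.1 (sec n)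
    rw [zeroMode, zeroMode]
    congr 1
    exact integral_sub_right_eq_self (fun s => u.1 s (sec n)) _

/-! ### The extended free field algebra and its states -/

/-- The symplectic space `L̂^f = p⁻¹(𝓗_IR)`. -/
def LhatSub : Submodule ℝ T := HIRsub.comap p

/-- The symplectic space `L̂^f` as a type. -/
abbrev Lhat : Type := LhatSub

/-- The map `p` from `L̂^f` to `𝓗_IR`. -/
def pIR (u : Lhat) : HIR := ⟨p u.1, u.2⟩

/-- The symplectic form of `L̂^f`. -/
def symLhat : SymplecticForm Lhat where
  form :=
    AddMonoidHom.mk' (fun u => AddMonoidHom.mk' (fun v => symT u.1 v.1)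
      fun v w => by rw [Submodule.coe_add, map_add])
      fun u v => by
        ext w
        change symT (u + v : Lhat).1 w.1 = symT u.1 w.1 + symT v.1 w.1
        rw [Submodule.coe_add, map_add, LinearMap.add_apply]
  alt u := symT_self u.1

open Classical in
/-- The values of the functional on the Weyl elements: `0` if `p([u]) ≠ 0`, and
`exp(-F(u,u)/2)` if `p([u]) = 0`. -/
def vacuum (u : Lhat) : ℂ := if pIR u = 0 then Complex.exp (-(1 / 2) * F u.1 u.1) else 0

/-- The translation `T_x` on `L̂^f`. -/
def shiftLhat (x : Mink) : Lhat →+ Lhat where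
  toFun u := ⟨shiftT x u.1, by
    change p (shiftT x u.1) ∈ HIRsub
    rw [p_shift]
    exact u.2⟩
  map_zero' := by ext; simp
  map_add' u v := by ext; simp

/-- The Hilbert space `Ĥ` of the GNS representation. -/
abbrev Hhat : Type := GNS symLhat vacuum

/-- The operators `π̂(Ŵ([u]))`. -/
def What (u : Lhat) : Hhat →L[ℂ] Hhat := GNS.W symLhat vacuum u

/-- The cyclic vector `Ω̂`. -/
def Ωhat : Hhat := GNS.Ω symLhat vacuum

/-- The translation operators `Û(x)`. -/
def Uhat (x : Mink) : Hhat →L[ℂ] Hhat :=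
  GNS.symm symLhat vacuum (shiftLhat x) (fun u v => symT_shift x u.1 v.1) fun u => by
    have h : pIR (shiftLhat x u) = pIR u := Subtype.ext (p_shift x u.1)
    have h' : F (shiftLhat x u).1 (shiftLhat x u).1 = F u.1 u.1 := F_shift x u.1 u.1
    unfold vacuum
    rw [h, h']

/-- The subspace `Ĥ_[f]`, the closed span of the vectors `π̂(Ŵ([u])) Ω̂` with `p([u]) = [f]`. -/
def fiber (f : HIR) : Submodule ℂ Hhat :=
  (Submodule.span ℂ {ψ | ∃ u : Lhat, pIR u = f ∧ ψ = What u Ωhat}).topologicalClosure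

/-! ### Profiles -/

/-- A real smooth function `h(s,l)`, homogeneous of degree `-1`, with `h̃(0,l) = 1` and with
derivatives `L_{a₁b₁} ⋯ L_{aₖbₖ} h` falling off faster than `1/|s|`. -/
structure Profile where
  /-- the function -/
  h : ℝ → Cone → ℝ
  smooth : Smooth h
  homogeneous : Homogeneous (-1) h
  decay : ∃ ε > 0, ∀ k : ℕ, ∃ C : ℝ, ∀ I : List (Fin 4 × Fin 4), I.length = k → ∀ s n,
    |iterL I (h s) (sec n)| ≤ C / weight ε s
  norm : ∀ l, 1 / (2 * Real.pi) * ∫ s, h s l = 1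

theorem continuous_toCone_sec : Continuous fun p : S2 × ℝ => (p.2, (sec p.1).1) :=
  continuous_snd.prodMk (continuous_subtype_val.comp (continuous_sec.comp continuous_fst))

theorem Smooth.continuous_onSec {E : Type} [NormedAddCommGroup E] [NormedSpace ℝ E] {f : ℝ → Cone → E} (hf : Smooth f) : Continuous (onSec f) := by
  have h := hf.continuousOn.comp_continuous continuous_toCone_sec fun p => by
    change 0 < spatial (sec p.1).1
    rw [spatial_cone, sec_zero]; exact one_pos
  refine h.congr fun p => ?_
  change f p.2 (toCone (sec p.1).1) = f p.2 (sec p.1)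
  rw [toCone_coe]

theorem Profile.smear_mem (h : Profile) (f : PreH0) :
    (fun s l => h.h s l • f.fn l) ∈ preT := by
  obtain ⟨ε, hε, hd⟩ := h.decay
  obtain ⟨C, hC⟩ := hd 0
  have hC' : ∀ s n, |h.h s (sec n)| ≤ C / weight ε s := hC [] rfl
  have hm : Measurable (onSec h.h) := h.smooth.continuous_onSec.measurable
  have hmu : Measurable (onSec fun s l => h.h s l • f.fn l) :=
    hm.smul (f.2.2.1.comp measurable_fst)
  refine ⟨fun μ l l' hμ hl s => ?_, hmu, fun s l => ?_, ε, hε, fun a => ?_⟩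
  · change h.h (μ * s) l' • f.fn l' = _
    rw [h.homogeneous μ l l' hμ hl, f.hom μ l l' hμ hl, smul_smul, smul_smul, smul_eq_mul]
    congr 1
    rw [show (-2 : ℤ) = -1 + -1 by norm_num, zpow_add₀ hμ.ne']; ring
  · rw [η_smul_right, f.orth, mul_zero]
  · have i := (((f.2.2.2.2 a).integrable_sq).mul_prod (integrable_inv_weight hε)).const_mul (C ^ 2)
    refine i.mono' ?_ (Eventually.of_forall fun p => ?_)
    · exact (((measurable_comp_onSec hmu a).pow_const 2).mul
        ((continuous_weight ε).measurable.comp measurable_snd)).aestronglyMeasurable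
    · have w := weight_pos ε p.2
      rw [Real.norm_eq_abs, abs_of_nonneg (mul_nonneg (sq_nonneg _) w.le)]
      simp only [Pi.smul_apply, smul_eq_mul]
      have h1 : h.h p.2 (sec p.1) ^ 2 ≤ (C / weight ε p.2) ^ 2 := by
        rw [← sq_abs (h.h p.2 (sec p.1))]
        exact pow_le_pow_left₀ (abs_nonneg _) (hC' _ _) 2
      calc (h.h p.2 (sec p.1) * f.fn (sec p.1) a) ^ 2 * weight ε p.2
          = h.h p.2 (sec p.1) ^ 2 * (f.fn (sec p.1) a ^ 2 * weight ε p.2) := by ring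
        _ ≤ (C / weight ε p.2) ^ 2 * (f.fn (sec p.1) a ^ 2 * weight ε p.2) :=
            mul_le_mul_of_nonneg_right h1 (by positivity)
        _ = C ^ 2 * (f.1 (sec p.1) a ^ 2 * (weight ε p.2)⁻¹) := by
            change _ = C ^ 2 * (f.fn (sec p.1) a ^ 2 * (weight ε p.2)⁻¹)
            field_simp

/-- A representative of an element of `𝓗_IR`. -/
def HIR.rep (f : HIR) : PreH0 := Quotient.out f.1

theorem HIR.mk_rep (f : HIR) : H0.mk f.rep = f.1 := Quotient.out_eq f.1

theorem Profile.p_smear (h : Profile) (f : PreH0) :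
    p (T.mk ⟨_, h.smear_mem f⟩) = H0.mk f := by
  rw [p_mk]
  refine H0.mk_eq_of_ae (Eventually.of_forall fun n => ?_)
  change (1 / (2 * Real.pi)) • ∫ s, h.h s (sec n) • f.fn (sec n) = f.fn (sec n)
  rw [integral_smul_const, smul_smul, h.norm, one_smul]

/-- The element `[f h]` of `L̂^f`. -/
def smear (h : Profile) (f : HIR) : Lhat :=
  ⟨T.mk ⟨_, h.smear_mem f.rep⟩, by
    rw [LhatSub, Submodule.mem_comap, h.p_smear, HIR.mk_rep]; exact f.2⟩

theorem pIR_smear (h : Profile) (f : HIR) : pIR (smear h f) = f :=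
  Subtype.ext ((h.p_smear f.rep).trans (HIR.mk_rep f))

section Differentiation
variable {E : Type} [NormedAddCommGroup E] [NormedSpace ℝ E]

theorem isOpen_spatial : IsOpen {y : Mink | 0 < spatial y} := by
  refine isOpen_lt continuous_const ?_
  unfold spatial; fun_prop

theorem spatial_toCone (y : Mink) : 0 < spatial (toCone y).1 := by
  rw [spatial_cone]; exact (toCone y).2.1

theorem contDiffOn_toCone : ContDiffOn ℝ ((⊤ : ℕ∞) : WithTop ℕ∞) (fun y => (toCone y).1)
    {y | 0 < spatial y} := by
  have h : ContDiffOn ℝ ((⊤ : ℕ∞) : WithTop ℕ∞) (fun y => (![spatial y, y 1, y 2, y 3] : Mink))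
      {y | 0 < spatial y} := by
    refine contDiffOn_pi.2 fun i => ?_
    fin_cases i
    · refine ContDiffOn.sqrt (by fun_prop) fun y hy => ?_
      exact (Real.sqrt_pos.1 hy).ne'
    · exact (contDiff_apply ℝ ℝ (1 : Fin 4)).contDiffOn
    · exact (contDiff_apply ℝ ℝ (2 : Fin 4)).contDiffOn
    · exact (contDiff_apply ℝ ℝ (3 : Fin 4)).contDiffOn
  refine h.congr fun y hy => ?_
  have hy' : 0 < spatial y := hy
  simp only [toCone, dif_pos hy']

theorem SmoothCone.differentiableAt {f : Cone → E} (hf : SmoothCone f) (l : Cone) :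
    DifferentiableAt ℝ (coneExt f) l.1 :=
  (hf.differentiableOn (by simp)).differentiableAt
    (isOpen_spatial.mem_nhds (by change 0 < spatial l.1; rw [spatial_cone]; exact l.2.1))

theorem SmoothCone.pd {f : Cone → E} (hf : SmoothCone f) (a : Fin 4) : SmoothCone (pd a f) := by
  have h := hf.fderiv_of_isOpen isOpen_spatial (m := ((⊤ : ℕ∞) : WithTop ℕ∞)) (by simp)
  have h2 := (h.comp contDiffOn_toCone fun y _ => spatial_toCone y)
  exact h2.clm_apply contDiffOn_const

theorem smoothCone_coord (a : Fin 4) : SmoothCone fun l => metric a * l.1 a := by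
  have h := contDiffOn_pi.1 contDiffOn_toCone a
  exact contDiffOn_const.mul h

theorem SmoothCone.Lop {f : Cone → E} (hf : SmoothCone f) (a b : Fin 4) :
    SmoothCone (Lop a b f) :=
  ((smoothCone_coord a).smul (hf.pd b)).sub ((smoothCone_coord b).smul (hf.pd a))

theorem SmoothCone.iterL {f : Cone → E} (hf : SmoothCone f) (I : List (Fin 4 × Fin 4)) :
    SmoothCone (iterL I f) := by
  induction I with
  | nil => exact hf
  | cons p I ih => exact ih.Lop p.1 p.2

theorem pd_add {f g : Cone → E} (hf : SmoothCone f) (hg : SmoothCone g) (a : Fin 4) (l : Cone) :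
    pd a (f + g) l = pd a f l + pd a g l := by
  have : coneExt (f + g) = coneExt f + coneExt g := rfl
  rw [pd, this, fderiv_add (hf.differentiableAt l) (hg.differentiableAt l)]; rfl

theorem pd_neg (f : Cone → E) (a : Fin 4) (l : Cone) : pd a (-f) l = -pd a f l := by
  have : coneExt (-f) = -coneExt f := rfl
  rw [pd, this, fderiv_neg]; rfl

theorem Lop_add {f g : Cone → E} (hf : SmoothCone f) (hg : SmoothCone g) (a b : Fin 4) :
    Lop a b (f + g) = Lop a b f + Lop a b g := by
  funext l
  simp only [Lop, pd_add hf hg, Pi.add_apply, smul_add]; abel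

theorem Lop_neg (f : Cone → E) (a b : Fin 4) : Lop a b (-f) = -Lop a b f := by
  funext l
  simp only [Lop, pd_neg, Pi.neg_apply, smul_neg]; abel

theorem iterL_add {f g : Cone → E} (hf : SmoothCone f) (hg : SmoothCone g)
    (I : List (Fin 4 × Fin 4)) : iterL I (f + g) = iterL I f + iterL I g := by
  induction I with
  | nil => rfl
  | cons p I ih =>
    change Lop p.1 p.2 (iterL I (f + g)) = _
    rw [ih, Lop_add (hf.iterL I) (hg.iterL I)]; rfl

theorem iterL_neg (f : Cone → E) (I : List (Fin 4 × Fin 4)) : iterL I (-f) = -iterL I f := by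
  induction I with
  | nil => rfl
  | cons p I ih =>
    change Lop p.1 p.2 (iterL I (-f)) = _
    rw [ih, Lop_neg]; rfl

theorem iterL_zero (I : List (Fin 4 × Fin 4)) : iterL I (0 : Cone → E) = 0 := by
  have h := iterL_add (f := (0 : Cone → E)) (g := 0) contDiffOn_const contDiffOn_const I
  rw [add_zero] at h
  exact left_eq_add.1 h

/-- The derivative `∂f/∂s`. -/
def dot (f : ℝ → Cone → E) (s : ℝ) (l : Cone) : E := deriv (fun s => f s l) s

theorem isOpen_prod_spatial : IsOpen {q : ℝ × Mink | 0 < spatial q.2} :=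
  isOpen_spatial.preimage continuous_snd

theorem Smooth.hasDerivAt_ext {f : ℝ → Cone → E} (hf : Smooth f) (s : ℝ) {y : Mink}
    (hy : 0 < spatial y) : HasDerivAt (fun s => coneExt (f s) y)
      (fderiv ℝ (fun q : ℝ × Mink => coneExt (f q.1) q.2) (s, y) (1, 0)) s := by
  have h : DifferentiableAt ℝ (fun q : ℝ × Mink => coneExt (f q.1) q.2) (s, y) :=
    (hf.differentiableOn (by simp)).differentiableAt (isOpen_prod_spatial.mem_nhds hy)
  exact h.hasFDerivAt.comp_hasDerivAt s ((hasDerivAt_id s).prodMk (hasDerivAt_const s y))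

theorem Smooth.hasDerivAt {f : ℝ → Cone → E} (hf : Smooth f) (s : ℝ) (l : Cone) :
    HasDerivAt (fun s => f s l) (dot f s l) s := by
  have h := hf.hasDerivAt_ext s (spatial_toCone l.1)
  simp only [coneExt, toCone_coe] at h
  exact h.differentiableAt.hasDerivAt

theorem Smooth.dot {f : ℝ → Cone → E} (hf : Smooth f) : Smooth (dot f) := by
  have h := hf.fderiv_of_isOpen isOpen_prod_spatial (m := ((⊤ : ℕ∞) : WithTop ℕ∞)) (by simp)
  refine (h.clm_apply (contDiffOn_const (c := ((1 : ℝ), (0 : Mink))))).congr fun q hq => ?_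
  exact (hf.hasDerivAt_ext q.1 hq).deriv

theorem Smooth.slice {f : ℝ → Cone → E} (hf : Smooth f) (s : ℝ) : SmoothCone (f s) := by
  have h : ContDiffOn ℝ ((⊤ : ℕ∞) : WithTop ℕ∞) (fun y : Mink => (s, y)) {y | 0 < spatial y} := by
    fun_prop
  exact ContDiffOn.comp (g := fun q : ℝ × Mink => coneExt (f q.1) q.2) hf h fun y hy => hy

theorem Smooth.add {f g : ℝ → Cone → E} (hf : Smooth f) (hg : Smooth g) : Smooth (f + g) :=
  ContDiffOn.add hf hg

theorem Smooth.neg {f : ℝ → Cone → E} (hf : Smooth f) : Smooth (-f) := ContDiffOn.neg hf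

theorem dot_add {f g : ℝ → Cone → E} (hf : Smooth f) (hg : Smooth g) :
    dot (f + g) = dot f + dot g := by
  funext s l
  exact ((hf.hasDerivAt s l).add (hg.hasDerivAt s l)).deriv

theorem dot_neg {f : ℝ → Cone → E} (hf : Smooth f) : dot (-f) = -dot f := by
  funext s l
  exact (hf.hasDerivAt s l).neg.deriv

theorem dot_zero : dot (0 : ℝ → Cone → E) = 0 := by
  funext s l
  exact deriv_const s (0 : E)

end Differentiation

/-! ### Test functions of the asymptotic electromagnetic field -/

/-- The fall-off condition
`|L_{b₁c₁} ⋯ L_{bₖcₖ} V̇_a(s,l)| ≤ const / ((t·l)² (1 + |s|/t·l)^{1+ε})`, `t` the time axis. -/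
def FallsOff (V : ℝ → Cone → Mink) : Prop :=
  ∀ k : ℕ, ∃ ε > 0, ∃ C : ℝ, ∀ I : List (Fin 4 × Fin 4), I.length = k → ∀ s l a,
    |iterL I (dot V s) l a| ≤ C / (l.1 0 ^ 2 * weight ε (s / l.1 0))

/-- The limit `V(-∞,l)` exists, is smooth, and satisfies `L_{[ab} V_{c]}(-∞,l) = 0`. -/
def PastLimit (V : ℝ → Cone → Mink) : Prop :=
  ∃ Vm : Cone → Mink, (∀ l, Tendsto (fun s => V s l) atBot (𝓝 (Vm l))) ∧ SmoothCone Vm ∧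
    ∀ a b c l, metric c * Lop a b Vm l c + metric a * Lop b c Vm l a + metric b * Lop c a Vm l b = 0

/-- The space of test functions `V_a(s,l)`. -/
def TestV : AddSubgroup (ℝ → Cone → Mink) where
  carrier := {V | Homogeneous (-1) V ∧ Smooth V ∧ (∀ s l, η l.1 (V s l) = 0) ∧ FallsOff V ∧
    (∀ l, Tendsto (fun s => V s l) atTop (𝓝 0)) ∧ PastLimit V}
  zero_mem' := by
    refine ⟨fun μ l l' _ _ s => by simp, contDiffOn_const, fun s l => η_zero_right _,
      fun k => ⟨1, one_pos, 0, fun I _ s l a => ?_⟩, fun l => tendsto_const_nhds,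
      0, fun l => tendsto_const_nhds, contDiffOn_const, fun a b c l => ?_⟩
    · rw [dot_zero]
      change |iterL I (0 : Cone → Mink) l a| ≤ _
      rw [iterL_zero]; simp
    · have : ∀ a b, Lop a b (0 : Cone → Mink) = 0 := fun a b => iterL_zero [(a, b)]
      simp [this]
  add_mem' := by
    rintro V W ⟨h1, h2, h3, h4, h5, Vm, h6, h7, h8⟩ ⟨k1, k2, k3, k4, k5, Wm, k6, k7, k8⟩
    refine ⟨fun μ l l' hμ hl s => ?_, h2.add k2, fun s l => ?_, fun k => ?_,
      fun l => by simpa using (h5 l).add (k5 l), Vm + Wm, fun l => (h6 l).add (k6 l),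
      ContDiffOn.add h7 k7, fun a b c l => ?_⟩
    · simp only [Pi.add_apply, h1 μ l l' hμ hl s, k1 μ l l' hμ hl s, smul_add]
    · simp only [Pi.add_apply, η_add_right, h3, k3, add_zero]
    · obtain ⟨ε, hε, C, hC⟩ := h4 k
      obtain ⟨δ, hδ, D, hD⟩ := k4 k
      have key : ∀ ε ε' C x y : ℝ, ∀ l : Cone, ε' ≤ ε →
          |y| ≤ C / (l.1 0 ^ 2 * weight ε (x / l.1 0)) →
          |y| ≤ C / (l.1 0 ^ 2 * weight ε' (x / l.1 0)) := fun ε ε' C x y l he h => by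
        have hl : 0 < l.1 0 ^ 2 := pow_pos l.2.1 2
        have hw := mul_pos hl (weight_pos ε (x / l.1 0))
        have hC : 0 ≤ C := by
          have := (abs_nonneg y).trans h
          by_contra hc
          exact absurd (div_neg_of_neg_of_pos (not_le.1 hc) hw) (not_lt.2 this)
        exact h.trans (div_le_div_of_nonneg_left hC (mul_pos hl (weight_pos ε' _))
          (mul_le_mul_of_nonneg_left (weight_mono he _) hl.le))
      refine ⟨min ε δ, lt_min hε hδ, C + D, fun I hI s l a => ?_⟩
      rw [dot_add h2 k2]
      change |iterL I (dot V s + dot W s) l a| ≤ _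
      rw [iterL_add (h2.dot.slice s) (k2.dot.slice s), add_div]
      exact (abs_add_le _ _).trans (add_le_add
        (key _ _ _ _ _ l (min_le_left _ _) (hC I hI s l a))
        (key _ _ _ _ _ l (min_le_right _ _) (hD I hI s l a)))
    · rw [Lop_add h7 k7, Lop_add h7 k7, Lop_add h7 k7]
      have e1 := h8 a b c l
      have e2 := k8 a b c l
      simp only [Pi.add_apply]
      linear_combination e1 + e2
  neg_mem' := by
    rintro V ⟨h1, h2, h3, h4, h5, Vm, h6, h7, h8⟩
    refine ⟨fun μ l l' hμ hl s => ?_, h2.neg, fun s l => ?_, fun k => ?_,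
      fun l => by simpa using (h5 l).neg, -Vm, fun l => (h6 l).neg,
      ContDiffOn.neg h7, fun a b c l => ?_⟩
    · simp only [Pi.neg_apply, h1 μ l l' hμ hl s, smul_neg]
    · have := η_smul_right (-1) l.1 (V s l)
      rw [neg_one_smul, h3, mul_zero] at this
      exact this
    · obtain ⟨ε, hε, C, hC⟩ := h4 k
      refine ⟨ε, hε, C, fun I hI s l a => ?_⟩
      rw [dot_neg h2]
      change |iterL I (-dot V s) l a| ≤ _
      rw [iterL_neg]
      change |-iterL I (dot V s) l a| ≤ _
      rw [abs_neg]
      exact hC I hI s l a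
    · rw [Lop_neg, Lop_neg, Lop_neg]
      have e1 := h8 a b c l
      simp only [Pi.neg_apply]
      linear_combination -e1

namespace TestV

theorem smooth (V : TestV) : Smooth V.1 := V.2.2.1
theorem orth (V : TestV) (s : ℝ) (l : Cone) : η l.1 (V.1 s l) = 0 := V.2.2.2.1 s l

theorem dot_bound (V : TestV) : ∃ ε > 0, ∃ C : ℝ, ∀ s n a,
    |dot V.1 s (sec n) a| ≤ C * (weight ε s)⁻¹ := by
  obtain ⟨ε, hε, C, hC⟩ := V.2.2.2.2.1 0
  refine ⟨ε, hε, C, fun s n a => ?_⟩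
  have := hC [] rfl s (sec n) a
  rw [sec_zero, div_one, one_pow, one_mul, div_eq_mul_inv] at this
  exact this

theorem bound (V : TestV) : ∃ C : ℝ, ∀ s n a, |V.1 s (sec n) a| ≤ C := by
  obtain ⟨ε, hε, C, hC⟩ := (dot_bound V)
  have hi : Integrable fun s => C * (weight ε s)⁻¹ := (integrable_inv_weight hε).const_mul C
  refine ⟨∫ s, C * (weight ε s)⁻¹, fun s n a => ?_⟩
  have hd : ∀ s, HasDerivAt (fun s => V.1 s (sec n) a) (dot V.1 s (sec n) a) s := fun s =>
    hasDerivAt_pi.1 ((smooth V).hasDerivAt s (sec n)) a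
  have hc : Continuous fun s => dot V.1 s (sec n) a :=
    (continuous_apply a).comp ((smooth V).dot.continuous_onSec.comp
      (continuous_const.prodMk continuous_id : Continuous fun s : ℝ => (n, s)))
  have hdi : Integrable fun s => dot V.1 s (sec n) a :=
    hi.mono' hc.aestronglyMeasurable (Eventually.of_forall fun s => hC s n a)
  have hz : Tendsto (fun s => V.1 s (sec n) a) atTop (𝓝 0) :=
    (tendsto_pi_nhds.1 (V.2.2.2.2.2.1 (sec n))) a
  have h := integral_Ioi_of_hasDerivAt_of_tendsto' (fun x _ => hd x)
    (hdi.integrableOn (s := Set.Ioi s)) hz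
  have h0 : ∀ s, 0 ≤ C * (weight ε s)⁻¹ := fun s => (abs_nonneg _).trans (hC s n a)
  calc |V.1 s (sec n) a| = ‖∫ x in Set.Ioi s, dot V.1 x (sec n) a‖ := by
        rw [h, zero_sub, norm_neg, Real.norm_eq_abs]
    _ ≤ ∫ x in Set.Ioi s, C * (weight ε x)⁻¹ :=
        norm_integral_le_of_norm_le hi.integrableOn (Eventually.of_forall fun s => hC s n a)
    _ ≤ _ := setIntegral_le_integral hi (Eventually.of_forall h0)

theorem continuous_eval (V : TestV) (a : Fin 4) :
    Continuous fun p : S2 × ℝ => V.1 p.2 (sec p.1) a :=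
  (continuous_apply a).comp (smooth V).continuous_onSec

theorem continuous_dot_eval (V : TestV) (a : Fin 4) :
    Continuous fun p : S2 × ℝ => dot V.1 p.2 (sec p.1) a :=
  (continuous_apply a).comp (smooth V).dot.continuous_onSec

theorem integrable_dot_mul (V W : TestV) : Integrable
    (fun p : S2 × ℝ => η (dot V.1 p.2 (sec p.1)) (W.1 p.2 (sec p.1))) (dl.prod volume) := by
  have h : ∀ a, Integrable (fun p : S2 × ℝ => dot V.1 p.2 (sec p.1) a * W.1 p.2 (sec p.1) a)
      (dl.prod volume) := fun a => by
    obtain ⟨ε, hε, C, hC⟩ := (dot_bound V)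
    obtain ⟨D, hD⟩ := (bound W)
    refine Integrable.mul_bdd (c := D) ?_ ((continuous_eval W) a).aestronglyMeasurable
      (Eventually.of_forall fun p => hD _ _ _)
    exact (((integrable_inv_weight hε).const_mul C).comp_snd dl).mono'
      ((continuous_dot_eval V) a).aestronglyMeasurable (Eventually.of_forall fun p => hC _ _ _)
  exact (((h 0).sub (h 1)).sub (h 2)).sub (h 3)

theorem dot_orth (V : TestV) (s : ℝ) (l : Cone) : η l.1 (dot V.1 s l) = 0 := by
  have hd : ∀ a, HasDerivAt (fun s => l.1 a * V.1 s l a) (l.1 a * dot V.1 s l a) s := fun a =>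
    (hasDerivAt_pi.1 ((smooth V).hasDerivAt s l) a).const_mul _
  have h1 : HasDerivAt (fun s => η l.1 (V.1 s l)) (η l.1 (dot V.1 s l)) s :=
    (((hd 0).sub (hd 1)).sub (hd 2)).sub (hd 3)
  have h2 : (fun s => η l.1 (V.1 s l)) = fun _ => 0 := funext fun s => (orth V) s l
  rw [h2] at h1
  exact h1.unique (hasDerivAt_const s 0)

theorem dot_add' (V W : TestV) : dot (V + W).1 = dot V.1 + dot W.1 := dot_add (smooth V) (smooth W)

/-- The integrand `V̇₁·V₂ - V̇₂·V₁` of the symplectic form. -/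
def ker (V W : TestV) (p : S2 × ℝ) : ℝ :=
  η (dot V.1 p.2 (sec p.1)) (W.1 p.2 (sec p.1)) - η (dot W.1 p.2 (sec p.1)) (V.1 p.2 (sec p.1))

theorem integrable_ker (V W : TestV) : Integrable (ker V W) (dl.prod volume) :=
  (integrable_dot_mul V W).sub (integrable_dot_mul W V)

theorem ker_add_left (V V' W : TestV) (p : S2 × ℝ) :
    ker (V + V') W p = ker V W p + ker V' W p := by
  unfold ker
  rw [dot_add', AddSubgroup.coe_add]
  simp only [Pi.add_apply, η_add_left, η_add_right]
  ring

theorem ker_add_right (V W W' : TestV) (p : S2 × ℝ) :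
    ker V (W + W') p = ker V W p + ker V W' p := by
  unfold ker
  rw [dot_add', AddSubgroup.coe_add]
  simp only [Pi.add_apply, η_add_left, η_add_right]
  ring

/-- The symplectic form `{V₁,V₂} = (1/4π) ∫ (V̇₁·V₂ - V̇₂·V₁)(s,l) ds d²l`. -/
def sym : TestV →+ TestV →+ ℝ :=
  AddMonoidHom.mk' (fun V => AddMonoidHom.mk'
      (fun W => 1 / (4 * Real.pi) * ∫ p, ker V W p ∂(dl.prod volume))
    fun W W' => by
      rw [← mul_add, ← integral_add (integrable_ker V W) (integrable_ker V W')]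
      simp only [ker_add_right])
    fun V V' => by
      ext W
      change 1 / (4 * Real.pi) * _ = 1 / (4 * Real.pi) * _ + 1 / (4 * Real.pi) * _
      rw [← mul_add, ← integral_add (integrable_ker V W) (integrable_ker V' W)]
      simp only [ker_add_left]

theorem sym_apply (V W : TestV) :
    sym V W = 1 / (4 * Real.pi) * ∫ p, ker V W p ∂(dl.prod volume) := rfl

theorem sym_self (V : TestV) : sym V V = 0 := by simp [sym_apply, ker]

/-- The functions `α(s,l) l_a` with `(1/4π) ∫ α(-∞,l) d²l = n 2π/e`, `n` an integer. -/
def gauge (e : ℝ) : AddSubgroup TestV where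
  carrier := {V | ∃ (α : ℝ → Cone → ℝ) (αm : Cone → ℝ), (∀ s l, V.1 s l = α s l • l.1) ∧
    (∀ l, Tendsto (fun s => α s l) atBot (𝓝 (αm l))) ∧
    ∃ n : ℤ, 1 / (4 * Real.pi) * ∫ m, αm (sec m) ∂dl = n * (2 * Real.pi / e)}
  zero_mem' := ⟨0, 0, fun s l => by simp, fun l => tendsto_const_nhds, 0, by simp⟩
  add_mem' := by
    have key : ∀ (V : TestV) (α : ℝ → Cone → ℝ) (αm : Cone → ℝ),
        (∀ s l, V.1 s l = α s l • l.1) → (∀ l, Tendsto (fun s => α s l) atBot (𝓝 (αm l))) →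
        Integrable (fun m => αm (sec m)) dl := fun V α αm h1 h2 => by
      have h0 : ∀ s m, V.1 s (sec m) 0 = α s (sec m) := fun s m => by
        rw [h1]; simp [sec_zero]
      obtain ⟨C, hC⟩ := (bound V)
      have hm : Measurable fun m => αm (sec m) := by
        refine measurable_of_tendsto_metrizable (f := fun (k : ℕ) m => V.1 (-(k : ℝ)) (sec m) 0)
          (fun k => ?_) (tendsto_pi_nhds.2 fun m => ?_)
        · exact (((continuous_eval V) 0).comp
            (continuous_id.prodMk continuous_const : Continuous fun m : S2 => (m, -(k : ℝ)))).measurable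
        · simp only [h0]
          exact (h2 (sec m)).comp (tendsto_neg_atTop_atBot.comp tendsto_natCast_atTop_atTop)
      refine (integrable_const C).mono' hm.aestronglyMeasurable (Eventually.of_forall fun m => ?_)
      refine le_of_tendsto (h2 (sec m)).norm (Eventually.of_forall fun s => ?_)
      rw [← h0]
      exact hC _ _ _
    rintro V W ⟨α, αm, h1, h2, n, h3⟩ ⟨β, βm, k1, k2, m, k3⟩
    refine ⟨α + β, αm + βm, fun s l => ?_, fun l => (h2 l).add (k2 l), n + m, ?_⟩
    · rw [AddSubgroup.coe_add, Pi.add_apply, Pi.add_apply, h1, k1, ← add_smul]; rfl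
    · have : ∫ m, (αm + βm) (sec m) ∂dl = ∫ m, αm (sec m) ∂dl + ∫ m, βm (sec m) ∂dl :=
        integral_add (key V α αm h1 h2) (key W β βm k1 k2)
      rw [this, mul_add, h3, k3]; push_cast; ring
  neg_mem' := by
    rintro V ⟨α, αm, h1, h2, n, h3⟩
    refine ⟨-α, -αm, fun s l => ?_, fun l => (h2 l).neg, -n, ?_⟩
    · rw [AddSubgroup.coe_neg, Pi.neg_apply, Pi.neg_apply, h1, ← neg_smul]; rfl
    · have : ∫ m, (-αm) (sec m) ∂dl = -∫ m, αm (sec m) ∂dl := integral_neg _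
      rw [this, mul_neg, h3]; push_cast; ring

theorem sym_gauge {e : ℝ} {V : TestV} (hV : V ∈ gauge e) (W : TestV) :
    sym V W = 0 ∧ sym W V = 0 := by
  obtain ⟨α, -, h, -⟩ := hV
  have h0 : ∀ s l a, V.1 s l a = V.1 s l 0 / l.1 0 * l.1 a := fun s l a => by
    have := l.2.1.ne'
    rw [h]; simp only [Pi.smul_apply, smul_eq_mul]; field_simp
  have hd : ∀ s l, dot V.1 s l = (dot V.1 s l 0 / l.1 0) • l.1 := fun s l => by
    have h1 := hasDerivAt_pi.1 ((smooth V).hasDerivAt s l)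
    ext a
    have h2 := ((h1 0).div_const (l.1 0)).mul_const (l.1 a)
    refine (h1 a).unique ?_
    have h3 : (fun s => V.1 s l a) = fun s => V.1 s l 0 / l.1 0 * l.1 a := funext fun s => h0 s l a
    rw [h3]
    exact h2
  have e1 : ∀ s l, η (dot V.1 s l) (W.1 s l) = 0 := fun s l => by
    rw [hd, η_smul_left, (orth W), mul_zero]
  have e2 : ∀ s l, η (dot W.1 s l) (V.1 s l) = 0 := fun s l => by
    rw [h, η_smul_right, η_comm, (dot_orth W), mul_zero]
  constructor <;> simp [sym_apply, ker, e1, e2]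

end TestV

/-- The group `L` of classes of test functions. -/
abbrev LV (e : ℝ) : Type := TestV ⧸ TestV.gauge e

/-- The symplectic form on `L`. -/
def symLV (e : ℝ) : SymplecticForm (LV e) where
  form := QuotientAddGroup.lift (TestV.gauge e)
    (AddMonoidHom.mk' (fun V => QuotientAddGroup.lift (TestV.gauge e) (TestV.sym V)
        fun W hW => (TestV.sym_gauge hW V).2)
      fun V V' => by
        ext W
        change TestV.sym (V + V') W = TestV.sym V W + TestV.sym V' W
        rw [map_add]; rfl)
    fun V hV => by
      ext W
      exact (TestV.sym_gauge hV W).1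
  alt x := by
    induction x using QuotientAddGroup.induction_on with
    | H V => exact TestV.sym_self V

/-- The algebra CCR of the asymptotic electromagnetic field. -/
abbrev CCR (e : ℝ) : Type := WeylCStar (symLV e)

/-- The generating element `W(V)` of CCR. -/
def CCR.W (e : ℝ) (V : TestV) : CCR e := WeylCStar.W (symLV e) (QuotientAddGroup.mk V)

/-! ### The direct integral -/

theorem norm_What (u : Lhat) (ψ : Hhat) : ‖What u ψ‖ = ‖ψ‖ := by
  induction ψ using UniformSpace.Completion.induction_on with
  | hp => exact isClosed_eq (What u).continuous.norm continuous_norm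
  | ih a =>
    have h : What u (a : Hhat) = ((PreGNS.isometry (ω := vacuum) (LinearMap.mulLeft ℂ
      (WeylStar.single u 1 : WeylStar symLhat)) (fun a => by
      simp only [LinearMap.mulLeft_apply, star_mul]
      rw [mul_assoc, ← mul_assoc (star (WeylStar.single u 1 : WeylStar symLhat)),
        WeylStar.star_single_mul_single, one_mul]) a : PreGNS symLhat vacuum) : Hhat) :=
      ContinuousLinearMap.completion_apply_coe _ a
    rw [h, UniformSpace.Completion.norm_coe, UniformSpace.Completion.norm_coe,
      LinearIsometry.norm_map]

/-- `π̂(Ŵ([u]))` as a linear isometry. -/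
def WhatIso (u : Lhat) : Hhat →ₗᵢ[ℂ] Hhat := ⟨(What u).toLinearMap, norm_What u⟩

theorem inner_What (u : Lhat) (φ ψ : Hhat) : inner ℂ (What u φ) (What u ψ) = inner ℂ φ ψ :=
  (WhatIso u).inner_map_map φ ψ

instance : CompleteSpace (fiber 0) :=
  (Submodule.isClosed_topologicalClosure _).completeSpace_coe

/-! #### Fields of the form `Ψ(x) = J(x) ψ(x)` with isometries `J(x)` -/

section Fields
variable {X : Type} [MeasurableSpace X] {K H : Type}
  [NormedAddCommGroup K] [InnerProductSpace ℂ K] [NormedAddCommGroup H] [InnerProductSpace ℂ H]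

/-- The square-integrable measurable vector fields `Ψ(x) = J(x) ψ(x)`, where `ψ` is measurable. -/
def sqFields (J : X → K →ₗᵢ[ℂ] H) (μ : Measure X) : Submodule ℂ (X → H) where
  carrier := {Ψ | ∃ ψ : X → K, MemLp ψ 2 μ ∧ ∀ x, Ψ x = J x (ψ x)}
  zero_mem' := ⟨0, MemLp.zero, fun x => by simp⟩
  add_mem' := by
    rintro Ψ Φ ⟨ψ, h1, e1⟩ ⟨φ, h2, e2⟩
    exact ⟨ψ + φ, h1.add h2, fun x => by simp [e1, e2]⟩
  smul_mem' := by
    rintro c Ψ ⟨ψ, h1, e1⟩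
    exact ⟨c • ψ, h1.const_smul c, fun x => by simp [e1]⟩

/-- Square-integrable vector fields, with the scalar product `∫ (Ψ(x), Φ(x)) dμ(x)`. -/
def SqField (J : X → K →ₗᵢ[ℂ] H) (μ : Measure X) : Type := sqFields J μ

namespace SqField
variable (J : X → K →ₗᵢ[ℂ] H) (μ : Measure X)

instance : AddCommGroup (SqField J μ) := inferInstanceAs (AddCommGroup (sqFields J μ))
instance : Module ℂ (SqField J μ) := inferInstanceAs (Module ℂ (sqFields J μ))

variable {J μ}

/-- The underlying function. -/
def fn (Ψ : SqField J μ) : X → H := Ψ.1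

variable (J) in
/-- The vector field `x ↦ J(x) ψ(x)`. -/
def of {ψ : X → K} (hψ : MemLp ψ 2 μ) : SqField J μ := ⟨fun x => J x (ψ x), ψ, hψ, fun _ => rfl⟩

theorem ind {P : SqField J μ → Prop} (h : ∀ (ψ : X → K) (hψ : MemLp ψ 2 μ), P (of J hψ))
    (Ψ : SqField J μ) : P Ψ := by
  obtain ⟨Ψ, ψ, hψ, e⟩ := Ψ
  obtain rfl : Ψ = fun x => J x (ψ x) := funext e
  exact h ψ hψ

theorem inner_of {ψ φ : X → K} (hψ : MemLp ψ 2 μ) (hφ : MemLp φ 2 μ) (x : X) :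
    inner ℂ ((of J hψ).fn x) ((of J hφ).fn x) = inner ℂ (ψ x) (φ x) :=
  (J x).inner_map_map (ψ x) (φ x)

theorem integrable_inner (Ψ Φ : SqField J μ) :
    Integrable (fun x => inner ℂ (Ψ.fn x) (Φ.fn x)) μ := by
  induction Ψ using ind with
  | h ψ hψ =>
    induction Φ using ind with
    | h φ hφ =>
      simp only [inner_of]
      refine (L2.integrable_inner (𝕜 := ℂ) hψ.toLp hφ.toLp).congr ?_
      filter_upwards [hψ.coeFn_toLp, hφ.coeFn_toLp] with x e1 e2
      rw [e1, e2]

/-- The scalar product. -/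
abbrev core : PreInnerProductSpace.Core ℂ (SqField J μ) where
  inner Ψ Φ := ∫ x, inner ℂ (Ψ.fn x) (Φ.fn x) ∂μ
  conj_inner_symm Ψ Φ := by
    rw [← integral_conj]
    congr 1; funext x
    exact inner_conj_symm _ _
  re_inner_nonneg Ψ := by
    rw [← integral_re (integrable_inner Ψ Ψ)]
    exact integral_nonneg fun x => inner_self_nonneg
  add_left Ψ Φ X := by
    rw [← integral_add (integrable_inner Ψ X) (integrable_inner Φ X)]
    congr 1; funext x
    exact inner_add_left _ _ _
  smul_left Ψ Φ r := by
    rw [← integral_const_mul]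
    congr 1; funext x
    exact inner_smul_left _ _ _

instance : SeminormedAddCommGroup (SqField J μ) :=
  InnerProductSpace.Core.toSeminormedAddCommGroup (c := core)
instance : InnerProductSpace ℂ (SqField J μ) := InnerProductSpace.ofCore core

theorem norm_of {ψ : X → K} (hψ : MemLp ψ 2 μ) : ‖of J hψ‖ = ‖hψ.toLp‖ := by
  have e : (inner ℂ (of J hψ) (of J hψ) : ℂ) = inner ℂ hψ.toLp hψ.toLp := by
    rw [L2.inner_def]
    change ∫ x, inner ℂ ((of J hψ).fn x) ((of J hψ).fn x) ∂μ = _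
    refine integral_congr_ae ?_
    filter_upwards [hψ.coeFn_toLp] with x e1
    rw [e1, inner_of]
  have e1 := inner_self_eq_norm_sq_to_K (𝕜 := ℂ) (of J hψ)
  have e2 := inner_self_eq_norm_sq_to_K (𝕜 := ℂ) hψ.toLp
  have e' : ‖of J hψ‖ ^ 2 = ‖hψ.toLp‖ ^ 2 := by
    have e3 := e1.symm.trans (e.trans e2)
    exact_mod_cast e3
  rwa [sq_eq_sq₀ (norm_nonneg _) (norm_nonneg _)] at e'

theorem of_sub {ψ φ : X → K} (hψ : MemLp ψ 2 μ) (hφ : MemLp φ 2 μ) :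
    of J hψ - of J hφ = of J (hψ.sub hφ) := by
  refine Subtype.ext (funext fun x => ?_)
  change J x (ψ x) - J x (φ x) = J x (ψ x - φ x)
  rw [map_sub]

end SqField

/-- The Hilbert space of classes of square-integrable vector fields, modulo fields vanishing almost
everywhere. -/
abbrev FieldSpace (J : X → K →ₗᵢ[ℂ] H) (μ : Measure X) : Type := SeparationQuotient (SqField J μ)

namespace FieldSpace
variable {J : X → K →ₗᵢ[ℂ] H} {μ : Measure X}

/-- The class of a vector field. -/
def mk (Ψ : SqField J μ) : FieldSpace J μ := SeparationQuotient.mk Ψ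

theorem dist_of {ψ φ : X → K} (hψ : MemLp ψ 2 μ) (hφ : MemLp φ 2 μ) :
    dist (mk (SqField.of J hψ)) (mk (SqField.of J hφ)) = ‖hψ.toLp - hφ.toLp‖ := by
  rw [mk, mk, SeparationQuotient.dist_mk, dist_eq_norm, SqField.of_sub, SqField.norm_of,
    MemLp.toLp_sub hψ hφ]

variable (J) in
/-- The isometry of `L²(X, K)` with the space of fields. -/
def ofLp (g : Lp K 2 μ) : FieldSpace J μ := mk (SqField.of J (Lp.memLp g))

theorem isometry_ofLp : Isometry (ofLp J (μ := μ)) := by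
  refine Isometry.of_dist_eq fun g g' => ?_
  rw [ofLp, ofLp, dist_of, Lp.toLp_coeFn, Lp.toLp_coeFn, dist_eq_norm]

theorem surjective_ofLp : Function.Surjective (ofLp J (μ := μ)) := by
  intro x
  obtain ⟨Ψ, rfl⟩ := SeparationQuotient.surjective_mk x
  induction Ψ using SqField.ind with
  | h ψ hψ =>
    refine ⟨hψ.toLp, ?_⟩
    rw [← dist_eq_zero, ofLp]
    exact (dist_of _ _).trans (by rw [Lp.toLp_coeFn, sub_self, norm_zero])

instance [CompleteSpace K] : CompleteSpace (FieldSpace J μ) :=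
  (IsometryEquiv.mk' (ofLp J) (Function.surjInv surjective_ofLp)
    (Function.surjInv_eq surjective_ofLp) isometry_ofLp).symm.completeSpace

/-- The element `x` is the class of the vector field `Ψ`, defined up to null sets. -/
def Represents (x : FieldSpace J μ) (Ψ : X → H) : Prop :=
  ∃ Φ : SqField J μ, mk Φ = x ∧ ∀ᵐ f ∂μ, Φ.fn f = Ψ f

end FieldSpace

end Fields

variable (h : Profile) (μ : Measure HIR)

/-- The operator `π̂(Ŵ([f h]))`, mapping `Ĥ_[0]` isometrically to `Ĥ_[f]`. -/
def dress (f : HIR) : fiber 0 →ₗᵢ[ℂ] Hhat := (WhatIso (smear h f)).comp (fiber 0).subtypeₗᵢ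

/-- The direct integral `∫⊕ Ĥ_[f] dμ([f])`; its elements are the classes of the square-integrable
vector fields `Ψ([f]) = π̂(Ŵ([f h])) ψ([f]) ∈ Ĥ_[f]`, with `ψ : 𝓗_IR → Ĥ_[0]` measurable. -/
abbrev DirectIntegral : Type := FieldSpace (dress h) μ

/-- Quasi-invariance under translations by smooth elements: the measure `B ↦ μ(B - k)` has the same
null sets as `μ`. -/
def QuasiInvariant : Prop :=
  ∀ k : HIR, IsSmoothIR k → ∀ B : Set HIR, MeasurableSet B →
    (μ ((fun f => f + k) ⁻¹' B) = 0 ↔ μ B = 0)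

/-- The translated measure `μ_k(B) = μ(B - k)`. -/
def translate (k : HIR) : Measure HIR := μ.map fun f => f + k

/-! ### Representations of the Weyl algebra and of translations -/

/-- The element `v` of `L̂^f` is the class of `V̇`. -/
def IsFieldClass (V : TestV) (v : Lhat) : Prop :=
  ∃ u : preT, v.1 = T.mk u ∧ ∀ s l, u.1 s l = dot V.1 s l

/-- Each `W(V)` acts in the representation by
`[π(W(V))Ψ]([f]) = (dμ_k/dμ([f]))^{1/2} π̂(Ŵ([V̇])) Ψ([f] - k)`, with `k = p([V̇])` a smooth element of
`𝓗_IR`. -/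
def ActsBy {e : ℝ}
    (π : CCR e →⋆ₐ[ℂ] (DirectIntegral h μ →L[ℂ] DirectIntegral h μ)) : Prop :=
  ∀ V : TestV, ∃ v : Lhat, IsFieldClass V v ∧ IsSmoothIR (pIR v) ∧ ∀ Ψ : SqField (dress h) μ,
    FieldSpace.Represents (π (CCR.W e V) (FieldSpace.mk Ψ)) fun f =>
      ((√((translate μ (pIR v)).rnDeriv μ f).toReal : ℝ) : ℂ) • What v (Ψ.fn (f - pIR v))

/-- `[U(x)Ψ]([f]) = Û_[f](x) Ψ([f])`, with `Û_[f](x)` the restriction of `Û(x)` to `Ĥ_[f]`. -/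
def ActsFibrewise (U : Mink → DirectIntegral h μ →L[ℂ] DirectIntegral h μ) : Prop :=
  ∀ x (Ψ : SqField (dress h) μ), FieldSpace.Represents (U x (FieldSpace.mk Ψ)) fun f => Uhat x (Ψ.fn f)

section Spectrum
variable {H : Type} [NormedAddCommGroup H] [InnerProductSpace ℂ H] [CompleteSpace H]

/-- Strongly continuous unitary representations of the translation group. -/
structure IsTranslationRep (U : Mink → H →L[ℂ] H) : Prop where
  unitary : ∀ x, U x ∈ unitary (H →L[ℂ] H)
  zero : U 0 = 1
  add : ∀ x y, U (x + y) = U x * U y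
  continuous : ∀ φ, Continuous fun x => U x φ

/-- The energy-momentum spectrum of `U(x) = ∫ e^{i p·x} dE(p)`, that is the support of the spectral
measure `E`: the momentum `p` belongs to it iff `∫ g(x) e^{i p·x} dx = 0` for each integrable `g` with
`∫ g(x) U(x) dx = 0`. -/
def energyMomentumSpectrum (U : Mink → H →L[ℂ] H) : Set Mink :=
  {q | ∀ g : Mink → ℂ, Integrable g → (∀ φ ψ : H, ∫ x, g x * inner ℂ φ (U x ψ) = 0) →
    ∫ x, g x * Complex.exp (Complex.I * η q x) = 0}

variable {e : ℝ}

/-- The translation automorphisms, `α_x(W(V)) = W(T_x V)` with `(T_x V)(s,l) = V(s - x·l, l)`. -/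
def IsTranslationAction (α : Mink → CCR e ≃⋆ₐ[ℂ] CCR e) : Prop :=
  ∀ x (V : TestV), ∃ V' : TestV, V'.1 = shift x V.1 ∧ α x (CCR.W e V) = CCR.W e V'

/-- The operators `U(x)` implement translations: `π(α_x A) = U(x) π(A) U(-x)`. -/
def Implements (π : CCR e →⋆ₐ[ℂ] (H →L[ℂ] H)) (U : Mink → H →L[ℂ] H) : Prop :=
  ∃ α : Mink → CCR e ≃⋆ₐ[ℂ] CCR e, IsTranslationAction α ∧
    ∀ x A, π (α x A) = U x * π A * U (-x)

/-- Borchers' criterion. -/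
def SatisfiesBorchers (π : CCR e →⋆ₐ[ℂ] (H →L[ℂ] H)) : Prop :=
  ∃ U : Mink → H →L[ℂ] H, IsTranslationRep U ∧
    energyMomentumSpectrum U ⊆ closedForwardCone ∧ Implements π U

end Spectrum

end IRQED
end

open IRQED

noncomputable section
namespace IRQED

/-- `ã(ω) = (1/2π) ∫ a(s) e^{iωs} ds`. -/
def ft (a : ℝ → ℝ) (w : ℝ) : ℂ :=
  (1 / (2 * Real.pi) : ℝ) * ∫ s : ℝ, (a s : ℂ) * Complex.exp (Complex.I * w * s)

theorem norm_exp_I_mul (w s : ℝ) : ‖Complex.exp (Complex.I * w * s)‖ = 1 := by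
  rw [show Complex.I * w * s = ((w * s : ℝ) : ℂ) * Complex.I by push_cast; ring,
    Complex.norm_exp_ofReal_mul_I]

theorem integrable_mul_exp {a : ℝ → ℝ} (ha : Integrable a) (w : ℝ) :
    Integrable fun s : ℝ => (a s : ℂ) * Complex.exp (Complex.I * w * s) := by
  refine ha.ofReal.mul_bdd (c := 1) ?_ (Eventually.of_forall fun s => ?_)
  · exact Continuous.aestronglyMeasurable (by fun_prop)
  · rw [norm_exp_I_mul]

theorem conj_exp_I (w s : ℝ) : conj (Complex.exp (Complex.I * w * s)) =
    Complex.exp (-(Complex.I * w * s)) := by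
  rw [← Complex.exp_conj]; simp

theorem conj_ft_mul_ft (a b : ℝ → ℝ) (w : ℝ) :
    conj (ft a w) * ft b w = ((1 / (2 * Real.pi)) ^ 2 : ℝ) *
      ∫ p : ℝ × ℝ, ((a p.1 * b p.2 : ℝ) : ℂ) * Complex.exp (Complex.I * w * (p.2 - p.1 : ℝ)) := by
  have h := integral_prod_mul (μ := (volume : Measure ℝ)) (ν := (volume : Measure ℝ))
    (fun s => (a s : ℂ) * Complex.exp (-(Complex.I * w * s)))
    (fun s => (b s : ℂ) * Complex.exp (Complex.I * w * s))
  have e : (fun p : ℝ × ℝ => ((a p.1 * b p.2 : ℝ) : ℂ) *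
      Complex.exp (Complex.I * w * (p.2 - p.1 : ℝ))) = fun p : ℝ × ℝ =>
      (a p.1 : ℂ) * Complex.exp (-(Complex.I * w * p.1)) *
        ((b p.2 : ℂ) * Complex.exp (Complex.I * w * p.2)) := by
    funext p
    rw [mul_mul_mul_comm, ← Complex.exp_add]
    push_cast
    congr 2; ring
  rw [e, ← Measure.volume_eq_prod] at *
  rw [h, ft, ft, map_mul, Complex.conj_ofReal, ← integral_conj]
  simp only [map_mul, Complex.conj_ofReal, conj_exp_I]
  push_cast; ring

theorem swap_prod_integral {g : ℝ → ℝ} {a b : ℝ → ℝ} {ν : Measure ℝ} [SFinite ν]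
    (hg : Integrable g ν) (ha : Integrable a) (hb : Integrable b) :
    ∫ w, (∫ p : ℝ × ℝ, ((a p.1 * b p.2 : ℝ) : ℂ) *
      Complex.exp (Complex.I * w * (p.2 - p.1 : ℝ))) * (g w : ℂ) ∂ν =
    ∫ p : ℝ × ℝ, ((a p.1 * b p.2 : ℝ) : ℂ) *
      ∫ w, Complex.exp (Complex.I * w * (p.2 - p.1 : ℝ)) * (g w : ℂ) ∂ν := by
  have hi : Integrable (fun q : ℝ × ℝ × ℝ => (g q.1 : ℂ) * ((a q.2.1 * b q.2.2 : ℝ) : ℂ) *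
      Complex.exp (Complex.I * q.1 * (q.2.2 - q.2.1 : ℝ))) (ν.prod volume) := by
    refine Integrable.mul_bdd (c := 1) ?_ (Continuous.aestronglyMeasurable (by fun_prop))
      (Eventually.of_forall fun q => (norm_exp_I_mul _ _).le)
    exact hg.ofReal.mul_prod (ha.mul_prod hb).ofReal
  have h := integral_integral_swap (f := fun (w : ℝ) (p : ℝ × ℝ) => (g w : ℂ) *
    ((a p.1 * b p.2 : ℝ) : ℂ) * Complex.exp (Complex.I * w * (p.2 - p.1 : ℝ))) hi
  refine Eq.trans (integral_congr_ae (Eventually.of_forall fun w => ?_))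
    (h.trans (integral_congr_ae (Eventually.of_forall fun p => ?_)))
  · simp only
    rw [← integral_mul_const]
    congr 1; funext p; ring
  · simp only
    rw [← integral_const_mul]
    congr 1; funext w; ring

theorem gaussian_kernel (b : ℝ) (hb : 0 < b) (r : ℝ) :
    ∫ w : ℝ, Complex.exp (Complex.I * w * r) * ((Real.exp (-b * w ^ 2) : ℝ) : ℂ) =
      ((√(Real.pi / b) * Real.exp (-(1 / (4 * b)) * r ^ 2) : ℝ) : ℂ) := by
  have h := fourierIntegral_gaussian (b := b) (by simpa using hb) r
  have e : (∫ w : ℝ, Complex.exp (Complex.I * w * r) * ((Real.exp (-b * w ^ 2) : ℝ) : ℂ)) =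
      ∫ x : ℝ, Complex.exp (Complex.I * r * x) * Complex.exp (-b * x ^ 2) := by
    congr 1; funext x; push_cast; congr 2; ring
  rw [e, h, Real.sqrt_eq_rpow]
  push_cast [Complex.ofReal_cpow (by positivity : 0 ≤ Real.pi / b)]
  congr 2
  field_simp

theorem lintegral_young (a : ℝ → ℝ) (ha : Measurable a) (g : ℝ → ℝ≥0∞) (hg : Measurable g)
    (hs : ∀ r, g (-r) = g r) :
    ∫⁻ p : ℝ × ℝ, ‖a p.1 * a p.2‖ₑ * g (p.2 - p.1) ≤
      (∫⁻ s, ENNReal.ofReal (a s ^ 2)) * ∫⁻ r, g r := by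
  have h1 : ∫⁻ p : ℝ × ℝ, ENNReal.ofReal (a p.1 ^ 2) * g (p.2 - p.1) =
      (∫⁻ s, ENNReal.ofReal (a s ^ 2)) * ∫⁻ r, g r := by
    rw [Measure.volume_eq_prod, lintegral_prod _ (by fun_prop)]
    simp only
    have : ∀ s, ∫⁻ t, ENNReal.ofReal (a s ^ 2) * g (t - s) =
        ENNReal.ofReal (a s ^ 2) * ∫⁻ r, g r := fun s => by
      rw [lintegral_const_mul _ (by fun_prop), lintegral_sub_right_eq_self g s]
    simp only [this]
    rw [lintegral_mul_const _ (by fun_prop)]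
  have h2 : ∫⁻ p : ℝ × ℝ, ENNReal.ofReal (a p.2 ^ 2) * g (p.2 - p.1) =
      (∫⁻ s, ENNReal.ofReal (a s ^ 2)) * ∫⁻ r, g r := by
    rw [← h1, Measure.volume_eq_prod, ← lintegral_prod_swap]
    congr 1; funext p
    simp only [Prod.fst_swap, Prod.snd_swap]
    rw [← hs, neg_sub]
  calc ∫⁻ p : ℝ × ℝ, ‖a p.1 * a p.2‖ₑ * g (p.2 - p.1)
      ≤ ∫⁻ p : ℝ × ℝ, (2⁻¹ * (ENNReal.ofReal (a p.1 ^ 2) * g (p.2 - p.1)) +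
          2⁻¹ * (ENNReal.ofReal (a p.2 ^ 2) * g (p.2 - p.1))) := by
        refine lintegral_mono fun p => ?_
        simp only
        rw [← mul_assoc, ← mul_assoc, ← add_mul]
        gcongr
        have e2 : (2⁻¹ : ℝ≥0∞) = ENNReal.ofReal (1 / 2) := by
          rw [one_div, ENNReal.ofReal_inv_of_pos two_pos]; simp
        rw [e2, ← ENNReal.ofReal_mul (by norm_num), ← ENNReal.ofReal_mul (by norm_num),
          ← ENNReal.ofReal_add (by positivity) (by positivity), ← ofReal_norm]
        refine ENNReal.ofReal_le_ofReal ?_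
        rw [Real.norm_eq_abs, abs_mul, ← sq_abs (a p.1), ← sq_abs (a p.2)]
        nlinarith [sq_nonneg (|a p.1| - |a p.2|)]
    _ = (∫⁻ s, ENNReal.ofReal (a s ^ 2)) * ∫⁻ r, g r := by
        rw [lintegral_add_left (by fun_prop), lintegral_const_mul _ (by fun_prop),
          lintegral_const_mul _ (by fun_prop), h1, h2, ← add_mul, ENNReal.inv_two_add_inv_two,
          one_mul]

theorem continuous_ft {a : ℝ → ℝ} (ha : Integrable a) : Continuous (ft a) := by
  refine continuous_const.mul ?_
  refine continuous_of_dominated (bound := fun s => ‖a s‖) (fun w => (integrable_mul_exp ha w).1)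
    (fun w => Eventually.of_forall fun s => ?_) ha.norm
    (Eventually.of_forall fun s => by fun_prop)
  rw [norm_mul, norm_exp_I_mul, mul_one, Complex.norm_real]

theorem norm_ft_le (a : ℝ → ℝ) (w : ℝ) : ‖ft a w‖ ≤ ∫ s, |a s| := by
  rw [ft, norm_mul, Complex.norm_real, Real.norm_eq_abs, abs_of_pos (by positivity)]
  have h1 : ‖∫ s : ℝ, (a s : ℂ) * Complex.exp (Complex.I * w * s)‖ ≤ ∫ s, |a s| := by
    refine (norm_integral_le_integral_norm _).trans (le_of_eq ?_)
    congr 1; funext s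
    rw [norm_mul, norm_exp_I_mul, mul_one, Complex.norm_real, Real.norm_eq_abs]
  have h2 : 1 / (2 * Real.pi) ≤ 1 := by
    rw [div_le_one (by positivity)]; linarith [Real.pi_gt_three]
  exact (mul_le_mul h2 h1 (norm_nonneg _) one_pos.le).trans (one_mul _).le

/-- Bessel's inequality for the Fourier transform. -/
theorem lintegral_ft_sq_le {a : ℝ → ℝ} (hm : Measurable a) (ha : Integrable a) :
    ∫⁻ w, ENNReal.ofReal (‖ft a w‖ ^ 2) ≤
      ENNReal.ofReal (1 / (2 * Real.pi)) * ∫⁻ s, ENNReal.ofReal (a s ^ 2) := by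
  have key : ∀ b : ℝ, 0 < b → ∫⁻ w, ENNReal.ofReal (‖ft a w‖ ^ 2 * Real.exp (-b * w ^ 2)) ≤
      ENNReal.ofReal (1 / (2 * Real.pi)) * ∫⁻ s, ENNReal.ofReal (a s ^ 2) := fun b hb => by
    have hgi : Integrable fun w : ℝ => Real.exp (-b * w ^ 2) := integrable_exp_neg_mul_sq hb
    have hint : Integrable fun w => ‖ft a w‖ ^ 2 * Real.exp (-b * w ^ 2) := by
      refine hgi.bdd_mul (c := (∫ s, |a s|) ^ 2) ?_ (Eventually.of_forall fun w => ?_)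
      · exact ((continuous_ft ha).norm.pow 2).aestronglyMeasurable
      · rw [norm_pow, norm_norm]
        exact pow_le_pow_left₀ (norm_nonneg _) (norm_ft_le a w) 2
    rw [← ofReal_integral_eq_lintegral_ofReal hint (Eventually.of_forall fun w => by positivity)]
    have e1 : ((∫ w, ‖ft a w‖ ^ 2 * Real.exp (-b * w ^ 2) : ℝ) : ℂ) =
        ((1 / (2 * Real.pi)) ^ 2 : ℝ) * ∫ p : ℝ × ℝ, ((a p.1 * a p.2 : ℝ) : ℂ) *
          ((√(Real.pi / b) * Real.exp (-(1 / (4 * b)) * (p.2 - p.1) ^ 2) : ℝ) : ℂ) := by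
      simp only [← gaussian_kernel b hb]
      rw [← swap_prod_integral hgi ha ha, ← integral_const_mul, ← integral_complex_ofReal]
      congr 1; funext w
      rw [← mul_assoc, ← conj_ft_mul_ft, mul_comm (conj (ft a w)), Complex.mul_conj,
        Complex.normSq_eq_norm_sq]
      push_cast; ring
    set g : ℝ → ℝ≥0∞ := fun r =>
      ENNReal.ofReal (√(Real.pi / b) * Real.exp (-(1 / (4 * b)) * r ^ 2)) with hgdef
    have hg : ∫⁻ r, g r = ENNReal.ofReal (2 * Real.pi) := by
      rw [hgdef, ← ofReal_integral_eq_lintegral_ofReal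
        ((integrable_exp_neg_mul_sq (by positivity)).const_mul _)
        (Eventually.of_forall fun w => by positivity), integral_const_mul, integral_gaussian,
        ← Real.sqrt_mul (by positivity)]
      congr 1
      rw [Real.sqrt_eq_iff_mul_self_eq (by positivity) (by positivity)]
      field_simp; norm_num
    have e2 : ENNReal.ofReal (∫ w, ‖ft a w‖ ^ 2 * Real.exp (-b * w ^ 2)) ≤
        ENNReal.ofReal ((1 / (2 * Real.pi)) ^ 2) *
          ∫⁻ p : ℝ × ℝ, ‖a p.1 * a p.2‖ₑ * g (p.2 - p.1) := by
      have h0 : 0 ≤ ∫ w, ‖ft a w‖ ^ 2 * Real.exp (-b * w ^ 2) :=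
        integral_nonneg fun w => by positivity
      have h1 : (∫ w, ‖ft a w‖ ^ 2 * Real.exp (-b * w ^ 2)) =
          ‖((∫ w, ‖ft a w‖ ^ 2 * Real.exp (-b * w ^ 2) : ℝ) : ℂ)‖ := by
        rw [Complex.norm_real, Real.norm_eq_abs, abs_of_nonneg h0]
      rw [h1, e1, norm_mul, Complex.norm_real, Real.norm_eq_abs, abs_of_pos (by positivity),
        ENNReal.ofReal_mul (by positivity)]
      gcongr
      rw [ofReal_norm]
      refine (enorm_integral_le_lintegral_enorm _).trans (le_of_eq ?_)
      congr 1; funext p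
      rw [enorm_mul, ← ofReal_norm, ← ofReal_norm, Complex.norm_real,
        Complex.norm_real, ← ofReal_norm, Real.norm_of_nonneg (by positivity :
          0 ≤ √(Real.pi / b) * Real.exp (-(1 / (4 * b)) * (p.2 - p.1) ^ 2))]
    refine e2.trans ?_
    have e3 := lintegral_young a hm g (by fun_prop) (fun r => by simp [hgdef])
    refine (mul_le_mul_right e3 _).trans (le_of_eq ?_)
    rw [hg, mul_comm (∫⁻ s, ENNReal.ofReal (a s ^ 2)), ← mul_assoc,
      ← ENNReal.ofReal_mul (by positivity)]
    congr 2
    field_simp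
  have hlim : ∀ w, ENNReal.ofReal (‖ft a w‖ ^ 2) = liminf (fun n : ℕ =>
      ENNReal.ofReal (‖ft a w‖ ^ 2 * Real.exp (-(1 / ((n : ℝ) + 1)) * w ^ 2))) atTop := fun w => by
    refine (Tendsto.liminf_eq ?_).symm
    refine ENNReal.tendsto_ofReal ?_
    have : Tendsto (fun n : ℕ => ‖ft a w‖ ^ 2 * Real.exp (-(1 / ((n : ℝ) + 1)) * w ^ 2)) atTop
        (𝓝 (‖ft a w‖ ^ 2 * Real.exp (-0 * w ^ 2))) :=
      ((Real.continuous_exp.tendsto _).comp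
        (tendsto_one_div_add_atTop_nhds_zero_nat.neg.mul_const _)).const_mul _
    simpa using this
  simp only [hlim]
  refine (lintegral_liminf_le fun n => ?_).trans ?_
  · have := (continuous_ft ha).measurable
    fun_prop
  · refine liminf_le_of_le (by isBoundedDefault) fun c hc => ?_
    obtain ⟨n, hn⟩ := hc.exists
    exact hn.trans (key _ (by positivity))

theorem abs_exp_sub_one_le (x θ : ℝ) (h0 : 0 ≤ θ) (h1 : θ ≤ 1) :
    ‖Complex.exp (Complex.I * x) - 1‖ ≤ 2 * |x| ^ θ := by
  rcases le_total |x| 1 with h | h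
  · have e1 : ‖Complex.exp (Complex.I * x) - 1‖ ≤ |x| := by
      simpa using Real.norm_exp_I_mul_ofReal_sub_one_le (x := x)
    rcases (abs_nonneg x).eq_or_lt with h2 | h2
    · rw [← h2] at e1; exact e1.trans (by positivity)
    · have := Real.rpow_le_rpow_of_exponent_ge h2 h h1
      rw [Real.rpow_one] at this
      linarith [Real.rpow_nonneg (abs_nonneg x) θ]
  · have e1 : ‖Complex.exp (Complex.I * x) - 1‖ ≤ 2 := by
      refine (norm_sub_le _ _).trans ?_
      rw [mul_comm, Complex.norm_exp_ofReal_mul_I, norm_one]; norm_num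
    have := Real.one_le_rpow h h0
    linarith

/-- Hölder continuity of the Fourier transform. -/
theorem norm_ft_sub_le {a : ℝ → ℝ} {θ : ℝ} (h0 : 0 ≤ θ) (h1 : θ ≤ 1) (hm : Integrable a)
    (ha : Integrable fun s => |a s| * (1 + |s|) ^ θ) (w : ℝ) :
    ‖ft a w - ft a 0‖ ≤ |w| ^ θ * ∫ s, |a s| * (1 + |s|) ^ θ := by
  rw [ft, ft, ← mul_sub, ← integral_sub (integrable_mul_exp hm w) (integrable_mul_exp hm 0),
    norm_mul, Complex.norm_real, Real.norm_eq_abs, abs_of_pos (by positivity)]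
  have e : ‖∫ s : ℝ, ((a s : ℂ) * Complex.exp (Complex.I * w * s) -
      (a s : ℂ) * Complex.exp (Complex.I * (0 : ℝ) * s))‖ ≤
      ∫ s, 2 * |w| ^ θ * (|a s| * (1 + |s|) ^ θ) := by
    refine norm_integral_le_of_norm_le (ha.const_mul _) (Eventually.of_forall fun s => ?_)
    have := abs_exp_sub_one_le (w * s) θ h0 h1
    rw [abs_mul, Real.mul_rpow (abs_nonneg _) (abs_nonneg _)] at this
    have e2 : |s| ^ θ ≤ (1 + |s|) ^ θ := Real.rpow_le_rpow (abs_nonneg _) (by linarith) h0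
    have e3 : (a s : ℂ) * Complex.exp (Complex.I * w * s) -
      (a s : ℂ) * Complex.exp (Complex.I * (0 : ℝ) * s) =
      a s * (Complex.exp (Complex.I * (w * s : ℝ)) - 1) := by
      simp only [Complex.ofReal_zero, mul_zero, zero_mul, Complex.exp_zero]
      push_cast; rw [mul_sub, mul_one, mul_assoc Complex.I]
    rw [e3, norm_mul, Complex.norm_real, Real.norm_eq_abs]
    calc |a s| * _ ≤ |a s| * (2 * (|w| ^ θ * (1 + |s|) ^ θ)) := by
          refine mul_le_mul_of_nonneg_left (this.trans ?_) (abs_nonneg _)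
          gcongr
      _ = _ := by ring
  rw [integral_const_mul] at e
  have h2 : 1 / (2 * Real.pi) ≤ 1 / 2 := by
    apply one_div_le_one_div_of_le <;> linarith [Real.pi_gt_three]
  have h3 : 0 ≤ ∫ s, |a s| * (1 + |s|) ^ θ := integral_nonneg fun s => by positivity
  calc _ ≤ 1 / 2 * (2 * |w| ^ θ * ∫ s, |a s| * (1 + |s|) ^ θ) := by
        gcongr
    _ = _ := by ring

/-- Integrable approximations from below of `1/ω` on the positive axis. -/
def invW (n : ℕ) (w : ℝ) : ℝ := (Real.exp (-(1 / ((n : ℝ) + 1)) * w) - Real.exp (-((n : ℝ) + 1) * w)) / w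

theorem invW_nonneg (n : ℕ) {w : ℝ} (hw : 0 < w) : 0 ≤ invW n w := by
  refine div_nonneg (sub_nonneg.2 (Real.exp_le_exp.2 ?_)) hw.le
  have : 1 / ((n : ℝ) + 1) ≤ (n : ℝ) + 1 := by
    rw [div_le_iff₀ (by positivity)]; nlinarith [(Nat.cast_nonneg n : (0 : ℝ) ≤ n)]
  nlinarith

theorem invW_le_inv (n : ℕ) {w : ℝ} (hw : 0 < w) : invW n w ≤ w⁻¹ := by
  rw [invW, ← one_div]
  refine div_le_div_of_nonneg_right ?_ hw.le
  have : Real.exp (-(1 / ((n : ℝ) + 1)) * w) ≤ 1 := by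
    rw [Real.exp_le_one_iff, neg_mul]
    have : 0 ≤ 1 / ((n : ℝ) + 1) * w := by positivity
    linarith
  linarith [Real.exp_pos (-((n : ℝ) + 1) * w)]

theorem invW_le_exp (n : ℕ) {w : ℝ} (hw : 0 < w) :
    invW n w ≤ ((n : ℝ) + 1) * Real.exp (-(1 / ((n : ℝ) + 1)) * w) := by
  rw [invW, div_le_iff₀ hw]
  set k : ℝ := 1 / ((n : ℝ) + 1) with hk
  set R : ℝ := (n : ℝ) + 1
  have hk0 : 0 < k := by positivity
  have e : Real.exp (-R * w) = Real.exp (-k * w) * Real.exp ((k - R) * w) := by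
    rw [← Real.exp_add]; ring_nf
  have h1 := Real.add_one_le_exp ((k - R) * w)
  rw [e]
  have h2 := Real.exp_pos (-k * w)
  nlinarith [mul_pos hk0 hw]

theorem invW_le (n : ℕ) {w : ℝ} (hw : 0 < w) : invW n w ≤ (n : ℝ) + 1 := by
  refine (invW_le_exp n hw).trans ?_
  refine mul_le_of_le_one_right (by positivity) ?_
  rw [Real.exp_le_one_iff, neg_mul]
  have : 0 ≤ 1 / ((n : ℝ) + 1) * w := by positivity
  linarith

theorem measurable_invW (n : ℕ) : Measurable (invW n) := by unfold invW; fun_prop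

theorem integrable_invW (n : ℕ) : IntegrableOn (invW n) (Set.Ioi 0) := by
  have h : IntegrableOn (fun w : ℝ => ((n : ℝ) + 1) * Real.exp (-(1 / ((n : ℝ) + 1)) * w))
      (Set.Ioi 0) := (exp_neg_integrableOn_Ioi 0 (by positivity)).const_mul _
  refine h.mono' (measurable_invW n).aestronglyMeasurable ?_
  filter_upwards [ae_restrict_mem measurableSet_Ioi] with w hw
  rw [Real.norm_of_nonneg (invW_nonneg n hw)]
  exact invW_le_exp n hw

theorem tendsto_invW {w : ℝ} (hw : 0 < w) : Tendsto (fun n => invW n w) atTop (𝓝 w⁻¹) := by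
  have h1 : Tendsto (fun n : ℕ => Real.exp (-(1 / ((n : ℝ) + 1)) * w)) atTop
      (𝓝 (Real.exp (-0 * w))) :=
    (Real.continuous_exp.tendsto _).comp (tendsto_one_div_add_atTop_nhds_zero_nat.neg.mul_const w)
  have h2 : Tendsto (fun n : ℕ => Real.exp (-((n : ℝ) + 1) * w)) atTop (𝓝 0) := by
    refine Real.tendsto_exp_atBot.comp ?_
    refine Tendsto.atBot_mul_const hw ?_
    exact tendsto_neg_atTop_atBot.comp
      (tendsto_atTop_add_const_right _ _ tendsto_natCast_atTop_atTop)
  have := (h1.sub h2).div_const w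
  simpa [invW] using this

theorem integral_exp_sin (t r : ℝ) (ht : 0 < t) :
    IntegrableOn (fun w => Real.exp (-t * w) * Real.sin (w * r)) (Set.Ioi 0) ∧
    ∫ w in Set.Ioi 0, Real.exp (-t * w) * Real.sin (w * r) = r / (t ^ 2 + r ^ 2) := by
  have ha : (-t + r * Complex.I : ℂ).re < 0 := by simpa using ht
  have h1 := integral_exp_mul_complex_Ioi ha 0
  have h2 := integrableOn_exp_mul_complex_Ioi ha 0
  have e : ∀ w : ℝ, (Complex.exp ((-t + r * Complex.I : ℂ) * w)).im =
      Real.exp (-t * w) * Real.sin (w * r) := fun w => by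
    rw [Complex.exp_im]; simp [mul_comm]
  constructor
  · have := h2.im
    simpa [e, IntegrableOn] using this
  · have h3 : (∫ w in Set.Ioi (0 : ℝ), Complex.exp ((-t + r * Complex.I : ℂ) * w)).im =
        ∫ w in Set.Ioi (0 : ℝ), (Complex.exp ((-t + r * Complex.I : ℂ) * w)).im := by
      have := integral_im (𝕜 := ℂ) h2
      simpa using this.symm
    simp only [e] at h3
    rw [← h3, h1]
    simp [Complex.div_im, Complex.normSq_apply]
    ring

theorem integral_ratio (r : ℝ) {k R : ℝ} :
    ∫ t in k..R, r / (t ^ 2 + r ^ 2) = Real.arctan (R / r) - Real.arctan (k / r) := by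
  rcases eq_or_ne r 0 with rfl | hr
  · simp
  refine intervalIntegral.integral_eq_sub_of_hasDerivAt (f := fun t => Real.arctan (t / r))
    (fun t _ => ?_) ?_
  · have := ((hasDerivAt_id t).div_const r).arctan
    refine this.congr_deriv ?_
    simp only [id]; field_simp; ring
  · refine Continuous.intervalIntegrable ?_ _ _
    refine continuous_const.div (by fun_prop) fun t => ?_
    positivity

theorem integral_sin_invW (n : ℕ) (r : ℝ) :
    ∫ w in Set.Ioi 0, Real.sin (w * r) * invW n w =
      Real.arctan (((n : ℝ) + 1) / r) - Real.arctan ((1 / ((n : ℝ) + 1)) / r) := by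
  set k : ℝ := 1 / ((n : ℝ) + 1) with hk
  set R : ℝ := (n : ℝ) + 1
  have hk0 : 0 < k := by positivity
  have hkR : k ≤ R := by
    rw [hk, div_le_iff₀ (by positivity)]
    simp only [R]; nlinarith [(Nat.cast_nonneg n : (0 : ℝ) ≤ n)]
  rw [← integral_ratio]
  have e : ∀ w ∈ Set.Ioi (0 : ℝ), Real.sin (w * r) * invW n w =
      ∫ t in k..R, Real.exp (-t * w) * Real.sin (w * r) := fun w hw => by
    have hw' : w ≠ 0 := (Set.mem_Ioi.1 hw).ne'
    rw [intervalIntegral.integral_mul_const, mul_comm]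
    congr 1
    have : ∀ t ∈ Set.uIcc k R, HasDerivAt (fun t => -Real.exp (-t * w) / w)
        (Real.exp (-t * w)) t := fun t _ => by
      have h := ((((hasDerivAt_id t).neg.mul_const w).exp).neg).div_const w
      refine h.congr_deriv ?_
      simp only [Pi.neg_apply, id]; field_simp
    rw [intervalIntegral.integral_eq_sub_of_hasDerivAt this
      (Continuous.intervalIntegrable (by fun_prop) _ _)]
    rw [invW]; ring
  rw [setIntegral_congr_fun measurableSet_Ioi e]
  have e2 : ∫ t in k..R, r / (t ^ 2 + r ^ 2) =
      ∫ t in k..R, ∫ w in Set.Ioi 0, Real.exp (-t * w) * Real.sin (w * r) := by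
    refine intervalIntegral.integral_congr fun t ht => ?_
    rw [Set.uIcc_of_le hkR] at ht
    exact ((integral_exp_sin t r (hk0.trans_le ht.1)).2).symm
  rw [e2]
  simp only [intervalIntegral.integral_of_le hkR]
  refine integral_integral_swap (f := fun w t => Real.exp (-t * w) * Real.sin (w * r)) ?_
  have hb : Integrable (fun q : ℝ × ℝ => Real.exp (-k * q.1) * (1 : ℝ))
      ((volume.restrict (Set.Ioi 0)).prod (volume.restrict (Set.Ioc k R))) :=
    Integrable.mul_prod (f := fun w => Real.exp (-k * w)) (g := fun _ => (1 : ℝ))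
      (exp_neg_integrableOn_Ioi 0 hk0) (integrable_const _)
  refine hb.mono' (Continuous.aestronglyMeasurable (by fun_prop)) ?_
  rw [Measure.prod_restrict]
  filter_upwards [ae_restrict_mem (measurableSet_Ioi.prod measurableSet_Ioc)] with q hq
  have h1 : 0 < q.1 := hq.1
  have h2 : k < q.2 := hq.2.1
  simp only [Function.uncurry]
  rw [norm_mul, Real.norm_of_nonneg (Real.exp_pos _).le]
  refine mul_le_mul (Real.exp_le_exp.2 (by nlinarith)) (Real.abs_sin_le_one _) (norm_nonneg _)
    (Real.exp_pos _).le

theorem abs_arctan_sub_le (x y : ℝ) : |Real.arctan x - Real.arctan y| ≤ Real.pi := by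
  rw [abs_le]
  constructor <;> linarith [Real.arctan_lt_pi_div_two x, Real.neg_pi_div_two_lt_arctan x,
    Real.arctan_lt_pi_div_two y, Real.neg_pi_div_two_lt_arctan y]

theorem tendsto_arctan_sub (r : ℝ) : Tendsto (fun n : ℕ => Real.arctan (((n : ℝ) + 1) / r) -
    Real.arctan ((1 / ((n : ℝ) + 1)) / r)) atTop (𝓝 (Real.pi / 2 * Real.sign r)) := by
  have h0 : Tendsto (fun n : ℕ => (n : ℝ) + 1) atTop atTop :=
    tendsto_atTop_add_const_right _ _ tendsto_natCast_atTop_atTop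
  have h2 : Tendsto (fun n : ℕ => Real.arctan ((1 / ((n : ℝ) + 1)) / r)) atTop (𝓝 0) := by
    have := (Real.continuous_arctan.tendsto _).comp
      ((tendsto_one_div_add_atTop_nhds_zero_nat (𝕜 := ℝ)).div_const r)
    simpa [Function.comp_def] using this
  rcases lt_trichotomy r 0 with hr | rfl | hr
  · have h1 : Tendsto (fun n : ℕ => Real.arctan (((n : ℝ) + 1) / r)) atTop (𝓝 (-(Real.pi / 2))) :=
      (Real.tendsto_arctan_atBot.mono_right nhdsWithin_le_nhds).comp
        (h0.atTop_div_const_of_neg hr)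
    rw [Real.sign_of_neg hr]
    simpa using h1.sub h2
  · simp
  · have h1 : Tendsto (fun n : ℕ => Real.arctan (((n : ℝ) + 1) / r)) atTop (𝓝 (Real.pi / 2)) :=
      (Real.tendsto_arctan_atTop.mono_right nhdsWithin_le_nhds).comp (h0.atTop_div_const hr)
    rw [Real.sign_of_pos hr]
    simpa using h1.sub h2

/-- The imaginary part of `∫ conj ã b̃ dω/ω` is given by the sign kernel. -/
theorem integral_im_conj_ft_mul_ft {a b : ℝ → ℝ} (ha : Integrable a) (hb : Integrable b)
    (hi : IntegrableOn (fun w => (conj (ft a w) * ft b w).im / w) (Set.Ioi 0)) :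
    ∫ w in Set.Ioi 0, (conj (ft a w) * ft b w).im / w =
      1 / (8 * Real.pi) * ∫ p : ℝ × ℝ, a p.1 * b p.2 * Real.sign (p.2 - p.1) := by
  have hab : Integrable (fun p : ℝ × ℝ => a p.1 * b p.2) := ha.mul_prod hb
  have hc : Continuous fun w => conj (ft a w) * ft b w :=
    (Complex.continuous_conj.comp (continuous_ft ha)).mul (continuous_ft hb)
  have key : ∀ n, ∫ w in Set.Ioi 0, (conj (ft a w) * ft b w).im * invW n w =
      (1 / (2 * Real.pi)) ^ 2 * ∫ p : ℝ × ℝ, a p.1 * b p.2 *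
        (Real.arctan (((n : ℝ) + 1) / (p.2 - p.1)) -
          Real.arctan ((1 / ((n : ℝ) + 1)) / (p.2 - p.1))) := fun n => by
    have h := swap_prod_integral (integrable_invW n) ha hb
    have h' : ∫ w in Set.Ioi (0 : ℝ), conj (ft a w) * ft b w * (invW n w : ℂ) =
        ∫ p : ℝ × ℝ, (((1 / (2 * Real.pi)) ^ 2 : ℝ) : ℂ) * ((a p.1 * b p.2 : ℝ) : ℂ) *
        ∫ w in Set.Ioi (0 : ℝ), Complex.exp (Complex.I * w * (p.2 - p.1 : ℝ)) * (invW n w : ℂ) := by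
      simp only [conj_ft_mul_ft, mul_assoc, integral_const_mul]
      simp only [mul_assoc] at h
      rw [h]
    have hint : IntegrableOn (fun w => conj (ft a w) * ft b w * (invW n w : ℂ)) (Set.Ioi 0) := by
      refine (integrable_invW n).ofReal.bdd_mul (c := (∫ s, |a s|) * ∫ s, |b s|)
        hc.aestronglyMeasurable (Eventually.of_forall fun w => ?_)
      rw [norm_mul, RCLike.norm_conj]
      exact mul_le_mul (norm_ft_le a w) (norm_ft_le b w) (norm_nonneg _)
        (integral_nonneg fun _ => abs_nonneg _)
    have h1 := congrArg Complex.im h'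
    have h2 : (∫ w in Set.Ioi (0 : ℝ), conj (ft a w) * ft b w * (invW n w : ℂ)).im =
        ∫ w in Set.Ioi 0, (conj (ft a w) * ft b w).im * invW n w := by
      have := integral_im (𝕜 := ℂ) hint
      simp only [RCLike.im_to_complex] at this
      rw [← this]
      congr 1; funext w
      rw [Complex.im_mul_ofReal]
    rw [h2] at h1
    rw [h1, ← integral_const_mul]
    have hint2 : ∀ r : ℝ, IntegrableOn (fun w : ℝ => Complex.exp (Complex.I * w * r) *
        (invW n w : ℂ)) (Set.Ioi 0) := fun r =>
      (integrable_invW n).ofReal.bdd_mul (c := 1) (Continuous.aestronglyMeasurable (by fun_prop))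
        (Eventually.of_forall fun w => (norm_exp_I_mul _ _).le)
    have e3 : ∀ r : ℝ, (∫ w in Set.Ioi (0 : ℝ), Complex.exp (Complex.I * w * r) * (invW n w : ℂ)).im =
        Real.arctan (((n : ℝ) + 1) / r) - Real.arctan ((1 / ((n : ℝ) + 1)) / r) := fun r => by
      rw [← integral_sin_invW]
      have := integral_im (𝕜 := ℂ) (hint2 r)
      simp only [RCLike.im_to_complex] at this
      rw [← this]
      congr 1; funext w
      rw [Complex.im_mul_ofReal, show Complex.I * w * r = ((w * r : ℝ) : ℂ) * Complex.I by
        push_cast; ring, Complex.exp_ofReal_mul_I_im]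
    have hint3 : Integrable (fun p : ℝ × ℝ => (((1 / (2 * Real.pi)) ^ 2 : ℝ) : ℂ) *
        ((a p.1 * b p.2 : ℝ) : ℂ) *
        ∫ w in Set.Ioi (0 : ℝ), Complex.exp (Complex.I * w * (p.2 - p.1 : ℝ)) * (invW n w : ℂ)) := by
      refine Integrable.mul_bdd (c := ∫ w in Set.Ioi 0, invW n w) (hab.ofReal.const_mul _) ?_ ?_
      · refine Continuous.aestronglyMeasurable ?_
        refine continuous_of_dominated (bound := fun w => ‖invW n w‖)
          (fun p => (hint2 (p.2 - p.1)).1)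
          (fun p => Eventually.of_forall fun w => ?_) (integrable_invW n).norm
          (Eventually.of_forall fun w => by fun_prop)
        rw [norm_mul, norm_exp_I_mul, one_mul, Complex.norm_real]
      · refine Eventually.of_forall fun p => ?_
        refine norm_integral_le_of_norm_le (integrable_invW n) ?_
        filter_upwards [ae_restrict_mem measurableSet_Ioi] with w hw
        rw [norm_mul, norm_exp_I_mul, one_mul, Complex.norm_real,
          Real.norm_of_nonneg (invW_nonneg n hw)]
    have h4 := integral_im (𝕜 := ℂ) hint3
    simp only [RCLike.im_to_complex] at h4
    rw [← h4]
    congr 1; funext p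
    rw [← Complex.ofReal_mul, Complex.im_ofReal_mul, e3, mul_assoc]
  have hL : Tendsto (fun n => ∫ w in Set.Ioi 0, (conj (ft a w) * ft b w).im * invW n w) atTop
      (𝓝 (∫ w in Set.Ioi 0, (conj (ft a w) * ft b w).im / w)) := by
    refine tendsto_integral_of_dominated_convergence
      (fun w => ‖(conj (ft a w) * ft b w).im / w‖) (fun n => ?_) hi.norm (fun n => ?_) ?_
    · exact ((Complex.continuous_im.comp hc).measurable.mul
        (measurable_invW n)).aestronglyMeasurable
    · filter_upwards [ae_restrict_mem measurableSet_Ioi] with w hw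
      rw [div_eq_mul_inv, norm_mul, norm_mul, Real.norm_of_nonneg (invW_nonneg n hw),
        Real.norm_of_nonneg (inv_nonneg.2 (Set.mem_Ioi.1 hw).le)]
      exact mul_le_mul_of_nonneg_left (invW_le_inv n hw) (norm_nonneg _)
    · filter_upwards [ae_restrict_mem measurableSet_Ioi] with w hw
      exact (tendsto_invW hw).const_mul _
  have hR : Tendsto (fun n : ℕ => (1 / (2 * Real.pi)) ^ 2 * ∫ p : ℝ × ℝ, a p.1 * b p.2 *
        (Real.arctan (((n : ℝ) + 1) / (p.2 - p.1)) -
          Real.arctan ((1 / ((n : ℝ) + 1)) / (p.2 - p.1)))) atTop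
      (𝓝 ((1 / (2 * Real.pi)) ^ 2 * ∫ p : ℝ × ℝ, a p.1 * b p.2 *
        (Real.pi / 2 * Real.sign (p.2 - p.1)))) := by
    refine Tendsto.const_mul _ ?_
    refine tendsto_integral_of_dominated_convergence
      (fun p => ‖a p.1 * b p.2‖ * Real.pi) (fun n => ?_) (hab.norm.mul_const _) (fun n => ?_) ?_
    · refine hab.1.mul (Measurable.aestronglyMeasurable ?_)
      have := Real.continuous_arctan.measurable
      fun_prop
    · refine Eventually.of_forall fun p => ?_
      rw [norm_mul]
      exact mul_le_mul_of_nonneg_left (abs_arctan_sub_le _ _) (norm_nonneg _)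
    · exact Eventually.of_forall fun p => (tendsto_arctan_sub _).const_mul _
  simp only [key] at hL
  rw [tendsto_nhds_unique hL hR, show (1 / (8 * Real.pi) : ℝ) =
    (1 / (2 * Real.pi)) ^ 2 * (Real.pi / 2) by field_simp; norm_num, mul_assoc,
    ← integral_const_mul (Real.pi / 2)]
  congr 2; funext p; ring

/-- Cauchy-Schwarz inequality for the weighted norm. -/
theorem integrable_mul_rpow_of_weight {ε : ℝ} (hε : 0 < ε) {a : ℝ → ℝ} (hm : Measurable a)
    (ha : Integrable fun s => a s ^ 2 * weight ε s) :
    Integrable (fun s => |a s| * (1 + |s|) ^ (ε / 4)) ∧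
    (∫ s, |a s| * (1 + |s|) ^ (ε / 4)) ^ 2 ≤
      (∫ s, (weight (ε / 2) s)⁻¹) * ∫ s, a s ^ 2 * weight ε s := by
  have hw := integrable_inv_weight (half_pos hε)
  have hc : Continuous fun s : ℝ => (1 + |s|) ^ (ε / 4) :=
    Continuous.rpow_const (by fun_prop) fun s => Or.inl (by positivity)
  have hpos : ∀ s : ℝ, 0 < 1 + |s| := fun s => by positivity
  have e1 : ∀ s : ℝ, ((1 + |s|) ^ (ε / 4)) ^ 2 * (weight (ε / 2) s) = weight ε s := fun s => by
    rw [weight, weight, ← Real.rpow_natCast, ← Real.rpow_mul (hpos s).le, ← Real.rpow_add (hpos s)]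
    congr 1; push_cast; ring
  have e2 : ∀ s, (|a s| * (1 + |s|) ^ (ε / 4)) * (1 : ℝ) ≤
      (a s ^ 2 * weight ε s + (weight (ε / 2) s)⁻¹) := fun s => by
    have w := weight_pos (ε / 2) s
    rw [← e1]
    set x := (1 + |s|) ^ (ε / 4)
    set y := weight (ε / 2) s
    have : a s ^ 2 * (x ^ 2 * y) + y⁻¹ = ((|a s| * x * y) ^ 2 + 1) * y⁻¹ := by
      rw [mul_pow, mul_pow, sq_abs]; field_simp
    rw [this, ← div_eq_mul_inv, le_div_iff₀ w]
    nlinarith [sq_nonneg (|a s| * x * y - 1)]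
  have hint : Integrable (fun s => |a s| * (1 + |s|) ^ (ε / 4)) := by
    refine (ha.add hw).mono' (hm.norm.mul hc.measurable).aestronglyMeasurable
      (Eventually.of_forall fun s => ?_)
    rw [Real.norm_of_nonneg (by positivity)]
    simpa using e2 s
  refine ⟨hint, ?_⟩
  have hq : ∀ t : ℝ, 0 ≤ (∫ s, (weight (ε / 2) s)⁻¹) * (t * t) +
      (-2 * ∫ s, |a s| * (1 + |s|) ^ (ε / 4)) * t + ∫ s, a s ^ 2 * weight ε s := fun t => by
    have : (∫ s, (weight (ε / 2) s)⁻¹) * (t * t) +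
        (-2 * ∫ s, |a s| * (1 + |s|) ^ (ε / 4)) * t + ∫ s, a s ^ 2 * weight ε s =
        ∫ s, ((weight (ε / 2) s)⁻¹ * (t * t) + (-2 * t) * (|a s| * (1 + |s|) ^ (ε / 4)) +
          a s ^ 2 * weight ε s) := by
      rw [integral_add (by exact (hw.mul_const _).add (hint.const_mul _)) ha,
        integral_add (hw.mul_const _) (hint.const_mul _), integral_mul_const, integral_const_mul]
      ring
    rw [this]
    refine integral_nonneg fun s => ?_
    simp only [Pi.zero_apply]
    have w := weight_pos (ε / 2) s
    rw [← e1, ← sq_abs (a s)]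
    set x := (1 + |s|) ^ (ε / 4)
    set y := weight (ε / 2) s
    have : y⁻¹ * (t * t) + -2 * t * (|a s| * x) + |a s| ^ 2 * (x ^ 2 * y) =
        y⁻¹ * (t - |a s| * x * y) ^ 2 := by field_simp; ring
    rw [this]; positivity
  have := discrim_le_zero hq
  rw [discrim] at this
  nlinarith

theorem fourier_eq_ft (u : preT) (w : ℝ) (l : Cone) (a : Fin 4) :
    fourier u w l a = ft (fun s => u.1 s l a) w := rfl

theorem measurable_slice (u : preT) (n : S2) (a : Fin 4) :
    Measurable fun s => u.1 s (sec n) a :=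
  (measurable_comp_onSec (preT.measurable u) a).comp (measurable_const.prodMk measurable_id)

theorem measurable_fourier (u : preT) (a : Fin 4) :
    Measurable fun p : S2 × ℝ => fourier u p.2 (sec p.1) a := by
  have h : StronglyMeasurable (fun q : (S2 × ℝ) × ℝ =>
      (u.1 q.2 (sec q.1.1) a : ℂ) * Complex.exp (Complex.I * q.1.2 * q.2)) := by
    refine Measurable.stronglyMeasurable (Measurable.mul ?_ (Continuous.measurable (by fun_prop)))
    exact Complex.measurable_ofReal.comp ((measurable_comp_onSec (preT.measurable u) a).comp
      ((measurable_fst.comp measurable_fst).prodMk measurable_snd))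
  exact (h.integral_prod_right'.measurable).const_mul _

theorem fourier_zero (u : preT) (l : Cone) (hi : ∀ a, Integrable fun s => u.1 s l a) (a : Fin 4) :
    fourier u 0 l a = (zeroMode u.1 l a : ℝ) := by
  simp only [zeroMode, Pi.smul_apply, smul_eq_mul, fourier]
  rw [integral_comp_eval hi]
  simp only [Complex.ofReal_zero, mul_zero, zero_mul, Complex.exp_zero, mul_one]
  rw [integral_complex_ofReal]
  push_cast; ring

/-- Uniform and Hölder bounds of the Fourier transform. -/
theorem preT.exists_bound (u : preT) : ∃ θ : ℝ, 0 < θ ∧ θ ≤ 1 ∧ ∃ M : S2 → ℝ,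
    Integrable (fun n => M n ^ 2) dl ∧ ∀ᵐ n ∂dl, 0 ≤ M n ∧ ∀ a w,
      ‖fourier u w (sec n) a‖ ≤ M n ∧
      ‖fourier u w (sec n) a - fourier u 0 (sec n) a‖ ≤ |w| ^ θ * M n := by
  obtain ⟨ε', hε', h'⟩ := u.2.2.2.2
  set ε := min ε' 1 with hε_def
  have hε : 0 < ε := lt_min hε' one_pos
  have h : FiniteNorm ε u.1 := h'.mono (min_le_left _ _) (preT.measurable u)
  set m : Fin 4 → S2 → ℝ := fun a n => ∫ s, |u.1 s (sec n) a| * (1 + |s|) ^ (ε / 4) with hm_def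
  have hmm : ∀ a, Measurable (m a) := fun a => by
    have : StronglyMeasurable (fun q : S2 × ℝ => |u.1 q.2 (sec q.1) a| * (1 + |q.2|) ^ (ε / 4)) := by
      refine Measurable.stronglyMeasurable (Measurable.mul ?_ (by fun_prop))
      exact (measurable_comp_onSec (preT.measurable u) a).norm
    exact this.integral_prod_right'.measurable
  have hae : ∀ᵐ n ∂dl, ∀ a, Integrable (fun s => u.1 s (sec n) a ^ 2 * weight ε s) :=
    ae_all_iff.2 fun a => (h a).prod_right_ae
  have hm0 : ∀ a n, 0 ≤ m a n := fun a n => integral_nonneg fun s => by positivity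
  have hm2 : ∀ a, Integrable (fun n => m a n ^ 2) dl := fun a => by
    refine ((h a).integral_prod_left.const_mul (∫ s, (weight (ε / 2) s)⁻¹)).mono'
      ((hmm a).pow_const 2).aestronglyMeasurable ?_
    filter_upwards [hae] with n hn
    rw [Real.norm_of_nonneg (by positivity)]
    exact (integrable_mul_rpow_of_weight hε (measurable_slice u n a) (hn a)).2
  refine ⟨ε / 4, by positivity, by have := min_le_right ε' 1; linarith, fun n => ∑ a, m a n, ?_, ?_⟩
  · refine ((integrable_finsetSum Finset.univ fun a _ => hm2 a).const_mul 4).mono'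
      (Measurable.aestronglyMeasurable (by fun_prop)) (Eventually.of_forall fun n => ?_)
    rw [Real.norm_of_nonneg (by positivity)]
    have := sq_sum_le_card_mul_sum_sq (s := Finset.univ) (f := fun a => m a n)
    simpa using this
  · filter_upwards [hae, preT.integrable_slice u] with n hn hi
    refine ⟨Finset.sum_nonneg fun a _ => hm0 a n, fun a w => ?_⟩
    have h1 := (integrable_mul_rpow_of_weight hε (measurable_slice u n a) (hn a)).1
    have h2 : m a n ≤ ∑ a, m a n := Finset.single_le_sum (fun a _ => hm0 a n) (Finset.mem_univ a)
    have h3 : ∫ s, |u.1 s (sec n) a| ≤ m a n := by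
      refine integral_mono (hi a).norm h1 fun s => ?_
      refine le_mul_of_one_le_right (abs_nonneg _) (Real.one_le_rpow ?_ (by positivity))
      linarith [abs_nonneg s]
    refine ⟨(norm_ft_le _ w).trans (h3.trans h2), ?_⟩
    refine (norm_ft_sub_le (by positivity) (by have := min_le_right ε' 1; linarith) (hi a) h1
      w).trans ?_
    exact mul_le_mul_of_nonneg_left h2 (by positivity)

/-- Square integrability, with the bound given by Bessel's inequality. -/
theorem preT.lintegral_fourier_sq_le (u : preT) (a : Fin 4) :
    ∫⁻ p : S2 × ℝ, ENNReal.ofReal (‖fourier u p.2 (sec p.1) a‖ ^ 2) ∂(dl.prod volume) ≤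
      ∫⁻ p : S2 × ℝ, ENNReal.ofReal (u.1 p.2 (sec p.1) a ^ 2) ∂(dl.prod volume) := by
  have m1 := measurable_fourier u a
  have m2 := measurable_comp_onSec (preT.measurable u) a
  rw [lintegral_prod _ (m1.norm.pow_const 2).ennreal_ofReal.aemeasurable,
    lintegral_prod _ (m2.pow_const 2).ennreal_ofReal.aemeasurable]
  refine lintegral_mono_ae ?_
  filter_upwards [preT.integrable_slice u] with n hn
  refine (lintegral_ft_sq_le (measurable_slice u n a) (hn a)).trans ?_
  refine mul_le_of_le_one_left zero_le ?_
  rw [ENNReal.ofReal_le_one, div_le_one (by positivity)]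
  linarith [Real.pi_gt_three]

theorem preT.integrable_sq (u : preT) (a : Fin 4) :
    Integrable (fun p : S2 × ℝ => u.1 p.2 (sec p.1) a ^ 2) (dl.prod volume) := by
  obtain ⟨ε, hε, h⟩ := u.2.2.2.2
  refine (h a).mono' ((measurable_comp_onSec (preT.measurable u) a).pow_const 2).aestronglyMeasurable
    (Eventually.of_forall fun p => ?_)
  rw [Real.norm_of_nonneg (sq_nonneg _)]
  refine le_mul_of_one_le_right (sq_nonneg _) (Real.one_le_rpow ?_ (by positivity))
  linarith [abs_nonneg p.2]

theorem preT.integrable_fourier_sq (u : preT) (a : Fin 4) :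
    Integrable (fun p : S2 × ℝ => ‖fourier u p.2 (sec p.1) a‖ ^ 2) (dl.prod volume) := by
  refine ⟨((measurable_fourier u a).norm.pow_const 2).aestronglyMeasurable, ?_⟩
  rw [hasFiniteIntegral_iff_ofReal (Eventually.of_forall fun p => by positivity)]
  refine (preT.lintegral_fourier_sq_le u a).trans_lt ?_
  have := (preT.integrable_sq u a).2
  rwa [hasFiniteIntegral_iff_ofReal (Eventually.of_forall fun p => by positivity)] at this

theorem preT.integral_fourier_sq_le (u : preT) (a : Fin 4) :
    ∫ p : S2 × ℝ, ‖fourier u p.2 (sec p.1) a‖ ^ 2 ∂(dl.prod volume) ≤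
      ∫ p : S2 × ℝ, u.1 p.2 (sec p.1) a ^ 2 ∂(dl.prod volume) := by
  rw [← ENNReal.ofReal_le_ofReal_iff (integral_nonneg fun p => by positivity),
    ofReal_integral_eq_lintegral_ofReal ((preT.integrable_fourier_sq u a))
      (Eventually.of_forall fun p => by positivity),
    ofReal_integral_eq_lintegral_ofReal ((preT.integrable_sq u a))
      (Eventually.of_forall fun p => by positivity)]
  exact preT.lintegral_fourier_sq_le u a

/-- The measure `dω d²l` on positive frequencies. -/
abbrev dlw : Measure (S2 × ℝ) := dl.prod (volume.restrict (Set.Ioi 0))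

theorem dlw_le : dlw ≤ dl.prod volume := by
  have : dlw = (dl.prod volume).restrict (Set.univ ×ˢ Set.Ioi 0) := by
    rw [← Measure.prod_restrict, Measure.restrict_univ]
  rw [this]; exact Measure.restrict_le_self

theorem ae_dlw_pos : ∀ᵐ p ∂dlw, 0 < p.2 := by
  have : dlw = (dl.prod volume).restrict (Set.univ ×ˢ Set.Ioi 0) := by
    rw [← Measure.prod_restrict, Measure.restrict_univ]
  rw [this]
  filter_upwards [ae_restrict_mem (MeasurableSet.univ.prod measurableSet_Ioi)] with p hp
  exact hp.2

theorem ae_dlw_of_ae {P : S2 → Prop} (h : ∀ᵐ n ∂dl, P n) : ∀ᵐ p ∂dlw, P p.1 :=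
  (Measure.quasiMeasurePreserving_fst (μ := dl) (ν := volume.restrict (Set.Ioi (0 : ℝ)))).ae h

/-- Subtraction of the zero mode at low frequencies. -/
def lowSub (u : preT) (p : S2 × ℝ) (a : Fin 4) : ℂ :=
  fourier u p.2 (sec p.1) a - (if p.2 < 1 then fourier u 0 (sec p.1) a else 0)

/-- Common integrable bounds of the products of Fourier transforms, divided by the frequency. -/
theorem exists_dominating (u v : preT) : ∃ G : S2 × ℝ → ℝ, Integrable G dlw ∧
    ∀ᵐ p ∂dlw, ∀ a b,
      ‖(conj (fourier u p.2 (sec p.1) a) * fourier v p.2 (sec p.1) b).im / p.2‖ ≤ G p ∧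
      ‖conj (lowSub u p a) * lowSub v p b / (p.2 : ℂ)‖ ≤ G p := by
  obtain ⟨θ, h0, h1, M, hM, hb⟩ := (preT.exists_bound u)
  obtain ⟨φ, k0, k1, N, hN, kb⟩ := (preT.exists_bound v)
  set r := min θ φ with hr
  have r0 : 0 < r := lt_min h0 k0
  refine ⟨fun p => (M p.1 ^ 2 + N p.1 ^ 2) * (Set.indicator (Set.Iio 1) (fun w => w ^ (r - 1)) p.2)
    + ∑ a, (‖fourier u p.2 (sec p.1) a‖ ^ 2 + ‖fourier v p.2 (sec p.1) a‖ ^ 2), ?_, ?_⟩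
  · refine Integrable.add ?_ ?_
    · refine (hM.add hN).mul_prod ?_
      rw [integrable_indicator_iff measurableSet_Iio, IntegrableOn,
        Measure.restrict_restrict measurableSet_Iio, Set.inter_comm, Set.Ioi_inter_Iio]
      have := (intervalIntegral.intervalIntegrable_rpow' (a := 0) (b := 1) (r := r - 1)
        (by linarith)).1
      exact this.mono_set Set.Ioo_subset_Ioc_self
    · refine integrable_finsetSum _ fun a _ => ?_
      exact (((preT.integrable_fourier_sq u a)).add ((preT.integrable_fourier_sq v a))).mono_measure dlw_le
  · filter_upwards [ae_dlw_pos, ae_dlw_of_ae hb, ae_dlw_of_ae kb,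
      ae_dlw_of_ae (preT.integrable_slice u), ae_dlw_of_ae (preT.integrable_slice v)] with p hp hu hv iu iv a b
    obtain ⟨hM0, hu⟩ := hu
    obtain ⟨hN0, hv⟩ := hv
    have hsum : 0 ≤ ∑ a, (‖fourier u p.2 (sec p.1) a‖ ^ 2 + ‖fourier v p.2 (sec p.1) a‖ ^ 2) :=
      Finset.sum_nonneg fun a _ => by positivity
    rcases lt_or_ge p.2 1 with hlt | hge
    · rw [Set.indicator_of_mem (Set.mem_Iio.2 hlt)]
      have ew : p.2 ^ (r - 1) = p.2 ^ r / p.2 := by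
        rw [Real.rpow_sub hp, Real.rpow_one]
      have eθ : |p.2| ^ θ ≤ p.2 ^ r := by
        rw [abs_of_pos hp]
        exact Real.rpow_le_rpow_of_exponent_ge hp hlt.le (min_le_left _ _)
      have eφ : |p.2| ^ φ ≤ p.2 ^ r := by
        rw [abs_of_pos hp]
        exact Real.rpow_le_rpow_of_exponent_ge hp hlt.le (min_le_right _ _)
      have er1 : p.2 ^ r ≤ 1 := Real.rpow_le_one hp.le hlt.le r0.le
      have er0 : 0 < p.2 ^ r := Real.rpow_pos_of_pos hp r
      set x := fourier u p.2 (sec p.1) a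
      set x0 := fourier u 0 (sec p.1) a with hx0
      set y := fourier v p.2 (sec p.1) b
      set y0 := fourier v 0 (sec p.1) b with hy0
      have a1 : ‖x‖ ≤ M p.1 := (hu a p.2).1
      have a2 : ‖x0‖ ≤ M p.1 := (hu a 0).1
      have a3 : ‖x - x0‖ ≤ p.2 ^ r * M p.1 :=
        (hu a p.2).2.trans (mul_le_mul_of_nonneg_right eθ hM0)
      have b1 : ‖y‖ ≤ N p.1 := (hv b p.2).1
      have b3 : ‖y - y0‖ ≤ p.2 ^ r * N p.1 :=
        (hv b p.2).2.trans (mul_le_mul_of_nonneg_right eφ hN0)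
      have hMN : 2 * (M p.1 * N p.1) ≤ M p.1 ^ 2 + N p.1 ^ 2 := by
        nlinarith [sq_nonneg (M p.1 - N p.1)]
      have hMN0 := mul_nonneg hM0 hN0
      constructor
      · have e1 : (conj x * y).im = (conj (x - x0) * y + conj x0 * (y - y0)).im := by
          have : (conj x0 * y0).im = 0 := by
            rw [hx0, hy0, fourier_zero u _ iu, fourier_zero v _ iv, Complex.conj_ofReal,
              ← Complex.ofReal_mul, Complex.ofReal_im]
          have e : conj x * y = conj (x - x0) * y + conj x0 * (y - y0) + conj x0 * y0 := by
            rw [map_sub]; ring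
          rw [e, Complex.add_im, this, add_zero]
        have e2 : |(conj x * y).im| ≤ p.2 ^ r * (M p.1 ^ 2 + N p.1 ^ 2) := by
          rw [e1]
          refine (Complex.abs_im_le_norm _).trans ((norm_add_le _ _).trans ?_)
          rw [norm_mul, norm_mul, RCLike.norm_conj, RCLike.norm_conj]
          have := mul_le_mul a3 b1 (norm_nonneg _) (by positivity)
          have := mul_le_mul a2 b3 (norm_nonneg _) hM0
          nlinarith
        rw [norm_div, Real.norm_eq_abs, Real.norm_of_nonneg hp.le, ew]
        refine le_add_of_le_of_nonneg ?_ hsum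
        rw [mul_div_assoc']
        refine div_le_div_of_nonneg_right ?_ hp.le
        linarith
      · rw [lowSub, lowSub, if_pos hlt, if_pos hlt, norm_div, norm_mul, RCLike.norm_conj,
          Complex.norm_real, Real.norm_of_nonneg hp.le, ew]
        refine le_add_of_le_of_nonneg ?_ hsum
        rw [mul_div_assoc']
        refine div_le_div_of_nonneg_right ?_ hp.le
        have := mul_le_mul a3 b3 (norm_nonneg _) (by positivity)
        have h5 : p.2 ^ r * (p.2 ^ r * (M p.1 * N p.1)) ≤ p.2 ^ r * (M p.1 * N p.1) :=
          mul_le_mul_of_nonneg_left (mul_le_of_le_one_left hMN0 er1) er0.le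
        nlinarith
    · rw [Set.indicator_of_notMem (by simpa using hge), mul_zero, zero_add]
      have s1 : ‖fourier u p.2 (sec p.1) a‖ ^ 2 + ‖fourier v p.2 (sec p.1) a‖ ^ 2 ≤ _ :=
        Finset.single_le_sum (f := fun a => ‖fourier u p.2 (sec p.1) a‖ ^ 2 +
          ‖fourier v p.2 (sec p.1) a‖ ^ 2) (fun a _ => by positivity) (Finset.mem_univ a)
      have s2 : ‖fourier u p.2 (sec p.1) b‖ ^ 2 + ‖fourier v p.2 (sec p.1) b‖ ^ 2 ≤ _ :=
        Finset.single_le_sum (f := fun a => ‖fourier u p.2 (sec p.1) a‖ ^ 2 +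
          ‖fourier v p.2 (sec p.1) a‖ ^ 2) (fun a _ => by positivity) (Finset.mem_univ b)
      have key : ‖conj (fourier u p.2 (sec p.1) a) * fourier v p.2 (sec p.1) b‖ ≤
          ∑ a, (‖fourier u p.2 (sec p.1) a‖ ^ 2 + ‖fourier v p.2 (sec p.1) a‖ ^ 2) := by
        rw [norm_mul, RCLike.norm_conj]
        nlinarith [sq_nonneg (‖fourier u p.2 (sec p.1) a‖ - ‖fourier v p.2 (sec p.1) b‖),
          sq_nonneg (‖fourier v p.2 (sec p.1) a‖), sq_nonneg (‖fourier u p.2 (sec p.1) b‖)]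
      constructor
      · rw [norm_div, Real.norm_eq_abs, Real.norm_of_nonneg hp.le]
        refine (div_le_self (abs_nonneg _) hge).trans ?_
        exact (Complex.abs_im_le_norm _).trans key
      · rw [lowSub, lowSub, if_neg (not_lt.2 hge), if_neg (not_lt.2 hge), sub_zero, sub_zero,
          norm_div, Complex.norm_real, Real.norm_of_nonneg hp.le]
        exact (div_le_self (norm_nonneg _) hge).trans key

/-- A class in `𝓗₀` vanishes only if the representative is proportional to `l`. -/
theorem H0.mk_eq_zero_iff {f : PreH0} :
    H0.mk f = 0 ↔ ∀ᵐ n ∂dl, ∃ c : ℝ, f.fn (sec n) = c • (sec n).1 := by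
  refine ⟨fun h => ?_, H0.mk_eq_zero_of_ae⟩
  have h1 : ‖f‖ = 0 := by
    have := congrArg norm h
    rwa [norm_zero] at this
  have h2 : inner ℝ f f = 0 := by rw [real_inner_self_eq_norm_sq, h1]; norm_num
  rw [PreH0.inner_def, integral_eq_zero_iff_of_nonneg (fun n => neg_η_nonneg n (f.orth _))
    (PreH0.integrable_η f f)] at h2
  filter_upwards [h2] with n hn
  have hn' : -η (f.fn (sec n)) (f.fn (sec n)) = 0 := hn
  refine ⟨f.fn (sec n) 0, ?_⟩
  have h := f.orth (sec n)
  have hs := n.sq_sum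
  generalize hF : f.fn (sec n) = F at h hn' ⊢
  simp only [η, sec, Matrix.cons_val] at h hn'
  set a := n.1 0; set b := n.1 1; set c := n.1 2
  have h0 : F 0 = a * F 1 + b * F 2 + c * F 3 := by linarith
  have e : (F 1 - F 0 * a) ^ 2 + (F 2 - F 0 * b) ^ 2 + (F 3 - F 0 * c) ^ 2 = 0 := by
    have : (F 1 - F 0 * a) ^ 2 + (F 2 - F 0 * b) ^ 2 + (F 3 - F 0 * c) ^ 2 =
      F 1 ^ 2 + F 2 ^ 2 + F 3 ^ 2 - 2 * F 0 * (a * F 1 + b * F 2 + c * F 3)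
        + F 0 ^ 2 * (a ^ 2 + b ^ 2 + c ^ 2) := by ring
    rw [this, hs, ← h0]; linarith
  have e1 : F 1 - F 0 * a = 0 := by
    nlinarith [sq_nonneg (F 1 - F 0 * a), sq_nonneg (F 2 - F 0 * b), sq_nonneg (F 3 - F 0 * c)]
  have e2 : F 2 - F 0 * b = 0 := by
    nlinarith [sq_nonneg (F 1 - F 0 * a), sq_nonneg (F 2 - F 0 * b), sq_nonneg (F 3 - F 0 * c)]
  have e3 : F 3 - F 0 * c = 0 := by
    nlinarith [sq_nonneg (F 1 - F 0 * a), sq_nonneg (F 2 - F 0 * b), sq_nonneg (F 3 - F 0 * c)]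
  ext i
  fin_cases i <;> simp [sec] <;> linarith

/-- Elements of `𝒯` with vanishing zero mode. -/
def kerP : Submodule ℝ preT := LinearMap.ker pPre

theorem mem_kerP (u : preT) : u ∈ kerP ↔ p (T.mk u) = 0 := Iff.rfl

theorem kerP_ae {u : preT} (hu : u ∈ kerP) : ∀ᵐ n ∂dl, ∃ c : ℝ, ∀ a,
    fourier u 0 (sec n) a = c * ((sec n).1 a : ℂ) := by
  have h : H0.mk ⟨zeroMode u.1, zeroMode_mem u⟩ = 0 := hu
  filter_upwards [H0.mk_eq_zero_iff.1 h, preT.integrable_slice u] with n ⟨c, hc⟩ hi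
  refine ⟨c, fun a => ?_⟩
  rw [fourier_zero u _ hi]
  have : zeroMode u.1 (sec n) a = c * (sec n).1 a := congrFun hc a
  rw [this]; push_cast; rfl

theorem ηC_add_left (x y z : Fin 4 → ℂ) : ηC (x + y) z = ηC x z + ηC y z := by
  simp only [ηC, Pi.add_apply, map_add]; ring
theorem ηC_add_right (x y z : Fin 4 → ℂ) : ηC x (y + z) = ηC x y + ηC x z := by
  simp only [ηC, Pi.add_apply]; ring
theorem ηC_smul_left (c : ℂ) (x y : Fin 4 → ℂ) : ηC (c • x) y = conj c * ηC x y := by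
  simp only [ηC, Pi.smul_apply, smul_eq_mul, map_mul]; ring
theorem ηC_smul_right (c : ℂ) (x y : Fin 4 → ℂ) : ηC x (c • y) = c * ηC x y := by
  simp only [ηC, Pi.smul_apply, smul_eq_mul]; ring

theorem fourier_add (u v : preT) : ∀ᵐ n ∂dl, ∀ w,
    fourier (u + v) w (sec n) = fourier u w (sec n) + fourier v w (sec n) := by
  filter_upwards [preT.integrable_slice u, preT.integrable_slice v] with n hu hv w
  ext a
  have h1 := integrable_mul_exp (hu a) w
  have h2 := integrable_mul_exp (hv a) w
  rw [Pi.add_apply, fourier, fourier, fourier, ← mul_add, ← integral_add h1 h2]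
  congr 2; funext s
  change ((u.1 s (sec n) a + v.1 s (sec n) a : ℝ) : ℂ) * _ = _
  push_cast; ring

theorem fourier_smul (c : ℝ) (u : preT) (w : ℝ) (l : Cone) :
    fourier (c • u) w l = (c : ℂ) • fourier u w l := by
  ext a
  rw [Pi.smul_apply, smul_eq_mul, fourier, fourier, mul_left_comm, ← integral_const_mul (c : ℂ)]
  congr 2; funext s
  change ((c * u.1 s l a : ℝ) : ℂ) * _ = _
  push_cast; ring

/-- The integrand `-ηC(ũ,ṽ)/ω` of the form `F`. -/
def FKer (u v : preT) (p : S2 × ℝ) : ℂ :=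
  -ηC (fourier u p.2 (sec p.1)) (fourier v p.2 (sec p.1)) / (p.2 : ℂ)

theorem FPre_eq (u v : preT) : FPre u v = ∫ p, FKer u v p ∂dlw := rfl

theorem measurable_ηC_fourier (u v : preT) : Measurable fun p : S2 × ℝ =>
    ηC (fourier u p.2 (sec p.1)) (fourier v p.2 (sec p.1)) := by
  have h : ∀ a, Measurable fun p : S2 × ℝ =>
      conj (fourier u p.2 (sec p.1) a) * fourier v p.2 (sec p.1) a := fun a =>
    (Complex.continuous_conj.measurable.comp (measurable_fourier u a)).mul (measurable_fourier v a)
  exact (((h 0).sub (h 1)).sub (h 2)).sub (h 3)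

theorem measurable_FKer (u v : preT) : Measurable (FKer u v) :=
  (measurable_ηC_fourier u v).neg.div (Complex.measurable_ofReal.comp measurable_snd)

theorem norm_ηC_le {x y : Fin 4 → ℂ} {G : ℝ} (h : ∀ a, ‖conj (x a) * y a‖ ≤ G) :
    ‖ηC x y‖ ≤ 4 * G := by
  have h1 := norm_sub_le (conj (x 0) * y 0 - conj (x 1) * y 1 - conj (x 2) * y 2)
    (conj (x 3) * y 3)
  have h2 := norm_sub_le (conj (x 0) * y 0 - conj (x 1) * y 1) (conj (x 2) * y 2)
  have h3 := norm_sub_le (conj (x 0) * y 0) (conj (x 1) * y 1)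
  unfold ηC
  linarith [h 0, h 1, h 2, h 3]

theorem lowSub_eq {u : preT} {p : S2 × ℝ} {c : ℝ}
    (hc : ∀ a, fourier u 0 (sec p.1) a = c * ((sec p.1).1 a : ℂ)) : ∃ d : ℂ,
    fourier u p.2 (sec p.1) = lowSub u p + d • fun a => ((sec p.1).1 a : ℂ) := by
  by_cases h : p.2 < 1
  · refine ⟨c, ?_⟩
    ext a
    simp [lowSub, h, hc]
  · refine ⟨0, ?_⟩
    ext a
    simp [lowSub, h]

theorem FKer_integrable {u v : preT} (hu : u ∈ kerP) (hv : v ∈ kerP) :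
    Integrable (FKer u v) dlw := by
  obtain ⟨G, hG, hb⟩ := exists_dominating u v
  refine (hG.const_mul 4).mono' (measurable_FKer u v).aestronglyMeasurable ?_
  filter_upwards [hb, ae_dlw_of_ae (kerP_ae hu), ae_dlw_of_ae (kerP_ae hv),
    ae_dlw_of_ae (η_fourier u), ae_dlw_of_ae (η_fourier v)] with p hp ⟨c, hc⟩ ⟨d, hd⟩ ou ov
  obtain ⟨c', hc'⟩ := lowSub_eq hc
  obtain ⟨d', hd'⟩ := lowSub_eq hd
  have o1 := ou p.2
  have o2 := ov p.2
  have e : ηC (fourier u p.2 (sec p.1)) (fourier v p.2 (sec p.1)) =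
      ηC (lowSub u p) (lowSub v p) := by
    have e3 := ηC_sec p.1
    rw [hc', ηC_add_right, ηC_smul_right, e3, mul_zero, add_zero] at o1
    rw [hd', ηC_add_right, ηC_smul_right, e3, mul_zero, add_zero] at o2
    have o1' : ηC (lowSub u p) (fun a => ((sec p.1).1 a : ℂ)) = 0 := by
      rw [ηC_conj, o1, map_zero]
    rw [hc', hd']
    simp only [ηC_add_left, ηC_add_right, ηC_smul_left, ηC_smul_right, e3, o1', o2]
    ring
  rw [FKer, e, norm_div, norm_neg, ← norm_div]
  have e2 : ηC (lowSub u p) (lowSub v p) / (p.2 : ℂ) =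
      ηC (lowSub u p) (fun a => lowSub v p a / (p.2 : ℂ)) := by
    simp only [ηC]; ring
  rw [e2]
  refine norm_ηC_le fun a => ?_
  rw [← mul_div_assoc]
  exact (hp a a).2

theorem FKer_im_integrable (u v : preT) : Integrable (fun p => (FKer u v p).im) dlw := by
  obtain ⟨G, hG, hb⟩ := exists_dominating u v
  refine (hG.const_mul 4).mono' (Complex.measurable_im.comp (measurable_FKer u v)).aestronglyMeasurable ?_
  filter_upwards [hb] with p hp
  have e : (FKer u v p).im = -((conj (fourier u p.2 (sec p.1) 0) * fourier v p.2 (sec p.1) 0).im / p.2)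
      + (conj (fourier u p.2 (sec p.1) 1) * fourier v p.2 (sec p.1) 1).im / p.2
      + (conj (fourier u p.2 (sec p.1) 2) * fourier v p.2 (sec p.1) 2).im / p.2
      + (conj (fourier u p.2 (sec p.1) 3) * fourier v p.2 (sec p.1) 3).im / p.2 := by
    rw [FKer, Complex.div_ofReal_im, ηC, Complex.neg_im, Complex.sub_im, Complex.sub_im,
      Complex.sub_im]; ring
  rw [e]
  refine (norm_add_le _ _).trans ?_
  have h1 := norm_add_le (-((conj (fourier u p.2 (sec p.1) 0) * fourier v p.2 (sec p.1) 0).im / p.2)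
      + (conj (fourier u p.2 (sec p.1) 1) * fourier v p.2 (sec p.1) 1).im / p.2)
      ((conj (fourier u p.2 (sec p.1) 2) * fourier v p.2 (sec p.1) 2).im / p.2)
  have h2 := norm_add_le (-((conj (fourier u p.2 (sec p.1) 0) * fourier v p.2 (sec p.1) 0).im / p.2))
      ((conj (fourier u p.2 (sec p.1) 1) * fourier v p.2 (sec p.1) 1).im / p.2)
  rw [norm_neg] at h2
  linarith [(hp 0 0).1, (hp 1 1).1, (hp 2 2).1, (hp 3 3).1]

/-- The imaginary part of `F` is half the symplectic form. -/
theorem integral_FKer_im (u v : preT) : ∫ p, (FKer u v p).im ∂dlw = 1 / 2 * symPre u v := by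
  obtain ⟨G, hG, hb⟩ := exists_dominating u v
  have hcomp : ∀ a, Integrable (fun p : S2 × ℝ =>
      (conj (fourier u p.2 (sec p.1) a) * fourier v p.2 (sec p.1) a).im / p.2) dlw := fun a => by
    refine hG.mono' ?_ (hb.mono fun p hp => (hp a a).1)
    have := (Complex.continuous_conj.measurable.comp (measurable_fourier u a)).mul
      (measurable_fourier v a)
    exact ((Complex.measurable_im.comp this).div measurable_snd).aestronglyMeasurable
  have hi : ∀ a, ∀ᵐ n ∂dl, ∫ w in Set.Ioi 0,
      (conj (fourier u w (sec n) a) * fourier v w (sec n) a).im / w = 1 / (8 * Real.pi) *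
        ∫ q : ℝ × ℝ, u.1 q.1 (sec n) a * v.1 q.2 (sec n) a * Real.sign (q.2 - q.1) := fun a => by
    filter_upwards [(hcomp a).prod_right_ae, preT.integrable_slice u, preT.integrable_slice v]
      with n h1 h2 h3
    exact integral_im_conj_ft_mul_ft (h2 a) (h3 a) h1
  have hs : ∀ a, Integrable (fun q : S2 × ℝ × ℝ => u.1 q.2.1 (sec q.1) a * v.1 q.2.2 (sec q.1) a *
      Real.sign (q.2.2 - q.2.1)) (dl.prod (volume.prod volume)) := fun a => by
    refine (preT.integrable_mul u v a a).mul_bdd (c := 1) ?_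
      (Eventually.of_forall fun p => abs_sign_le _)
    exact (measurable_sign.comp (by fun_prop)).aestronglyMeasurable
  have hI : ∀ a, ∫ p : S2 × ℝ, (conj (fourier u p.2 (sec p.1) a) * fourier v p.2 (sec p.1) a).im / p.2
      ∂dlw = 1 / (8 * Real.pi) * ∫ q : S2 × ℝ × ℝ, u.1 q.2.1 (sec q.1) a * v.1 q.2.2 (sec q.1) a *
      Real.sign (q.2.2 - q.2.1) ∂(dl.prod (volume.prod volume)) := fun a => by
    rw [integral_prod _ (hcomp a), integral_prod _ (hs a), ← integral_const_mul]
    exact integral_congr_ae (hi a)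
  have e : ∀ p, (FKer u v p).im =
      -((conj (fourier u p.2 (sec p.1) 0) * fourier v p.2 (sec p.1) 0).im / p.2)
      + (conj (fourier u p.2 (sec p.1) 1) * fourier v p.2 (sec p.1) 1).im / p.2
      + (conj (fourier u p.2 (sec p.1) 2) * fourier v p.2 (sec p.1) 2).im / p.2
      + (conj (fourier u p.2 (sec p.1) 3) * fourier v p.2 (sec p.1) 3).im / p.2 := fun p => by
    rw [FKer, Complex.div_ofReal_im, ηC, Complex.neg_im, Complex.sub_im, Complex.sub_im,
      Complex.sub_im]; ring
  simp only [e]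
  rw [integral_add (by exact ((hcomp 0).neg.add (hcomp 1)).add (hcomp 2)) (hcomp 3),
    integral_add (by exact (hcomp 0).neg.add (hcomp 1)) (hcomp 2),
    integral_add (by exact (hcomp 0).neg) (hcomp 1), integral_neg, hI, hI, hI, hI, symPre_apply]
  have e2 : ∀ q : S2 × ℝ × ℝ, symKer u v q =
      -(u.1 q.2.1 (sec q.1) 0 * v.1 q.2.2 (sec q.1) 0 * Real.sign (q.2.2 - q.2.1))
      + u.1 q.2.1 (sec q.1) 1 * v.1 q.2.2 (sec q.1) 1 * Real.sign (q.2.2 - q.2.1)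
      + u.1 q.2.1 (sec q.1) 2 * v.1 q.2.2 (sec q.1) 2 * Real.sign (q.2.2 - q.2.1)
      + u.1 q.2.1 (sec q.1) 3 * v.1 q.2.2 (sec q.1) 3 * Real.sign (q.2.2 - q.2.1) := fun q => by
    rw [symKer, ← neg_sub q.2.2, Real.sign_neg, η]; ring
  simp only [e2]
  rw [integral_add (by exact ((hs 0).neg.add (hs 1)).add (hs 2)) (hs 3),
    integral_add (by exact (hs 0).neg.add (hs 1)) (hs 2),
    integral_add (by exact (hs 0).neg) (hs 1), integral_neg]
  ring

/-- Positivity of `-ηC` on vectors orthogonal to a null vector. -/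
theorem neg_ηC_nonneg (n : S2) {z : Fin 4 → ℂ} (h : ηC (fun a => ((sec n).1 a : ℂ)) z = 0) :
    0 ≤ (-ηC z z).re ∧ (-ηC z z).im = 0 := by
  have hre : η (sec n) (fun a => (z a).re) = 0 := by
    have := congrArg Complex.re h
    simpa [ηC, η] using this
  have him : η (sec n) (fun a => (z a).im) = 0 := by
    have := congrArg Complex.im h
    simpa [ηC, η] using this
  have h1 := neg_η_nonneg n hre
  have h2 := neg_η_nonneg n him
  simp only [η] at h1 h2
  constructor
  · simp [ηC]; linarith
  · simp [ηC]; ring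

theorem FPre_add_left {u v w : preT} (hu : u ∈ kerP) (hv : v ∈ kerP) (hw : w ∈ kerP) :
    FPre (u + v) w = FPre u w + FPre v w := by
  rw [FPre_eq, FPre_eq, FPre_eq, ← integral_add (FKer_integrable hu hw) (FKer_integrable hv hw)]
  refine integral_congr_ae ?_
  filter_upwards [ae_dlw_of_ae (fourier_add u v)] with p hp
  rw [FKer, FKer, FKer, hp, ηC_add_left]; ring

theorem FPre_conj (u v : preT) : FPre u v = conj (FPre v u) := by
  rw [FPre_eq, FPre_eq, ← integral_conj]
  congr 1; funext p
  rw [FKer, FKer, ηC_conj, map_div₀, map_neg, Complex.conj_ofReal]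

theorem FPre_smul_left (c : ℝ) (u v : preT) : FPre (c • u) v = c * FPre u v := by
  rw [FPre_eq, FPre_eq, ← integral_const_mul]
  congr 1; funext p
  rw [FKer, FKer, fourier_smul, ηC_smul_left, Complex.conj_ofReal]; ring

theorem F_conj (u v : T) : F u v = conj (F v u) := by
  induction u using T.ind with
  | h u => induction v using T.ind with
    | h v => rw [F_mk, F_mk, FPre_conj]

theorem F_add_left {u v w : T} (hu : p u = 0) (hv : p v = 0) (hw : p w = 0) :
    F (u + v) w = F u w + F v w := by
  induction u using T.ind with
  | h u => induction v using T.ind with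
    | h v => induction w using T.ind with
      | h w =>
        rw [F_mk, F_mk, ← FPre_add_left hu hv hw]
        exact F_mk (u + v) w

theorem F_add_right {u v w : T} (hu : p u = 0) (hv : p v = 0) (hw : p w = 0) :
    F u (v + w) = F u v + F u w := by
  rw [F_conj, F_add_left hv hw hu, map_add, ← F_conj, ← F_conj]

theorem F_smul_left (c : ℝ) (u v : T) : F (c • u) v = c * F u v := by
  induction u using T.ind with
  | h u => induction v using T.ind with
    | h v => rw [F_mk, ← FPre_smul_left]; exact F_mk (c • u) v

theorem F_smul_right (c : ℝ) (u v : T) : F u (c • v) = c * F u v := by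
  rw [F_conj, F_smul_left, map_mul, Complex.conj_ofReal, ← F_conj]

theorem F_neg_left (u v : T) : F (-u) v = -F u v := by
  have := F_smul_left (-1) u v
  simpa using this

theorem F_neg_right (u v : T) : F u (-v) = -F u v := by
  have := F_smul_right (-1) u v
  simpa using this

theorem F_im {u v : T} (hu : p u = 0) (hv : p v = 0) : (F u v).im = 1 / 2 * symT u v := by
  induction u using T.ind with
  | h u => induction v using T.ind with
    | h v =>
      rw [F_mk, symT_mk, ← integral_FKer_im, FPre_eq]
      have := integral_im (𝕜 := ℂ) (FKer_integrable (u := u) (v := v) hu hv)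
      simp only [RCLike.im_to_complex] at this
      exact this.symm

theorem F_self_im (u : T) : (F u u).im = 0 := by
  have := congrArg Complex.im (F_conj u u)
  rw [Complex.conj_im] at this
  linarith

theorem F_sub_self {u v : T} (hu : p u = 0) (hv : p v = 0) :
    F (v - u) (v - u) = F u u + F v v - F u v - F v u := by
  have hu' : p (-u) = 0 := by rw [map_neg, hu, neg_zero]
  have h' : p (v + -u) = 0 := by rw [map_add, hv, hu', add_zero]
  rw [sub_eq_add_neg, F_add_left hv hu' h', F_add_right hv hv hu', F_add_right hu' hv hu']
  simp only [F_neg_left, F_neg_right]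
  ring

/-- Positivity of `F` on complex combinations. -/
theorem F_psd {ι : Type} [Fintype ι] (c : ι → ℂ) (u : ι → T) (hu : ∀ i, p (u i) = 0) :
    0 ≤ (∑ i, ∑ j, conj (c i) * c j * F (u i) (u j)).re := by
  choose v hv using fun i => Submodule.Quotient.mk_surjective nullT (u i)
  obtain rfl : u = fun i => T.mk (v i) := funext fun i => (hv i).symm
  have hk : ∀ i, v i ∈ kerP := hu
  have hI : ∀ i j, Integrable (fun q => conj (c i) * c j * FKer (v i) (v j) q) dlw := fun i j =>
    (FKer_integrable (hk i) (hk j)).const_mul _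
  have e : ∑ i, ∑ j, conj (c i) * c j * F (T.mk (v i)) (T.mk (v j)) =
      ∫ q, ∑ i, ∑ j, conj (c i) * c j * FKer (v i) (v j) q ∂dlw := by
    rw [integral_finsetSum _ fun i _ => integrable_finsetSum _ fun j _ => hI i j]
    refine Finset.sum_congr rfl fun i _ => ?_
    rw [integral_finsetSum _ fun j _ => hI i j]
    refine Finset.sum_congr rfl fun j _ => ?_
    rw [F_mk, FPre_eq, integral_const_mul]
  rw [e]
  have hI' : Integrable (fun q => ∑ i, ∑ j, conj (c i) * c j * FKer (v i) (v j) q) dlw :=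
    integrable_finsetSum _ fun i _ => integrable_finsetSum _ fun j _ => hI i j
  have h1 := integral_re (𝕜 := ℂ) hI'
  simp only [RCLike.re_to_complex] at h1
  rw [← h1]
  refine integral_nonneg_of_ae ?_
  filter_upwards [ae_dlw_pos, ae_all_iff.2 fun i => ae_dlw_of_ae (η_fourier (v i))] with q hq ho
  set z : Fin 4 → ℂ := ∑ i, c i • fourier (v i) q.2 (sec q.1) with hz
  have e2 : ∑ i, ∑ j, conj (c i) * c j * FKer (v i) (v j) q = -ηC z z / (q.2 : ℂ) := by
    have hl : ∀ y, ηC z y = ∑ i, conj (c i) * ηC (fourier (v i) q.2 (sec q.1)) y := fun y => by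
      have h0 : ∀ s : Finset ι, ηC (∑ i ∈ s, c i • fourier (v i) q.2 (sec q.1)) y =
          ∑ i ∈ s, conj (c i) * ηC (fourier (v i) q.2 (sec q.1)) y := fun s => by
        induction s using Finset.cons_induction with
        | empty => simp [ηC]
        | cons a s ha ih => rw [Finset.sum_cons, Finset.sum_cons, ηC_add_left, ih, ηC_smul_left]
      exact h0 _
    have hr : ∀ y, ηC y z = ∑ i, c i * ηC y (fourier (v i) q.2 (sec q.1)) := fun y => by
      have h0 : ∀ s : Finset ι, ηC y (∑ i ∈ s, c i • fourier (v i) q.2 (sec q.1)) =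
          ∑ i ∈ s, c i * ηC y (fourier (v i) q.2 (sec q.1)) := fun s => by
        induction s using Finset.cons_induction with
        | empty => simp [ηC]
        | cons a s ha ih => rw [Finset.sum_cons, Finset.sum_cons, ηC_add_right, ih, ηC_smul_right]
      exact h0 _
    rw [hl]
    simp only [hr, FKer, Finset.mul_sum, ← Finset.sum_neg_distrib, Finset.sum_div]
    refine Finset.sum_congr rfl fun i _ => Finset.sum_congr rfl fun j _ => ?_
    ring
  have hz0 : ηC (fun a => ((sec q.1).1 a : ℂ)) z = 0 := by
    have h0 : ∀ s : Finset ι, ηC (fun a => ((sec q.1).1 a : ℂ))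
        (∑ i ∈ s, c i • fourier (v i) q.2 (sec q.1)) = 0 := fun s => by
      induction s using Finset.cons_induction with
      | empty => simp [ηC]
      | cons a s ha ih => rw [Finset.sum_cons, ηC_add_right, ih, ηC_smul_right, ho a q.2]; simp
    exact h0 _
  change 0 ≤ (∑ i, ∑ j, conj (c i) * c j * FKer (v i) (v j) q).re
  rw [e2, Complex.div_ofReal_re]
  exact div_nonneg (neg_ηC_nonneg q.1 hz0).1 hq.le

theorem F_self_nonneg {u : T} (hu : p u = 0) : 0 ≤ (F u u).re := by
  have := F_psd (fun _ : Unit => 1) (fun _ => u) fun _ => hu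
  simpa using this

/-- The `ℓ¹` length of a vector. -/
def len (x : Mink) : ℝ := |x 0| + |x 1| + |x 2| + |x 3|

theorem F_shift_sub_le (x : Mink) (u : preT) :
    (F (shiftT x (T.mk u) - T.mk u) (shiftT x (T.mk u) - T.mk u)).re ≤
      4 * len x * ∑ a, ∫ q : S2 × ℝ, u.1 q.2 (sec q.1) a ^ 2 ∂(dl.prod volume) := by
  have hk : shiftPre x u - u ∈ kerP := by
    rw [mem_kerP]
    change p (shiftT x (T.mk u) - T.mk u) = 0
    rw [map_sub, p_shift, sub_self]
  have e0 : F (shiftT x (T.mk u) - T.mk u) (shiftT x (T.mk u) - T.mk u) =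
      FPre (shiftPre x u - u) (shiftPre x u - u) := F_mk (shiftPre x u - u) (shiftPre x u - u)
  have hl : 0 ≤ len x := by unfold len; positivity
  have hint : Integrable (fun q : S2 × ℝ => 4 * len x *
      ∑ a, ‖fourier u q.2 (sec q.1) a‖ ^ 2) (dl.prod volume) :=
    (integrable_finsetSum _ fun a _ => preT.integrable_fourier_sq u a).const_mul _
  have h1 := integral_re (𝕜 := ℂ) (FKer_integrable hk hk)
  simp only [RCLike.re_to_complex] at h1
  rw [e0, FPre_eq, ← h1]
  calc ∫ q, (FKer (shiftPre x u - u) (shiftPre x u - u) q).re ∂dlw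
      ≤ ∫ q, 4 * len x * ∑ a, ‖fourier u q.2 (sec q.1) a‖ ^ 2 ∂dlw := by
        refine integral_mono_ae (FKer_integrable hk hk).re (hint.mono_measure dlw_le) ?_
        filter_upwards [ae_dlw_pos, ae_dlw_of_ae (fourier_add (shiftPre x u) (-u))] with q hq ha
        have e1 : fourier (shiftPre x u - u) q.2 (sec q.1) =
            (Complex.exp (Complex.I * (q.2 * η x (sec q.1).1 : ℝ)) - 1) •
              fourier u q.2 (sec q.1) := by
          rw [sub_eq_add_neg, ha q.2]
          have h2 := fourier_smul (-1) u q.2 (sec q.1)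
          have h2' : (-1 : ℝ) • u = -u := neg_one_smul ℝ u
          rw [h2'] at h2
          rw [h2]
          ext a
          simp only [Pi.add_apply, fourier_shift, Pi.smul_apply, smul_eq_mul]
          push_cast; ring_nf
        set g := Complex.exp (Complex.I * (q.2 * η x (sec q.1).1 : ℝ)) - 1 with hg
        have hgn : ‖g‖ ^ 2 ≤ 4 * (q.2 * len x) := by
          have h3 := abs_exp_sub_one_le (q.2 * η x (sec q.1).1) (1 / 2) (by norm_num) (by norm_num)
          have h4 : ‖g‖ ^ 2 ≤ (2 * |q.2 * η x (sec q.1).1| ^ (1 / 2 : ℝ)) ^ 2 :=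
            pow_le_pow_left₀ (norm_nonneg _) h3 2
          rw [mul_pow, ← Real.sqrt_eq_rpow, Real.sq_sqrt (abs_nonneg _), abs_mul,
            abs_of_pos hq] at h4
          have h5 := abs_η_sec_le x q.1
          have h6 : q.2 * |η x (sec q.1).1| ≤ q.2 * len x := mul_le_mul_of_nonneg_left h5 hq.le
          linarith
        have e2 : (FKer (shiftPre x u - u) (shiftPre x u - u) q).re = ‖g‖ ^ 2 / q.2 *
            (-ηC (fourier u q.2 (sec q.1)) (fourier u q.2 (sec q.1))).re := by
          rw [FKer, e1, ηC_smul_left, ηC_smul_right, ← mul_assoc, Complex.div_ofReal_re,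
            mul_comm (conj g), Complex.mul_conj, Complex.normSq_eq_norm_sq, ← mul_neg,
            Complex.re_ofReal_mul]
          ring
        have e3 : (-ηC (fourier u q.2 (sec q.1)) (fourier u q.2 (sec q.1))).re ≤
            ∑ a, ‖fourier u q.2 (sec q.1) a‖ ^ 2 := by
          have hn : ∀ z : ℂ, (conj z * z).re = ‖z‖ ^ 2 := fun z => by
            rw [mul_comm, Complex.mul_conj, Complex.normSq_eq_norm_sq, Complex.ofReal_re]
          simp only [ηC, Complex.neg_re, Complex.sub_re, hn, Fin.sum_univ_four]
          nlinarith [sq_nonneg ‖fourier u q.2 (sec q.1) 0‖]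
        change (FKer (shiftPre x u - u) (shiftPre x u - u) q).re ≤ _
        rw [e2]
        have h7 : ‖g‖ ^ 2 / q.2 ≤ 4 * len x := by
          rw [div_le_iff₀ hq]; linarith
        have h8 : 0 ≤ ∑ a, ‖fourier u q.2 (sec q.1) a‖ ^ 2 :=
          Finset.sum_nonneg fun a _ => by positivity
        exact (mul_le_mul_of_nonneg_left e3 (by positivity)).trans
          (mul_le_mul_of_nonneg_right h7 h8)
    _ ≤ ∫ q, 4 * len x * ∑ a, ‖fourier u q.2 (sec q.1) a‖ ^ 2 ∂(dl.prod volume) := by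
        refine integral_mono_measure dlw_le (Eventually.of_forall fun q => ?_) hint
        simp only [Pi.zero_apply]
        positivity
    _ ≤ _ := by
        rw [integral_const_mul, integral_finsetSum _ fun a _ => preT.integrable_fourier_sq u a]
        refine mul_le_mul_of_nonneg_left ?_ (by positivity)
        exact Finset.sum_le_sum fun a _ => preT.integral_fourier_sq_le u a

theorem tendsto_sign {ι : Type} {l : Filter ι} {f : ι → ℝ} {y : ℝ} (h : Tendsto f l (𝓝 y))
    (hy : y ≠ 0) : Tendsto (fun i => Real.sign (f i)) l (𝓝 (Real.sign y)) := by
  rcases lt_or_gt_of_ne hy with hy | hy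
  · refine tendsto_const_nhds.congr' ?_
    filter_upwards [h.eventually (gt_mem_nhds hy)] with i hi
    rw [Real.sign_of_neg hi, Real.sign_of_neg hy]
  · refine tendsto_const_nhds.congr' ?_
    filter_upwards [h.eventually (lt_mem_nhds hy)] with i hi
    rw [Real.sign_of_pos hi, Real.sign_of_pos hy]

theorem tendsto_integral_mul_sign {X ι : Type} [MeasurableSpace X] {m : Measure X} {l : Filter ι}
    [l.IsCountablyGenerated] {K : X → ℝ} (hK : Integrable K m) {D : ι → X → ℝ} {E : X → ℝ}
    (hD : ∀ i, Measurable (D i))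
    (h : ∀ᵐ q ∂m, Tendsto (fun i => D i q) l (𝓝 (E q)) ∧ E q ≠ 0) :
    Tendsto (fun i => ∫ q, K q * Real.sign (D i q) ∂m) l (𝓝 (∫ q, K q * Real.sign (E q) ∂m)) := by
  refine tendsto_integral_filter_of_dominated_convergence (fun q => ‖K q‖)
    (Eventually.of_forall fun i => ?_) (Eventually.of_forall fun i => Eventually.of_forall fun q => ?_)
    hK.norm ?_
  · exact hK.1.mul (measurable_sign.comp (hD i)).aestronglyMeasurable
  · rw [norm_mul]
    exact mul_le_of_le_one_right (norm_nonneg _) (abs_sign_le _)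
  · filter_upwards [h] with q ⟨h1, h2⟩
    exact (tendsto_sign h1 h2).const_mul _

/-- The abbreviation for the measure in the symplectic form. -/
abbrev dlss : Measure (S2 × ℝ × ℝ) := dl.prod (volume.prod volume)

theorem ae_ne_dlss {g : S2 → ℝ} (hg : Measurable g) : ∀ᵐ q ∂dlss, q.2.1 - q.2.2 - g q.1 ≠ 0 := by
  have hm : MeasurableSet {q : S2 × ℝ × ℝ | q.2.1 - q.2.2 - g q.1 ≠ 0} :=
    (measurableSet_eq_fun (f := fun q : S2 × ℝ × ℝ => q.2.1 - q.2.2 - g q.1) (by fun_prop)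
      measurable_const).compl
  rw [Measure.ae_prod_iff_ae_ae hm]
  refine Eventually.of_forall fun n => ?_
  have hm' : MeasurableSet {q : ℝ × ℝ | q.1 - q.2 - g n ≠ 0} :=
    (measurableSet_eq_fun (f := fun q : ℝ × ℝ => q.1 - q.2 - g n) (by fun_prop)
      measurable_const).compl
  change ∀ᵐ q : ℝ × ℝ ∂(volume.prod volume), q.1 - q.2 - g n ≠ 0
  rw [Measure.ae_prod_iff_ae_ae hm']
  refine Eventually.of_forall fun t => ?_
  have : ∀ᵐ s : ℝ, s ≠ t - g n := by
    rw [ae_iff]; simp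
  filter_upwards [this] with s hs h
  exact hs (by linarith)

theorem integrable_η_mul (u v : preT) :
    Integrable (fun q : S2 × ℝ × ℝ => η (u.1 q.2.1 (sec q.1)) (v.1 q.2.2 (sec q.1))) dlss :=
  (((preT.integrable_mul u v 0 0).sub (preT.integrable_mul u v 1 1)).sub
    (preT.integrable_mul u v 2 2)).sub (preT.integrable_mul u v 3 3)

theorem symPre_shift_right (x : Mink) (u v : preT) : symPre u (shiftPre x v) =
    1 / (4 * Real.pi) * ∫ q, η (u.1 q.2.1 (sec q.1)) (v.1 q.2.2 (sec q.1)) *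
      Real.sign (q.2.1 - q.2.2 - η x (sec q.1).1) ∂dlss := by
  have hm : Measurable fun q : S2 × ℝ × ℝ => η x (sec q.1).1 :=
    (measurable_η_sec x).comp measurable_fst
  have mp : MeasurePreserving (fun q : S2 × ℝ × ℝ => (q.1, q.2.1, q.2.2 - η x (sec q.1).1))
      dlss dlss := by
    refine (MeasurePreserving.id dl).skew_product
      (g := fun n (s : ℝ × ℝ) => (s.1, s.2 - η x (sec n).1)) ?_ ?_
    · exact (measurable_fst.comp measurable_snd).prodMk ((measurable_snd.comp measurable_snd).sub hm)
    · exact Eventually.of_forall fun n =>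
        ((MeasurePreserving.id volume).prod
          (measurePreserving_sub_right volume (η x (sec n).1))).map_eq
  rw [symPre_apply]
  congr 1
  have h := integral_map mp.aemeasurable (f := fun q : S2 × ℝ × ℝ =>
    η (u.1 q.2.1 (sec q.1)) (v.1 q.2.2 (sec q.1)) *
      Real.sign (q.2.1 - q.2.2 - η x (sec q.1).1)) (by
    rw [mp.map_eq]
    refine (integrable_η_mul u v).1.mul (measurable_sign.comp ?_).aestronglyMeasurable
    fun_prop)
  rw [mp.map_eq] at h
  rw [h]
  congr 1; funext q
  change η (u.1 q.2.1 (sec q.1)) (v.1 (q.2.2 - η x (sec q.1).1) (sec q.1)) *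
    Real.sign (q.2.1 - q.2.2) = _
  congr 2; ring

theorem continuous_symT_shift (u v : T) : Continuous fun x => symT u (shiftT x v) := by
  induction u using T.ind with
  | h u => induction v using T.ind with
    | h v =>
      have e : (fun x => symT (T.mk u) (shiftT x (T.mk v))) = fun x => 1 / (4 * Real.pi) *
          ∫ q, η (u.1 q.2.1 (sec q.1)) (v.1 q.2.2 (sec q.1)) *
            Real.sign (q.2.1 - q.2.2 - η x (sec q.1).1) ∂dlss := by
        funext x; exact symPre_shift_right x u v
      rw [e, continuous_iff_continuousAt]
      intro x
      refine Tendsto.const_mul _ (tendsto_integral_mul_sign (integrable_η_mul u v) (fun y => ?_) ?_)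
      · have : Measurable fun q : S2 × ℝ × ℝ => η y (sec q.1).1 :=
          (measurable_η_sec y).comp measurable_fst
        fun_prop
      · filter_upwards [ae_ne_dlss (measurable_η_sec x)] with q hq
        refine ⟨?_, hq⟩
        refine Tendsto.const_sub _ ?_
        exact (continuous_η.comp (continuous_id.prodMk continuous_const)).tendsto x

theorem F_shift_sub_tendsto (u : T) :
    Tendsto (fun x => (F (shiftT x u - u) (shiftT x u - u)).re) (𝓝 0) (𝓝 0) := by
  induction u using T.ind with
  | h u =>
    have hc : Continuous fun x : Mink => 4 * len x *
        ∑ a, ∫ q : S2 × ℝ, u.1 q.2 (sec q.1) a ^ 2 ∂(dl.prod volume) := by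
      unfold len; fun_prop
    have h0 := hc.tendsto 0
    simp only [len, Pi.zero_apply, abs_zero, add_zero, mul_zero, zero_mul] at h0
    refine squeeze_zero (fun x => F_self_nonneg ?_) (fun x => F_shift_sub_le x u) h0
    rw [map_sub, p_shift, sub_self]

section Weyl
variable {G : Type} [AddCommGroup G] (σ : SymplecticForm G)

theorem WeylStar.eq_sum (a : WeylStar σ) : ∃ (s : Finset G) (c : G → ℂ),
    a = ∑ x ∈ s, WeylStar.single x (c x) :=
  ⟨Finsupp.support (show G →₀ ℂ from a), (show G →₀ ℂ from a),
    (Finsupp.sum_single (show G →₀ ℂ from a)).symm⟩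

theorem functional_single (ω : G → ℂ) (x : G) (c : ℂ) :
    functional σ ω (WeylStar.single x c) = c * ω x := by
  rw [functional, WeylStar.lift_single, smul_eq_mul]

theorem functional_star_mul_single (ω : G → ℂ) (x y : G) (c d : ℂ) :
    functional σ ω (star (WeylStar.single x c) * WeylStar.single y d) =
      conj c * d * (phase (-σ.form x y) * ω (y - x)) := by
  rw [WeylStar.star_single, WeylStar.single_mul_single, functional_single, map_neg,
    AddMonoidHom.neg_apply, neg_add_eq_sub]
  ring

/-- Positivity in terms of the kernel on the group. -/
theorem isPositive_of_kernel {ω : G → ℂ} (h : ∀ x, ω (-x) = conj (ω x))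
    (hp : ∀ (s : Finset G) (c : G → ℂ), 0 ≤ (∑ x ∈ s, ∑ y ∈ s,
      conj (c x) * c y * (phase (-σ.form x y) * ω (y - x))).re) : IsPositive σ ω := by
  refine ⟨fun a => ?_, fun a => ?_⟩
  · induction a using WeylStar.induction with
    | h0 => simp
    | ha a b h h' => rw [star_add, map_add, h, h', map_add, map_add]
    | hs x c => rw [WeylStar.star_single, functional_single, functional_single, h, map_mul]
  · obtain ⟨s, c, rfl⟩ := WeylStar.eq_sum σ a
    rw [star_sum, Finset.sum_mul_sum, map_sum]
    simp only [map_sum, functional_star_mul_single]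
    exact hp s c

namespace GNS
variable {ω : G → ℂ}

theorem inner_vec (hω : IsPositive σ ω) (a b : WeylStar σ) :
    inner ℂ (vec σ ω a) (vec σ ω b) = functional σ ω (star a * b) := by
  rw [vec, vec, UniformSpace.Completion.inner_coe]
  change gnsInner σ ω a b = _
  rw [gnsInner, if_pos hω]

theorem vec_add (a b : WeylStar σ) : vec σ ω (a + b) = vec σ ω a + vec σ ω b := by
  rw [vec, map_add, UniformSpace.Completion.coe_add]; rfl

theorem vec_smul (c : ℂ) (a : WeylStar σ) : vec σ ω (c • a) = c • vec σ ω a := by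
  rw [vec, map_smul, UniformSpace.Completion.coe_smul]; rfl

theorem completion_isometry_vec (φ : WeylStar σ →ₗ[ℂ] WeylStar σ)
    (h : ∀ a, functional σ ω (star (φ a) * φ a) = functional σ ω (star a * a)) (a : WeylStar σ) :
    (PreGNS.isometry (ω := ω) φ h).toContinuousLinearMap.completion (vec σ ω a) =
      vec σ ω (φ a) :=
  ContinuousLinearMap.completion_apply_coe _ _

theorem W_vec (x : G) (a : WeylStar σ) :
    W σ ω x (vec σ ω a) = vec σ ω (WeylStar.single x 1 * a) :=
  ContinuousLinearMap.completion_apply_coe _ _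

theorem symm_vec (T : G →+ G) (hT : ∀ x y, σ.form (T x) (T y) = σ.form x y)
    (hω : ∀ x, ω (T x) = ω x) (a : WeylStar σ) :
    symm σ ω T hT hω (vec σ ω a) = vec σ ω (WeylStar.map T hT a) :=
  completion_isometry_vec σ (WeylStar.map T hT : WeylStar σ →ₐ[ℂ] WeylStar σ).toLinearMap _ a

theorem vec_induction {P : GNS σ ω → Prop} (ψ : GNS σ ω) (hP : IsClosed {ψ | P ψ})
    (h : ∀ a, P (vec σ ω a)) : P ψ :=
  UniformSpace.Completion.induction_on ψ hP h

theorem W_Ω (x : G) : W σ ω x (Ω σ ω) = vec σ ω (WeylStar.single x 1) := by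
  rw [Ω, W_vec, mul_one]

theorem W_W (x y : G) (ψ : GNS σ ω) :
    W σ ω x (W σ ω y ψ) = phase (σ.form x y) • W σ ω (x + y) ψ := by
  have hc : Continuous fun ψ => phase (σ.form x y) • W σ ω (x + y) ψ :=
    (continuous_const_smul (phase (σ.form x y))).comp (W σ ω (x + y)).continuous
  induction ψ using vec_induction with
  | hP => exact isClosed_eq ((W σ ω x).continuous.comp (W σ ω y).continuous) hc
  | h a =>
    rw [W_vec, W_vec, W_vec, ← mul_assoc, WeylStar.single_mul_single, ← vec_smul,
      ← smul_mul_assoc, WeylStar.smul_single]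
    simp

theorem W_zero (ψ : GNS σ ω) : W σ ω 0 ψ = ψ := by
  induction ψ using vec_induction with
  | hP => exact isClosed_eq (by fun_prop) (by fun_prop)
  | h a => rw [W_vec, ← WeylStar.one_def, one_mul]

theorem symm_W (T : G →+ G) (hT : ∀ x y, σ.form (T x) (T y) = σ.form x y)
    (hω : ∀ x, ω (T x) = ω x) (x : G) (ψ : GNS σ ω) :
    symm σ ω T hT hω (W σ ω x ψ) = W σ ω (T x) (symm σ ω T hT hω ψ) := by
  induction ψ using vec_induction with
  | hP => exact isClosed_eq (by fun_prop) (by fun_prop)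
  | h a => rw [W_vec, symm_vec, symm_vec, W_vec, map_mul, WeylStar.map_single]

theorem symm_Ω (T : G →+ G) (hT : ∀ x y, σ.form (T x) (T y) = σ.form x y)
    (hω : ∀ x, ω (T x) = ω x) : symm σ ω T hT hω (Ω σ ω) = Ω σ ω := by
  rw [Ω, symm_vec, map_one]

theorem inner_W_Ω (hω : IsPositive σ ω) (x y : G) :
    inner ℂ (W σ ω x (Ω σ ω)) (W σ ω y (Ω σ ω)) = phase (-σ.form x y) * ω (y - x) := by
  rw [W_Ω, W_Ω, inner_vec σ hω, functional_star_mul_single]; simp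

/-- The Weyl operators applied to the cyclic vector are total. -/
theorem span_W_Ω (ψ : GNS σ ω) :
    ψ ∈ (Submodule.span ℂ (Set.range fun x => W σ ω x (Ω σ ω))).topologicalClosure := by
  induction ψ using vec_induction with
  | hP => exact Submodule.isClosed_topologicalClosure _
  | h a =>
    refine Submodule.le_topologicalClosure _ ?_
    induction a using WeylStar.induction with
    | h0 =>
      have : vec σ ω (0 : WeylStar σ) = 0 := by simpa using vec_smul σ (ω := ω) 0 0
      rw [this]; exact Submodule.zero_mem _
    | ha a b h h' => rw [vec_add]; exact Submodule.add_mem _ h h'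
    | hs x c =>
      have : (WeylStar.single x c : WeylStar σ) = c • WeylStar.single x 1 := by
        rw [WeylStar.smul_single, mul_one]
      rw [this, vec_smul, ← W_Ω]
      exact Submodule.smul_mem _ _ (Submodule.subset_span ⟨x, rfl⟩)

end GNS

end Weyl

theorem norm_phase (r : ℝ) : ‖phase r‖ = 1 := by
  rw [phase, show -(Complex.I / 2) * (r : ℂ) = ((-r / 2 : ℝ) : ℂ) * Complex.I by push_cast; ring,
    Complex.norm_exp_ofReal_mul_I]

theorem continuous_phase : Continuous phase := by unfold phase; fun_prop

theorem phase_mul_phase_neg (r : ℝ) : phase r * phase (-r) = 1 := by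
  rw [← phase_add, add_neg_cancel, phase_zero]

open scoped ComplexOrder MatrixOrder in
/-- The entrywise exponential of a positive semidefinite kernel is positive semidefinite. -/
theorem exp_psd {ι : Type} [Fintype ι] (A : ι → ι → ℂ) (hh : ∀ i j, A i j = conj (A j i))
    (hA : ∀ c : ι → ℂ, 0 ≤ (∑ i, ∑ j, conj (c i) * c j * A i j).re) (c : ι → ℂ) :
    0 ≤ (∑ i, ∑ j, conj (c i) * c j * Complex.exp (A i j)).re := by
  classical
  have hform : ∀ (B : Matrix ι ι ℂ) (x : ι → ℂ), star x ⬝ᵥ (B.mulVec x) =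
      ∑ i, ∑ j, conj (x i) * x j * B i j := fun B x => by
    simp only [dotProduct, Matrix.mulVec, Finset.mul_sum, Pi.star_apply]
    refine Finset.sum_congr rfl fun i _ => Finset.sum_congr rfl fun j _ => ?_
    change conj (x i) * (B i j * x j) = _
    ring
  have hP : (Matrix.of A).PosSemidef := by
    refine Matrix.PosSemidef.of_dotProduct_mulVec_nonneg ?_ fun x => ?_
    · ext i j
      exact (hh i j).symm
    · rw [hform]
      refine Complex.nonneg_iff.2 ⟨hA x, ?_⟩
      have e : conj (∑ i, ∑ j, conj (x i) * x j * A i j) =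
          ∑ i, ∑ j, conj (x i) * x j * A i j := by
        simp only [map_sum, map_mul, Complex.conj_conj]
        rw [Finset.sum_comm]
        refine Finset.sum_congr rfl fun i _ => Finset.sum_congr rfl fun j _ => ?_
        rw [← hh]; ring
      have := congrArg Complex.im e
      rw [Complex.conj_im] at this
      change 0 = (∑ i, ∑ j, conj (x i) * x j * A i j).im
      linarith
  have hpow : ∀ k : ℕ, (Matrix.of fun i j => A i j ^ k).PosSemidef := fun k => by
    induction k with
    | zero =>
      have e : (Matrix.of fun i j => A i j ^ 0) =
          Matrix.vecMulVec (fun _ : ι => (1 : ℂ)) (star fun _ : ι => (1 : ℂ)) := by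
        ext i j; simp [Matrix.vecMulVec]
      rw [e]
      exact Matrix.posSemidef_vecMulVec_self_star (fun _ : ι => (1 : ℂ))
    | succ k ih =>
      have e : (Matrix.of fun i j => A i j ^ (k + 1)) =
          (Matrix.of fun i j => A i j ^ k).hadamard (Matrix.of A) := by
        ext i j; simp [pow_succ]
      rw [e]
      exact ih.hadamard hP
  have hk : ∀ k : ℕ, 0 ≤ (∑ i, ∑ j, conj (c i) * c j * (A i j ^ k / (k.factorial : ℂ))).re :=
    fun k => by
      have h1 := (hpow k).dotProduct_mulVec_nonneg c
      rw [hform] at h1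
      have h2 := (Complex.nonneg_iff.1 h1).1
      have e : ∑ i, ∑ j, conj (c i) * c j * (A i j ^ k / (k.factorial : ℂ)) =
          (((k.factorial : ℝ)⁻¹ : ℝ) : ℂ) * ∑ i, ∑ j, conj (c i) * c j * A i j ^ k := by
        simp only [Finset.mul_sum]
        refine Finset.sum_congr rfl fun i _ => Finset.sum_congr rfl fun j _ => ?_
        push_cast; ring
      rw [e, Complex.re_ofReal_mul]
      exact mul_nonneg (by positivity) h2
  have hs : HasSum (fun k : ℕ => ∑ i, ∑ j, conj (c i) * c j * (A i j ^ k / (k.factorial : ℂ)))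
      (∑ i, ∑ j, conj (c i) * c j * Complex.exp (A i j)) := by
    refine hasSum_sum fun i _ => hasSum_sum fun j _ => HasSum.mul_left _ ?_
    have := NormedSpace.expSeries_div_hasSum_exp (A i j)
    rwa [← Complex.exp_eq_exp_ℂ] at this
  have hs' := Complex.hasSum_re hs
  exact hs'.nonneg hk

/-! ### Positivity of the state -/

theorem pIR_add (u v : Lhat) : pIR (u + v) = pIR u + pIR v := Subtype.ext (map_add p u.1 v.1)
theorem pIR_neg (u : Lhat) : pIR (-u) = -pIR u := Subtype.ext (map_neg p u.1)
theorem pIR_sub (u v : Lhat) : pIR (u - v) = pIR u - pIR v := Subtype.ext (map_sub p u.1 v.1)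
theorem pIR_zero : pIR 0 = 0 := Subtype.ext (map_zero p)

theorem p_eq_zero {u : Lhat} (hu : pIR u = 0) : p u.1 = 0 := congrArg Subtype.val hu

/-- `F` on `L̂`. -/
def FL (u v : Lhat) : ℂ := F u.1 v.1

theorem FL_conj (u v : Lhat) : FL u v = conj (FL v u) := F_conj _ _
theorem FL_smul_left (c : ℝ) (u v : Lhat) : FL (c • u) v = c * FL u v := F_smul_left _ _ _
theorem FL_smul_right (c : ℝ) (u v : Lhat) : FL u (c • v) = c * FL u v := F_smul_right _ _ _

theorem FL_im {u v : Lhat} (hu : pIR u = 0) (hv : pIR v = 0) :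
    (FL u v).im = 1 / 2 * symLhat.form u v := F_im (p_eq_zero hu) (p_eq_zero hv)

theorem FL_sub_self {u v : Lhat} (hu : pIR u = 0) (hv : pIR v = 0) :
    FL (v - u) (v - u) = FL u u + FL v v - FL u v - FL v u :=
  F_sub_self (p_eq_zero hu) (p_eq_zero hv)

theorem FL_self (u : Lhat) : FL u u = ((FL u u).re : ℂ) :=
  Complex.ext (by simp) (by rw [Complex.ofReal_im]; exact F_self_im u.1)

theorem FL_self_nonneg {u : Lhat} (hu : pIR u = 0) : 0 ≤ (FL u u).re := F_self_nonneg (p_eq_zero hu)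

theorem vacuum_of_zero {u : Lhat} (hu : pIR u = 0) :
    vacuum u = Complex.exp (-(1 / 2) * FL u u) := by rw [vacuum, if_pos hu]; rfl

theorem vacuum_of_ne {u : Lhat} (hu : pIR u ≠ 0) : vacuum u = 0 := by rw [vacuum, if_neg hu]

/-- The kernel of the state on the subspace of vanishing infrared part. -/
theorem phase_mul_vacuum_sub {u v : Lhat} (hu : pIR u = 0) (hv : pIR v = 0) :
    phase (-symLhat.form u v) * vacuum (v - u) =
      Complex.exp (-(1 / 2) * FL u u) * Complex.exp (-(1 / 2) * FL v v) * Complex.exp (FL u v) := by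
  rw [vacuum_of_zero (by rw [pIR_sub, hu, hv, sub_zero]), FL_sub_self hu hv, phase,
    ← Complex.exp_add, ← Complex.exp_add, ← Complex.exp_add]
  congr 1
  have h1 : FL u v - FL v u = Complex.I * (symLhat.form u v : ℝ) := by
    rw [FL_conj v u, Complex.sub_conj, FL_im hu hv]
    push_cast; ring
  push_cast
  linear_combination (-1 / 2 : ℂ) * h1

open Classical in
/-- Some element of `L̂` with the given infrared part, if there is any. -/
def someLift (f : HIR) : Lhat := if h : ∃ u, pIR u = f then h.choose else 0

theorem pIR_someLift (u : Lhat) : pIR (someLift (pIR u)) = pIR u := by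
  have h : ∃ v, pIR v = pIR u := ⟨u, rfl⟩
  rw [someLift, dif_pos h]
  exact h.choose_spec

theorem phase_mul_vacuum_sub' {u v w : Lhat} (hu : pIR u = pIR w) (hv : pIR v = pIR w) :
    phase (-symLhat.form u v) * vacuum (v - u) =
      conj (Complex.exp (-(1 / 2) * FL (u - w) (u - w)) * phase (-symLhat.form w (u - w))) *
      (Complex.exp (-(1 / 2) * FL (v - w) (v - w)) * phase (-symLhat.form w (v - w))) *
      Complex.exp (FL (u - w) (v - w)) := by
  have hu' : pIR (u - w) = 0 := by rw [pIR_sub, hu, sub_self]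
  have hv' : pIR (v - w) = 0 := by rw [pIR_sub, hv, sub_self]
  have h := phase_mul_vacuum_sub hu' hv'
  rw [sub_sub_sub_cancel_right] at h
  have e : -symLhat.form u v = -symLhat.form w (v - w) + symLhat.form w (u - w) +
      -symLhat.form (u - w) (v - w) := by
    simp only [map_sub, AddMonoidHom.sub_apply, symLhat.alt]
    rw [symLhat.swap w u]; ring
  have hr : conj (Complex.exp (-(1 / 2) * FL (u - w) (u - w))) =
      Complex.exp (-(1 / 2) * FL (u - w) (u - w)) := by
    rw [FL_self, ← Complex.exp_conj]
    simp [Complex.conj_ofNat]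
  rw [e, phase_add, phase_add, mul_assoc, h, map_mul, hr, conj_phase, neg_neg]
  ring

theorem vacuum_neg (u : Lhat) : vacuum (-u) = conj (vacuum u) := by
  by_cases hu : pIR u = 0
  · have e : FL (-u) (-u) = FL u u := by
      have := FL_smul_left (-1) u (-u)
      have h2 := FL_smul_right (-1) u u
      rw [show (-1 : ℝ) • u = -u from neg_one_smul ℝ u] at this h2
      rw [this, h2]; push_cast; ring
    rw [vacuum_of_zero hu, vacuum_of_zero (by rw [pIR_neg, hu, neg_zero]), e, FL_self,
      ← Complex.exp_conj]
    simp [Complex.conj_ofNat]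
  · rw [vacuum_of_ne hu, vacuum_of_ne (by rw [pIR_neg]; simpa using hu), map_zero]

/-- The functional of the extended free field is positive. -/
theorem vacuum_isPositive : IsPositive symLhat vacuum := by
  classical
  refine isPositive_of_kernel symLhat vacuum_neg fun s c => ?_
  have hzero : ∀ x y : Lhat, pIR x ≠ pIR y → vacuum (y - x) = 0 := fun x y h =>
    vacuum_of_ne (by rw [pIR_sub, sub_ne_zero]; exact h.symm)
  have e : ∑ x ∈ s, ∑ y ∈ s, conj (c x) * c y * (phase (-symLhat.form x y) * vacuum (y - x)) =
      ∑ f ∈ s.image pIR, ∑ x ∈ s.filter (fun x => pIR x = f), ∑ y ∈ s.filter (fun x => pIR x = f),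
        conj (c x) * c y * (phase (-symLhat.form x y) * vacuum (y - x)) := by
    rw [← Finset.sum_fiberwise_of_maps_to (g := pIR) (t := s.image pIR)
      fun x hx => Finset.mem_image_of_mem _ hx]
    refine Finset.sum_congr rfl fun f _ => Finset.sum_congr rfl fun x hx => ?_
    refine (Finset.sum_subset (Finset.filter_subset _ _) fun y hy hy' => ?_).symm
    have h1 : pIR x = f := (Finset.mem_filter.1 hx).2
    have h2 : pIR y ≠ f := fun h => hy' (Finset.mem_filter.2 ⟨hy, h⟩)
    rw [hzero x y (by rw [h1]; exact h2.symm)]; simp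
  rw [e, Complex.re_sum]
  refine Finset.sum_nonneg fun f _ => ?_
  set t := s.filter (fun x => pIR x = f)
  set w := someLift f
  have ht : ∀ x : t, pIR x.1 = pIR w := fun x => by
    have h : pIR x.1 = f := (Finset.mem_filter.1 x.2).2
    have := pIR_someLift x.1
    rw [h] at this
    rw [h, this]
  set d : t → ℂ := fun x => c x.1 *
    (Complex.exp (-(1 / 2) * FL (x.1 - w) (x.1 - w)) * phase (-symLhat.form w (x.1 - w)))
  have key := exp_psd (fun x y : t => FL (x.1 - w) (y.1 - w)) (fun x y => FL_conj _ _)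
    (fun c => F_psd c (fun x : t => (x.1 - w).1) fun x =>
      p_eq_zero (by rw [pIR_sub, ht, sub_self])) d
  refine le_of_le_of_eq key (congrArg Complex.re ?_)
  rw [← Finset.sum_coe_sort t (fun x => ∑ y ∈ t,
    conj (c x) * c y * (phase (-symLhat.form x y) * vacuum (y - x)))]
  refine Finset.sum_congr rfl fun x _ => ?_
  rw [← Finset.sum_coe_sort t (fun y =>
    conj (c x.1) * c y * (phase (-symLhat.form x.1 y) * vacuum (y - x.1)))]
  refine Finset.sum_congr rfl fun y _ => ?_
  rw [phase_mul_vacuum_sub' (ht x) (ht y)]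
  simp only [d, map_mul]
  ring

/-! ### The Weyl operators and the translations of the extended free field -/

theorem GNS.norm_completion_isometry {G : Type} [AddCommGroup G] {σ : SymplecticForm G} {ω : G → ℂ}
    (φ : WeylStar σ →ₗ[ℂ] WeylStar σ)
    (h : ∀ a, functional σ ω (star (φ a) * φ a) = functional σ ω (star a * a)) (ψ : GNS σ ω) :
    ‖(PreGNS.isometry (ω := ω) φ h).toContinuousLinearMap.completion ψ‖ = ‖ψ‖ := by
  induction ψ using UniformSpace.Completion.induction_on with
  | hp => exact isClosed_eq (ContinuousLinearMap.continuous _).norm continuous_norm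
  | ih a =>
    rw [ContinuousLinearMap.completion_apply_coe, UniformSpace.Completion.norm_coe,
      UniformSpace.Completion.norm_coe]
    exact LinearIsometry.norm_map _ _

theorem norm_Uhat (x : Mink) (ψ : Hhat) : ‖Uhat x ψ‖ = ‖ψ‖ :=
  GNS.norm_completion_isometry _ _ ψ

theorem What_What (u v : Lhat) (ψ : Hhat) :
    What u (What v ψ) = phase (symLhat.form u v) • What (u + v) ψ := GNS.W_W _ u v ψ

theorem What_zero (ψ : Hhat) : What 0 ψ = ψ := GNS.W_zero _ ψ

theorem What_neg_What (u : Lhat) (ψ : Hhat) : What (-u) (What u ψ) = ψ := by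
  rw [What_What, neg_add_cancel, What_zero, map_neg, AddMonoidHom.neg_apply, symLhat.alt, neg_zero,
    phase_zero, one_smul]

theorem inner_What_Ωhat (u v : Lhat) : inner ℂ (What u Ωhat) (What v Ωhat) =
    phase (-symLhat.form u v) * vacuum (v - u) := GNS.inner_W_Ω _ vacuum_isPositive u v

theorem shiftLhat_zero (u : Lhat) : shiftLhat 0 u = u := by
  refine Subtype.ext ?_
  change shiftT 0 u.1 = u.1
  induction u.1 using T.ind with
  | h u =>
    rw [shiftT_mk]
    congr 1
    refine Subtype.ext ?_
    funext s l
    change u.1 (s - η 0 l.1) l = _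
    rw [η_comm, η_zero_right, sub_zero]

theorem shiftLhat_add (x y : Mink) (u : Lhat) :
    shiftLhat (x + y) u = shiftLhat x (shiftLhat y u) := by
  refine Subtype.ext ?_
  change shiftT (x + y) u.1 = shiftT x (shiftT y u.1)
  induction u.1 using T.ind with
  | h u =>
    rw [shiftT_mk, shiftT_mk, shiftT_mk]
    congr 1
    refine Subtype.ext ?_
    funext s l
    change u.1 (s - η (x + y) l.1) l = u.1 (s - η x l.1 - η y l.1) l
    rw [η_add_left, sub_sub]

theorem pIR_shift (x : Mink) (u : Lhat) : pIR (shiftLhat x u) = pIR u := Subtype.ext (p_shift x u.1)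

theorem symLhat_shift (x : Mink) (u v : Lhat) :
    symLhat.form (shiftLhat x u) (shiftLhat x v) = symLhat.form u v := symT_shift x u.1 v.1

theorem Uhat_What (x : Mink) (u : Lhat) (ψ : Hhat) :
    Uhat x (What u ψ) = What (shiftLhat x u) (Uhat x ψ) := GNS.symm_W _ _ _ _ u ψ

theorem Uhat_Ωhat (x : Mink) : Uhat x Ωhat = Ωhat := GNS.symm_Ω _ _ _ _

theorem Uhat_What_Ωhat (x : Mink) (u : Lhat) : Uhat x (What u Ωhat) = What (shiftLhat x u) Ωhat := by
  rw [Uhat_What, Uhat_Ωhat]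

/-- A closed subspace containing all vectors `Ŵ(u)Ω̂` is the whole space. -/
theorem Hhat_induction {P : Hhat → Prop} (hP : IsClosed {ψ | P ψ}) (h0 : P 0)
    (ha : ∀ φ ψ, P φ → P ψ → P (φ + ψ)) (hs : ∀ (c : ℂ) ψ, P ψ → P (c • ψ))
    (h : ∀ u, P (What u Ωhat)) (ψ : Hhat) : P ψ := by
  let S : Submodule ℂ Hhat :=
    { carrier := {ψ | P ψ}, zero_mem' := h0, add_mem' := fun h h' => ha _ _ h h',
      smul_mem' := fun c _ h => hs c _ h }
  have h1 := GNS.span_W_Ω symLhat (ω := vacuum) ψ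
  refine Submodule.topologicalClosure_minimal (t := S) _ (Submodule.span_le.2 ?_) hP h1
  rintro _ ⟨u, rfl⟩
  exact h u

theorem Hhat_ext {A B : Hhat →L[ℂ] Hhat} (h : ∀ u, A (What u Ωhat) = B (What u Ωhat)) (ψ : Hhat) :
    A ψ = B ψ := by
  refine Hhat_induction (P := fun ψ => A ψ = B ψ) (isClosed_eq A.continuous B.continuous) ?_
    (fun φ ψ h h' => ?_) (fun c ψ h => ?_) h ψ
  · rw [map_zero, map_zero]
  · rw [map_add, map_add, h, h']
  · rw [map_smul, map_smul, h]

theorem Uhat_zero (ψ : Hhat) : Uhat 0 ψ = ψ :=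
  Hhat_ext (A := Uhat 0) (B := ContinuousLinearMap.id ℂ Hhat)
    (fun u => by rw [Uhat_What_Ωhat, shiftLhat_zero]; rfl) ψ

theorem Uhat_add (x y : Mink) (ψ : Hhat) : Uhat (x + y) ψ = Uhat x (Uhat y ψ) :=
  Hhat_ext (A := Uhat (x + y)) (B := (Uhat x).comp (Uhat y))
    (fun u => by
      rw [ContinuousLinearMap.comp_apply, Uhat_What_Ωhat, Uhat_What_Ωhat, Uhat_What_Ωhat,
        shiftLhat_add]) ψ

theorem map_mem_fiber {A : Hhat →L[ℂ] Hhat} {f g : HIR}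
    (h : ∀ u, pIR u = f → A (What u Ωhat) ∈ fiber g) {ψ : Hhat} (hψ : ψ ∈ fiber f) :
    A ψ ∈ fiber g := by
  have hc : IsClosed ((fiber g).comap (A : Hhat →ₗ[ℂ] Hhat) : Set Hhat) :=
    (Submodule.isClosed_topologicalClosure _).preimage A.continuous
  refine Submodule.topologicalClosure_minimal (t := (fiber g).comap (A : Hhat →ₗ[ℂ] Hhat)) _
    (Submodule.span_le.2 ?_) hc hψ
  rintro _ ⟨u, hu, rfl⟩
  exact h u hu

theorem What_Ωhat_mem (u : Lhat) : What u Ωhat ∈ fiber (pIR u) :=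
  Submodule.le_topologicalClosure _ (Submodule.subset_span ⟨u, rfl, rfl⟩)

theorem What_mem_fiber (u : Lhat) {f : HIR} {ψ : Hhat} (hψ : ψ ∈ fiber f) :
    What u ψ ∈ fiber (pIR u + f) := by
  refine map_mem_fiber (fun v hv => ?_) hψ
  rw [What_What, ← hv, ← pIR_add]
  exact Submodule.smul_mem _ _ (What_Ωhat_mem _)

theorem Uhat_mem_fiber (x : Mink) {f : HIR} {ψ : Hhat} (hψ : ψ ∈ fiber f) : Uhat x ψ ∈ fiber f := by
  refine map_mem_fiber (fun v hv => ?_) hψ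
  rw [Uhat_What_Ωhat, ← hv, ← pIR_shift x v]
  exact What_Ωhat_mem _

theorem What_mem_fiber_zero {u : Lhat} (hu : pIR u = 0) {ψ : Hhat} (hψ : ψ ∈ fiber 0) :
    What u ψ ∈ fiber 0 := by
  simpa [hu] using What_mem_fiber u hψ

/-! ### Continuity -/

theorem tendsto_of_total {ι : Type} {l : Filter ι} {A : ι → Hhat →L[ℂ] Hhat} {B : Hhat →L[ℂ] Hhat}
    (hA : ∀ i ψ, ‖A i ψ‖ = ‖ψ‖) (hB : ∀ ψ, ‖B ψ‖ = ‖ψ‖)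
    (h : ∀ u, Tendsto (fun i => A i (What u Ωhat)) l (𝓝 (B (What u Ωhat)))) (ψ : Hhat) :
    Tendsto (fun i => A i ψ) l (𝓝 (B ψ)) := by
  refine Hhat_induction (P := fun ψ => Tendsto (fun i => A i ψ) l (𝓝 (B ψ))) ?_ ?_
    (fun φ ψ h h' => ?_) (fun c ψ h => ?_) h ψ
  · refine isClosed_of_closure_subset fun ψ hψ => ?_
    refine Metric.tendsto_nhds.2 ?_
    intro ε hε
    obtain ⟨φ, hφ, hd⟩ := Metric.mem_closure_iff.1 hψ (ε / 3) (by positivity)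
    filter_upwards [Metric.tendsto_nhds.1 hφ (ε / 3) (by positivity)] with i hi
    have h1 : dist (A i ψ) (A i φ) = dist ψ φ := by
      rw [dist_eq_norm, ← map_sub, hA, dist_eq_norm]
    have h2 : dist (B φ) (B ψ) = dist ψ φ := by
      rw [dist_eq_norm, ← map_sub, hB, dist_comm, dist_eq_norm]
    have := dist_triangle4 (A i ψ) (A i φ) (B φ) (B ψ)
    linarith
  · simpa using tendsto_const_nhds
  · simpa using h.add h'
  · simpa using h.const_smul c

theorem norm_What_Ωhat (u : Lhat) : ‖What u Ωhat‖ = 1 := by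
  have h := inner_self_eq_norm_sq_to_K (𝕜 := ℂ) (What u Ωhat)
  rw [inner_What_Ωhat, symLhat.alt, neg_zero, phase_zero, sub_self, vacuum_of_zero pIR_zero] at h
  have h0 : FL 0 0 = 0 := by simpa using FL_smul_left 0 0 0
  rw [h0, mul_zero, Complex.exp_zero, mul_one] at h
  have h2 : ‖What u Ωhat‖ ^ 2 = 1 := by
    have := congrArg Complex.re h
    norm_cast at this
    exact this.symm
  exact (pow_eq_one_iff_of_nonneg (norm_nonneg _) two_ne_zero).1 h2

theorem tendsto_What_Ωhat {ι : Type} {l : Filter ι} {w : ι → Lhat} {w₀ : Lhat}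
    (hp : ∀ i, pIR (w i) = pIR w₀)
    (hF : Tendsto (fun i => (FL (w i - w₀) (w i - w₀)).re) l (𝓝 0))
    (hs : Tendsto (fun i => symLhat.form w₀ (w i)) l (𝓝 0)) :
    Tendsto (fun i => What (w i) Ωhat) l (𝓝 (What w₀ Ωhat)) := by
  have h1 : Tendsto (fun i => inner ℂ (What w₀ Ωhat) (What (w i) Ωhat)) l (𝓝 (1 : ℂ)) := by
    have e : ∀ i, inner ℂ (What w₀ Ωhat) (What (w i) Ωhat) = phase (-symLhat.form w₀ (w i)) *
        Complex.exp (-(1 / 2) * ((FL (w i - w₀) (w i - w₀)).re : ℂ)) := fun i => by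
      rw [inner_What_Ωhat, vacuum_of_zero (by rw [pIR_sub, hp, sub_self]), ← FL_self]
    simp only [e]
    have h2 := (continuous_phase.tendsto _).comp hs.neg
    have h3 := ((show Continuous fun r : ℝ => Complex.exp (-(1 / 2) * (r : ℂ)) by
      fun_prop).tendsto _).comp hF
    have h4 := h2.mul h3
    simpa [phase_zero] using h4
  rw [tendsto_iff_norm_sub_tendsto_zero]
  have h2 : ∀ i, ‖What (w i) Ωhat - What w₀ Ωhat‖ =
      √(2 - 2 * (inner ℂ (What w₀ Ωhat) (What (w i) Ωhat)).re) := fun i => by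
    have := norm_sub_sq (𝕜 := ℂ) (What w₀ Ωhat) (What (w i) Ωhat)
    rw [norm_What_Ωhat, norm_What_Ωhat, norm_sub_rev] at this
    rw [← Real.sqrt_sq (norm_nonneg (_ - _)), this]
    congr 1
    change 1 ^ 2 - 2 * (inner ℂ (What w₀ Ωhat) (What (w i) Ωhat)).re + 1 ^ 2 = _
    ring
  simp only [h2]
  have h3 := (Complex.continuous_re.tendsto _).comp h1
  have h4 := (Real.continuous_sqrt.tendsto _).comp ((h3.const_mul 2).const_sub 2)
  simpa [Function.comp_def] using h4

theorem tendsto_What {ι : Type} {l : Filter ι} {w : ι → Lhat} {w₀ : Lhat}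
    (hp : ∀ i, pIR (w i) = pIR w₀)
    (hF : Tendsto (fun i => (FL (w i - w₀) (w i - w₀)).re) l (𝓝 0))
    (hs : ∀ v, Tendsto (fun i => symLhat.form (w i) v) l (𝓝 (symLhat.form w₀ v))) (ψ : Hhat) :
    Tendsto (fun i => What (w i) ψ) l (𝓝 (What w₀ ψ)) := by
  refine tendsto_of_total (fun i ψ => norm_What _ ψ) (norm_What _) (fun v => ?_) ψ
  simp only [What_What]
  refine ((continuous_phase.tendsto _).comp (hs v)).smul (tendsto_What_Ωhat (fun i => ?_) ?_ ?_)
  · rw [pIR_add, pIR_add, hp]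
  · simpa only [add_sub_add_right_eq_sub] using hF
  · have h1 := hs (w₀ + v)
    have h2 : ∀ i, symLhat.form (w₀ + v) (w i + v) =
        -symLhat.form (w i) (w₀ + v) + symLhat.form w₀ v := fun i => by
      rw [map_add (symLhat.form (w₀ + v)), symLhat.swap (w i), map_add symLhat.form w₀ v,
        AddMonoidHom.add_apply, symLhat.alt v]
      ring
    simp only [h2]
    have h3 := h1.neg.add_const (symLhat.form w₀ v)
    rw [map_add, symLhat.alt, zero_add] at h3
    simpa using h3

theorem continuous_symLhat_shift (u v : Lhat) :
    Continuous fun x => symLhat.form u (shiftLhat x v) := continuous_symT_shift u.1 v.1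

theorem continuous_Uhat (ψ : Hhat) : Continuous fun x => Uhat x ψ := by
  have h0 : ∀ ψ, Tendsto (fun x => Uhat x ψ) (𝓝 0) (𝓝 ψ) := fun ψ => by
    refine tendsto_of_total (A := Uhat) (B := ContinuousLinearMap.id ℂ Hhat) norm_Uhat
      (fun _ => rfl) (fun u => ?_) ψ
    simp only [Uhat_What_Ωhat, ContinuousLinearMap.id_apply]
    refine tendsto_What_Ωhat (fun x => pIR_shift x u) (F_shift_sub_tendsto u.1) ?_
    have := (continuous_symLhat_shift u u).tendsto 0
    rwa [shiftLhat_zero, symLhat.alt] at this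
  refine continuous_iff_continuousAt.2 fun x => ?_
  have h1 : Tendsto (fun y => y - x) (𝓝 x) (𝓝 0) := by
    have : Continuous fun y => y - x := by fun_prop
    simpa using this.tendsto x
  have h2 := ((Uhat x).continuous.tendsto _).comp ((h0 ψ).comp h1)
  refine h2.congr fun y => ?_
  simp only [Function.comp_apply]
  rw [← Uhat_add, add_sub_cancel]

/-! ### Separability of the space of infrared characteristics -/

/-- The components of `f` as elements of `L²`. -/
def PreH0.toLp (f : PreH0) (a : Fin 4) : Lp ℝ 2 dl := (f.2.2.2.2 a).toLp

theorem PreH0.norm_sub_sq_le (f g : PreH0) :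
    ‖f - g‖ ^ 2 ≤ ∑ a, ‖f.toLp a - g.toLp a‖ ^ 2 := by
  have e : ∀ a, ‖f.toLp a - g.toLp a‖ ^ 2 =
      ∫ n, (f.fn (sec n) a - g.fn (sec n) a) ^ 2 ∂dl := fun a => by
    rw [PreH0.toLp, PreH0.toLp, ← MemLp.toLp_sub, ← real_inner_self_eq_norm_sq, L2.inner_def]
    refine integral_congr_ae ?_
    filter_upwards [((f.2.2.2.2 a).sub (g.2.2.2.2 a)).coeFn_toLp] with n hn
    rw [hn]
    change inner ℝ (f.fn (sec n) a - g.fn (sec n) a) (f.fn (sec n) a - g.fn (sec n) a) = _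
    rw [real_inner_self_eq_norm_sq, Real.norm_eq_abs, sq_abs]
  have hi : ∀ a, Integrable (fun n => (f.fn (sec n) a - g.fn (sec n) a) ^ 2) dl := fun a =>
    ((f.2.2.2.2 a).sub (g.2.2.2.2 a)).integrable_sq
  simp only [e]
  rw [← integral_finsetSum _ fun a _ => hi a, ← real_inner_self_eq_norm_sq, PreH0.inner_def]
  refine integral_mono (PreH0.integrable_η _ _) (integrable_finsetSum _ fun a _ => hi a) fun n => ?_
  change -η (f.fn (sec n) - g.fn (sec n)) (f.fn (sec n) - g.fn (sec n)) ≤ _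
  simp only [η, Fin.sum_univ_four, Pi.sub_apply]
  nlinarith [sq_nonneg (f.fn (sec n) 0 - g.fn (sec n) 0)]

instance : SecondCountableTopology H0 := by
  have hne : Fact ((2 : ℝ≥0∞) ≠ ⊤) := ⟨by norm_num⟩
  let R : Type := Set.range PreH0.toLp
  have hL : SecondCountableTopology (Lp ℝ 2 dl) := Lp.SecondCountableTopology
  have hR : SecondCountableTopology R :=
    TopologicalSpace.Subtype.secondCountableTopology (Set.range PreH0.toLp)
  let g : R → PreH0 := fun y => y.2.choose
  have hg : ∀ y : R, (g y).toLp = y.1 := fun y => y.2.choose_spec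
  have hc : Continuous fun y : R => H0.mk (g y) := by
    refine continuous_iff_continuousAt.2 fun y => ?_
    refine tendsto_iff_dist_tendsto_zero.2 ?_
    have h1 : Continuous fun z : R => √(∑ a, ‖z.1 a - y.1 a‖ ^ 2) := by
      refine Real.continuous_sqrt.comp (continuous_finsetSum _ fun a _ => ?_)
      exact ((((continuous_apply a).comp continuous_subtype_val).sub continuous_const).norm.pow 2)
    have h2 := h1.tendsto y
    simp only [sub_self, norm_zero] at h2
    refine squeeze_zero (fun _ => dist_nonneg) (fun z => ?_) (by simpa using h2)
    change dist (SeparationQuotient.mk (g z)) (SeparationQuotient.mk (g y)) ≤ _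
    rw [SeparationQuotient.dist_mk, dist_eq_norm]
    refine Real.le_sqrt_of_sq_le ?_
    have := PreH0.norm_sub_sq_le (g z) (g y)
    rwa [hg, hg] at this
  have hs : Function.Surjective fun y : R => H0.mk (g y) := by
    intro x
    obtain ⟨f, rfl⟩ := SeparationQuotient.surjective_mk x
    refine ⟨⟨f.toLp, f, rfl⟩, ?_⟩
    have h1 := PreH0.norm_sub_sq_le (g ⟨f.toLp, f, rfl⟩) f
    rw [hg] at h1
    simp only [sub_self, norm_zero] at h1
    rw [← dist_eq_zero]
    change dist (SeparationQuotient.mk _) (SeparationQuotient.mk _) = 0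
    rw [SeparationQuotient.dist_mk, dist_eq_norm]
    exact pow_eq_zero_iff two_ne_zero |>.1 (le_antisymm (by simpa using h1) (sq_nonneg _))
  have : TopologicalSpace.SeparableSpace H0 := hs.denseRange.separableSpace hc
  exact UniformSpace.secondCountable_of_separable H0

/-! ### Functions with vanishing integral at low frequencies -/

theorem exists_lintegral_ft_div_le {ε : ℝ} (hε : 0 < ε) (C : ℝ) : ∃ B : ℝ≥0∞, B ≠ ⊤ ∧
    ∀ a : ℝ → ℝ, Measurable a → (∀ s, |a s| ≤ C / weight ε s) → ∫ s, a s = 0 →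
      ∫⁻ w in Set.Ioi 0, ENNReal.ofReal (‖ft a w‖ ^ 2 / w) ≤ B := by
  set δ := min ε 1
  have hδ : 0 < δ := lt_min hε one_pos
  have hδ1 : δ ≤ 1 := min_le_right _ _
  have hJ := integrable_inv_weight (half_pos hδ)
  set J := ∫ s, (weight (δ / 2) s)⁻¹
  set B₁ : ℝ≥0∞ := ∫⁻ w in Set.Ioc 0 1, ENNReal.ofReal (w ^ (δ - 1) * (C * J) ^ 2)
  set B₂ : ℝ≥0∞ := ∫⁻ s, ENNReal.ofReal (C ^ 2 * (weight δ s)⁻¹)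
  refine ⟨B₁ + B₂, ENNReal.add_ne_top.2 ⟨?_, ?_⟩, fun a hm ha h0 => ?_⟩
  · have hi : IntegrableOn (fun w : ℝ => w ^ (δ - 1) * (C * J) ^ 2) (Set.Ioc 0 1) := by
      have := intervalIntegral.intervalIntegrable_rpow' (a := 0) (b := 1)
        (show -1 < δ - 1 by linarith)
      exact (((intervalIntegrable_iff_integrableOn_Ioc_of_le zero_le_one).1 this).mul_const _)
    exact (hi.lintegral_lt_top).ne
  · exact (((integrable_inv_weight hδ).const_mul _).lintegral_lt_top).ne
  have hC : 0 ≤ C := by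
    have h1 := (abs_nonneg _).trans (ha 0)
    by_contra hc
    exact absurd (div_neg_of_neg_of_pos (not_le.1 hc) (weight_pos ε 0)) (not_lt.2 h1)
  have ha' : ∀ s, |a s| ≤ C * (weight δ s)⁻¹ := fun s => by
    rw [← div_eq_mul_inv]
    exact (ha s).trans (div_le_div_of_nonneg_left hC (weight_pos δ s)
      (weight_mono (min_le_left _ _) s))
  have hw1 : ∀ s, 1 ≤ weight δ s := fun s =>
    Real.one_le_rpow (by linarith [abs_nonneg s]) (by positivity)
  have hi : Integrable a := ((integrable_inv_weight hδ).const_mul C).mono' hm.aestronglyMeasurable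
    (Eventually.of_forall ha')
  have hb : ∀ s, |a s| * (1 + |s|) ^ (δ / 2) ≤ C * (weight (δ / 2) s)⁻¹ := fun s => by
    have hp : 0 < 1 + |s| := by positivity
    have e : (weight δ s)⁻¹ * (1 + |s|) ^ (δ / 2) = (weight (δ / 2) s)⁻¹ := by
      rw [weight, weight, ← Real.rpow_neg hp.le, ← Real.rpow_neg hp.le, ← Real.rpow_add hp]
      congr 1; ring
    calc |a s| * (1 + |s|) ^ (δ / 2) ≤ C * (weight δ s)⁻¹ * (1 + |s|) ^ (δ / 2) := by
          gcongr; exact ha' s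
      _ = _ := by rw [mul_assoc, e]
  have hi2 : Integrable fun s => |a s| * (1 + |s|) ^ (δ / 2) := by
    refine (hJ.const_mul C).mono' ?_ (Eventually.of_forall fun s => ?_)
    · exact (hm.abs.mul (by fun_prop)).aestronglyMeasurable
    · rw [Real.norm_of_nonneg (by positivity)]; exact hb s
  have hI : ∫ s, |a s| * (1 + |s|) ^ (δ / 2) ≤ C * J := by
    rw [← integral_const_mul]
    exact integral_mono hi2 (hJ.const_mul C) hb
  have hft0 : ft a 0 = 0 := by
    have : ∀ s : ℝ, (a s : ℂ) * Complex.exp (Complex.I * (0 : ℝ) * s) = ((a s : ℝ) : ℂ) :=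
      fun s => by simp
    simp only [ft, this]
    rw [integral_complex_ofReal, h0]; simp
  have hft : ∀ w, 0 < w → ‖ft a w‖ ≤ w ^ (δ / 2) * (C * J) := fun w hw => by
    have := norm_ft_sub_le (θ := δ / 2) (by positivity) (by linarith) hi hi2 w
    rw [hft0, sub_zero, abs_of_pos hw] at this
    exact this.trans (mul_le_mul_of_nonneg_left hI (by positivity))
  rw [← Set.Ioc_union_Ioi_eq_Ioi (zero_le_one' ℝ),
    lintegral_union measurableSet_Ioi (Set.Ioc_disjoint_Ioi le_rfl)]
  refine add_le_add ?_ ?_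
  · refine setLIntegral_mono' measurableSet_Ioc fun w hw => ENNReal.ofReal_le_ofReal ?_
    have hw0 : 0 < w := hw.1
    have e : w ^ (δ - 1) * (C * J) ^ 2 = (w ^ (δ / 2) * (C * J)) ^ 2 / w := by
      have e2 : (w ^ (δ / 2)) ^ 2 = w ^ δ := by
        rw [← Real.rpow_natCast, ← Real.rpow_mul hw0.le]
        congr 1; push_cast; ring
      rw [mul_pow (w ^ (δ / 2)), e2, Real.rpow_sub hw0, Real.rpow_one]
      ring
    rw [e]
    gcongr
    exact hft w hw0
  · calc ∫⁻ w in Set.Ioi 1, ENNReal.ofReal (‖ft a w‖ ^ 2 / w)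
        ≤ ∫⁻ w in Set.Ioi 1, ENNReal.ofReal (‖ft a w‖ ^ 2) :=
          setLIntegral_mono' measurableSet_Ioi fun w hw =>
            ENNReal.ofReal_le_ofReal (div_le_self (sq_nonneg _) (le_of_lt hw))
      _ ≤ ∫⁻ w, ENNReal.ofReal (‖ft a w‖ ^ 2) := setLIntegral_le_lintegral _ _
      _ ≤ ENNReal.ofReal (1 / (2 * Real.pi)) * ∫⁻ s, ENNReal.ofReal (a s ^ 2) :=
          lintegral_ft_sq_le hm hi
      _ ≤ 1 * B₂ := by
          refine mul_le_mul' ?_ (lintegral_mono fun s => ENNReal.ofReal_le_ofReal ?_)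
          · rw [ENNReal.ofReal_le_one, div_le_one (by positivity)]
            linarith [Real.pi_gt_three]
          · have h1 := ha' s
            have h2 : (weight δ s)⁻¹ ≤ 1 := inv_le_one_of_one_le₀ (hw1 s)
            have h3 : 0 < (weight δ s)⁻¹ := inv_pos.2 (weight_pos δ s)
            calc a s ^ 2 = |a s| ^ 2 := (sq_abs _).symm
              _ ≤ (C * (weight δ s)⁻¹) ^ 2 := by gcongr
              _ = C ^ 2 * (weight δ s)⁻¹ * (weight δ s)⁻¹ := by ring
              _ ≤ C ^ 2 * (weight δ s)⁻¹ * 1 := by gcongr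
              _ = _ := mul_one _
      _ = B₂ := one_mul _

/-! ### Smearing with profiles of restricted smoothness -/

/-- Measurable profiles: functions `k(s,l)`, homogeneous of degree `-1`, with `k̃(0,l) = 1`, falling
off faster than `1/|s|`. -/
structure Kern where
  k : ℝ → Cone → ℝ
  hom : Homogeneous (-1) k
  meas : Measurable (onSec k)
  bound : ∃ ε > 0, ∃ C : ℝ, ∀ s n, |k s (sec n)| ≤ C / weight ε s
  norm : ∀ l, 1 / (2 * Real.pi) * ∫ s, k s l = 1

def Profile.kern (h : Profile) : Kern where
  k := h.h
  hom := h.homogeneous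
  meas := h.smooth.continuous_onSec.measurable
  bound := by
    obtain ⟨ε, hε, hd⟩ := h.decay
    obtain ⟨C, hC⟩ := hd 0
    exact ⟨ε, hε, C, hC [] rfl⟩
  norm := h.norm

namespace Kern

theorem bound_nonneg {ε C x s : ℝ} (h : |x| ≤ C / weight ε s) : 0 ≤ C := by
  have h1 := (abs_nonneg _).trans h
  by_contra hc
  exact absurd (div_neg_of_neg_of_pos (not_le.1 hc) (weight_pos ε s)) (not_lt.2 h1)

def shift (x : Mink) (k : Kern) : Kern where
  k := IRQED.shift x k.k
  hom := fun μ l l' hμ hl s => by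
    simp only [IRQED.shift]
    rw [hl, η_smul_right, ← mul_sub]
    exact k.hom μ l l' hμ hl _
  meas := k.meas.comp (shear_mp x).measurable
  bound := by
    obtain ⟨ε, hε, C, hC⟩ := k.bound
    set K := |x 0| + |x 1| + |x 2| + |x 3|
    refine ⟨ε, hε, (1 + K) ^ (1 + ε) * C, fun s n => ?_⟩
    have h1 := hC (s - η x (sec n).1) n
    have hC0 := bound_nonneg h1
    have h2 := weight_shift ε hε K s _ (abs_η_sec_le x n)
    refine h1.trans ?_
    rw [div_le_div_iff₀ (weight_pos _ _) (weight_pos _ _)]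
    nlinarith
  norm := fun l => by
    have := integral_sub_right_eq_self (μ := volume) (fun s => k.k s l) (η x l.1)
    simp only [IRQED.shift, this]
    exact k.norm l

/-- The profile `λ k(λ s, l)`. -/
def scale (r : ℝ) (hr : 0 < r) (k : Kern) : Kern where
  k := fun s l => r * k.k (r * s) l
  hom := fun μ l l' hμ hl s => by
    have := k.hom μ l l' hμ hl (r * s)
    change r * k.k (r * (μ * s)) l' = μ ^ (-1 : ℤ) * (r * k.k (r * s) l)
    rw [mul_left_comm r μ s, this, smul_eq_mul]; ring
  meas := (k.meas.comp (measurable_fst.prodMk (measurable_const.mul measurable_snd))).const_mul r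
  bound := by
    obtain ⟨ε, hε, C, hC⟩ := k.bound
    refine ⟨ε, hε, r * C * (max 1 r⁻¹) ^ (1 + ε), fun s n => ?_⟩
    have h1 := hC (r * s) n
    have hC0 := bound_nonneg h1
    have h2 : weight ε s ≤ (max 1 r⁻¹) ^ (1 + ε) * weight ε (r * s) := by
      unfold weight
      rw [← Real.mul_rpow (by positivity) (by positivity)]
      refine Real.rpow_le_rpow (by positivity) ?_ (by positivity)
      rw [abs_mul, abs_of_pos hr, mul_add, mul_one]
      refine add_le_add (le_max_left _ _) ?_
      calc |s| = r⁻¹ * (r * |s|) := by field_simp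
        _ ≤ _ := mul_le_mul_of_nonneg_right (le_max_right _ _) (by positivity)
    rw [abs_mul, abs_of_pos hr]
    refine (mul_le_mul_of_nonneg_left h1 hr.le).trans ?_
    rw [← mul_div_assoc, div_le_div_iff₀ (weight_pos _ _) (weight_pos _ _)]
    have := mul_le_mul_of_nonneg_left h2 (mul_nonneg hr.le hC0)
    linarith
  norm := fun l => by
    have h := Measure.integral_comp_mul_left (fun s => k.k s l) r
    rw [abs_of_pos (inv_pos.2 hr), smul_eq_mul] at h
    rw [integral_const_mul, h, mul_inv_cancel_left₀ hr.ne']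
    exact k.norm l

variable (k : Kern)

theorem measurable_slice (n : S2) : Measurable fun s => k.k s (sec n) :=
  k.meas.comp (measurable_const.prodMk measurable_id)

theorem integrable (n : S2) : Integrable fun s => k.k s (sec n) := by
  obtain ⟨ε, hε, C, hC⟩ := k.bound
  refine ((integrable_inv_weight hε).const_mul C).mono'
    (k.measurable_slice n).aestronglyMeasurable (Eventually.of_forall fun s => ?_)
  rw [← div_eq_mul_inv]
  exact hC s n

theorem smear_mem (f : PreH0) : (fun s l => k.k s l • f.fn l) ∈ preT := by
  obtain ⟨ε, hε, C, hC⟩ := k.bound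
  have hmu : Measurable (onSec fun s l => k.k s l • f.fn l) :=
    k.meas.smul (f.2.2.1.comp measurable_fst)
  refine ⟨fun μ l l' hμ hl s => ?_, hmu, fun s l => ?_, ε, hε, fun a => ?_⟩
  · change k.k (μ * s) l' • f.fn l' = _
    rw [k.hom μ l l' hμ hl, f.hom μ l l' hμ hl, smul_smul, smul_smul, smul_eq_mul]
    congr 1
    rw [show (-2 : ℤ) = -1 + -1 by norm_num, zpow_add₀ hμ.ne']; ring
  · rw [η_smul_right, f.orth, mul_zero]
  · have i := (((f.2.2.2.2 a).integrable_sq).mul_prod (integrable_inv_weight hε)).const_mul (C ^ 2)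
    refine i.mono' ?_ (Eventually.of_forall fun p => ?_)
    · exact (((measurable_comp_onSec hmu a).pow_const 2).mul
        ((continuous_weight ε).measurable.comp measurable_snd)).aestronglyMeasurable
    · have w := weight_pos ε p.2
      rw [Real.norm_eq_abs, abs_of_nonneg (mul_nonneg (sq_nonneg _) w.le)]
      simp only [Pi.smul_apply, smul_eq_mul]
      have h1 : k.k p.2 (sec p.1) ^ 2 ≤ (C / weight ε p.2) ^ 2 := by
        rw [← sq_abs (k.k p.2 (sec p.1))]
        exact pow_le_pow_left₀ (abs_nonneg _) (hC _ _) 2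
      calc (k.k p.2 (sec p.1) * f.fn (sec p.1) a) ^ 2 * weight ε p.2
          = k.k p.2 (sec p.1) ^ 2 * (f.fn (sec p.1) a ^ 2 * weight ε p.2) := by ring
        _ ≤ (C / weight ε p.2) ^ 2 * (f.fn (sec p.1) a ^ 2 * weight ε p.2) :=
            mul_le_mul_of_nonneg_right h1 (by positivity)
        _ = C ^ 2 * (f.1 (sec p.1) a ^ 2 * (weight ε p.2)⁻¹) := by
            change _ = C ^ 2 * (f.fn (sec p.1) a ^ 2 * (weight ε p.2)⁻¹)
            field_simp

/-- The function `k f`. -/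
def smearPre : PreH0 →ₗ[ℝ] preT where
  toFun f := ⟨fun s l => k.k s l • f.fn l, k.smear_mem f⟩
  map_add' f g := Subtype.ext (funext fun s => funext fun l => smul_add (k.k s l) (f.fn l) (g.fn l))
  map_smul' c f := Subtype.ext (funext fun s => funext fun l => smul_comm (k.k s l) c (f.fn l))

theorem smearPre_apply (f : PreH0) (s : ℝ) (l : Cone) :
    (k.smearPre f).1 s l = k.k s l • f.fn l := rfl

theorem mk_smearPre_congr {f g : PreH0} (h : H0.mk f = H0.mk g) :
    T.mk (k.smearPre f) = T.mk (k.smearPre g) := by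
  have h1 : H0.mk (f - g) = 0 := by
    change SeparationQuotient.mk (f - g) = 0
    rw [SeparationQuotient.mk_sub]
    exact sub_eq_zero.2 h
  have h2 : Measure.QuasiMeasurePreserving (fun p : S2 × ℝ => p.1) (dl.prod volume) dl :=
    Measure.quasiMeasurePreserving_fst
  refine (Submodule.Quotient.eq nullT).2 ?_
  rw [← map_sub]
  change ∀ᵐ p ∂(dl.prod volume), ∃ c : ℝ, _
  filter_upwards [h2.ae (H0.mk_eq_zero_iff.1 h1)] with p ⟨c, hc⟩
  refine ⟨k.k p.2 (sec p.1) * c, ?_⟩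
  change k.k p.2 (sec p.1) • (f - g).fn (sec p.1) = _
  rw [hc, smul_smul]

theorem p_smearPre (f : PreH0) : IRQED.p (T.mk (k.smearPre f)) = H0.mk f := by
  rw [p_mk]
  refine H0.mk_eq_of_ae (Eventually.of_forall fun n => ?_)
  change (1 / (2 * Real.pi)) • ∫ s, k.k s (sec n) • f.fn (sec n) = f.fn (sec n)
  rw [integral_smul_const, smul_smul, k.norm, one_smul]

/-- The element `[k f]` of `L̂`. -/
def smear : HIR →ₗ[ℝ] Lhat where
  toFun f := ⟨T.mk (k.smearPre f.rep), by
    rw [LhatSub, Submodule.mem_comap, k.p_smearPre, HIR.mk_rep]; exact f.2⟩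
  map_add' f g := by
    refine Subtype.ext ?_
    change T.mk _ = T.mk _ + T.mk _
    have : H0.mk (f + g).rep = H0.mk (f.rep + g.rep) := by
      change _ = SeparationQuotient.mk _
      rw [SeparationQuotient.mk_add, HIR.mk_rep]
      change (f + g).1 = H0.mk _ + H0.mk _
      rw [HIR.mk_rep, HIR.mk_rep]; rfl
    rw [k.mk_smearPre_congr this, map_add]; rfl
  map_smul' c f := by
    refine Subtype.ext ?_
    change T.mk _ = c • T.mk _
    have : H0.mk (c • f).rep = H0.mk (c • f.rep) := by
      change _ = SeparationQuotient.mk _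
      rw [SeparationQuotient.mk_smul, HIR.mk_rep]
      change (c • f).1 = c • H0.mk _
      rw [HIR.mk_rep]; rfl
    rw [k.mk_smearPre_congr this, map_smul]; rfl

theorem pIR_smear (f : HIR) : pIR (k.smear f) = f :=
  Subtype.ext ((k.p_smearPre f.rep).trans (HIR.mk_rep f))

end Kern

theorem smear_eq (h : Profile) (f : HIR) : smear h f = h.kern.smear f := rfl

theorem shiftLhat_smear (x : Mink) (k : Kern) (f : HIR) :
    shiftLhat x (k.smear f) = (k.shift x).smear f := rfl

namespace Kern

/-- The function `∫ k(τ,l) ε(τ - s) dτ`. -/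
def sgn (k : Kern) (s : ℝ) (l : Cone) : ℝ := ∫ τ, k.k τ l * Real.sign (τ - s)

theorem exists_sgn_le (k : Kern) : ∃ C : ℝ, ∀ s n, |k.sgn s (sec n)| ≤ C := by
  obtain ⟨ε, hε, C, hC⟩ := k.bound
  have hi : Integrable fun s => C * (weight ε s)⁻¹ := (integrable_inv_weight hε).const_mul C
  refine ⟨∫ s, C * (weight ε s)⁻¹, fun s n => (norm_integral_le_of_norm_le (f := fun τ =>
    k.k τ (sec n) * Real.sign (τ - s)) hi (Eventually.of_forall fun τ => ?_) :)⟩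
  rw [norm_mul, ← div_eq_mul_inv]
  calc ‖k.k τ (sec n)‖ * ‖Real.sign (τ - s)‖ ≤ ‖k.k τ (sec n)‖ * 1 := by
        gcongr; exact abs_sign_le _
    _ ≤ _ := by rw [mul_one]; exact hC τ n

theorem measurable_sgn (k : Kern) : Measurable (onSec k.sgn) := by
  have h : StronglyMeasurable fun q : (S2 × ℝ) × ℝ => k.k q.2 (sec q.1.1) * Real.sign (q.2 - q.1.2) := by
    refine Measurable.stronglyMeasurable (Measurable.mul ?_ (measurable_sign.comp (by fun_prop)))
    exact k.meas.comp ((measurable_fst.comp measurable_fst).prodMk measurable_snd)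
  exact h.integral_prod_right'.measurable

theorem sgn_hom (k : Kern) {μ : ℝ} {l l' : Cone} (hμ : 0 < μ) (hl : l'.1 = μ • l.1) (s : ℝ) :
    k.sgn (μ * s) l' = k.sgn s l := by
  have h := Measure.integral_comp_mul_left (fun τ => k.k τ l' * Real.sign (τ - μ * s)) μ
  have h2 : ∀ τ, k.k (μ * τ) l' * Real.sign (μ * τ - μ * s) =
      μ⁻¹ * (k.k τ l * Real.sign (τ - s)) := fun τ => by
    rw [k.hom μ l l' hμ hl, ← mul_sub, zpow_neg_one, smul_eq_mul, mul_assoc]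
    congr 2
    rcases lt_trichotomy (τ - s) 0 with h | h | h
    · rw [Real.sign_of_neg h, Real.sign_of_neg (mul_neg_of_pos_of_neg hμ h)]
    · rw [h, mul_zero]
    · rw [Real.sign_of_pos h, Real.sign_of_pos (mul_pos hμ h)]
  simp only [h2, abs_of_pos (inv_pos.2 hμ), smul_eq_mul] at h
  rw [integral_const_mul] at h
  exact (mul_left_cancel₀ (inv_pos.2 hμ).ne' h).symm

theorem sgn_smul_mem (k : Kern) (v : preT) : (fun s l => k.sgn s l • v.1 s l) ∈ preT := by
  obtain ⟨ε, hε, h4⟩ := v.2.2.2.2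
  obtain ⟨C, hC⟩ := k.exists_sgn_le
  have hm : Measurable (onSec fun s l => k.sgn s l • v.1 s l) :=
    k.measurable_sgn.smul (preT.measurable v)
  refine ⟨fun μ l l' hμ hl s => ?_, hm, fun s l => ?_, ε, hε, fun a => ?_⟩
  · change k.sgn (μ * s) l' • v.1 (μ * s) l' = μ ^ (-2 : ℤ) • k.sgn s l • v.1 s l
    rw [k.sgn_hom hμ hl, v.2.1 μ l l' hμ hl, smul_comm]
  · rw [η_smul_right, v.2.2.2.1, mul_zero]
  · refine ((h4 a).const_mul (C ^ 2)).mono' ?_ (Eventually.of_forall fun p => ?_)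
    · exact (((measurable_comp_onSec hm a).pow_const 2).mul
        ((continuous_weight ε).measurable.comp measurable_snd)).aestronglyMeasurable
    · rw [Real.norm_eq_abs, abs_of_nonneg (mul_nonneg (sq_nonneg _) (weight_pos _ _).le)]
      simp only [Pi.smul_apply, smul_eq_mul]
      have h1 : k.sgn p.2 (sec p.1) ^ 2 ≤ C ^ 2 := sq_le_sq' (by linarith [abs_le.1 (hC p.2 p.1)])
        (abs_le.1 (hC p.2 p.1)).2
      rw [mul_pow, mul_assoc]
      exact mul_le_mul_of_nonneg_right h1 (mul_nonneg (sq_nonneg _) (weight_pos _ _).le)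

end Kern

/-- The zero-frequency part as an element of the space of representatives. -/
def zeroModeH (u : preT) : PreH0 := ⟨zeroMode u.1, zeroMode_mem u⟩

namespace Kern

theorem symPre_smearPre (k : Kern) (f : PreH0) (v : preT) :
    symPre (k.smearPre f) v = -(1 / 2) *
      inner ℝ f (zeroModeH ⟨_, k.sgn_smul_mem v⟩) := by
  have hi := symKer_integrable (k.smearPre f) v
  rw [symPre_apply, integral_prod _ hi, PreH0.inner_def, ← integral_const_mul,
    ← integral_const_mul]
  refine integral_congr_ae ?_
  filter_upwards [hi.prod_right_ae, preT.integrable_slice v,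
    preT.integrable_slice ⟨_, k.sgn_smul_mem v⟩] with n hn hv hg
  change _ = -(1 / 2) * -η (f.fn (sec n)) ((1 / (2 * Real.pi)) • ∫ s, k.sgn s (sec n) • v.1 s (sec n))
  rw [integral_prod_symm _ hn]
  have hz : η (f.fn (sec n)) (∫ s, k.sgn s (sec n) • v.1 s (sec n)) =
      ∫ s, η (f.fn (sec n)) (k.sgn s (sec n) • v.1 s (sec n)) := by
    have hc := integral_comp_eval hg
    have j := fun a => (hg a).const_mul (f.fn (sec n) a)
    simp only [η]
    rw [integral_sub (by exact ((j 0).sub (j 1)).sub (j 2)) (j 3),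
      integral_sub (by exact (j 0).sub (j 1)) (j 2), integral_sub (j 0) (j 1)]
    simp only [integral_const_mul]
    rw [← hc 0, ← hc 1, ← hc 2, ← hc 3]
  rw [η_smul_right, hz]
  have e : ∀ s, ∫ τ, symKer (k.smearPre f) v (n, τ, s) =
      η (f.fn (sec n)) (k.sgn s (sec n) • v.1 s (sec n)) := fun s => by
    have : ∀ τ, symKer (k.smearPre f) v (n, τ, s) =
        k.k τ (sec n) * Real.sign (τ - s) * η (f.fn (sec n)) (v.1 s (sec n)) := fun τ => by
      simp only [symKer, smearPre_apply]
      rw [η_smul_left]; ring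
    simp only [this]
    rw [integral_mul_const, η_smul_right]; rfl
  simp only [e]
  field_simp
  ring

theorem continuous_form_smear (k : Kern) (v : Lhat) :
    Continuous fun f => symLhat.form (k.smear f) v := by
  obtain ⟨v, hv⟩ := v
  induction v using T.ind with
  | h v =>
    set g := zeroModeH ⟨_, k.sgn_smul_mem v⟩
    have e : ∀ f : HIR, symLhat.form (k.smear f) ⟨T.mk v, hv⟩ = -(1 / 2) * inner ℝ f.1 (H0.mk g) :=
      fun f => by
      have h1 := k.symPre_smearPre f.rep v
      have h2 : inner ℝ f.rep g = inner ℝ f.1 (H0.mk g) := by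
        conv_rhs => rw [← HIR.mk_rep f]
        exact (SeparationQuotient.inner_mk_mk (𝕜 := ℝ) _ _).symm
      rw [← h2]
      exact h1
    simp only [e]
    fun_prop

end Kern

instance : SecondCountableTopology HIR := TopologicalSpace.Subtype.secondCountableTopology _

theorem norm_rep (f : HIR) : ‖f.rep‖ = ‖f‖ := by
  have : ‖f.1‖ = ‖f.rep‖ := by
    rw [← HIR.mk_rep f]; exact SeparationQuotient.norm_mk _
  rw [← this]; rfl

namespace Kern

theorem fourier_smearPre_sub (k₁ k₂ : Kern) (f : PreH0) (w : ℝ) (l : Cone) (a : Fin 4) :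
    fourier (k₁.smearPre f - k₂.smearPre f) w l a =
      (f.fn l a : ℂ) * ft (fun s => k₁.k s l - k₂.k s l) w := by
  rw [fourier_eq_ft, ft, ft, mul_left_comm, ← integral_const_mul (f.fn l a : ℂ)]
  congr 2; funext s
  change ((k₁.k s l * f.fn l a - k₂.k s l * f.fn l a : ℝ) : ℂ) * _ = _
  push_cast; ring

theorem smearPre_sub_mem (k₁ k₂ : Kern) (f : PreH0) : k₁.smearPre f - k₂.smearPre f ∈ kerP := by
  rw [mem_kerP]
  change IRQED.p (T.mk (k₁.smearPre f) - T.mk (k₂.smearPre f)) = 0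
  rw [map_sub, p_smearPre, p_smearPre, sub_self]

theorem FKer_smearPre_sub (k₁ k₂ : Kern) (f : PreH0) (q : S2 × ℝ) :
    FKer (k₁.smearPre f - k₂.smearPre f) (k₁.smearPre f - k₂.smearPre f) q =
      ((-η (f.fn (sec q.1)) (f.fn (sec q.1)) *
        (‖ft (fun s => k₁.k s (sec q.1) - k₂.k s (sec q.1)) q.2‖ ^ 2 / q.2) : ℝ) : ℂ) := by
  have h := Complex.conj_mul' (ft (fun s => k₁.k s (sec q.1) - k₂.k s (sec q.1)) q.2)
  simp only [FKer, ηC, fourier_smearPre_sub, map_mul, Complex.conj_ofReal, η]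
  push_cast
  rw [← h]
  ring

theorem exists_FL_smear_sub_le (k₁ k₂ : Kern) : ∃ B : ℝ, ∀ f : HIR,
    (FL (k₁.smear f - k₂.smear f) (k₁.smear f - k₂.smear f)).re ≤ B * ‖f‖ ^ 2 := by
  obtain ⟨ε₁, h₁, C₁, b₁⟩ := k₁.bound
  obtain ⟨ε₂, h₂, C₂, b₂⟩ := k₂.bound
  obtain ⟨B, hB, hb⟩ := exists_lintegral_ft_div_le (lt_min h₁ h₂) (C₁ + C₂)
  refine ⟨B.toReal, fun f => ?_⟩
  set d : S2 → ℝ → ℝ := fun n s => k₁.k s (sec n) - k₂.k s (sec n)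
  have hd : ∀ n, ∫⁻ w in Set.Ioi 0, ENNReal.ofReal (‖ft (d n) w‖ ^ 2 / w) ≤ B := fun n => by
    refine hb (d n) ((k₁.measurable_slice n).sub (k₂.measurable_slice n)) (fun s => ?_) ?_
    · refine (abs_sub _ _).trans ?_
      rw [add_div]
      exact add_le_add ((b₁ s n).trans (div_le_div_of_nonneg_left (bound_nonneg (b₁ s n))
          (weight_pos _ _) (weight_mono (min_le_left _ _) s)))
        ((b₂ s n).trans (div_le_div_of_nonneg_left (bound_nonneg (b₂ s n))
          (weight_pos _ _) (weight_mono (min_le_right _ _) s)))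
    · have e : ∀ k : Kern, ∫ s, k.k s (sec n) = 2 * Real.pi := fun k => by
        have := k.norm (sec n)
        field_simp at this
        linarith
      rw [integral_sub (k₁.integrable n) (k₂.integrable n), e, e, sub_self]
  set u := k₁.smearPre f.rep - k₂.smearPre f.rep
  have hu : u ∈ kerP := smearPre_sub_mem k₁ k₂ f.rep
  have hi := FKer_integrable hu hu
  set Q : S2 → ℝ := fun n => -η (f.rep.fn (sec n)) (f.rep.fn (sec n))
  have hQ : ∀ n, 0 ≤ Q n := fun n => neg_η_nonneg n (f.rep.orth _)
  have hre : ∀ q, (FKer u u q).re = Q q.1 * (‖ft (d q.1) q.2‖ ^ 2 / q.2) := fun q => by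
    rw [FKer_smearPre_sub, Complex.ofReal_re]
  have hF : (FL (k₁.smear f - k₂.smear f) (k₁.smear f - k₂.smear f)).re =
      ∫ q, (FKer u u q).re ∂dlw := by
    have e1 : FL (k₁.smear f - k₂.smear f) (k₁.smear f - k₂.smear f) = FPre u u := F_mk u u
    rw [e1, FPre_eq]
    exact (integral_re hi).symm
  have hnn : 0 ≤ᵐ[dlw] fun q => (FKer u u q).re := by
    filter_upwards [ae_dlw_pos] with q hq
    rw [hre]
    exact mul_nonneg (hQ _) (by positivity)
  have hir : Integrable (fun q => (FKer u u q).re) dlw := hi.re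
  have key : ENNReal.ofReal (∫ q, (FKer u u q).re ∂dlw) ≤ ENNReal.ofReal (‖f‖ ^ 2) * B := by
    rw [ofReal_integral_eq_lintegral_ofReal hir hnn,
      lintegral_prod (fun q => ENNReal.ofReal (FKer u u q).re)
        (Complex.measurable_re.comp (measurable_FKer u u)).ennreal_ofReal.aemeasurable]
    have hn : ENNReal.ofReal (‖f‖ ^ 2) = ∫⁻ n, ENNReal.ofReal (Q n) ∂dl := by
      rw [← norm_rep, ← real_inner_self_eq_norm_sq, PreH0.inner_def,
        ofReal_integral_eq_lintegral_ofReal (PreH0.integrable_η _ _) (Eventually.of_forall hQ)]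
    have hQm : Measurable Q := by
      have h : ∀ a, Measurable fun n => f.rep.fn (sec n) a * f.rep.fn (sec n) a := fun a =>
        ((measurable_pi_apply a).comp f.rep.2.2.1).mul ((measurable_pi_apply a).comp f.rep.2.2.1)
      exact ((((h 0).sub (h 1)).sub (h 2)).sub (h 3)).neg
    rw [hn, ← lintegral_mul_const _ hQm.ennreal_ofReal]
    refine lintegral_mono fun n => ?_
    simp only [hre]
    calc ∫⁻ w in Set.Ioi 0, ENNReal.ofReal (Q n * (‖ft (d n) w‖ ^ 2 / w))
        = ∫⁻ w in Set.Ioi 0, ENNReal.ofReal (Q n) * ENNReal.ofReal (‖ft (d n) w‖ ^ 2 / w) := by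
          simp only [ENNReal.ofReal_mul (hQ n)]
      _ = ENNReal.ofReal (Q n) * ∫⁻ w in Set.Ioi 0, ENNReal.ofReal (‖ft (d n) w‖ ^ 2 / w) :=
          lintegral_const_mul' _ _ ENNReal.ofReal_ne_top
      _ ≤ _ := mul_le_mul' le_rfl (hd n)
  rw [hF, ← ENNReal.ofReal_le_ofReal_iff (by positivity),
    mul_comm, ENNReal.ofReal_mul (by positivity), ENNReal.ofReal_toReal hB]
  exact key

theorem pIR_smear_sub (k₁ k₂ : Kern) (f : HIR) : pIR (k₁.smear f - k₂.smear f) = 0 := by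
  rw [pIR_sub, k₁.pIR_smear, k₂.pIR_smear, sub_self]

theorem continuous_What_smear_sub (k₁ k₂ : Kern) :
    Continuous fun q : HIR × Hhat => What (k₁.smear q.1 - k₂.smear q.1) q.2 := by
  obtain ⟨B, hB⟩ := exists_FL_smear_sub_le k₁ k₂
  have h1 : ∀ f₀ ξ, Tendsto (fun f => What (k₁.smear f - k₂.smear f) ξ) (𝓝 f₀)
      (𝓝 (What (k₁.smear f₀ - k₂.smear f₀) ξ)) := fun f₀ ξ => by
    refine tendsto_What (fun f => ?_) ?_ (fun v => ?_) ξ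
    · rw [pIR_smear_sub, pIR_smear_sub]
    · have e : ∀ f, k₁.smear f - k₂.smear f - (k₁.smear f₀ - k₂.smear f₀) =
          k₁.smear (f - f₀) - k₂.smear (f - f₀) := fun f => by
        rw [map_sub, map_sub]; abel
      simp only [e]
      have h2 : Tendsto (fun f => B * ‖f - f₀‖ ^ 2) (𝓝 f₀) (𝓝 0) := by
        have : Continuous fun f : HIR => B * ‖f - f₀‖ ^ 2 := by fun_prop
        simpa using this.tendsto f₀
      exact squeeze_zero (fun f => FL_self_nonneg (pIR_smear_sub _ _ _)) (fun f => hB _) h2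
    · simp only [map_sub, AddMonoidHom.sub_apply]
      exact ((k₁.continuous_form_smear v).sub (k₂.continuous_form_smear v)).tendsto f₀
  refine continuous_iff_continuousAt.2 fun ⟨f₀, ξ₀⟩ => tendsto_iff_dist_tendsto_zero.2 ?_
  have h2 : Tendsto (fun q : HIR × Hhat => dist q.2 ξ₀ +
      dist (What (k₁.smear q.1 - k₂.smear q.1) ξ₀) (What (k₁.smear f₀ - k₂.smear f₀) ξ₀))
      (𝓝 (f₀, ξ₀)) (𝓝 (0 + 0)) := by
    refine Tendsto.add ?_ ?_
    · exact tendsto_iff_dist_tendsto_zero.1 (continuous_snd.tendsto (f₀, ξ₀))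
    · exact (tendsto_iff_dist_tendsto_zero.1 (h1 f₀ ξ₀)).comp (continuous_fst.tendsto (f₀, ξ₀))
  rw [add_zero] at h2
  refine squeeze_zero (fun _ => dist_nonneg) (fun q => ?_) h2
  refine (dist_triangle _ (What (k₁.smear q.1 - k₂.smear q.1) ξ₀) _).trans ?_
  gcongr
  rw [dist_eq_norm, ← map_sub, norm_What, dist_eq_norm]

theorem aestronglyMeasurable_What_smear_sub (k₁ k₂ : Kern) {μ : Measure HIR} {ψ : HIR → Hhat}
    (hψ : AEStronglyMeasurable ψ μ) :
    AEStronglyMeasurable (fun f => What (k₁.smear f - k₂.smear f) (ψ f)) μ := by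
  have h : AEStronglyMeasurable (fun f : HIR => (f, ψ f)) μ := aestronglyMeasurable_id.prodMk hψ
  exact Continuous.comp_aestronglyMeasurable
    (g := fun q : HIR × Hhat => What (k₁.smear q.1 - k₂.smear q.1) q.2)
    (f := fun f : HIR => (f, ψ f)) (continuous_What_smear_sub k₁ k₂) h

theorem measurable_form_smear_smear (k₁ k₂ : Kern) :
    Measurable fun f : HIR => symLhat.form (k₁.smear f) (k₂.smear f) := by
  have h := measurable_uncurry_of_continuous_of_measurable
    (u := fun f g : HIR => symLhat.form (k₁.smear f) (k₂.smear g))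
    (fun g => k₁.continuous_form_smear (k₂.smear g)) fun f => by
      simp only [fun g => symLhat.swap (k₂.smear g) (k₁.smear f)]
      exact (k₂.continuous_form_smear (k₁.smear f)).neg.measurable
  have hd : Measurable fun f : HIR => (f, f) := measurable_id.prodMk measurable_id
  exact Measurable.comp (g := Function.uncurry fun f g : HIR =>
    symLhat.form (k₁.smear f) (k₂.smear g)) (f := fun f : HIR => (f, f)) h hd

end Kern

/-! ### Operators on spaces of vector fields -/

section Fields
variable {X : Type} [MeasurableSpace X] {K H : Type}
  [NormedAddCommGroup K] [InnerProductSpace ℂ K] [NormedAddCommGroup H] [InnerProductSpace ℂ H]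
  {J : X → K →ₗᵢ[ℂ] H} {μ : Measure X}

theorem SqField.inner_def (Ψ Φ : SqField J μ) :
    inner ℂ Ψ Φ = ∫ x, inner ℂ (Ψ.fn x) (Φ.fn x) ∂μ := rfl

namespace FieldSpace

theorem inner_mk (Ψ Φ : SqField J μ) :
    inner ℂ (mk Ψ) (mk Φ) = ∫ x, inner ℂ (Ψ.fn x) (Φ.fn x) ∂μ :=
  SeparationQuotient.inner_mk_mk Ψ Φ

theorem mk_eq_of_ae {Ψ Φ : SqField J μ} (h : ∀ᵐ f ∂μ, Ψ.fn f = Φ.fn f) : mk Ψ = mk Φ := by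
  rw [← sub_eq_zero, mk, mk, ← SeparationQuotient.mk_sub]
  refine (inner_self_eq_zero (𝕜 := ℂ)).1 ?_
  change inner ℂ (mk (Ψ - Φ)) (mk (Ψ - Φ)) = 0
  rw [inner_mk, integral_congr_ae (g := fun _ => (0 : ℂ)), integral_zero]
  filter_upwards [h] with f hf
  have : (Ψ - Φ).fn f = 0 := sub_eq_zero.2 hf
  rw [this, inner_zero_left]

theorem mk_surjective (x : FieldSpace J μ) : ∃ Ψ, mk Ψ = x := SeparationQuotient.surjective_mk x

theorem Represents.unique {x y : FieldSpace J μ} {Ψ : X → H} (hx : Represents x Ψ)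
    (hy : Represents y Ψ) : x = y := by
  obtain ⟨Φ, rfl, h⟩ := hx
  obtain ⟨Φ', rfl, h'⟩ := hy
  refine mk_eq_of_ae ?_
  filter_upwards [h, h'] with f e e'
  rw [e, e']

theorem represents_mk (Ψ : SqField J μ) : Represents (mk Ψ) Ψ.fn :=
  ⟨Ψ, rfl, Eventually.of_forall fun _ => rfl⟩

theorem Represents.congr {x : FieldSpace J μ} {Ψ Φ : X → H} (h : Represents x Ψ)
    (e : ∀ᵐ f ∂μ, Ψ f = Φ f) : Represents x Φ := by
  obtain ⟨Ξ, hx, h'⟩ := h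
  exact ⟨Ξ, hx, by filter_upwards [h', e] with f h1 h2; rw [h1, h2]⟩

theorem Represents.add {x y : FieldSpace J μ} {Ψ Φ : X → H} (hx : Represents x Ψ)
    (hy : Represents y Φ) : Represents (x + y) (Ψ + Φ) := by
  obtain ⟨Ξ, rfl, h⟩ := hx
  obtain ⟨Ξ', rfl, h'⟩ := hy
  refine ⟨Ξ + Ξ', rfl, ?_⟩
  filter_upwards [h, h'] with f e e'
  rw [Pi.add_apply, ← e, ← e']; rfl

theorem Represents.smul {x : FieldSpace J μ} {Ψ : X → H} (c : ℂ) (hx : Represents x Ψ) :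
    Represents (c • x) (c • Ψ) := by
  obtain ⟨Ξ, rfl, h⟩ := hx
  refine ⟨c • Ξ, rfl, ?_⟩
  filter_upwards [h] with f e
  rw [Pi.smul_apply, ← e]; rfl

theorem norm_sq_eq (Ψ : SqField J μ) : ENNReal.ofReal (‖Ψ‖ ^ 2) = ∫⁻ f, ‖Ψ.fn f‖ₑ ^ 2 ∂μ := by
  have h1 : ‖Ψ‖ ^ 2 = ∫ f, ‖Ψ.fn f‖ ^ 2 ∂μ := by
    have h := inner_self_eq_norm_sq_to_K (𝕜 := ℂ) Ψ
    rw [SqField.inner_def] at h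
    have e : ∀ f, inner ℂ (Ψ.fn f) (Ψ.fn f) = ((‖Ψ.fn f‖ ^ 2 : ℝ) : ℂ) := fun f => by
      rw [inner_self_eq_norm_sq_to_K]; norm_cast
    simp only [e] at h
    rw [integral_complex_ofReal] at h
    have h2 := congrArg Complex.re h
    rw [Complex.ofReal_re] at h2
    rw [h2]
    norm_cast
  have hi : Integrable (fun f => ‖Ψ.fn f‖ ^ 2) μ := by
    have := (SqField.integrable_inner Ψ Ψ).norm
    refine this.congr (Eventually.of_forall fun f => ?_)
    simp only [inner_self_eq_norm_sq_to_K]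
    norm_num
  rw [h1, ofReal_integral_eq_lintegral_ofReal hi (Eventually.of_forall fun f => sq_nonneg _)]
  refine lintegral_congr fun f => ?_
  rw [ENNReal.ofReal_pow (norm_nonneg _), ofReal_norm]

end FieldSpace

/-- Linear maps of vector fields that define contractions. -/
structure IsFieldMap (J : X → K →ₗᵢ[ℂ] H) (μ : Measure X) (L : (X → H) →ₗ[ℂ] (X → H)) : Prop where
  exists_field : ∀ Ψ : SqField J μ, ∃ Φ : SqField J μ, (∀ᵐ f ∂μ, Φ.fn f = L Ψ.fn f) ∧ ‖Φ‖ ≤ ‖Ψ‖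
  ae_congr : ∀ Ψ Φ : X → H, (∀ᵐ f ∂μ, Ψ f = Φ f) → ∀ᵐ f ∂μ, L Ψ f = L Φ f

namespace IsFieldMap
open FieldSpace
variable {L M N : (X → H) →ₗ[ℂ] (X → H)}

theorem exists_op (hL : IsFieldMap J μ L) : ∃ T : FieldSpace J μ →L[ℂ] FieldSpace J μ,
    (∀ Ψ : SqField J μ, Represents (T (FieldSpace.mk Ψ)) (L Ψ.fn)) ∧ ∀ x, ‖T x‖ ≤ ‖x‖ := by
  choose Φ hΦ hn using hL.exists_field
  have hr : ∀ Ψ : SqField J μ, Represents (FieldSpace.mk (Φ Ψ)) (L Ψ.fn) := fun Ψ => ⟨_, rfl, hΦ Ψ⟩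
  let S : SqField J μ →ₗ[ℂ] FieldSpace J μ :=
    { toFun := fun Ψ => FieldSpace.mk (Φ Ψ)
      map_add' := fun Ψ Ξ => by
        have h := hr (Ψ + Ξ)
        have e : (Ψ + Ξ).fn = Ψ.fn + Ξ.fn := rfl
        rw [e, map_add] at h
        exact h.unique ((hr Ψ).add (hr Ξ))
      map_smul' := fun c Ψ => by
        have h := hr (c • Ψ)
        have e : (c • Ψ).fn = c • Ψ.fn := rfl
        rw [e, map_smul] at h
        exact h.unique ((hr Ψ).smul c) }
  have hS : ∀ Ψ, ‖S Ψ‖ ≤ 1 * ‖Ψ‖ := fun Ψ => by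
    rw [one_mul]
    exact (SeparationQuotient.norm_mk (Φ Ψ)).le.trans (hn Ψ)
  let S' : SqField J μ →L[ℂ] FieldSpace J μ := S.mkContinuous 1 hS
  refine ⟨SeparationQuotient.liftCLM S' fun Ψ Ξ h => (h.map S'.continuous).eq, fun Ψ => hr Ψ,
    fun x => ?_⟩
  obtain ⟨Ψ, rfl⟩ := mk_surjective x
  refine (hS Ψ).trans_eq ?_
  rw [one_mul]
  exact (SeparationQuotient.norm_mk Ψ).symm

/-- The operator defined by a linear map of vector fields. -/
def op (hL : IsFieldMap J μ L) : FieldSpace J μ →L[ℂ] FieldSpace J μ := hL.exists_op.choose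

theorem represents (hL : IsFieldMap J μ L) (Ψ : SqField J μ) :
    Represents (hL.op (FieldSpace.mk Ψ)) (L Ψ.fn) := hL.exists_op.choose_spec.1 Ψ

theorem norm_op_le (hL : IsFieldMap J μ L) (x : FieldSpace J μ) : ‖hL.op x‖ ≤ ‖x‖ :=
  hL.exists_op.choose_spec.2 x

theorem op_eq (hL : IsFieldMap J μ L) {T : FieldSpace J μ →L[ℂ] FieldSpace J μ}
    (hT : ∀ Ψ : SqField J μ, Represents (T (FieldSpace.mk Ψ)) (L Ψ.fn)) : T = hL.op := by
  ext x
  obtain ⟨Ψ, rfl⟩ := mk_surjective x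
  exact (hT Ψ).unique (hL.represents Ψ)

theorem represents_of (hL : IsFieldMap J μ L) {x : FieldSpace J μ} {Ψ : X → H}
    (h : Represents x Ψ) : Represents (hL.op x) (L Ψ) := by
  obtain ⟨Φ, rfl, h⟩ := h
  exact (hL.represents Φ).congr (hL.ae_congr _ _ h)

/-- Products of operators. -/
theorem op_mul_op (hL : IsFieldMap J μ L) (hM : IsFieldMap J μ M) (hN : IsFieldMap J μ N) (c : ℂ)
    (h : ∀ Ψ : X → H, ∀ᵐ f ∂μ, L (M Ψ) f = c • N Ψ f) : hL.op * hM.op = c • hN.op := by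
  ext x
  obtain ⟨Ψ, rfl⟩ := mk_surjective x
  refine Represents.unique (hL.represents_of (hM.represents Ψ)) ?_
  refine ((hN.represents Ψ).smul c).congr ?_
  filter_upwards [h Ψ.fn] with f hf
  rw [hf]; rfl

theorem op_mul_op_eq (hL : IsFieldMap J μ L) (hM : IsFieldMap J μ M) (hN : IsFieldMap J μ N)
    (h : ∀ Ψ : X → H, ∀ᵐ f ∂μ, L (M Ψ) f = N Ψ f) : hL.op * hM.op = hN.op := by
  simpa using op_mul_op hL hM hN 1 (by simpa using h)

theorem op_eq_one (hL : IsFieldMap J μ L) (h : ∀ Ψ : X → H, ∀ᵐ f ∂μ, L Ψ f = Ψ f) : hL.op = 1 :=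
  (hL.op_eq (T := 1) fun Ψ => (FieldSpace.represents_mk Ψ).congr (by
    filter_upwards [h Ψ.fn] with f hf
    exact hf.symm)).symm

end IsFieldMap

end Fields

theorem mem_unitary_of_contraction {H : Type} [NormedAddCommGroup H] [InnerProductSpace ℂ H]
    [CompleteSpace H] {A B : H →L[ℂ] H} (hA : ∀ x, ‖A x‖ ≤ ‖x‖) (hB : ∀ x, ‖B x‖ ≤ ‖x‖)
    (hAB : A * B = 1) (hBA : B * A = 1) : A ∈ unitary (H →L[ℂ] H) ∧ star A = B := by
  have h1 : ∀ x, ‖A x‖ = ‖x‖ := fun x => by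
    refine le_antisymm (hA x) ?_
    have : B (A x) = x := congrArg (fun T : H →L[ℂ] H => T x) hBA
    calc ‖x‖ = ‖B (A x)‖ := by rw [this]
      _ ≤ _ := hB _
  have h2 : star A * A = 1 := (ContinuousLinearMap.norm_map_iff_adjoint_comp_self A).1 h1
  have h3 : star A = B := by
    calc star A = star A * (A * B) := by rw [hAB, mul_one]
      _ = B := by rw [← mul_assoc, h2, one_mul]
  exact ⟨Unitary.mem_iff.2 ⟨h2, by rw [h3, hAB]⟩, h3⟩

theorem isTranslationRep_of {H : Type} [NormedAddCommGroup H] [InnerProductSpace ℂ H]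
    [CompleteSpace H] {U : Mink → H →L[ℂ] H} (h0 : U 0 = 1) (hadd : ∀ x y, U (x + y) = U x * U y)
    (hn : ∀ x φ, ‖U x φ‖ ≤ ‖φ‖) (hc : ∀ φ, Continuous fun x => inner ℂ φ (U x φ)) :
    IsTranslationRep U ∧ ∀ x, star (U x) = U (-x) := by
  have hneg : ∀ x, U (-x) * U x = 1 := fun x => by rw [← hadd, neg_add_cancel, h0]
  have hneg' : ∀ x, U x * U (-x) = 1 := fun x => by rw [← hadd, add_neg_cancel, h0]
  have hu : ∀ x, U x ∈ unitary (H →L[ℂ] H) ∧ star (U x) = U (-x) := fun x =>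
    mem_unitary_of_contraction (hn x) (hn (-x)) (hneg' x) (hneg x)
  have happ : ∀ x y φ, U (x + y) φ = U x (U y φ) := fun x y φ =>
    congrArg (fun T : H →L[ℂ] H => T φ) (hadd x y)
  have hz : ∀ φ, U 0 φ = φ := fun φ => congrArg (fun T : H →L[ℂ] H => T φ) h0
  have hn' : ∀ x φ, ‖U x φ‖ = ‖φ‖ := fun x φ => by
    refine le_antisymm (hn x φ) ?_
    have h1 := hn (-x) (U x φ)
    rwa [← happ, neg_add_cancel, hz] at h1
  refine ⟨⟨fun x => (hu x).1, h0, hadd, fun φ => ?_⟩, fun x => (hu x).2⟩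
  have h1 : Tendsto (fun x => U x φ) (𝓝 0) (𝓝 φ) := by
    rw [tendsto_iff_norm_sub_tendsto_zero]
    have h1 : ∀ x, ‖U x φ - φ‖ = √(2 * ‖φ‖ ^ 2 - 2 * (inner ℂ φ (U x φ)).re) := fun x => by
      have := norm_sub_sq (𝕜 := ℂ) φ (U x φ)
      rw [norm_sub_rev, hn'] at this
      rw [← Real.sqrt_sq (norm_nonneg (_ - _)), this]
      congr 1
      change _ - 2 * (inner ℂ φ (U x φ)).re + _ = _
      ring
    have h2 : Continuous fun x => √(2 * ‖φ‖ ^ 2 - 2 * (inner ℂ φ (U x φ)).re) :=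
      Real.continuous_sqrt.comp (continuous_const.sub
        (continuous_const.mul (Complex.continuous_re.comp (hc φ))))
    have h3 := h2.tendsto 0
    rw [← h1, hz, sub_self, norm_zero] at h3
    exact h3.congr fun x => (h1 x).symm
  refine continuous_iff_continuousAt.2 fun x => ?_
  have h2 : Tendsto (fun y => y - x) (𝓝 x) (𝓝 0) := by
    have : Continuous fun y => y - x := by fun_prop
    simpa using this.tendsto x
  have h3 := ((U x).continuous.tendsto _).comp (h1.comp h2)
  refine h3.congr fun y => ?_
  simp only [Function.comp_apply]
  rw [← happ, add_sub_cancel]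

/-! ### Representations of Weyl algebras -/

section Weyl
variable {G : Type} [AddCommGroup G] {σ : SymplecticForm G} {B : Type} [CStarAlgebra B]

theorem WeylStar.single_eq_smul (x : G) (c : ℂ) :
    (WeylStar.single x c : WeylStar σ) = c • WeylStar.single x 1 := by
  rw [WeylStar.smul_single, mul_one]

theorem WeylStar.exists_hom {U : G → B} (h0 : U 0 = 1)
    (hm : ∀ x y, U x * U y = phase (σ.form x y) • U (x + y)) (hs : ∀ x, star (U x) = U (-x)) :
    ∃ φ : WeylStar σ →⋆ₐ[ℂ] B, ∀ x c, φ (WeylStar.single x c) = c • U x := by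
  let φ : WeylStar σ →ₗ[ℂ] B := WeylStar.lift σ U
  have e : ∀ x c, φ (WeylStar.single x c) = c • U x := WeylStar.lift_single σ U
  refine ⟨{ AlgHom.ofLinearMap φ (by rw [WeylStar.one_def, e, one_smul, h0]) (fun a b => ?_) with
    map_star' := fun a => ?_ }, e⟩
  · induction a using WeylStar.induction with
    | h0 => rw [zero_mul, map_zero, zero_mul]
    | ha a b h h' => rw [add_mul, map_add, h, h', map_add, add_mul]
    | hs x c =>
      induction b using WeylStar.induction with
      | h0 => rw [mul_zero, map_zero, mul_zero]
      | ha a b h h' => rw [mul_add, map_add, h, h', map_add, mul_add]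
      | hs y d =>
        rw [WeylStar.single_mul_single, e, e, e, smul_mul_smul_comm, hm, smul_smul]
  · change φ (star a) = star (φ a)
    induction a using WeylStar.induction with
    | h0 => rw [star_zero, map_zero, star_zero]
    | ha a b h h' => rw [star_add, map_add, h, h', map_add, star_add]
    | hs x c => rw [WeylStar.star_single, e, e, star_smul, hs]; rfl

/-- The norm of a C*-algebra as a C*-seminorm. -/
def CStarSeminorm.ofNorm (B : Type) [CStarAlgebra B] : CStarSeminorm B :=
  { normSeminorm ℂ B with
    mul_le' := norm_mul_le
    star_mul_self' := fun a => by
      change ‖star a * a‖ = ‖a‖ ^ 2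
      rw [CStarRing.norm_star_mul_self, sq] }

theorem WeylStar.norm_hom_le (φ : WeylStar σ →⋆ₐ[ℂ] B) (a : WeylStar σ) : ‖φ a‖ ≤ ‖a‖ :=
  WeylStar.le_norm σ ((CStarSeminorm.ofNorm B).comp φ) a

theorem WeylCStar.exists_hom {U : G → B} (h0 : U 0 = 1)
    (hm : ∀ x y, U x * U y = phase (σ.form x y) • U (x + y)) (hs : ∀ x, star (U x) = U (-x)) :
    ∃ π : WeylCStar σ →⋆ₐ[ℂ] B, ∀ x, π (WeylCStar.W σ x) = U x := by
  obtain ⟨φ, hφ⟩ := WeylStar.exists_hom (σ := σ) h0 hm hs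
  have hc : Continuous (φ : WeylStar σ →+* B) :=
    AddMonoidHomClass.continuous_of_bound φ 1 fun a => by
      rw [one_mul]; exact WeylStar.norm_hom_le φ a
  let ψ : WeylCStar σ →+* B := UniformSpace.Completion.extensionHom (φ : WeylStar σ →+* B) hc
  have e : ∀ a, ψ (WeylCStar.coe σ a) = φ a := fun a =>
    UniformSpace.Completion.extensionHom_coe (φ : WeylStar σ →+* B) hc a
  have hψ : Continuous ψ := UniformSpace.Completion.continuous_extension
  refine ⟨{ ψ with
    commutes' := fun r => ?_
    map_star' := fun a => ?_ }, fun x => ?_⟩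
  · change ψ (WeylCStar.coe σ (algebraMap ℂ (WeylStar σ) r)) = _
    rw [e, AlgHomClass.commutes]
  · change ψ (star a) = star (ψ a)
    induction a using WeylCStar.induction with
    | hp => exact isClosed_eq (hψ.comp (WeylCStar.continuous_star' σ)) (continuous_star.comp hψ)
    | h a => rw [← WeylCStar.coe_star, e, e, map_star]
  · change ψ (WeylCStar.coe σ _) = _
    rw [e, hφ, one_smul]

theorem WeylCStar.hom_continuous (π : WeylCStar σ →⋆ₐ[ℂ] B) : Continuous π :=
  AddMonoidHomClass.continuous_of_bound π 1 fun a => by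
    rw [one_mul]; exact NonUnitalStarAlgHom.norm_apply_le π a

/-- A closed subspace that contains the Weyl elements is the whole algebra. -/
theorem WeylCStar.induction_W {P : WeylCStar σ → Prop} (hP : IsClosed {a | P a}) (h0 : P 0)
    (ha : ∀ a b, P a → P b → P (a + b)) (hs : ∀ (c : ℂ) a, P a → P (c • a))
    (h : ∀ x, P (WeylCStar.W σ x)) (a : WeylCStar σ) : P a := by
  induction a using WeylCStar.induction with
  | hp => exact hP
  | h a =>
    induction a using WeylStar.induction with
    | h0 => exact h0
    | ha a b h h' => rw [WeylCStar.coe_add]; exact ha _ _ h h'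
    | hs x c =>
      rw [WeylStar.single_eq_smul, WeylCStar.coe_smul]
      exact hs _ _ (h x)

theorem WeylCStar.hom_ext {π ρ : WeylCStar σ →⋆ₐ[ℂ] B}
    (h : ∀ x, π (WeylCStar.W σ x) = ρ (WeylCStar.W σ x)) : π = ρ := by
  refine StarAlgHom.ext fun a => ?_
  refine WeylCStar.induction_W (P := fun a => π a = ρ a)
    (isClosed_eq (WeylCStar.hom_continuous π) (WeylCStar.hom_continuous ρ)) ?_ (fun a b h h' => ?_)
    (fun c a h => ?_) h a
  · rw [map_zero, map_zero]
  · rw [map_add, map_add, h, h']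
  · rw [map_smul, map_smul, h]

end Weyl

theorem memLp_two_of_lintegral {X K : Type} [MeasurableSpace X] [NormedAddCommGroup K]
    {μ : Measure X} {φ : X → K} (hm : AEStronglyMeasurable φ μ) (h : ∫⁻ x, ‖φ x‖ₑ ^ 2 ∂μ < ⊤) :
    MemLp φ 2 μ := by
  refine ⟨hm, (eLpNorm_lt_top_iff_lintegral_rpow_enorm_lt_top two_ne_zero (by norm_num)).2 ?_⟩
  simpa using h

/-! ### Measurable vector fields -/

section
variable (h : Profile) {μ : Measure HIR}

theorem exists_sqField {Φ ξ : HIR → Hhat} (hξ : AEStronglyMeasurable ξ μ)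
    (hmem : ∀ f, ξ f ∈ fiber 0) (e : ∀ f, Φ f = What (smear h f) (ξ f))
    (hfin : ∫⁻ f, ‖Φ f‖ₑ ^ 2 ∂μ < ⊤) : ∃ Φ' : SqField (dress h) μ, ∀ f, Φ'.fn f = Φ f := by
  let φ : HIR → fiber 0 := fun f => ⟨ξ f, hmem f⟩
  have hφ : AEStronglyMeasurable φ μ :=
    (Topology.IsEmbedding.subtypeVal.aestronglyMeasurable_comp_iff (f := φ)).1 hξ
  have hn : ∀ f, ‖φ f‖ₑ = ‖Φ f‖ₑ := fun f => by
    rw [e, ← ofReal_norm, ← ofReal_norm, norm_What]; rfl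
  have h2 : MemLp φ 2 μ := memLp_two_of_lintegral hφ (by simpa only [hn] using hfin)
  exact ⟨SqField.of (dress h) h2, fun f => (e f).symm⟩

theorem SqField.exists_eq (Ψ : SqField (dress h) μ) : ∃ ξ : HIR → Hhat,
    AEStronglyMeasurable ξ μ ∧ (∀ f, ξ f ∈ fiber 0) ∧ ∀ f, Ψ.fn f = What (smear h f) (ξ f) := by
  obtain ⟨Ψ, ψ, hψ, e⟩ := Ψ
  exact ⟨fun f => (ψ f).1, continuous_subtype_val.comp_aestronglyMeasurable hψ.1,
    fun f => (ψ f).2, e⟩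

theorem SqField.lintegral_lt_top (Ψ : SqField (dress h) μ) : ∫⁻ f, ‖Ψ.fn f‖ₑ ^ 2 ∂μ < ⊤ := by
  rw [← FieldSpace.norm_sq_eq]; exact ENNReal.ofReal_lt_top

theorem SqField.aemeasurable_norm (Ψ : SqField (dress h) μ) :
    AEMeasurable (fun f => ‖Ψ.fn f‖ₑ ^ 2) μ := by
  obtain ⟨ξ, hξ, -, e⟩ := SqField.exists_eq h Ψ
  have : ∀ f, ‖Ψ.fn f‖ₑ = ‖ξ f‖ₑ := fun f => by rw [e, ← ofReal_norm, ← ofReal_norm, norm_What]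
  simp only [this]
  exact hξ.enorm.pow_const 2

/-- A criterion for linear maps of fields to define contractions. -/
theorem isFieldMap_of {L : (HIR → Hhat) →ₗ[ℂ] (HIR → Hhat)}
    (h1 : ∀ ξ : HIR → Hhat, AEStronglyMeasurable ξ μ → (∀ f, ξ f ∈ fiber 0) →
      ∃ χ : HIR → Hhat, AEStronglyMeasurable χ μ ∧ (∀ f, χ f ∈ fiber 0) ∧
        ∀ f, L (fun f => What (smear h f) (ξ f)) f = What (smear h f) (χ f))
    (h2 : ∀ Ψ : HIR → Hhat, AEMeasurable (fun f => ‖Ψ f‖ₑ ^ 2) μ →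
      ∫⁻ f, ‖L Ψ f‖ₑ ^ 2 ∂μ ≤ ∫⁻ f, ‖Ψ f‖ₑ ^ 2 ∂μ)
    (h3 : ∀ Ψ Φ : HIR → Hhat, (∀ᵐ f ∂μ, Ψ f = Φ f) → ∀ᵐ f ∂μ, L Ψ f = L Φ f) :
    IsFieldMap (dress h) μ L := by
  refine ⟨fun Ψ => ?_, h3⟩
  obtain ⟨ξ, hξ, hm, e⟩ := SqField.exists_eq h Ψ
  obtain ⟨χ, hχ, hm', e'⟩ := h1 ξ hξ hm
  have e2 : Ψ.fn = fun f => What (smear h f) (ξ f) := funext e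
  rw [← e2] at e'
  have h4 := h2 Ψ.fn (SqField.aemeasurable_norm h Ψ)
  obtain ⟨Φ, hΦ⟩ := exists_sqField h hχ hm' e' (h4.trans_lt (SqField.lintegral_lt_top h Ψ))
  refine ⟨Φ, Eventually.of_forall hΦ, ?_⟩
  have h5 : ENNReal.ofReal (‖Φ‖ ^ 2) ≤ ENNReal.ofReal (‖Ψ‖ ^ 2) := by
    rw [FieldSpace.norm_sq_eq, FieldSpace.norm_sq_eq]
    simpa only [hΦ] using h4
  rw [ENNReal.ofReal_le_ofReal_iff (by positivity)] at h5
  exact (sq_le_sq₀ (norm_nonneg _) (norm_nonneg _)).1 h5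

/-! ### The translation operators -/

/-- The action of the translations on vector fields. -/
def transMap (x : Mink) : (HIR → Hhat) →ₗ[ℂ] (HIR → Hhat) where
  toFun Ψ f := Uhat x (Ψ f)
  map_add' _ _ := funext fun _ => map_add _ _ _
  map_smul' c Ψ := funext fun f => (Uhat x).map_smul c (Ψ f)

theorem measurable_phase : Measurable phase := continuous_phase.measurable

theorem isFieldMap_transMap (x : Mink) : IsFieldMap (dress h) μ (transMap x) := by
  refine isFieldMap_of h (fun ξ hξ hm => ?_) (fun Ψ _ => ?_) fun Ψ Φ e => ?_
  · refine ⟨fun f => phase (-symLhat.form (h.kern.smear f) ((h.kern.shift x).smear f)) •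
      What ((h.kern.shift x).smear f - h.kern.smear f) (Uhat x (ξ f)), ?_, fun f => ?_, fun f => ?_⟩
    · refine AEStronglyMeasurable.fun_smul (𝕜 := ℂ) ?_ ?_
      · exact (measurable_phase.comp (Kern.measurable_form_smear_smear _ _).neg).aestronglyMeasurable
      · exact Kern.aestronglyMeasurable_What_smear_sub _ _
          ((Uhat x).continuous.comp_aestronglyMeasurable hξ)
    · exact Submodule.smul_mem _ _
        (What_mem_fiber_zero (Kern.pIR_smear_sub _ _ _) (Uhat_mem_fiber x (hm f)))
    · change Uhat x (What (h.kern.smear f) (ξ f)) = What (h.kern.smear f) _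
      rw [Uhat_What, shiftLhat_smear, map_smul, What_What, smul_smul, map_sub, symLhat.alt,
        sub_zero, mul_comm, phase_mul_phase_neg, one_smul, add_sub_cancel]
  · refine le_of_eq (lintegral_congr fun f => ?_)
    change ‖Uhat x (Ψ f)‖ₑ ^ 2 = _
    rw [← ofReal_norm, norm_Uhat, ofReal_norm]
  · filter_upwards [e] with f hf
    change Uhat x (Ψ f) = Uhat x (Φ f)
    rw [hf]

/-- The translation operators. -/
def Ur (μ : Measure HIR) (x : Mink) : DirectIntegral h μ →L[ℂ] DirectIntegral h μ :=
  (isFieldMap_transMap h x).op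

theorem Ur_actsFibrewise : ActsFibrewise h μ (Ur h μ) :=
  fun x Ψ => (isFieldMap_transMap h x).represents Ψ

theorem eq_Ur {U : Mink → DirectIntegral h μ →L[ℂ] DirectIntegral h μ}
    (hU : ActsFibrewise h μ U) : U = Ur h μ :=
  funext fun x => (isFieldMap_transMap h x).op_eq (hU x)

theorem Ur_zero : Ur h μ 0 = 1 :=
  (isFieldMap_transMap h 0).op_eq_one fun Ψ => Eventually.of_forall fun f => Uhat_zero (Ψ f)

theorem Ur_add (x y : Mink) : Ur h μ (x + y) = Ur h μ x * Ur h μ y :=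
  ((isFieldMap_transMap h x (μ := μ)).op_mul_op_eq (isFieldMap_transMap h y)
    (isFieldMap_transMap h (x + y)) fun Ψ => Eventually.of_forall fun f =>
      (Uhat_add x y (Ψ f)).symm).symm

theorem norm_Ur_le (x : Mink) (φ : DirectIntegral h μ) : ‖Ur h μ x φ‖ ≤ ‖φ‖ :=
  (isFieldMap_transMap h x).norm_op_le φ

theorem inner_mk_Ur (x : Mink) (Ψ Φ : SqField (dress h) μ) :
    Integrable (fun f => inner ℂ (Ψ.fn f) (Uhat x (Φ.fn f))) μ ∧
    inner ℂ (FieldSpace.mk Ψ) (Ur h μ x (FieldSpace.mk Φ)) =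
      ∫ f, inner ℂ (Ψ.fn f) (Uhat x (Φ.fn f)) ∂μ := by
  obtain ⟨Ξ, e, hΞ⟩ := Ur_actsFibrewise h x Φ
  have e2 : (fun f => inner ℂ (Ψ.fn f) (Ξ.fn f)) =ᵐ[μ]
      fun f => inner ℂ (Ψ.fn f) (Uhat x (Φ.fn f)) := by
    filter_upwards [hΞ] with f hf
    rw [hf]
  refine ⟨(SqField.integrable_inner Ψ Ξ).congr e2, ?_⟩
  rw [← e, FieldSpace.inner_mk]
  exact integral_congr_ae e2

theorem continuous_inner_Ur (Ψ Φ : SqField (dress h) μ) :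
    Continuous fun x => inner ℂ (FieldSpace.mk Ψ) (Ur h μ x (FieldSpace.mk Φ)) := by
  simp only [fun x => (inner_mk_Ur h x Ψ Φ).2]
  refine continuous_of_dominated (bound := fun f => (‖Ψ.fn f‖ₑ ^ 2 + ‖Φ.fn f‖ₑ ^ 2).toReal)
    (fun x => (inner_mk_Ur h x Ψ Φ).1.1) (fun x => Eventually.of_forall fun f => ?_) ?_
    (Eventually.of_forall fun f => by
      exact Continuous.inner continuous_const (continuous_Uhat (Φ.fn f)))
  · refine (norm_inner_le_norm _ _).trans ?_
    rw [norm_Uhat, ENNReal.toReal_add (by simp) (by simp), ENNReal.toReal_pow, ENNReal.toReal_pow,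
      toReal_enorm, toReal_enorm]
    nlinarith [sq_nonneg (‖Ψ.fn f‖ - ‖Φ.fn f‖), sq_nonneg ‖Ψ.fn f‖, sq_nonneg ‖Φ.fn f‖]
  · refine integrable_toReal_of_lintegral_ne_top
      ((SqField.aemeasurable_norm h Ψ).add (SqField.aemeasurable_norm h Φ)) ?_
    have := lintegral_add_left' (SqField.aemeasurable_norm h Ψ) fun f => ‖Φ.fn f‖ₑ ^ 2
    rw [this]
    exact (ENNReal.add_lt_top.2
      ⟨SqField.lintegral_lt_top h Ψ, SqField.lintegral_lt_top h Φ⟩).ne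

theorem Ur_isTranslationRep : IsTranslationRep (Ur h μ) :=
  (isTranslationRep_of (Ur_zero h) (Ur_add h) (norm_Ur_le h) fun φ => by
    obtain ⟨Ψ, rfl⟩ := FieldSpace.mk_surjective φ
    exact continuous_inner_Ur h Ψ Ψ).1

end

/-! ### The Weyl operators of the direct integral -/

theorem IsSmoothIR.add {k l : HIR} (hk : IsSmoothIR k) (hl : IsSmoothIR l) : IsSmoothIR (k + l) := by
  obtain ⟨f, e, hf⟩ := hk
  obtain ⟨g, e', hg⟩ := hl
  refine ⟨f + g, ?_, ContDiffOn.add hf hg⟩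
  change H0.mk f + H0.mk g = k.1 + l.1
  rw [e, e']

theorem IsSmoothIR.neg {k : HIR} (hk : IsSmoothIR k) : IsSmoothIR (-k) := by
  obtain ⟨f, e, hf⟩ := hk
  refine ⟨-f, ?_, ContDiffOn.neg hf⟩
  change -H0.mk f = -k.1
  rw [e]

theorem IsSmoothIR.congr {k l : HIR} (hk : IsSmoothIR k) (e : k = l) : IsSmoothIR l := e ▸ hk

theorem isSmoothIR_zero : IsSmoothIR 0 := ⟨0, rfl, contDiffOn_const⟩

section
variable {H : Type*} [NormedAddCommGroup H] [InnerProductSpace ℂ H]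

theorem mul_eq_smul_of_eq {A B C A' B' C' : H →L[ℂ] H} {c : ℂ} (hA : A = A') (hB : B = B')
    (hC : C = C') (h : A' * B' = c • C') : A * B = c • C := by
  subst hA hB hC; exact h

theorem mul_eq_one_of_smul {A B C : H →L[ℂ] H} {c : ℂ} (h : A * B = c • C) (hc : c = 1)
    (hC : C = 1) : A * B = 1 := by
  rw [h, hc, hC, one_smul]

theorem mul_mul_ext {A B C D : H →L[ℂ] H} (h : ∀ φ, A (B (C φ)) = D φ) : A * B * C = D :=
  ContinuousLinearMap.ext h

end

section
variable {μ : Measure HIR}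

theorem translate_ac (hq : QuasiInvariant μ) {k : HIR} (hk : IsSmoothIR k) : translate μ k ≪ μ := by
  refine Measure.AbsolutelyContinuous.mk fun B hB h => ?_
  rw [translate, Measure.map_apply (by fun_prop) hB]
  exact (hq k hk B hB).2 h

theorem quasi_sub (hq : QuasiInvariant μ) {k : HIR} (hk : IsSmoothIR k) :
    Measure.QuasiMeasurePreserving (fun f => f - k) μ μ := by
  simp only [sub_eq_add_neg]
  exact ⟨by fun_prop, translate_ac hq hk.neg⟩

variable (μ) in
/-- The density of the translated measure. -/
def dens (k : HIR) : HIR → ℝ≥0∞ := (translate μ k).rnDeriv μ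

theorem measurable_dens (k : HIR) : Measurable (dens μ k) := Measure.measurable_rnDeriv _ _

variable [SigmaFinite μ]

instance (k : HIR) : SigmaFinite (translate μ k) :=
  (MeasurableEquiv.addRight k).sigmaFinite_map

theorem withDensity_dens (hq : QuasiInvariant μ) {k : HIR} (hk : IsSmoothIR k) :
    μ.withDensity (dens μ k) = translate μ k :=
  Measure.withDensity_rnDeriv_eq _ _ (translate_ac hq hk)

theorem dens_lt_top (k : HIR) : ∀ᵐ f ∂μ, dens μ k f < ⊤ := Measure.rnDeriv_lt_top _ _

theorem dens_zero : ∀ᵐ f ∂μ, dens μ 0 f = 1 := by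
  have : translate μ 0 = μ := by simp [translate]
  filter_upwards [Measure.rnDeriv_self μ] with f hf
  rw [dens, this]; exact hf

theorem dens_add (hq : QuasiInvariant μ) {k l : HIR} (hk : IsSmoothIR k) (hl : IsSmoothIR l) :
    ∀ᵐ f ∂μ, dens μ (k + l) f = dens μ k f * dens μ l (f - k) := by
  have hm : Measurable fun f => dens μ k f * dens μ l (f - k) :=
    (measurable_dens k).mul ((measurable_dens l).comp (by fun_prop))
  have e : translate μ (k + l) = μ.withDensity fun f => dens μ k f * dens μ l (f - k) := by
    have h1 : translate μ (k + l) = (translate μ l).map fun f => f + k := by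
      rw [translate, translate, Measure.map_map (by fun_prop) (by fun_prop)]
      congr 1; funext f
      simp only [Function.comp_apply]; abel
    rw [h1, ← withDensity_dens hq hl]
    ext B hB
    rw [Measure.map_apply (by fun_prop) hB, withDensity_apply _ (hB.preimage (by fun_prop)),
      withDensity_apply _ hB]
    have h2 := setLIntegral_map (μ := μ) (f := fun f => dens μ l (f - k)) hB
      ((measurable_dens l).comp (by fun_prop)) (by fun_prop : Measurable fun f : HIR => f + k)
    simp only [add_sub_cancel_right] at h2
    rw [← h2]
    change ∫⁻ f in B, dens μ l (f - k) ∂(translate μ k) = _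
    rw [← withDensity_dens hq hk]
    exact setLIntegral_withDensity_eq_setLIntegral_mul (g := fun f => dens μ l (f - k)) _
      (measurable_dens k) ((measurable_dens l).comp (by fun_prop)) hB
  have h := Measure.rnDeriv_withDensity μ hm
  rw [← e] at h
  exact h

theorem lintegral_dens_mul (hq : QuasiInvariant μ) {k : HIR} (hk : IsSmoothIR k)
    {G : HIR → ℝ≥0∞} (hG : AEMeasurable G μ) :
    ∫⁻ f, dens μ k f * G (f - k) ∂μ = ∫⁻ f, G f ∂μ := by
  have hG' : AEMeasurable (fun f => G (f - k)) μ := hG.comp_quasiMeasurePreserving (quasi_sub hq hk)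
  have h1 := lintegral_rnDeriv_mul (translate_ac hq hk) hG'
  rw [dens, h1]
  refine (lintegral_map_equiv (fun f => G (f - k)) (MeasurableEquiv.addRight k)).trans ?_
  simp

variable (μ) in
/-- The square root of the density. -/
def rootDens (k f : HIR) : ℂ := (√(dens μ k f).toReal : ℝ)

theorem measurable_rootDens (k : HIR) : Measurable (rootDens μ k) :=
  Complex.measurable_ofReal.comp ((measurable_dens k).ennreal_toReal.sqrt)

theorem enorm_rootDens_sq (k : HIR) : ∀ᵐ f ∂μ, ‖rootDens μ k f‖ₑ ^ 2 = dens μ k f := by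
  filter_upwards [dens_lt_top k] with f hf
  rw [rootDens, ← ofReal_norm, Complex.norm_real, Real.norm_of_nonneg (Real.sqrt_nonneg _),
    ← ENNReal.ofReal_pow (Real.sqrt_nonneg _), Real.sq_sqrt ENNReal.toReal_nonneg,
    ENNReal.ofReal_toReal hf.ne]

theorem rootDens_zero : ∀ᵐ f ∂μ, rootDens μ 0 f = 1 := by
  filter_upwards [dens_zero (μ := μ)] with f hf
  simp [rootDens, hf]

theorem rootDens_add (hq : QuasiInvariant μ) {k l : HIR} (hk : IsSmoothIR k) (hl : IsSmoothIR l) :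
    ∀ᵐ f ∂μ, rootDens μ (k + l) f = rootDens μ k f * rootDens μ l (f - k) := by
  filter_upwards [dens_add hq hk hl] with f hf
  rw [rootDens, rootDens, rootDens, hf, ENNReal.toReal_mul, Real.sqrt_mul ENNReal.toReal_nonneg]
  push_cast; rfl

variable (μ) in
/-- The action of the Weyl elements on vector fields. -/
def weylMap (v : Lhat) : (HIR → Hhat) →ₗ[ℂ] (HIR → Hhat) where
  toFun Ψ f := rootDens μ (pIR v) f • What v (Ψ (f - pIR v))
  map_add' Ψ Φ := funext fun f => by
    change _ • What v (Ψ (f - pIR v) + Φ (f - pIR v)) = _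
    rw [map_add, smul_add]; rfl
  map_smul' c Ψ := funext fun f => by
    change _ • What v (c • Ψ (f - pIR v)) = _
    rw [(What v).map_smul, smul_comm]; rfl

theorem weylMap_apply (v : Lhat) (Ψ : HIR → Hhat) (f : HIR) :
    weylMap μ v Ψ f = rootDens μ (pIR v) f • What v (Ψ (f - pIR v)) := rfl

variable (h : Profile)

theorem isFieldMap_weylMap (hq : QuasiInvariant μ) {v : Lhat} (hv : IsSmoothIR (pIR v)) :
    IsFieldMap (dress h) μ (weylMap μ v) := by
  set k := pIR v with hk
  set s := h.kern.smear
  refine isFieldMap_of h (fun ξ hξ hm => ?_) (fun Ψ hΨ => le_of_eq ?_) fun Ψ Φ e => ?_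
  · refine ⟨fun f => (rootDens μ k f * phase (symLhat.form v (s f - s k) -
      symLhat.form (s f) (v - s k))) • What (v - s k) (ξ (f - k)), ?_, fun f => ?_, fun f => ?_⟩
    · refine AEStronglyMeasurable.fun_smul (𝕜 := ℂ) ?_ ?_
      · have h1 : Continuous fun f => symLhat.form v (s f - s k) - symLhat.form (s f) (v - s k) := by
          refine Continuous.sub ?_ (h.kern.continuous_form_smear _)
          simp only [map_sub, fun f => symLhat.swap (s f) v]
          exact (h.kern.continuous_form_smear v).neg.sub continuous_const
        exact ((measurable_rootDens k).mul (measurable_phase.comp h1.measurable)).aestronglyMeasurable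
      · exact (What (v - s k)).continuous.comp_aestronglyMeasurable
          (hξ.comp_quasiMeasurePreserving (quasi_sub hq hv))
    · refine Submodule.smul_mem _ _ (What_mem_fiber_zero ?_ (hm _))
      rw [pIR_sub, h.kern.pIR_smear, sub_self]
    · rw [weylMap_apply, smear_eq, smear_eq, ← hk, map_sub, What_What, (What (s f)).map_smul,
        What_What, smul_smul, smul_smul, mul_assoc]
      change _ = (_ * (phase _ * phase (symLhat.form (s f) (v - s k)))) • What (s f + (v - s k)) _
      rw [← phase_add, sub_add_cancel, add_sub_left_comm]
  · rw [← lintegral_dens_mul hq hv hΨ]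
    refine lintegral_congr_ae ?_
    filter_upwards [enorm_rootDens_sq (μ := μ) k] with f hf
    rw [weylMap_apply, enorm_smul, mul_pow, ← hk, hf, ← ofReal_norm (What v _), norm_What, ofReal_norm]
  · filter_upwards [(quasi_sub hq hv).ae e] with f hf
    rw [weylMap_apply, weylMap_apply, hf]

theorem weylMap_weylMap (hq : QuasiInvariant μ) {v w : Lhat} (hv : IsSmoothIR (pIR v))
    (hw : IsSmoothIR (pIR w)) (Ψ : HIR → Hhat) : ∀ᵐ f ∂μ, weylMap μ v (weylMap μ w Ψ) f =
      phase (symLhat.form v w) • weylMap μ (v + w) Ψ f := by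
  filter_upwards [rootDens_add hq hv hw] with f hf
  rw [weylMap_apply, weylMap_apply, weylMap_apply, (What v).map_smul, What_What, pIR_add, hf,
    smul_smul, smul_smul, smul_smul, sub_sub]
  congr 1; ring

theorem weylMap_zero (Ψ : HIR → Hhat) : ∀ᵐ f ∂μ, weylMap μ 0 Ψ f = Ψ f := by
  filter_upwards [rootDens_zero (μ := μ)] with f hf
  rw [weylMap_apply, pIR_zero, hf, one_smul, What_zero, sub_zero]

theorem transMap_weylMap (x : Mink) (v : Lhat) (Ψ : HIR → Hhat) (f : HIR) :
    transMap x (weylMap μ v Ψ) f = weylMap μ (shiftLhat x v) (transMap x Ψ) f := by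
  change Uhat x (rootDens μ (pIR v) f • What v (Ψ (f - pIR v))) =
    rootDens μ (pIR (shiftLhat x v)) f • What (shiftLhat x v) (Uhat x (Ψ (f - pIR (shiftLhat x v))))
  rw [(Uhat x).map_smul, Uhat_What, pIR_shift]

open Classical in
/-- The Weyl operators. -/
def Rr (μ : Measure HIR) [SigmaFinite μ] (hq : QuasiInvariant μ) (v : Lhat) :
    DirectIntegral h μ →L[ℂ] DirectIntegral h μ :=
  if hv : IsSmoothIR (pIR v) then (isFieldMap_weylMap h hq hv).op else 1

variable (hq : QuasiInvariant μ)

theorem Rr_eq {v : Lhat} (hv : IsSmoothIR (pIR v)) : Rr h μ hq v = (isFieldMap_weylMap h hq hv).op :=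
  dif_pos hv

theorem Rr_zero : Rr h μ hq 0 = 1 :=
  (Rr_eq h hq (isSmoothIR_zero.congr pIR_zero.symm)).trans
    (IsFieldMap.op_eq_one _ weylMap_zero)

theorem Rr_mul {v w : Lhat} (hv : IsSmoothIR (pIR v)) (hw : IsSmoothIR (pIR w)) :
    Rr h μ hq v * Rr h μ hq w = phase (symLhat.form v w) • Rr h μ hq (v + w) :=
  mul_eq_smul_of_eq (Rr_eq h hq hv) (Rr_eq h hq hw)
    (Rr_eq h hq ((hv.add hw).congr (pIR_add v w).symm))
    (IsFieldMap.op_mul_op _ _ _ _ (weylMap_weylMap hq hv hw))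

theorem norm_Rr_le {v : Lhat} (hv : IsSmoothIR (pIR v)) (φ : DirectIntegral h μ) :
    ‖Rr h μ hq v φ‖ ≤ ‖φ‖ := by
  rw [Rr_eq h hq hv]; exact IsFieldMap.norm_op_le _ φ

theorem Rr_star {v : Lhat} (hv : IsSmoothIR (pIR v)) : star (Rr h μ hq v) = Rr h μ hq (-v) := by
  have hv' : IsSmoothIR (pIR (-v)) := hv.neg.congr (pIR_neg v).symm
  have p1 : phase (symLhat.form v (-v)) = 1 := by
    rw [map_neg, symLhat.alt, neg_zero, phase_zero]
  have p2 : phase (symLhat.form (-v) v) = 1 := by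
    rw [map_neg, AddMonoidHom.neg_apply, symLhat.alt, neg_zero, phase_zero]
  exact (mem_unitary_of_contraction (norm_Rr_le h hq hv) (norm_Rr_le h hq hv')
    (mul_eq_one_of_smul (Rr_mul h hq hv hv') p1
      ((congrArg (Rr h μ hq) (add_neg_cancel v)).trans (Rr_zero h hq)))
    (mul_eq_one_of_smul (Rr_mul h hq hv' hv) p2
      ((congrArg (Rr h μ hq) (neg_add_cancel v)).trans (Rr_zero h hq)))).2

theorem Ur_mul_Rr (x : Mink) {v : Lhat} (hv : IsSmoothIR (pIR v)) :
    Ur h μ x * Rr h μ hq v * Ur h μ (-x) = Rr h μ hq (shiftLhat x v) := by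
  have hx : IsSmoothIR (pIR (shiftLhat x v)) := by rw [pIR_shift]; exact hv
  refine mul_mul_ext fun φ => ?_
  obtain ⟨Ψ, rfl⟩ := FieldSpace.mk_surjective φ
  have h1 := (isFieldMap_transMap h x).represents_of ((isFieldMap_weylMap h hq hv).represents_of
    ((isFieldMap_transMap h (-x)).represents Ψ))
  rw [Rr_eq h hq hv, Rr_eq h hq hx]
  refine h1.unique (((isFieldMap_weylMap h hq hx).represents Ψ).congr (Eventually.of_forall fun f => ?_))
  rw [transMap_weylMap]
  refine congrArg (fun Φ => weylMap μ (shiftLhat x v) Φ f) (funext fun f => ?_)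
  change Ψ.fn f = Uhat x (Uhat (-x) (Ψ.fn f))
  rw [← Uhat_add, add_neg_cancel, Uhat_zero]

theorem Rr_represents {v : Lhat} (hv : IsSmoothIR (pIR v)) (Ψ : SqField (dress h) μ) :
    FieldSpace.Represents (Rr h μ hq v (FieldSpace.mk Ψ)) fun f =>
      ((√((translate μ (pIR v)).rnDeriv μ f).toReal : ℝ) : ℂ) • What v (Ψ.fn (f - pIR v)) := by
  rw [Rr_eq h hq hv]
  exact (isFieldMap_weylMap h hq hv).represents Ψ

end

/-! ### Closed forms on the cone -/

/-- The projection of Minkowski space onto its spatial part. -/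
def spatialProj : Mink →L[ℝ] Mink :=
  ContinuousLinearMap.id ℝ Mink -
    (ContinuousLinearMap.proj (R := ℝ) (φ := fun _ : Fin 4 => ℝ) 0).smulRight (Pi.single 0 1)

theorem spatialProj_apply (y : Mink) : spatialProj y = ![0, y 1, y 2, y 3] := by
  ext i
  fin_cases i <;> simp [spatialProj]

theorem spatial_spatialProj (y : Mink) : spatial (spatialProj y) = spatial y := by
  rw [spatialProj_apply]; rfl

/-- The inverse stereographic projection from the pole `(0, 0, ∓1)`, up to scaling. -/
def invStereo (κ : ℝ) (p : ℝ × ℝ) : Mink :=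
  ![0, 2 * p.1, 2 * p.2, κ * (1 - p.1 ^ 2 - p.2 ^ 2)]

/-- The stereographic projection from the pole `(0, 0, ∓1)`. -/
def stereo (κ : ℝ) (y : Mink) : ℝ × ℝ := (y 1 / (spatial y + κ * y 3), y 2 / (spatial y + κ * y 3))

theorem spatial_sq (y : Mink) : spatial y ^ 2 = y 1 ^ 2 + y 2 ^ 2 + y 3 ^ 2 :=
  Real.sq_sqrt (by positivity)

theorem spatial_smul {c : ℝ} (hc : 0 ≤ c) (y : Mink) : spatial (c • y) = c * spatial y := by
  have h := spatial_sq y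
  have : (c • y) 1 ^ 2 + (c • y) 2 ^ 2 + (c • y) 3 ^ 2 = (c * spatial y) ^ 2 := by
    simp only [Pi.smul_apply, smul_eq_mul]
    linear_combination -c ^ 2 * h
  have h0 : 0 ≤ spatial y := Real.sqrt_nonneg _
  rw [← Real.sqrt_sq (mul_nonneg hc h0), ← this]; rfl

theorem spatial_pos_iff {y : Mink} : 0 < spatial y ↔ 0 < y 1 ^ 2 + y 2 ^ 2 + y 3 ^ 2 := Real.sqrt_pos

theorem contDiffOn_spatial : ContDiffOn ℝ ((⊤ : ℕ∞) : WithTop ℕ∞) spatial {y | 0 < spatial y} :=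
  ContDiffOn.sqrt (by fun_prop) fun _ hy => (Real.sqrt_pos.1 hy).ne'

theorem contDiff_invStereo (κ : ℝ) : ContDiff ℝ ((⊤ : ℕ∞) : WithTop ℕ∞) (invStereo κ) := by
  refine contDiff_pi.2 fun i => ?_
  fin_cases i
  · exact contDiff_const
  · exact contDiff_const.mul contDiff_fst
  · exact contDiff_const.mul contDiff_snd
  · exact contDiff_const.mul ((contDiff_const.sub (contDiff_fst.pow 2)).sub (contDiff_snd.pow 2))

theorem spatial_invStereo_pos {κ : ℝ} (hκ : κ ^ 2 = 1) (p : ℝ × ℝ) : 0 < spatial (invStereo κ p) := by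
  rw [spatial_pos_iff]
  have : (invStereo κ p) 1 ^ 2 + (invStereo κ p) 2 ^ 2 + (invStereo κ p) 3 ^ 2 =
      (1 + p.1 ^ 2 + p.2 ^ 2) ^ 2 := by
    simp only [invStereo, Matrix.cons_val]
    linear_combination (1 - p.1 ^ 2 - p.2 ^ 2) ^ 2 * hκ
  rw [this]; positivity

theorem spatial_pos_of_chart {κ : ℝ} (hκ : κ ^ 2 = 1) {y : Mink} (hy : 0 < spatial y + κ * y 3) :
    0 < spatial y := by
  by_contra h
  have h0 : spatial y = 0 := le_antisymm (not_lt.1 h) (Real.sqrt_nonneg _)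
  have h1 := spatial_sq y
  rw [h0] at h1 hy
  have : y 3 = 0 := by nlinarith [sq_nonneg (y 1), sq_nonneg (y 2), sq_nonneg (y 3)]
  rw [this] at hy; simp at hy

theorem invStereo_stereo {κ : ℝ} (hκ : κ ^ 2 = 1) {y : Mink} (hy : 0 < spatial y + κ * y 3) :
    invStereo κ (stereo κ y) = (2 / (spatial y + κ * y 3)) • spatialProj y := by
  have h1 := spatial_sq y
  rw [spatialProj_apply]
  ext i
  fin_cases i
  · simp [invStereo]
  · simp [invStereo, stereo]; ring
  · simp [invStereo, stereo]; ring
  · simp only [invStereo, stereo, Fin.reduceFinMk, Matrix.cons_val, Pi.smul_apply, smul_eq_mul]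
    field_simp
    linear_combination κ * h1 + (spatial y * 2 * y 3 + y 3 ^ 2 * κ) * hκ

section
variable {A : Mink → Mink →L[ℝ] ℝ}

/-- A closed form on the cone has a primitive on each chart of the stereographic atlas. -/
theorem exists_primitive_chart (hA : ContDiffOn ℝ ((⊤ : ℕ∞) : WithTop ℕ∞) A {y | 0 < spatial y})
    (hsym : ∀ y, 0 < spatial y → ∀ u v, fderiv ℝ A y u v = fderiv ℝ A y v u)
    (hp : ∀ y, A (spatialProj y) = A y) (hp' : ∀ y v, A y (spatialProj v) = A y v)
    (hom : ∀ c : ℝ, 0 < c → ∀ y, 0 < spatial y → A (c • y) = c⁻¹ • A y) (hrad : ∀ y, 0 < spatial y → A y y = 0)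
    {κ : ℝ} (hκ : κ ^ 2 = 1) :
    ∃ φ : Mink → ℝ, ∀ y, 0 < spatial y + κ * y 3 → HasFDerivAt φ (A y) y := by
  have hAd : ∀ y, 0 < spatial y → DifferentiableAt ℝ A y := fun y hy =>
    (hA.differentiableOn (by simp)).differentiableAt (isOpen_spatial.mem_nhds hy)
  have hσ := contDiff_invStereo κ
  have hσd : ∀ q, DifferentiableAt ℝ (invStereo κ) q := fun q => hσ.differentiable (by simp) q
  have hσd2 : ∀ q, DifferentiableAt ℝ (fderiv ℝ (invStereo κ)) q := fun q =>
    ((hσ.fderiv_right (m := ((⊤ : ℕ∞) : WithTop ℕ∞)) (by simp)).differentiable (by simp)) q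
  set ω : ℝ × ℝ → ℝ × ℝ →L[ℝ] ℝ := fun q => (A (invStereo κ q)).comp (fderiv ℝ (invStereo κ) q)
  have hω : ∀ q, HasFDerivAt ω _ q := fun q =>
    ((hAd _ (spatial_invStereo_pos hκ q)).hasFDerivAt.comp q (hσd q).hasFDerivAt).clm_comp
      (hσd2 q).hasFDerivAt
  obtain ⟨g, hg⟩ := convex_univ.exists_forall_hasFDerivAt_of_fderiv_symmetric (s := Set.univ) (ω := ω)
    isOpen_univ (fun q _ => (hω q).differentiableAt.differentiableWithinAt) fun q _ u v => by
      rw [(hω q).fderiv]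
      have h2 : fderiv ℝ (fderiv ℝ (invStereo κ)) q u v = fderiv ℝ (fderiv ℝ (invStereo κ)) q v u :=
        (hσ.contDiffAt.isSymmSndFDerivAt (by simp only [minSmoothness_of_isRCLikeNormedField]; exact WithTop.coe_le_coe.2 le_top)) u v
      have h3 := hsym _ (spatial_invStereo_pos hκ q) (fderiv ℝ (invStereo κ) q u)
        (fderiv ℝ (invStereo κ) q v)
      simp [h2, h3]
  refine ⟨fun y => g (stereo κ y), fun y hy => ?_⟩
  have hy' := spatial_pos_of_chart hκ hy
  have hsp : DifferentiableAt ℝ spatial y :=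
    (contDiffOn_spatial.differentiableOn (by simp)).differentiableAt (isOpen_spatial.mem_nhds hy')
  have hden : DifferentiableAt ℝ (fun y : Mink => spatial y + κ * y 3) y := by fun_prop
  have hS : DifferentiableAt ℝ (stereo κ) y := by
    unfold stereo
    simp only [div_eq_mul_inv]
    exact ((differentiableAt_apply 1 y).mul (hden.fun_inv hy.ne')).prodMk
      ((differentiableAt_apply 2 y).mul (hden.fun_inv hy.ne'))
  have h1 := (hg (stereo κ y) trivial).comp y hS.hasFDerivAt
  have hc : DifferentiableAt ℝ (fun y : Mink => 2 / (spatial y + κ * y 3)) y := by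
    simp only [div_eq_mul_inv]
    exact (hden.fun_inv hy.ne').const_mul 2
  have h2 : HasFDerivAt (fun y => invStereo κ (stereo κ y)) _ y :=
    (hσd (stereo κ y)).hasFDerivAt.comp y hS.hasFDerivAt
  have h3 := hc.hasFDerivAt.smul (spatialProj.hasFDerivAt (x := y))
  have hopen : {y : Mink | 0 < spatial y + κ * y 3} ∈ 𝓝 y := by
    refine (isOpen_lt continuous_const ?_).mem_nhds hy
    unfold spatial; fun_prop
  have h4 := h2.unique (h3.congr_of_eventuallyEq (by
    filter_upwards [hopen] with z hz; exact invStereo_stereo hκ hz))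
  refine h1.congr_fderiv ?_
  ext v
  have h5 := congrArg (fun L : Mink →L[ℝ] Mink => A (invStereo κ (stereo κ y)) (L v)) h4
  change A (invStereo κ (stereo κ y)) (fderiv ℝ (invStereo κ) (stereo κ y) (fderiv ℝ (stereo κ) y v)) = _
  refine h5.trans ?_
  have hc0 : 0 < 2 / (spatial y + κ * y 3) := by positivity
  have h6 : A y (spatialProj y) = 0 := by rw [hp', hrad y hy']
  rw [invStereo_stereo hκ hy, hom _ hc0 _ (by rwa [spatial_spatialProj]), hp]
  simp only [add_apply, smul_apply,
    ContinuousLinearMap.smulRight_apply, map_add, map_smul, h6, hp', smul_eq_mul]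
  field_simp
  ring

theorem isPreconnected_offAxis : IsPreconnected {y : Mink | 0 < y 1 ^ 2 + y 2 ^ 2} := by
  have h : {y : Mink | 0 < y 1 ^ 2 + y 2 ^ 2} = Set.range fun q : ℂ × ℝ × ℝ =>
      (![q.2.1, (Complex.exp q.1).re, (Complex.exp q.1).im, q.2.2] : Mink) := by
    ext y
    constructor
    · intro hy
      have hz : (⟨y 1, y 2⟩ : ℂ) ≠ 0 := fun h => by
        rw [Complex.ext_iff] at h
        have hy' : 0 < y 1 ^ 2 + y 2 ^ 2 := hy
        rw [show y 1 = 0 from h.1, show y 2 = 0 from h.2] at hy'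
        simp at hy'
      refine ⟨(Complex.log ⟨y 1, y 2⟩, y 0, y 3), ?_⟩
      dsimp only
      rw [Complex.exp_log hz]
      ext i; fin_cases i <;> rfl
    · rintro ⟨q, rfl⟩
      have : (Complex.exp q.1).re ^ 2 + (Complex.exp q.1).im ^ 2 = Complex.normSq (Complex.exp q.1) := by
        rw [Complex.normSq_apply]; ring
      change 0 < (Complex.exp q.1).re ^ 2 + (Complex.exp q.1).im ^ 2
      rw [this]; exact Complex.normSq_pos.2 (Complex.exp_ne_zero _)
  rw [h]
  refine isPreconnected_range (continuous_pi fun i => ?_)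
  fin_cases i
  · exact continuous_snd.fst
  · exact Complex.continuous_re.comp (Complex.continuous_exp.comp continuous_fst)
  · exact Complex.continuous_im.comp (Complex.continuous_exp.comp continuous_fst)
  · exact continuous_snd.snd

theorem chart_or {y : Mink} (hy : 0 < spatial y) : 0 < spatial y + 1 * y 3 ∨ 0 < spatial y + -1 * y 3 := by
  by_contra! h
  linarith [h.1, h.2]

theorem chart_and_iff {y : Mink} :
    (0 < spatial y + 1 * y 3 ∧ 0 < spatial y + -1 * y 3) ↔ 0 < y 1 ^ 2 + y 2 ^ 2 := by
  have h := spatial_sq y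
  have h0 : 0 ≤ spatial y := Real.sqrt_nonneg _
  constructor
  · rintro ⟨h1, h2⟩; nlinarith
  · intro h1
    have : |y 3| < spatial y := abs_lt_of_sq_lt_sq (by linarith) h0
    rw [abs_lt] at this
    constructor <;> linarith [this.1, this.2]

/-- A closed form on the cone is exact. -/
theorem exists_primitive (hA : ContDiffOn ℝ ((⊤ : ℕ∞) : WithTop ℕ∞) A {y | 0 < spatial y})
    (hsym : ∀ y, 0 < spatial y → ∀ u v, fderiv ℝ A y u v = fderiv ℝ A y v u)
    (hp : ∀ y, A (spatialProj y) = A y) (hp' : ∀ y v, A y (spatialProj v) = A y v)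
    (hom : ∀ c : ℝ, 0 < c → ∀ y, 0 < spatial y → A (c • y) = c⁻¹ • A y) (hrad : ∀ y, 0 < spatial y → A y y = 0) :
    ∃ φ : Mink → ℝ, ContDiffOn ℝ ((⊤ : ℕ∞) : WithTop ℕ∞) φ {y | 0 < spatial y} ∧
      ∀ y, 0 < spatial y → HasFDerivAt φ (A y) y := by
  have hcont : Continuous spatial := by unfold spatial; fun_prop
  have hopen : ∀ κ : ℝ, IsOpen {y : Mink | 0 < spatial y + κ * y 3} := fun κ =>
    isOpen_lt continuous_const (hcont.add (continuous_const.mul (continuous_apply 3)))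
  obtain ⟨φ, hφ⟩ := exists_primitive_chart hA hsym hp hp' hom hrad (κ := 1) (by norm_num)
  obtain ⟨χ, hχ⟩ := exists_primitive_chart hA hsym hp hp' hom hrad (κ := -1) (by norm_num)
  have hoff : IsOpen {y : Mink | 0 < y 1 ^ 2 + y 2 ^ 2} := isOpen_lt continuous_const (by fun_prop)
  have hd : ∀ y ∈ {y : Mink | 0 < y 1 ^ 2 + y 2 ^ 2}, HasFDerivAt (fun z : Mink => φ z - χ z) (0 : Mink →L[ℝ] ℝ) y := by
    intro y hy
    have h := chart_and_iff.2 hy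
    refine ((hφ y h.1).sub (hχ y h.2)).congr_fderiv (sub_self _)
  obtain ⟨c, hc⟩ := hoff.exists_is_const_of_fderiv_eq_zero (𝕜 := ℝ) (f := fun y => φ y - χ y) isPreconnected_offAxis
    (fun y hy => (hd y hy).differentiableAt.differentiableWithinAt) fun y hy => (hd y hy).fderiv
  classical
  set Φ : Mink → ℝ := fun y => if 0 < spatial y + 1 * y 3 then φ y else χ y + c with hΦ
  have e1 : ∀ y, 0 < spatial y + 1 * y 3 → Φ y = φ y := fun y hy => if_pos hy
  have e2 : ∀ y, 0 < spatial y + -1 * y 3 → Φ y = χ y + c := fun y hy => by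
    by_cases h : 0 < spatial y + 1 * y 3
    · rw [e1 y h]
      linarith [hc y (chart_and_iff.1 ⟨h, hy⟩)]
    · exact if_neg h
  have key : ∀ y, 0 < spatial y → HasFDerivAt Φ (A y) y := by
    intro y hy
    rcases chart_or hy with h | h
    · exact (hφ y h).congr_of_eventuallyEq (by filter_upwards [(hopen 1).mem_nhds h] with z hz using e1 z hz)
    · exact ((hχ y h).add_const c).congr_of_eventuallyEq
        (by filter_upwards [(hopen (-1)).mem_nhds h] with z hz using e2 z hz)
  refine ⟨Φ, ?_, key⟩
  rw [contDiffOn_infty_iff_fderiv_of_isOpen isOpen_spatial]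
  exact ⟨fun y hy => (key y hy).differentiableAt.differentiableWithinAt,
    hA.congr fun y hy => (key y hy).fderiv⟩

end

/-! ### The infrared characteristic of a test function -/

theorem toCone_congr {y z : Mink} (h1 : y 1 = z 1) (h2 : y 2 = z 2) (h3 : y 3 = z 3) :
    toCone y = toCone z := by
  simp only [toCone, spatial, h1, h2, h3]
  rfl

theorem spatial_index {i : Fin 4} (hi : i ≠ 0) : i = 1 ∨ i = 2 ∨ i = 3 := by
  revert i; decide

theorem toCone_zero {y : Mink} (hy : 0 < spatial y) : (toCone y).1 0 = spatial y := by
  simp [toCone, hy]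

theorem toCone_apply {y : Mink} (hy : 0 < spatial y) {i : Fin 4} (hi : i ≠ 0) :
    (toCone y).1 i = y i := by
  fin_cases i
  · exact absurd rfl hi
  all_goals simp [toCone, hy]

theorem toCone_smul {c : ℝ} (hc : 0 < c) {y : Mink} (hy : 0 < spatial y) :
    (toCone (c • y)).1 = c • (toCone y).1 := by
  have h : 0 < spatial (c • y) := by rw [spatial_smul hc.le]; positivity
  ext i
  by_cases hi : i = 0
  · subst hi; rw [toCone_zero h, Pi.smul_apply, toCone_zero hy, spatial_smul hc.le]; rfl
  · rw [toCone_apply h hi, Pi.smul_apply, Pi.smul_apply, toCone_apply hy hi]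

theorem toCone_add_time (y : Mink) (t : ℝ) : toCone (y + t • Pi.single 0 1) = toCone y :=
  toCone_congr (by simp) (by simp) (by simp)

theorem eq_toCone_add {y : Mink} (hy : 0 < spatial y) :
    y = (toCone y).1 + (y 0 - spatial y) • Pi.single 0 1 := by
  ext i
  by_cases hi : i = 0
  · subst hi; simp [toCone_zero hy]
  · simp [toCone_apply hy hi, hi]

section
theorem coneExt_add_time {E : Type} (g : Cone → E) (t : ℝ) (y : Mink) :
    coneExt g (y + t • Pi.single 0 1) = coneExt g y := by
  rw [coneExt, toCone_add_time]; rfl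

variable {E : Type} [NormedAddCommGroup E] [NormedSpace ℝ E]

theorem fderiv_coneExt (g : Cone → E) {y : Mink} (hy : 0 < spatial y) :
    fderiv ℝ (coneExt g) y = fderiv ℝ (coneExt g) (toCone y).1 := by
  have h := fderiv_comp_add_right (𝕜 := ℝ) (f := coneExt g) (x := (toCone y).1)
    ((y 0 - spatial y) • Pi.single 0 1)
  simp only [coneExt_add_time] at h
  rw [← eq_toCone_add hy] at h
  exact h.symm

theorem pd_time {g : Cone → E} (hg : SmoothCone g) (l : Cone) : pd 0 g l = 0 := by
  have h1 : HasDerivAt (fun t : ℝ => l.1 + t • (Pi.single 0 1 : Mink)) (Pi.single 0 1) 0 := by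
    simpa using ((hasDerivAt_id (0 : ℝ)).smul_const (Pi.single 0 1 : Mink)).const_add l.1
  have h2 : HasFDerivAt (coneExt g) (fderiv ℝ (coneExt g) l.1) (l.1 + (0 : ℝ) • (Pi.single 0 1 : Mink)) := by
    rw [zero_smul, add_zero]; exact (hg.differentiableAt l).hasFDerivAt
  have h3 := h2.comp_hasDerivAt (0 : ℝ) h1
  have h4 : (coneExt g ∘ fun t : ℝ => l.1 + t • (Pi.single 0 1 : Mink)) = fun _ => coneExt g l.1 :=
    funext fun t => coneExt_add_time g t l.1
  rw [h4] at h3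
  exact h3.unique (hasDerivAt_const _ _)

theorem SmoothCone.continuous_sec {g : Cone → E} (hg : SmoothCone g) : Continuous fun n => g (sec n) := by
  have h := hg.continuousOn.comp_continuous (continuous_subtype_val.comp IRQED.continuous_sec) fun n => by
    change 0 < spatial (sec n).1
    rw [spatial_cone, sec_zero]; exact one_pos
  refine h.congr fun n => ?_
  change g (toCone (sec n).1) = _
  rw [toCone_coe]

theorem fderiv_coneExt_eq_sum {g : Cone → E} (hg : SmoothCone g) {y : Mink} (hy : 0 < spatial y)
    (v : Mink) : fderiv ℝ (coneExt g) y v =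
      v 1 • pd 1 g (toCone y) + v 2 • pd 2 g (toCone y) + v 3 • pd 3 g (toCone y) := by
  rw [fderiv_coneExt g hy]
  have h := LinearMap.pi_apply_eq_sum_univ (fderiv ℝ (coneExt g) (toCone y).1).toLinearMap v
  rw [Fin.sum_univ_four] at h
  have e : ∀ i : Fin 4, (fun j => if i = j then (1 : ℝ) else 0) = Pi.single i 1 := fun i => by
    ext j; simp [Pi.single_apply, eq_comm]
  simp only [e] at h
  have h0 : fderiv ℝ (coneExt g) (toCone y).1 (Pi.single 0 1) = 0 := pd_time hg _
  refine h.trans ?_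
  change v 0 • fderiv ℝ (coneExt g) (toCone y).1 (Pi.single 0 1) + _ + _ + _ = _
  rw [h0, smul_zero, zero_add]; rfl

end

/-- The smooth elements of `PreH0`. -/
def PreH0.ofSmooth (f : Cone → Mink) (hh : ConeHomogeneous (-1) f) (ho : ∀ l, η l.1 (f l) = 0)
    (hs : SmoothCone f) : PreH0 :=
  ⟨f, hh, hs.continuous_sec.measurable, ho, fun a => by
    have hc : Continuous fun n => f (sec n) a := (continuous_apply a).comp hs.continuous_sec
    obtain ⟨C, hC⟩ := (isCompact_range hc).isBounded.exists_norm_le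
    exact MemLp.of_bound hc.aestronglyMeasurable C (Eventually.of_forall fun n => hC _ ⟨n, rfl⟩)⟩

theorem smoothCone_time : SmoothCone fun l => l.1 0 := contDiffOn_pi.1 contDiffOn_toCone 0

theorem SmoothCone.apply {f : Cone → Mink} (hf : SmoothCone f) (a : Fin 4) :
    SmoothCone fun l => f l a := contDiffOn_pi.1 hf a

theorem pd_apply {f : Cone → Mink} (hf : SmoothCone f) (a b : Fin 4) (l : Cone) :
    pd a f l b = pd a (fun l => f l b) l := by
  have h := hasFDerivAt_pi'.1 (hf.differentiableAt l).hasFDerivAt b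
  change _ = fderiv ℝ (fun y => coneExt f y b) l.1 _
  rw [h.fderiv]; rfl

theorem pd_mul {f g : Cone → ℝ} (hf : SmoothCone f) (hg : SmoothCone g) (a : Fin 4)
    (l : Cone) : pd a (fun l => f l * g l) l = pd a f l * g l + f l * pd a g l := by
  have h := (hf.differentiableAt l).hasFDerivAt.mul (hg.differentiableAt l).hasFDerivAt
  have e : pd a (fun l => f l * g l) l = _ := congrArg (fun L : Mink →L[ℝ] ℝ => L (Pi.single a 1)) h.fderiv
  rw [e]
  have e1 : ∀ k : Cone → ℝ, coneExt k l.1 = k l := fun k => by rw [coneExt, toCone_coe]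
  simp only [e1, add_apply, smul_apply, smul_eq_mul]
  rw [add_comm, mul_comm (g l)]; rfl

theorem pd_coord (a : Fin 4) {i : Fin 4} (hi : i ≠ 0) (l : Cone) :
    pd a (fun l => l.1 i) l = if a = i then 1 else 0 := by
  have h : HasFDerivAt (coneExt fun l => l.1 i)
      (ContinuousLinearMap.proj (R := ℝ) (φ := fun _ : Fin 4 => ℝ) i) l.1 := by
    refine (ContinuousLinearMap.hasFDerivAt _).congr_of_eventuallyEq ?_
    filter_upwards [isOpen_spatial.mem_nhds (show 0 < spatial l.1 by rw [spatial_cone]; exact l.2.1)]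
      with z hz using toCone_apply hz hi
  rw [pd, h.fderiv]
  simp [Pi.single_apply, eq_comm]

theorem pd_time_coord {i : Fin 4} (hi : i ≠ 0) (l : Cone) :
    l.1 0 * pd i (fun l => l.1 0) l = l.1 i := by
  have hc : ∀ j : Fin 4, SmoothCone fun l => l.1 j := fun j => contDiffOn_pi.1 contDiffOn_toCone j
  have e : (fun l : Cone => l.1 0 * l.1 0) = (fun l : Cone => l.1 1 * l.1 1) +
      ((fun l : Cone => l.1 2 * l.1 2) + fun l : Cone => l.1 3 * l.1 3) := funext fun l => by
    have := l.2.2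
    rw [η] at this
    simp only [Pi.add_apply]; linarith
  have hm : ∀ j, SmoothCone fun l => l.1 j * l.1 j := fun j => ContDiffOn.mul (hc j) (hc j)
  have hm' : SmoothCone ((fun l : Cone => l.1 2 * l.1 2) + fun l : Cone => l.1 3 * l.1 3) :=
    ContDiffOn.add (hm 2) (hm 3)
  have h : pd i _ l = pd i _ l := congrArg (fun k => pd i k l) e
  rw [pd_add (hm 1) hm', pd_add (hm 2) (hm 3), pd_mul (hc 0) (hc 0),
    pd_mul (hc 1) (hc 1), pd_mul (hc 2) (hc 2), pd_mul (hc 3) (hc 3), pd_coord i (i := 1) (by decide),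
    pd_coord i (i := 2) (by decide), pd_coord i (i := 3) (by decide)] at h
  rcases spatial_index hi with rfl | rfl | rfl <;>
  · simp only [Fin.isValue, reduceIte, Fin.reduceEq, zero_mul, mul_zero, add_zero, zero_add,
      one_mul, mul_one] at h
    linarith

/-- The gauge of a vector function on the cone in which the time component vanishes. -/
def timeGauge (w : Cone → Mink) (l : Cone) : Mink := w l - (w l 0 * (l.1 0)⁻¹) • l.1

section
variable {w : Cone → Mink} (hs : SmoothCone w)

include hs in
theorem smoothCone_ratio : SmoothCone fun l => w l 0 * (l.1 0)⁻¹ :=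
  ContDiffOn.mul (hs.apply 0) (ContDiffOn.inv smoothCone_time fun y _ => (toCone y).2.1.ne')

include hs in
theorem smoothCone_timeGauge : SmoothCone (timeGauge w) :=
  ContDiffOn.sub hs (ContDiffOn.smul (smoothCone_ratio hs) contDiffOn_toCone)

include hs in
theorem pd_timeGauge {i j : Fin 4} (hi : i ≠ 0) (hj : j ≠ 0) (l : Cone) :
    l.1 0 * (pd j (timeGauge w) l i - pd i (timeGauge w) l j) =
      l.1 0 * (pd j w l i - pd i w l j) - (pd j w l 0 * l.1 i - pd i w l 0 * l.1 j) := by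
  set ρ : Cone → ℝ := fun l => w l 0 * (l.1 0)⁻¹
  have hρ : SmoothCone ρ := smoothCone_ratio hs
  have hc : ∀ j : Fin 4, SmoothCone fun l => l.1 j := fun j => contDiffOn_pi.1 contDiffOn_toCone j
  have h1 : ∀ {a b : Fin 4}, b ≠ 0 → pd a (timeGauge w) l b =
      pd a w l b - (pd a ρ l * l.1 b + ρ l * if a = b then 1 else 0) := fun {a b} hb => by
    rw [pd_apply (smoothCone_timeGauge hs), pd_apply hs, ← pd_coord a hb l, ← pd_mul hρ (hc b)]
    have e : (fun l => timeGauge w l b) = (fun l => w l b) + -fun l => ρ l * l.1 b := funext fun l => by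
      simp only [timeGauge, Pi.sub_apply, Pi.smul_apply, smul_eq_mul, Pi.add_apply, Pi.neg_apply, ρ]
      ring
    have hm : SmoothCone fun l => ρ l * l.1 b := ContDiffOn.mul hρ (hc b)
    have hm' : SmoothCone (-fun l => ρ l * l.1 b) := ContDiffOn.neg hm
    rw [e, pd_add (hs.apply b) hm', pd_neg, sub_eq_add_neg]
  have h2 : ∀ {a : Fin 4}, a ≠ 0 → l.1 0 * (l.1 0 * pd a ρ l) = l.1 0 * pd a w l 0 - ρ l * l.1 a :=
    fun {a} ha => by
      have e : (fun l => w l 0) = fun l => ρ l * l.1 0 := funext fun l => by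
        simp only [ρ]; rw [mul_assoc, inv_mul_cancel₀ l.2.1.ne', mul_one]
      rw [pd_apply hs, e, pd_mul hρ (hc 0), ← pd_time_coord ha]; ring
  rw [h1 hi, h1 hj]
  refine mul_left_cancel₀ l.2.1.ne' ?_
  have k1 := h2 hi
  have k2 := h2 hj
  have h3 : (if j = i then (1 : ℝ) else 0) = if i = j then 1 else 0 := by simp only [eq_comm]
  rw [h3]
  linear_combination l.1 j * k1 - l.1 i * k2

/-- A smooth closed vector function is a gradient up to gauge. -/
theorem exists_potential (hs : SmoothCone w) (hh : ConeHomogeneous (-1) w)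
    (ho : ∀ l, η l.1 (w l) = 0) (hcl : ∀ a b c l, metric c * Lop a b w l c +
      metric a * Lop b c w l a + metric b * Lop c a w l b = 0) :
    ∃ φ : Cone → ℝ, SmoothCone φ ∧ ConeHomogeneous 0 φ ∧
      ∀ l a, timeGauge w l a = metric a * pd a φ l := by
  have hf := smoothCone_timeGauge hs
  set f := timeGauge w with hfdef
  have hf0 : ∀ l, f l 0 = 0 := fun l => by
    have := l.2.1.ne'
    simp only [hfdef, timeGauge, Pi.sub_apply, Pi.smul_apply, smul_eq_mul]
    field_simp; ring
  have hfo : ∀ l, η l.1 (f l) = 0 := fun l => by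
    have := η_add_right l.1 (w l) (-(w l 0 * (l.1 0)⁻¹) • l.1)
    rw [neg_smul, ← sub_eq_add_neg, ho, ← neg_smul, η_smul_right, l.2.2, mul_zero, add_zero] at this
    exact this
  have hfh : ∀ (μ : ℝ) (l l' : Cone), 0 < μ → l'.1 = μ • l.1 → f l' = μ⁻¹ • f l := fun μ l l' hμ e => by
    have h1 := hh μ l l' hμ e
    rw [zpow_neg_one] at h1
    rw [hfdef, timeGauge, timeGauge, h1, e, smul_sub, smul_smul, smul_smul]
    simp only [Pi.smul_apply, smul_eq_mul, mul_inv]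
    congr 2
    have := l.2.1.ne'
    field_simp
  have hsymm : ∀ {i j : Fin 4}, i ≠ 0 → j ≠ 0 → ∀ l, pd j f l i = pd i f l j := by
    intro i j hi hj l
    have h1 := pd_timeGauge hs hi hj l
    have h2 := hcl 0 i j l
    have t := pd_time hs l
    have m : ∀ {i : Fin 4}, i ≠ 0 → metric i = -1 := fun hi => if_neg hi
    have m0 : metric 0 = 1 := if_pos rfl
    simp only [Lop, m hi, m hj, m0, t, smul_zero, Pi.smul_apply,
       Pi.sub_apply, smul_eq_mul, one_mul] at h2
    have h3 : l.1 0 * (pd j f l i - pd i f l j) = 0 := by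
      rw [h1]; linear_combination h2
    rcases mul_eq_zero.1 h3 with h | h
    · exact absurd h l.2.1.ne'
    · linarith
  set pr : Fin 4 → Mink →L[ℝ] ℝ := fun i => ContinuousLinearMap.proj (R := ℝ) (φ := fun _ : Fin 4 => ℝ) i
  set A : Mink → Mink →L[ℝ] ℝ := fun y =>
    -(coneExt f y 1 • pr 1 + coneExt f y 2 • pr 2 + coneExt f y 3 • pr 3) with hA
  have hAv : ∀ y v, A y v = -(coneExt f y 1 * v 1 + coneExt f y 2 * v 2 + coneExt f y 3 * v 3) :=
    fun y v => rfl
  have hcomp : ∀ i, ContDiffOn ℝ ((⊤ : ℕ∞) : WithTop ℕ∞) (fun y => coneExt f y i) {y | 0 < spatial y} :=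
    fun i => contDiffOn_pi.1 hf i
  obtain ⟨φ, hφs, hφ⟩ := exists_primitive (A := A)
    ((((hcomp 1).smul contDiffOn_const).add ((hcomp 2).smul contDiffOn_const)).add
      ((hcomp 3).smul contDiffOn_const)).neg
    (fun y hy u v => by
      have hd : DifferentiableAt ℝ (coneExt f) y :=
        (hf.differentiableOn (by simp)).differentiableAt (isOpen_spatial.mem_nhds hy)
      have hi := fun i => (hasFDerivAt_pi'.1 hd.hasFDerivAt i).smul_const (pr i)
      have h := (((hi 1).add (hi 2)).add (hi 3)).neg
      have h' : fderiv ℝ A y = _ := h.fderiv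
      have e : ∀ u v, fderiv ℝ A y u v = -(fderiv ℝ (coneExt f) y u 1 * v 1 +
          fderiv ℝ (coneExt f) y u 2 * v 2 + fderiv ℝ (coneExt f) y u 3 * v 3) := fun u v => by
        rw [h']; rfl
      rw [e, e, fderiv_coneExt_eq_sum hf hy, fderiv_coneExt_eq_sum hf hy]
      simp only [Pi.add_apply, Pi.smul_apply, smul_eq_mul]
      have s12 := hsymm (i := 1) (j := 2) (by decide) (by decide) (toCone y)
      have s13 := hsymm (i := 1) (j := 3) (by decide) (by decide) (toCone y)
      have s23 := hsymm (i := 2) (j := 3) (by decide) (by decide) (toCone y)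
      rw [s12, s13, s23]; ring)
    (fun y => by
      have : toCone (spatialProj y) = toCone y := by
        rw [spatialProj_apply]; exact toCone_congr rfl rfl rfl
      simp only [hA, coneExt, this])
    (fun y v => by rw [hAv, hAv, spatialProj_apply]; rfl)
    (fun c hc y hy => by
      have h := hfh c _ _ hc (toCone_smul hc hy)
      ext v
      rw [smul_apply, hAv, hAv, coneExt, coneExt, h]
      simp only [Pi.smul_apply, smul_eq_mul]; ring)
    (fun y hy => by
      have h := hfo (toCone y)
      rw [η, hf0, toCone_apply hy (i := 1) (by decide), toCone_apply hy (i := 2) (by decide),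
        toCone_apply hy (i := 3) (by decide)] at h
      rw [hAv, coneExt]; linarith)
  have hl : ∀ l : Cone, 0 < spatial l.1 := fun l => by rw [spatial_cone]; exact l.2.1
  have hφc : SmoothCone fun l => φ l.1 := hφs.comp contDiffOn_toCone fun y _ => spatial_toCone y
  refine ⟨fun l => φ l.1, hφc, ?_, fun l a => ?_⟩
  · intro μ l l' hμ e
    rw [zpow_zero, one_smul]
    change φ l'.1 = φ l.1
    rw [e]
    have hd : ∀ t : ℝ, HasDerivAt (fun t => φ (Real.exp t • l.1)) 0 t := fun t => by
      have hp : 0 < spatial (Real.exp t • l.1) := by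
        rw [spatial_smul (Real.exp_pos t).le]; exact mul_pos (Real.exp_pos t) (hl l)
      have h := (hφ _ hp).comp_hasDerivAt t ((Real.hasDerivAt_exp t).smul_const l.1)
      refine h.congr_deriv ?_
      have e1 : toCone (Real.exp t • l.1) = ⟨Real.exp t • l.1, by
          simp only [Pi.smul_apply, smul_eq_mul, η_smul_left, η_smul_right, l.2.2, mul_zero, and_true]
          exact mul_pos (Real.exp_pos t) l.2.1⟩ := toCone_coe ⟨Real.exp t • l.1, _⟩
      have h2 := hfo (toCone (Real.exp t • l.1))
      rw [η, hf0, e1] at h2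
      rw [hAv, coneExt, e1]; simp only at h2; linarith
    have h := is_const_of_deriv_eq_zero (fun t => (hd t).differentiableAt) (fun t => (hd t).deriv)
      (Real.log μ) 0
    simpa [Real.exp_log hμ] using h
  · by_cases ha : a = 0
    · subst ha
      rw [pd_time hφc, mul_zero, hf0]
    · have hT : DifferentiableAt ℝ (fun y => (toCone y).1) l.1 :=
        (contDiffOn_toCone.differentiableOn (by simp)).differentiableAt (isOpen_spatial.mem_nhds (hl l))
      have h1 : HasFDerivAt φ (A l.1) ((fun y => (toCone y).1) l.1) := by
        change HasFDerivAt φ (A l.1) (toCone l.1).1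
        rw [toCone_coe]; exact hφ _ (hl l)
      have h2 := (h1.comp l.1 hT.hasFDerivAt).fderiv
      have h3 : pd a (fun l => φ l.1) l = A l.1 (pd a (fun l => l.1) l) :=
        congrArg (fun L : Mink →L[ℝ] ℝ => L (Pi.single a 1)) h2
      have hid : SmoothCone fun l => l.1 := contDiffOn_toCone
      rw [h3, hAv, pd_apply hid, pd_apply hid, pd_apply hid, pd_coord a (i := 1) (by decide),
        pd_coord a (i := 2) (by decide), pd_coord a (i := 3) (by decide), coneExt, toCone_coe, metric, if_neg ha]
      fin_cases a
      · exact absurd rfl ha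
      all_goals simp

end

/-! ### The classes of the derivatives of test functions -/

theorem integral_mul_sign_eq {a b a' b' : ℝ → ℝ} {am bm C D : ℝ}
    (ha : ∀ s, HasDerivAt a (a' s) s) (hb : ∀ s, HasDerivAt b (b' s) s)
    (ia : Integrable a') (ib : Integrable b') (ta : Tendsto a atTop (𝓝 0)) (tb : Tendsto b atTop (𝓝 0))
    (ta' : Tendsto a atBot (𝓝 am)) (tb' : Tendsto b atBot (𝓝 bm)) (hC : ∀ s, |a s| ≤ C)
    (hD : ∀ s, |b s| ≤ D) :
    Integrable (fun p : ℝ × ℝ => a' p.1 * b' p.2 * Real.sign (p.1 - p.2)) ∧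
    Integrable (fun s => a' s * b s - b' s * a s) ∧
    ∫ p : ℝ × ℝ, a' p.1 * b' p.2 * Real.sign (p.1 - p.2) = ∫ s, (a' s * b s - b' s * a s) := by
  have ca : Continuous a := continuous_iff_continuousAt.2 fun s => (ha s).continuousAt
  have cb : Continuous b := continuous_iff_continuousAt.2 fun s => (hb s).continuousAt
  have i1 : Integrable fun s => a' s * b s :=
    ia.mul_bdd (c := D) cb.aestronglyMeasurable (Eventually.of_forall hD)
  have i2 : Integrable fun s => b' s * a s :=
    ib.mul_bdd (c := C) ca.aestronglyMeasurable (Eventually.of_forall hC)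
  have i3 : Integrable fun p : ℝ × ℝ => a' p.1 * b' p.2 * Real.sign (p.1 - p.2) := by
    refine Integrable.mul_bdd (c := 1) (ia.mul_prod ib)
      (measurable_sign.comp (measurable_fst.sub measurable_snd)).aestronglyMeasurable
      (Eventually.of_forall fun p => abs_sign_le _)
  refine ⟨i3, i1.sub i2, ?_⟩
  have hin : ∀ τ, ∫ s, b' s * Real.sign (τ - s) = 2 * b τ - bm := by
    intro τ
    have is : Integrable fun s => b' s * Real.sign (τ - s) :=
      ib.mul_bdd (c := 1) (measurable_sign.comp (measurable_const.sub measurable_id)).aestronglyMeasurable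
        (Eventually.of_forall fun p => abs_sign_le _)
    rw [← integral_add_compl (measurableSet_Iic (a := τ)) is, Set.compl_Iic]
    have e1 : ∫ s in Set.Iic τ, b' s * Real.sign (τ - s) = ∫ s in Set.Iic τ, b' s := by
      rw [integral_Iic_eq_integral_Iio, integral_Iic_eq_integral_Iio]
      refine setIntegral_congr_fun measurableSet_Iio fun s hs => ?_
      rw [Real.sign_of_pos (sub_pos.2 hs), mul_one]
    have e2 : ∫ s in Set.Ioi τ, b' s * Real.sign (τ - s) = -∫ s in Set.Ioi τ, b' s := by
      rw [← integral_neg]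
      refine setIntegral_congr_fun measurableSet_Ioi fun s hs => ?_
      change b' s * Real.sign (τ - s) = -b' s
      rw [Real.sign_of_neg (sub_neg.2 hs), mul_neg_one]
    rw [e1, e2, integral_Iic_of_hasDerivAt_of_tendsto' (fun s _ => hb s) ib.integrableOn tb',
      integral_Ioi_of_hasDerivAt_of_tendsto' (fun s _ => hb s) ib.integrableOn tb]
    ring
  have e3 : ∫ p : ℝ × ℝ, a' p.1 * b' p.2 * Real.sign (p.1 - p.2) =
      ∫ τ, (2 * (a' τ * b τ) - bm * a' τ) := by
    rw [Measure.volume_eq_prod, integral_prod _ i3]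
    refine integral_congr_ae (Eventually.of_forall fun τ => ?_)
    simp only [mul_assoc]
    rw [integral_const_mul, hin]; ring
  have e4 : ∫ s, (b s * a' s + b' s * a s) = 0 - bm * am := by
    refine integral_of_hasDerivAt_of_tendsto (f := fun s => b s * a s)
      (fun s => ((hb s).mul (ha s)).congr_deriv (by ring)) ?_ (tb'.mul ta') (by simpa using tb.mul ta)
    simp only [mul_comm (b _)]
    exact i1.add i2
  have e5 : ∫ s, a' s = 0 - am := integral_of_hasDerivAt_of_tendsto ha ia ta' ta
  simp only [mul_comm (b _)] at e4
  rw [integral_add i1 i2] at e4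
  rw [e3, integral_sub (i1.const_mul 2) (ia.const_mul bm), integral_const_mul, integral_const_mul,
    integral_sub i1 i2, e5]
  linarith

theorem integral_sub_sub_sub {X : Type} [MeasurableSpace X] {m : Measure X} {f : Fin 4 → X → ℝ}
    (h : ∀ a, Integrable (f a) m) : ∫ x, (f 0 x - f 1 x - f 2 x - f 3 x) ∂m =
      ∫ x, f 0 x ∂m - ∫ x, f 1 x ∂m - ∫ x, f 2 x ∂m - ∫ x, f 3 x ∂m := by
  have h1 := integral_sub ((h 0).sub (h 1)) (h 2)
  have h2 := integral_sub (((h 0).sub (h 1)).sub (h 2)) (h 3)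
  simp only [Pi.sub_apply] at h1 h2
  rw [h2, h1, integral_sub (h 0) (h 1)]

namespace TestV

theorem hom (V : TestV) : Homogeneous (-1) V.1 := V.2.1

theorem dot_hom (V : TestV) : Homogeneous (-2) (dot V.1) := by
  intro μ l l' hμ e s
  have h1 : HasDerivAt (fun s => V.1 (μ * s) l') (μ • dot V.1 (μ * s) l') s := by
    have := ((smooth V).hasDerivAt (μ * s) l').scomp s ((hasDerivAt_id s).const_mul μ)
    rw [mul_one] at this
    exact this
  have h2 : (fun s => V.1 (μ * s) l') = fun s => μ ^ (-1 : ℤ) • V.1 s l :=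
    funext fun s => (hom V) μ l l' hμ e s
  rw [h2] at h1
  have h3 := h1.unique (((smooth V).hasDerivAt s l).const_smul (μ ^ (-1 : ℤ)))
  rw [← one_smul ℝ (dot V.1 (μ * s) l'), ← inv_mul_cancel₀ hμ.ne', mul_smul, h3, smul_smul,
    show (-2 : ℤ) = -1 + -1 by norm_num, zpow_add₀ hμ.ne', zpow_neg_one]

theorem dot_mem (V : TestV) : dot V.1 ∈ preT := by
  obtain ⟨ε, hε, C, hC⟩ := dot_bound V
  refine ⟨dot_hom V, (smooth V).dot.continuous_onSec.measurable, dot_orth V, ε, hε, fun a => ?_⟩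
  refine (((integrable_inv_weight hε).const_mul (C ^ 2)).comp_snd dl).mono'
    (((continuous_dot_eval V a).pow 2).mul
      ((continuous_weight ε).comp continuous_snd)).aestronglyMeasurable (Eventually.of_forall fun p => ?_)
  have w := weight_pos ε p.2
  rw [Real.norm_eq_abs, abs_of_nonneg (mul_nonneg (sq_nonneg _) w.le)]
  have h1 : dot V.1 p.2 (sec p.1) a ^ 2 ≤ (C * (weight ε p.2)⁻¹) ^ 2 := by
    rw [← sq_abs]
    exact pow_le_pow_left₀ (abs_nonneg _) (hC _ _ _) 2
  calc _ ≤ (C * (weight ε p.2)⁻¹) ^ 2 * weight ε p.2 := mul_le_mul_of_nonneg_right h1 w.le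
    _ = C ^ 2 * (weight ε p.2)⁻¹ := by field_simp

/-- The derivative of a test function. -/
def dotPre (V : TestV) : preT := ⟨dot V.1, dot_mem V⟩

theorem dotPre_add (V W : TestV) : dotPre (V + W) = dotPre V + dotPre W := Subtype.ext (dot_add' V W)

/-- The limit of a test function at `-∞`. -/
def past (V : TestV) : Cone → Mink := V.2.2.2.2.2.2.choose

theorem tendsto_past (V : TestV) (l : Cone) : Tendsto (fun s => V.1 s l) atBot (𝓝 (past V l)) :=
  V.2.2.2.2.2.2.choose_spec.1 l

theorem smooth_past (V : TestV) : SmoothCone (past V) := V.2.2.2.2.2.2.choose_spec.2.1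

theorem closed_past (V : TestV) (a b c : Fin 4) (l : Cone) : metric c * Lop a b (past V) l c +
    metric a * Lop b c (past V) l a + metric b * Lop c a (past V) l b = 0 :=
  V.2.2.2.2.2.2.choose_spec.2.2 a b c l

theorem hom_past (V : TestV) : ConeHomogeneous (-1) (past V) := by
  intro μ l l' hμ e
  have h1 : Tendsto (fun s => V.1 (μ * s) l') atBot (𝓝 (past V l')) :=
    (tendsto_past V l').comp (tendsto_id.const_mul_atBot hμ)
  have h2 : (fun s => V.1 (μ * s) l') = fun s => μ ^ (-1 : ℤ) • V.1 s l :=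
    funext fun s => (hom V) μ l l' hμ e s
  rw [h2] at h1
  exact tendsto_nhds_unique h1 ((tendsto_past V l).const_smul _)

theorem orth_past (V : TestV) (l : Cone) : η l.1 (past V l) = 0 := by
  have hc : Continuous fun x : Mink => η l.1 x := continuous_η.comp (continuous_const.prodMk continuous_id)
  have h := (hc.tendsto _).comp (tendsto_past V l)
  have h2 : ((fun x : Mink => η l.1 x) ∘ fun s => V.1 s l) = fun _ => 0 := funext fun s => orth V s l
  rw [h2] at h
  exact (tendsto_nhds_unique h tendsto_const_nhds)

/-- The limit at `-∞` as an element of `PreH0`. -/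
def pastH (V : TestV) : PreH0 := PreH0.ofSmooth (past V) (hom_past V) (orth_past V) (smooth_past V)

theorem isGradient_pastH (V : TestV) : IsGradient (H0.mk (pastH V)) := by
  obtain ⟨φ, hφ, h0, hg⟩ := exists_potential (smooth_past V) (hom_past V) (orth_past V) (closed_past V)
  have ho : ∀ l, η l.1 (timeGauge (past V) l) = 0 := fun l => by
    have := η_add_right l.1 (past V l) (-(past V l 0 * (l.1 0)⁻¹) • l.1)
    rw [neg_smul, ← sub_eq_add_neg, orth_past, ← neg_smul, η_smul_right, l.2.2, mul_zero, add_zero] at this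
    exact this
  have hh : ConeHomogeneous (-1) (timeGauge (past V)) := fun μ l l' hμ e => by
    have h1 := hom_past V μ l l' hμ e
    rw [zpow_neg_one] at h1 ⊢
    rw [timeGauge, timeGauge, h1, e, smul_sub, smul_smul, smul_smul]
    simp only [Pi.smul_apply, smul_eq_mul, mul_inv]
    congr 2
    have := l.2.1.ne'
    field_simp
  refine ⟨φ, hφ, h0, PreH0.ofSmooth _ hh ho (smoothCone_timeGauge (smooth_past V)), ?_, hg⟩
  rw [← sub_eq_zero]
  refine H0.mk_eq_zero_of_ae (f := PreH0.ofSmooth _ hh ho (smoothCone_timeGauge (smooth_past V)) - pastH V)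
    (Eventually.of_forall fun n => ⟨-(past V (sec n) 0 * ((sec n).1 0)⁻¹), ?_⟩)
  change timeGauge (past V) (sec n) - past V (sec n) = _
  rw [timeGauge, neg_smul]; abel

theorem integrable_dot (V : TestV) (n : S2) (a : Fin 4) : Integrable fun s => dot V.1 s (sec n) a := by
  obtain ⟨ε, hε, C, hC⟩ := dot_bound V
  exact ((integrable_inv_weight hε).const_mul C).mono'
    (((continuous_dot_eval V a).comp
      (continuous_const.prodMk continuous_id : Continuous fun s : ℝ => (n, s))).aestronglyMeasurable)
    (Eventually.of_forall fun s => hC s n a)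

theorem hasDerivAt_eval (V : TestV) (s : ℝ) (l : Cone) (a : Fin 4) :
    HasDerivAt (fun s => V.1 s l a) (dot V.1 s l a) s := hasDerivAt_pi.1 ((smooth V).hasDerivAt s l) a

theorem tendsto_future (V : TestV) (l : Cone) : Tendsto (fun s => V.1 s l) atTop (𝓝 0) :=
  V.2.2.2.2.2.1 l

theorem p_dotPre (V : TestV) : p (T.mk (dotPre V)) = H0.mk (-((1 / (2 * Real.pi)) • pastH V)) := by
  rw [p_mk]
  refine H0.mk_eq_of_ae (Eventually.of_forall fun n => ?_)
  change (1 / (2 * Real.pi)) • ∫ s, dot V.1 s (sec n) = -((1 / (2 * Real.pi)) • past V (sec n))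
  rw [← smul_neg]
  congr 1
  ext a
  rw [integral_comp_eval (integrable_dot V n), integral_of_hasDerivAt_of_tendsto
    (fun s => hasDerivAt_eval V s (sec n) a) (integrable_dot V n a)
    (tendsto_pi_nhds.1 (tendsto_past V _) a) (tendsto_pi_nhds.1 (tendsto_future V _) a)]
  simp

theorem p_dotPre_mem (V : TestV) : p (T.mk (dotPre V)) ∈ HIRsub := by
  rw [p_dotPre]
  have h : H0.mk (pastH V) ∈ HIRsub :=
    Submodule.le_topologicalClosure _ (Submodule.subset_span (isGradient_pastH V))
  exact HIRsub.neg_mem (HIRsub.smul_mem (1 / (2 * Real.pi)) h)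

/-- The element of `Lhat` given by the derivative of a test function. -/
def cls : TestV →+ Lhat :=
  AddMonoidHom.mk' (fun V => ⟨T.mk (dotPre V), p_dotPre_mem V⟩) fun V W =>
    Subtype.ext (by change T.mk _ = T.mk _ + T.mk _; rw [dotPre_add]; rfl)

theorem isFieldClass_cls (V : TestV) : IsFieldClass V (cls V) := ⟨dotPre V, rfl, fun _ _ => rfl⟩

theorem eq_cls {V : TestV} {v : Lhat} (h : IsFieldClass V v) : v = cls V := by
  obtain ⟨u, h1, h2⟩ := h
  have : u = dotPre V := Subtype.ext (funext fun s => funext fun l => h2 s l)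
  exact Subtype.ext (by rw [h1, this]; rfl)

theorem isSmoothIR_cls (V : TestV) : IsSmoothIR (pIR (cls V)) :=
  ⟨-((1 / (2 * Real.pi)) • pastH V), (p_dotPre V).symm,
    ContDiffOn.neg (ContDiffOn.smul contDiffOn_const (smooth_past V))⟩

theorem sym_eq (V W : TestV) : symLhat.form (cls V) (cls W) = sym V W := by
  change symPre (dotPre V) (dotPre W) = sym V W
  rw [symPre_apply, sym_apply, integral_prod _ (integrable_ker V W),
    integral_prod _ (symKer_integrable (dotPre V) (dotPre W))]
  congr 1
  refine integral_congr_ae (Eventually.of_forall fun n => ?_)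
  obtain ⟨C, hC⟩ := bound V
  obtain ⟨D, hD⟩ := bound W
  have h := fun a => integral_mul_sign_eq (fun s => hasDerivAt_eval V s (sec n) a)
    (fun s => hasDerivAt_eval W s (sec n) a) (integrable_dot V n a) (integrable_dot W n a)
    (tendsto_pi_nhds.1 (tendsto_future V _) a) (tendsto_pi_nhds.1 (tendsto_future W _) a)
    (tendsto_pi_nhds.1 (tendsto_past V _) a) (tendsto_pi_nhds.1 (tendsto_past W _) a)
    (fun s => hC s n a) (fun s => hD s n a)
  have e1 : (fun q : ℝ × ℝ => symKer (dotPre V) (dotPre W) (n, q)) = fun q =>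
      dot V.1 q.1 (sec n) 0 * dot W.1 q.2 (sec n) 0 * Real.sign (q.1 - q.2) -
      dot V.1 q.1 (sec n) 1 * dot W.1 q.2 (sec n) 1 * Real.sign (q.1 - q.2) -
      dot V.1 q.1 (sec n) 2 * dot W.1 q.2 (sec n) 2 * Real.sign (q.1 - q.2) -
      dot V.1 q.1 (sec n) 3 * dot W.1 q.2 (sec n) 3 * Real.sign (q.1 - q.2) := by
    funext q; simp only [symKer, η, dotPre]; ring
  have e2 : (fun s => ker V W (n, s)) = fun s =>
      (dot V.1 s (sec n) 0 * W.1 s (sec n) 0 - dot W.1 s (sec n) 0 * V.1 s (sec n) 0) -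
      (dot V.1 s (sec n) 1 * W.1 s (sec n) 1 - dot W.1 s (sec n) 1 * V.1 s (sec n) 1) -
      (dot V.1 s (sec n) 2 * W.1 s (sec n) 2 - dot W.1 s (sec n) 2 * V.1 s (sec n) 2) -
      (dot V.1 s (sec n) 3 * W.1 s (sec n) 3 - dot W.1 s (sec n) 3 * V.1 s (sec n) 3) := by
    funext s; simp only [ker, η]; ring
  change ∫ q : ℝ × ℝ, symKer (dotPre V) (dotPre W) (n, q) = ∫ s, ker V W (n, s)
  rw [e1, e2]
  refine (integral_sub_sub_sub fun a => (h a).1).trans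
    (Eq.trans ?_ (integral_sub_sub_sub fun a => (h a).2.1).symm)
  rw [(h 0).2.2, (h 1).2.2, (h 2).2.2, (h 3).2.2]

theorem cls_gauge {e : ℝ} {V : TestV} (hV : V ∈ gauge e) : cls V = 0 := by
  obtain ⟨α, -, h, -⟩ := hV
  refine Subtype.ext ((Submodule.Quotient.mk_eq_zero _).2 ?_)
  change ∀ᵐ p ∂(dl.prod volume), ∃ c : ℝ, _
  refine Eventually.of_forall fun p => ⟨dot V.1 p.2 (sec p.1) 0, ?_⟩
  change dot V.1 p.2 (sec p.1) = _
  have h0 : ∀ s a, V.1 s (sec p.1) a = V.1 s (sec p.1) 0 * (sec p.1).1 a := fun s a => by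
    rw [h]; simp [sec_zero]
  ext a
  refine (hasDerivAt_eval V p.2 (sec p.1) a).unique ?_
  simp only [h0 _ a]
  exact (hasDerivAt_eval V p.2 (sec p.1) 0).mul_const _

end TestV

/-- The map from the classes of test functions to `Lhat`. -/
def LV.cls (e : ℝ) : LV e →+ Lhat :=
  QuotientAddGroup.lift (TestV.gauge e) TestV.cls fun _ hV => TestV.cls_gauge hV

theorem LV.form_cls (e : ℝ) (x y : LV e) :
    symLhat.form (LV.cls e x) (LV.cls e y) = (symLV e).form x y := by
  induction x using QuotientAddGroup.induction_on with
  | H V =>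
    induction y using QuotientAddGroup.induction_on with
    | H W => exact TestV.sym_eq V W

theorem LV.isSmoothIR_cls (e : ℝ) (x : LV e) : IsSmoothIR (pIR (LV.cls e x)) := by
  induction x using QuotientAddGroup.induction_on with
  | H V => exact TestV.isSmoothIR_cls V

/-! ### Decay of tangential derivatives under translations -/

section
variable {E : Type} [NormedAddCommGroup E] [NormedSpace ℝ E]

theorem spatial_pos (l : Cone) : 0 < spatial l.1 := by rw [spatial_cone]; exact l.2.1

theorem coneExt_coe {F : Type} (g : Cone → F) (l : Cone) : coneExt g l.1 = g l := by
  rw [coneExt, toCone_coe]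

theorem Smooth.hasFDerivAt {w : ℝ → Cone → E} (hw : Smooth w) (s : ℝ) (l : Cone) :
    HasFDerivAt (fun q : ℝ × Mink => coneExt (w q.1) q.2)
      ((fderiv ℝ (coneExt (w s)) l.1).comp (ContinuousLinearMap.snd ℝ ℝ Mink) +
        (ContinuousLinearMap.fst ℝ ℝ Mink).smulRight (IRQED.dot w s l)) (s, l.1) := by
  have h : DifferentiableAt ℝ (fun q : ℝ × Mink => coneExt (w q.1) q.2) (s, l.1) :=
    (hw.differentiableOn (by simp)).differentiableAt (isOpen_prod_spatial.mem_nhds (spatial_pos l))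
  have h1 := hw.hasDerivAt_ext s (spatial_pos l)
  simp only [coneExt_coe] at h1
  have h2 : HasFDerivAt (fun y : Mink => coneExt (w s) y) _ l.1 :=
    h.hasFDerivAt.comp (x := l.1) (f := fun y : Mink => (s, y)) (hasFDerivAt_prodMk_right s l.1)
  refine h.hasFDerivAt.congr_fderiv ?_
  rw [h2.fderiv, IRQED.dot, h1.deriv]
  ext v
  · simp; try exact map_zero (fderiv ℝ (fun q : ℝ × Mink => coneExt (w q.1) q.2) (s, l.1))
  · simp; try exact map_zero (fderiv ℝ (fun q : ℝ × Mink => coneExt (w q.1) q.2) (s, l.1))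

theorem smoothCone_η (x : Mink) : SmoothCone fun l => η x l.1 := by
  have hc : ∀ j : Fin 4, ContDiffOn ℝ ((⊤ : ℕ∞) : WithTop ℕ∞) (fun y => x j * (toCone y).1 j)
    {y | 0 < spatial y} := fun j => contDiffOn_const.mul (contDiffOn_pi.1 contDiffOn_toCone j)
  exact (((hc 0).sub (hc 1)).sub (hc 2)).sub (hc 3)

theorem pd_shift (x : Mink) {w : ℝ → Cone → E} (hw : Smooth w) (s : ℝ) (l : Cone) (a : Fin 4) :
    pd a (shift x w s) l = pd a (w (s - η x l.1)) l -
      pd a (fun l => η x l.1) l • dot w (s - η x l.1) l := by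
  have hX := smoothCone_η x
  have h1 : HasFDerivAt (fun y : Mink => (s - coneExt (fun l => η x l.1) y, y)) _ l.1 :=
    ((hX.differentiableAt l).hasFDerivAt.const_sub s).prodMk (hasFDerivAt_id l.1)
  have h2 := hw.hasFDerivAt (s - η x l.1) l
  have e : (s - η x l.1, l.1) = (fun y : Mink => (s - coneExt (fun l => η x l.1) y, y)) l.1 := by
    simp only [coneExt_coe]
  rw [e] at h2
  have h3 : HasFDerivAt (coneExt (shift x w s)) _ l.1 :=
    HasFDerivAt.comp (g := fun q : ℝ × Mink => coneExt (w q.1) q.2)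
      (f := fun y : Mink => (s - coneExt (fun l => η x l.1) y, y)) l.1 h2 h1
  rw [pd, h3.fderiv]
  simp only [ContinuousLinearMap.comp_apply, ContinuousLinearMap.prod_apply, add_apply,
    ContinuousLinearMap.smulRight_apply, ContinuousLinearMap.coe_fst', ContinuousLinearMap.coe_snd',
    neg_apply, neg_smul, ← sub_eq_add_neg]
  rfl

theorem Lop_shift (x : Mink) {w : ℝ → Cone → E} (hw : Smooth w) (s : ℝ) (a b : Fin 4) :
    Lop a b (shift x w s) = shift x (fun s l => Lop a b (w s) l -
      Lop a b (fun l => η x l.1) l • dot w s l) s := by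
  funext l
  simp only [Lop, pd_shift x hw, shift, smul_sub, sub_smul, smul_smul, smul_eq_mul]
  abel

theorem Smooth.shift {w : ℝ → Cone → E} (hw : Smooth w) (x : Mink) : Smooth (shift x w) := by
  have h : ContDiffOn ℝ ((⊤ : ℕ∞) : WithTop ℕ∞)
      (fun q : ℝ × Mink => (q.1 - coneExt (fun l => η x l.1) q.2, q.2)) {q | 0 < spatial q.2} :=
    (contDiffOn_fst.sub ((smoothCone_η x).comp contDiffOn_snd fun q hq => hq)).prodMk contDiffOn_snd
  exact ContDiffOn.comp (g := fun q : ℝ × Mink => coneExt (w q.1) q.2) hw h fun q hq => hq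

theorem Smooth.Lop {w : ℝ → Cone → E} (hw : Smooth w) (a b : Fin 4) :
    Smooth fun s => Lop a b (w s) := by
  have h := hw.fderiv_of_isOpen isOpen_prod_spatial (m := ((⊤ : ℕ∞) : WithTop ℕ∞)) (by simp)
  have hT : ContDiffOn ℝ ((⊤ : ℕ∞) : WithTop ℕ∞) (fun q : ℝ × Mink => (q.1, (toCone q.2).1))
      {q | 0 < spatial q.2} :=
    contDiffOn_fst.prodMk (contDiffOn_toCone.comp contDiffOn_snd fun q hq => hq)
  have hpd : ∀ a, Smooth fun s => IRQED.pd a (w s) := fun a => by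
    refine ((h.comp hT fun q _ => spatial_toCone q.2).clm_apply
      (contDiffOn_const (c := ((0 : ℝ), (Pi.single a 1 : Mink))))).congr fun q _ => ?_
    change fderiv ℝ (coneExt (w q.1)) (toCone q.2).1 (Pi.single a 1) = _
    simp only [Function.comp_apply, (hw.hasFDerivAt q.1 (toCone q.2)).fderiv]
    simp
  have hc : ∀ a, Smooth fun (_ : ℝ) l => metric a * l.1 a := fun a =>
    (smoothCone_coord a).comp contDiffOn_snd fun q hq => hq
  exact ContDiffOn.sub (ContDiffOn.smul (hc a) (hpd b)) (ContDiffOn.smul (hc b) (hpd a))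

theorem Smooth.iterL {w : ℝ → Cone → E} (hw : Smooth w) (I : List (Fin 4 × Fin 4)) :
    Smooth fun s => iterL I (w s) := by
  induction I with
  | nil => exact hw
  | cons p I ih => exact ih.Lop p.1 p.2

theorem Smooth.smulCone {w : ℝ → Cone → E} (hw : Smooth w) {c : Cone → ℝ} (hc : SmoothCone c) :
    Smooth fun s l => c l • w s l :=
  ContDiffOn.smul (hc.comp contDiffOn_snd fun q hq => hq) hw

theorem iterL_append (I J : List (Fin 4 × Fin 4)) (f : Cone → E) :
    iterL (I ++ J) f = iterL I (iterL J f) := List.foldr_append ..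

theorem pd_smul {c : Cone → ℝ} {f : Cone → E} (hc : SmoothCone c) (hf : SmoothCone f) (a : Fin 4)
    (l : Cone) : pd a (fun l => c l • f l) l = pd a c l • f l + c l • pd a f l := by
  have h : HasFDerivAt (coneExt fun l => c l • f l) _ l.1 :=
    (hc.differentiableAt l).hasFDerivAt.smul (hf.differentiableAt l).hasFDerivAt
  rw [pd, h.fderiv]
  simp only [coneExt, toCone_coe, add_apply, smul_apply, ContinuousLinearMap.smulRight_apply]
  rw [add_comm]; rfl

theorem Lop_smul {c : Cone → ℝ} {f : Cone → E} (hc : SmoothCone c) (hf : SmoothCone f)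
    (a b : Fin 4) : Lop a b (fun l => c l • f l) =
      (fun l => Lop a b c l • f l) + fun l => c l • Lop a b f l := by
  funext l
  simp only [Lop, pd_smul hc hf, Pi.add_apply, smul_add, sub_smul, smul_sub, smul_smul, smul_eq_mul,
    mul_comm (c l)]
  abel

theorem pd_homogeneous {d : ℤ} {w : ℝ → Cone → E} (hw : Smooth w) (hd : Homogeneous d w) {μ : ℝ}
    {l l' : Cone} (hμ : 0 < μ) (e : l'.1 = μ • l.1) (s : ℝ) (a : Fin 4) :
    μ • pd a (w (μ * s)) l' = μ ^ d • pd a (w s) l := by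
  have h1 : HasFDerivAt (coneExt (w (μ * s))) (fderiv ℝ (coneExt (w (μ * s))) l'.1) (μ • l.1) := by
    rw [← e]; exact ((hw.slice (μ * s)).differentiableAt l').hasFDerivAt
  have h2 := h1.comp l.1 ((hasFDerivAt_id l.1).const_smul μ)
  have h3 := ((hw.slice s).differentiableAt l).hasFDerivAt.const_smul (μ ^ d)
  have h4 := h2.unique (h3.congr_of_eventuallyEq (by
    filter_upwards [isOpen_spatial.mem_nhds (spatial_pos l)] with y hy
    exact hd μ _ _ hμ (toCone_smul hμ hy) s))
  have h5 := congrArg (fun L : Mink →L[ℝ] E => L (Pi.single a 1)) h4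
  simpa [pd] using h5

theorem Homogeneous.Lop {d : ℤ} {w : ℝ → Cone → E} (hw : Smooth w) (hd : Homogeneous d w)
    (a b : Fin 4) : Homogeneous d fun s => Lop a b (w s) := by
  intro μ l l' hμ e s
  have h := fun a => pd_homogeneous hw hd hμ e s a
  simp only [IRQED.Lop, e, Pi.smul_apply, smul_eq_mul, smul_sub]
  rw [smul_comm (μ ^ d), smul_comm (μ ^ d), ← h, ← h, smul_smul, smul_smul]
  congr 2 <;> ring

theorem Homogeneous.dot {d : ℤ} {w : ℝ → Cone → E} (hw : Smooth w) (hd : Homogeneous d w) :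
    Homogeneous (d - 1) (dot w) := by
  intro μ l l' hμ e s
  have h1 : HasDerivAt (fun s => w (μ * s) l') (μ • IRQED.dot w (μ * s) l') s := by
    have := (hw.hasDerivAt (μ * s) l').scomp s ((hasDerivAt_id s).const_mul μ)
    rw [mul_one] at this
    exact this
  have h2 : (fun s => w (μ * s) l') = fun s => μ ^ d • w s l := funext fun s => hd μ l l' hμ e s
  rw [h2] at h1
  have h3 := h1.unique ((hw.hasDerivAt s l).const_smul (μ ^ d))
  rw [← one_smul ℝ (IRQED.dot w (μ * s) l'), ← inv_mul_cancel₀ hμ.ne', mul_smul, h3, smul_smul,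
    sub_eq_add_neg, zpow_add₀ hμ.ne', zpow_neg_one, mul_comm]

/-- Euler's identity. -/
theorem euler {d : ℤ} {w : ℝ → Cone → E} (hw : Smooth w) (hd : Homogeneous d w) (s : ℝ) (l : Cone) :
    s • dot w s l = (d : ℝ) • w s l - ((l.1 1 * (l.1 0)⁻¹) • Lop 0 1 (w s) l +
      (l.1 2 * (l.1 0)⁻¹) • Lop 0 2 (w s) l + (l.1 3 * (l.1 0)⁻¹) • Lop 0 3 (w s) l) := by
  have hL : ∀ i : Fin 4, i ≠ 0 → (l.1 i * (l.1 0)⁻¹) • Lop 0 i (w s) l = l.1 i • pd i (w s) l := by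
    intro i hi
    rw [Lop, pd_time (hw.slice s), smul_zero, sub_zero, smul_smul]
    have := l.2.1.ne'
    simp only [metric, if_pos]
    congr 1; field_simp
  rw [hL 1 (by decide), hL 2 (by decide), hL 3 (by decide)]
  have h0 := fderiv_coneExt_eq_sum (hw.slice s) (spatial_pos l) l.1
  rw [toCone_coe] at h0
  rw [← h0, eq_sub_iff_add_eq]
  have h1 : HasDerivAt (fun t : ℝ => (t * s, t • l.1)) (s, l.1) 1 := by
    have a1 := (hasDerivAt_id (1 : ℝ)).mul_const s
    have a2 := (hasDerivAt_id (1 : ℝ)).smul_const l.1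
    rw [one_mul] at a1
    rw [one_smul] at a2
    exact a1.prodMk a2
  have h2 := hw.hasFDerivAt s l
  have e : (s, l.1) = (fun t : ℝ => (t * s, t • l.1)) 1 := by simp
  rw [e] at h2
  have h3 := h2.comp_hasDerivAt (1 : ℝ) h1
  have h4 : HasDerivAt (fun t : ℝ => t ^ d • w s l) (((d : ℝ) * 1 ^ (d - 1)) • w s l) 1 :=
    (hasDerivAt_zpow d 1 (Or.inl one_ne_zero)).smul_const _
  have h5 := h3.unique (h4.congr_of_eventuallyEq (by
    filter_upwards [lt_mem_nhds (zero_lt_one (α := ℝ))] with t ht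
    have hl := toCone_smul ht (spatial_pos l)
    rw [toCone_coe] at hl
    exact hd t l _ ht hl s))
  rw [one_zpow, mul_one] at h5
  rw [← h5]
  simp [add_comm]

/-- Integrable decay on the section `l⁰ = 1`. -/
def Decays (w : ℝ → Cone → E) : Prop := ∃ ε > 0, ∃ C : ℝ, ∀ s n, ‖w s (sec n)‖ ≤ C / weight ε s

theorem div_weight_mono {ε ε' C C' : ℝ} (h : ε' ≤ ε) (hC : C ≤ C') (h0 : 0 ≤ C') (s : ℝ) :
    C / weight ε s ≤ C' / weight ε' s :=
  (div_le_div_of_nonneg_right hC (weight_pos _ _).le).trans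
    (div_le_div_of_nonneg_left h0 (weight_pos _ _) (weight_mono h s))

theorem Decays.add {w v : ℝ → Cone → E} (hw : Decays w) (hv : Decays v) : Decays (w + v) := by
  obtain ⟨ε, hε, C, h⟩ := hw
  obtain ⟨δ, hδ, D, k⟩ := hv
  refine ⟨min ε δ, lt_min hε hδ, |C| + |D|, fun s n => ?_⟩
  rw [add_div]
  exact (norm_add_le _ _).trans (add_le_add
    ((h s n).trans (div_weight_mono (min_le_left _ _) (le_abs_self _) (abs_nonneg _) s))
    ((k s n).trans (div_weight_mono (min_le_right _ _) (le_abs_self _) (abs_nonneg _) s)))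

theorem Decays.smulCone {w : ℝ → Cone → E} (hw : Decays w) {c : Cone → ℝ} (hc : SmoothCone c) :
    Decays fun s l => c l • w s l := by
  obtain ⟨ε, hε, C, h⟩ := hw
  obtain ⟨D, hD⟩ := (isCompact_range hc.continuous_sec).isBounded.exists_norm_le
  refine ⟨ε, hε, |D| * C, fun s n => ?_⟩
  rw [norm_smul, mul_div_assoc]
  exact mul_le_mul ((hD _ ⟨n, rfl⟩).trans (le_abs_self _)) (h s n) (norm_nonneg _) (abs_nonneg _)

/-- Smooth functions all of whose tangential derivatives decay. -/
def DecaysAll (w : ℝ → Cone → E) : Prop :=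
  Smooth w ∧ ∀ I : List (Fin 4 × Fin 4), Decays fun s => iterL I (w s)

theorem DecaysAll.add {w v : ℝ → Cone → E} (hw : DecaysAll w) (hv : DecaysAll v) :
    DecaysAll (w + v) := by
  refine ⟨hw.1.add hv.1, fun I => ?_⟩
  have : (fun s => iterL I ((w + v) s)) = (fun s => iterL I (w s)) + fun s => iterL I (v s) :=
    funext fun s => iterL_add (hw.1.slice s) (hv.1.slice s) I
  rw [this]
  exact (hw.2 I).add (hv.2 I)

theorem DecaysAll.Lop {w : ℝ → Cone → E} (hw : DecaysAll w) (a b : Fin 4) :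
    DecaysAll fun s => Lop a b (w s) :=
  ⟨hw.1.Lop a b, fun I => by
    have : (fun s => IRQED.iterL I (IRQED.Lop a b (w s))) = fun s => IRQED.iterL (I ++ [(a, b)]) (w s) :=
      funext fun s => (iterL_append I [(a, b)] (w s)).symm
    rw [this]; exact hw.2 _⟩

theorem DecaysAll.smulCone {w : ℝ → Cone → E} (hw : DecaysAll w) {c : Cone → ℝ} (hc : SmoothCone c) :
    DecaysAll fun s l => c l • w s l := by
  refine ⟨hw.1.smulCone hc, fun I => ?_⟩
  induction I using List.reverseRecOn generalizing w c with
  | nil => exact (hw.2 []).smulCone hc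
  | append_singleton I p ih =>
    have e : (fun s => iterL (I ++ [p]) fun l => c l • w s l) =
        (fun s => iterL I fun l => IRQED.Lop p.1 p.2 c l • w s l) +
          fun s => iterL I fun l => c l • IRQED.Lop p.1 p.2 (w s) l := funext fun s => by
      rw [iterL_append]
      change iterL I (IRQED.Lop p.1 p.2 fun l => c l • w s l) = _
      rw [Lop_smul hc (hw.1.slice s), iterL_add]
      · rfl
      · exact (hw.1.smulCone (hc.Lop p.1 p.2)).slice s
      · exact ((hw.1.Lop p.1 p.2).smulCone hc).slice s
    rw [e]
    exact (ih hw (hc.Lop p.1 p.2)).add (ih (hw.Lop p.1 p.2) hc)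

theorem smoothCone_const (r : ℝ) : SmoothCone fun _ => r := contDiffOn_const

theorem Lop_const (r : ℝ) (a b : Fin 4) : Lop a b (fun _ : Cone => r) = 0 := by
  have h : ∀ a l, pd a (fun _ : Cone => r) l = 0 := fun a l => by
    have : coneExt (fun _ : Cone => r) = fun _ => r := rfl
    rw [pd, this]; simp
  funext l
  simp [Lop, h]

theorem iterL_const_smul (r : ℝ) {f : Cone → E} (hf : SmoothCone f) (I : List (Fin 4 × Fin 4)) :
    iterL I (fun l => r • f l) = fun l => r • iterL I f l := by
  induction I with
  | nil => rfl
  | cons p I ih =>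
    change Lop p.1 p.2 (iterL I _) = _
    rw [ih, Lop_smul (smoothCone_const r) (hf.iterL I), Lop_const]
    funext l; simp; rfl

theorem DecaysAll.dot {d : ℤ} {w : ℝ → Cone → E} (hw : DecaysAll w) (hd : Homogeneous d w) :
    DecaysAll (dot w) := by
  refine ⟨hw.1.dot, fun I => ?_⟩
  have hr : ∀ i : Fin 4, SmoothCone fun l => l.1 i * (l.1 0)⁻¹ := fun i =>
    ContDiffOn.mul (contDiffOn_pi.1 contDiffOn_toCone i)
      (ContDiffOn.inv smoothCone_time fun y _ => (toCone y).2.1.ne')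
  have hr' : ∀ i : Fin 4, SmoothCone fun l => -(l.1 i * (l.1 0)⁻¹) := fun i => ContDiffOn.neg (hr i)
  set v : ℝ → Cone → E := (fun s l => (d : ℝ) • w s l) +
    ((fun s l => (-(l.1 1 * (l.1 0)⁻¹)) • IRQED.Lop 0 1 (w s) l) +
    ((fun s l => (-(l.1 2 * (l.1 0)⁻¹)) • IRQED.Lop 0 2 (w s) l) +
    fun s l => (-(l.1 3 * (l.1 0)⁻¹)) • IRQED.Lop 0 3 (w s) l)) with hv
  have hvd : DecaysAll v := (hw.smulCone (smoothCone_const d)).add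
    (((hw.Lop 0 1).smulCone (hr' 1)).add (((hw.Lop 0 2).smulCone (hr' 2)).add
      ((hw.Lop 0 3).smulCone (hr' 3))))
  have e : ∀ s, (fun l => s • IRQED.dot w s l) = v s := fun s => funext fun l => by
    rw [euler hw.1 hd, hv]
    simp only [Pi.add_apply, neg_smul]; abel
  obtain ⟨ε, hε, C, hC⟩ := hvd.2 I
  have hcont := (hw.1.dot.iterL I).continuous_onSec
  obtain ⟨D, hD⟩ := ((isCompact_univ (X := S2)).prod (isCompact_Icc (a := (-1 : ℝ)) (b := 1))).image
    hcont |>.isBounded.exists_norm_le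
  have hD' : ∀ s n, |s| ≤ 1 → ‖iterL I (IRQED.dot w s) (sec n)‖ ≤ D := fun s n hs =>
    hD _ ⟨(n, s), ⟨trivial, abs_le.1 hs⟩, rfl⟩
  refine ⟨ε, hε, max |C| (|D| * 2 ^ (1 + ε)), fun s n => ?_⟩
  have hw0 := weight_pos ε s
  rcases le_total |s| 1 with hs | hs
  · rw [le_div_iff₀ hw0]
    refine le_trans ?_ (le_max_right _ _)
    refine mul_le_mul ((hD' s n hs).trans (le_abs_self _)) ?_ hw0.le (abs_nonneg _)
    exact Real.rpow_le_rpow (by positivity) (by linarith) (by linarith)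
  · have h1 := hC s n
    simp only [← e] at h1
    rw [iterL_const_smul _ (hw.1.dot.slice s), norm_smul, Real.norm_eq_abs] at h1
    calc _ ≤ |s| * ‖iterL I (IRQED.dot w s) (sec n)‖ := le_mul_of_one_le_left (norm_nonneg _) hs
      _ ≤ _ := h1.trans (div_le_div_of_nonneg_right ((le_abs_self _).trans (le_max_left _ _)) hw0.le)

theorem Decays.shift {w : ℝ → Cone → E} (hw : Decays w) (x : Mink) : Decays (shift x w) := by
  obtain ⟨ε, hε, C, h⟩ := hw
  refine ⟨ε, hε, |C| * (1 + (|x 0| + |x 1| + |x 2| + |x 3|)) ^ (1 + ε), fun s n => ?_⟩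
  have h1 := weight_shift ε hε (|x 0| + |x 1| + |x 2| + |x 3|) s (η x (sec n).1)
    (abs_η_sec_le x n)
  refine (h _ n).trans ?_
  rw [div_le_div_iff₀ (weight_pos _ _) (weight_pos _ _)]
  calc C * weight ε s ≤ |C| * weight ε s := mul_le_mul_of_nonneg_right (le_abs_self _) (weight_pos _ _).le
    _ ≤ _ := by rw [mul_assoc]; exact mul_le_mul_of_nonneg_left h1 (abs_nonneg _)

theorem DecaysAll.shift {d : ℤ} {w : ℝ → Cone → E} (hw : DecaysAll w) (hd : Homogeneous d w)
    (x : Mink) : DecaysAll (shift x w) := by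
  refine ⟨hw.1.shift x, fun I => ?_⟩
  induction I using List.reverseRecOn generalizing w with
  | nil => exact (hw.2 []).shift x
  | append_singleton I p ih =>
    have hc : SmoothCone (IRQED.Lop p.1 p.2 fun l => η x l.1) := (smoothCone_η x).Lop p.1 p.2
    have hc' : SmoothCone (-IRQED.Lop p.1 p.2 fun l => η x l.1) := ContDiffOn.neg hc
    have e : (fun s => iterL (I ++ [p]) (IRQED.shift x w s)) = fun s => iterL I (IRQED.shift x
        ((fun s l => IRQED.Lop p.1 p.2 (w s) l) +
          fun s l => (-IRQED.Lop p.1 p.2 fun l => η x l.1) l • IRQED.dot w s l) s) := funext fun s => by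
      rw [iterL_append]
      change iterL I (IRQED.Lop p.1 p.2 (IRQED.shift x w s)) = _
      rw [Lop_shift x hw.1]
      congr 1; funext l
      simp only [IRQED.shift, Pi.add_apply, Pi.neg_apply, neg_smul, sub_eq_add_neg]
    rw [e]
    refine ih ((hw.Lop p.1 p.2).add ((hw.dot hd).smulCone hc')) ?_
    have hx : Homogeneous 1 fun (_ : ℝ) l => η x l.1 := fun μ l l' _ e s => by
      simp only [e, η_smul_right, zpow_one, smul_eq_mul]
    have hxs : Smooth fun (_ : ℝ) l => η x l.1 := (smoothCone_η x).comp contDiffOn_snd fun q hq => hq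
    intro μ l l' hμ e s
    have h1 := (hd.Lop hw.1 p.1 p.2) μ l l' hμ e s
    have h2 := (hd.dot hw.1) μ l l' hμ e s
    have h3 := (hx.Lop hxs p.1 p.2) μ l l' hμ e s
    simp only at h1 h3
    simp only [Pi.add_apply, Pi.neg_apply, h1, h2, h3, smul_add, smul_smul, neg_smul, smul_neg,
      smul_eq_mul, zpow_one]
    congr 3
    rw [zpow_sub_one₀ hμ.ne']; field_simp

end

namespace TestV

theorem decaysAll_dot (V : TestV) : DecaysAll (dot V.1) := by
  refine ⟨(smooth V).dot, fun I => ?_⟩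
  obtain ⟨ε, hε, C, hC⟩ := V.2.2.2.2.1 I.length
  refine ⟨ε, hε, |C|, fun s n => ?_⟩
  have h0 : 0 ≤ |C| / weight ε s := div_nonneg (abs_nonneg _) (weight_pos _ _).le
  rw [pi_norm_le_iff_of_nonneg h0]
  intro a
  have := hC I rfl s (sec n) a
  rw [sec_zero, div_one, one_pow, one_mul] at this
  exact this.trans (div_le_div_of_nonneg_right (le_abs_self _) (weight_pos _ _).le)

end TestV

theorem Homogeneous.iterL {E : Type} [NormedAddCommGroup E] [NormedSpace ℝ E] {d : ℤ}
    {w : ℝ → Cone → E} (hw : Smooth w) (hd : Homogeneous d w) (I : List (Fin 4 × Fin 4)) :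
    Homogeneous d fun s => iterL I (w s) := by
  induction I with
  | nil => exact hd
  | cons p I ih => exact ih.Lop (hw.iterL I) p.1 p.2

theorem exists_eq_smul_sec (l : Cone) : ∃ n : S2, l.1 = l.1 0 • (sec n).1 := by
  have hl := l.2.1
  have hs : spatial l.1 = l.1 0 := spatial_cone l
  have h3 := spatial_sq l.1
  rw [hs] at h3
  refine ⟨⟨!₂[l.1 1 / l.1 0, l.1 2 / l.1 0, l.1 3 / l.1 0], ?_⟩, ?_⟩
  · rw [mem_sphere_zero_iff_norm, EuclideanSpace.norm_eq, Real.sqrt_eq_one, Fin.sum_univ_three]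
    simp only [Real.norm_eq_abs, sq_abs, Matrix.cons_val]
    field_simp
    linarith
  · ext i
    fin_cases i <;> simp [sec] <;> field_simp

theorem fallsOff_of_decaysAll {V : ℝ → Cone → Mink} (h : DecaysAll (dot V))
    (hd : Homogeneous (-2) (dot V)) : FallsOff V := by
  intro k
  have hfin : {I : List (Fin 4 × Fin 4) | I.length = k}.Finite := List.finite_length_eq _ k
  have key : ∀ S : Set (List (Fin 4 × Fin 4)), S.Finite → ∃ ε > 0, ∃ C : ℝ, 0 ≤ C ∧ ∀ I ∈ S, ∀ s n,
      ‖iterL I (dot V s) (sec n)‖ ≤ C / weight ε s := by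
    intro S hS
    induction S, hS using Set.Finite.induction_on with
    | empty => exact ⟨1, one_pos, 0, le_rfl, fun I hI => absurd hI (Set.notMem_empty I)⟩
    | @insert I S _ _ ih =>
      obtain ⟨ε, hε, C, hC, h1⟩ := ih
      obtain ⟨δ, hδ, D, h2⟩ := h.2 I
      have h0 : 0 ≤ C + |D| := add_nonneg hC (abs_nonneg D)
      refine ⟨min ε δ, lt_min hε hδ, C + |D|, h0, ?_⟩
      rintro J (rfl | hJ) s n
      · exact (h2 s n).trans (div_weight_mono (min_le_right _ _) (by linarith [le_abs_self D]) h0 s)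
      · exact (h1 J hJ s n).trans (div_weight_mono (min_le_left _ _) (by linarith [abs_nonneg D]) h0 s)
  obtain ⟨ε, hε, C, -, hC⟩ := key _ hfin
  refine ⟨ε, hε, C, fun I hI s l a => ?_⟩
  have hl := l.2.1
  obtain ⟨n, hn⟩ := exists_eq_smul_sec l
  have h1 := (hd.iterL h.1 I) (l.1 0) (sec n) l hl hn (s / l.1 0)
  rw [mul_div_cancel₀ s hl.ne'] at h1
  simp only at h1
  rw [h1, Pi.smul_apply, smul_eq_mul, abs_mul, abs_of_pos (zpow_pos hl _)]
  have h2 := (norm_le_pi_norm (iterL I (dot V (s / l.1 0)) (sec n)) a).trans (hC I hI (s / l.1 0) n)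
  rw [Real.norm_eq_abs] at h2
  calc _ ≤ l.1 0 ^ (-2 : ℤ) * (C / weight ε (s / l.1 0)) :=
        mul_le_mul_of_nonneg_left h2 (zpow_pos hl _).le
    _ = _ := by
      rw [zpow_neg, div_mul_eq_div_div, div_eq_mul_inv C, ← div_eq_inv_mul, div_right_comm]
      norm_cast

/-! ### Translations of the algebra CCR -/

theorem dot_shift {E : Type} [NormedAddCommGroup E] [NormedSpace ℝ E] (x : Mink) (V : ℝ → Cone → E) :
    dot (shift x V) = shift x (dot V) := by
  funext s l
  exact deriv_comp_sub_const (fun s => V s l) (η x l.1) s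

theorem Homogeneous.shift {E : Type} [SMul ℝ E] {d : ℤ} {V : ℝ → Cone → E} (h : Homogeneous d V)
    (x : Mink) : Homogeneous d (shift x V) := fun μ l l' hμ e s => by
  have := h μ l l' hμ e (s - η x l.1)
  rw [mul_sub] at this
  simp only [IRQED.shift, e, η_smul_right, this]

namespace TestV

theorem shift_mem (x : Mink) (V : TestV) : shift x V.1 ∈ TestV := by
  have hb : ∀ l : Cone, Tendsto (fun s => s - η x l.1) atBot atBot := fun l =>
    tendsto_atBot_add_const_right _ _ tendsto_id
  have ht : ∀ l : Cone, Tendsto (fun s => s - η x l.1) atTop atTop := fun l =>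
    tendsto_atTop_add_const_right _ _ tendsto_id
  refine ⟨(hom V).shift x, (smooth V).shift x, fun s l => orth V _ l, ?_,
    fun l => (tendsto_future V l).comp (ht l), past V, fun l => (tendsto_past V l).comp (hb l),
    smooth_past V, closed_past V⟩
  refine fallsOff_of_decaysAll ?_ ?_
  · rw [dot_shift]; exact (decaysAll_dot V).shift (dot_hom V) x
  · rw [dot_shift]; exact (dot_hom V).shift x

/-- Translations of test functions. -/
def shift (x : Mink) : TestV →+ TestV :=
  AddMonoidHom.mk' (fun V => ⟨IRQED.shift x V.1, shift_mem x V⟩) fun _ _ => rfl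

theorem shift_gauge {e : ℝ} (x : Mink) : gauge e ≤ (gauge e).comap (shift x) := by
  rintro V ⟨α, αm, h1, h2, n, h3⟩
  exact ⟨IRQED.shift x α, αm, fun s l => h1 _ l, fun l => (h2 l).comp
    (tendsto_atBot_add_const_right _ _ tendsto_id), n, h3⟩

theorem cls_shift (x : Mink) (V : TestV) : cls (shift x V) = shiftLhat x (cls V) := by
  have : dotPre (shift x V) = shiftPre x (dotPre V) := Subtype.ext (dot_shift x V.1)
  refine Subtype.ext ?_
  change T.mk (dotPre (shift x V)) = shiftT x (T.mk (dotPre V))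
  rw [this]; rfl

end TestV

/-- Translations of classes of test functions. -/
def LV.shift (e : ℝ) (x : Mink) : LV e →+ LV e :=
  QuotientAddGroup.map _ _ (TestV.shift x) (TestV.shift_gauge x)

theorem LV.cls_shift (e : ℝ) (x : Mink) (v : LV e) : LV.cls e (LV.shift e x v) = shiftLhat x (LV.cls e v) := by
  induction v using QuotientAddGroup.induction_on with
  | H V => exact TestV.cls_shift x V

theorem LV.form_shift (e : ℝ) (x : Mink) (v w : LV e) :
    (symLV e).form (LV.shift e x v) (LV.shift e x w) = (symLV e).form v w := by
  rw [← LV.form_cls, ← LV.form_cls, LV.cls_shift, LV.cls_shift]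
  exact symLhat_shift x _ _

theorem LV.shift_shift_neg (e : ℝ) (x : Mink) (v : LV e) : LV.shift e x (LV.shift e (-x) v) = v := by
  induction v using QuotientAddGroup.induction_on with
  | H V =>
    refine congrArg (QuotientAddGroup.mk) (a₁ := TestV.shift x (TestV.shift (-x) V)) (Subtype.ext ?_)
    funext s l
    change V.1 (s - η x l.1 - η (-x) l.1) l = V.1 s l
    have := η_smul_left (-1) x l.1
    rw [neg_one_smul] at this
    rw [this, neg_one_mul, sub_neg_eq_add, sub_add_cancel]

section
variable {G : Type} [AddCommGroup G] {σ : SymplecticForm G}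

/-- The automorphism of the Weyl algebra given by an automorphism of the group. -/
def WeylCStar.equiv (S S' : G →+ G) (hS : ∀ x y, σ.form (S x) (S y) = σ.form x y)
    (hS' : ∀ x y, σ.form (S' x) (S' y) = σ.form x y) (h : ∀ x, S (S' x) = x) (h' : ∀ x, S' (S x) = x) :
    WeylCStar σ ≃⋆ₐ[ℂ] WeylCStar σ :=
  StarAlgEquiv.ofStarAlgHom (WeylCStar.map S hS) (WeylCStar.map S' hS')
    (WeylCStar.hom_ext fun x => by
      change WeylCStar.map S' hS' (WeylCStar.map S hS (WeylCStar.W σ x)) = WeylCStar.W σ x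
      rw [WeylCStar.map_W, WeylCStar.map_W, h'])
    (WeylCStar.hom_ext fun x => by
      change WeylCStar.map S hS (WeylCStar.map S' hS' (WeylCStar.W σ x)) = WeylCStar.W σ x
      rw [WeylCStar.map_W, WeylCStar.map_W, h])

theorem WeylCStar.equiv_W (S S' : G →+ G) (hS : ∀ x y, σ.form (S x) (S y) = σ.form x y)
    (hS' : ∀ x y, σ.form (S' x) (S' y) = σ.form x y) (h : ∀ x, S (S' x) = x) (h' : ∀ x, S' (S x) = x)
    (x : G) : WeylCStar.equiv S S' hS hS' h h' (WeylCStar.W σ x) = WeylCStar.W σ (S x) :=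
  WeylCStar.map_W _ S hS x

variable {H : Type} [NormedAddCommGroup H] [InnerProductSpace ℂ H] [CompleteSpace H]

theorem WeylCStar.covariant {π : WeylCStar σ →⋆ₐ[ℂ] (H →L[ℂ] H)}
    {α : WeylCStar σ ≃⋆ₐ[ℂ] WeylCStar σ} {A B : H →L[ℂ] H}
    (h : ∀ x, π (α (WeylCStar.W σ x)) = A * π (WeylCStar.W σ x) * B) (a : WeylCStar σ) :
    π (α a) = A * π a * B := by
  have hα : Continuous α := WeylCStar.hom_continuous (α : WeylCStar σ →⋆ₐ[ℂ] WeylCStar σ)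
  refine WeylCStar.induction_W (P := fun a => π (α a) = A * π a * B)
    (isClosed_eq ((WeylCStar.hom_continuous π).comp hα)
      ((continuous_const.mul (WeylCStar.hom_continuous π)).mul continuous_const)) ?_ (fun a b h h' => ?_)
    (fun c a h => ?_) h a
  · rw [map_zero, map_zero, mul_zero, zero_mul]
  · rw [map_add, map_add, map_add, mul_add, add_mul, h, h']
  · rw [map_smul, map_smul, map_smul, mul_smul_comm, smul_mul_assoc, h]

theorem WeylCStar.exists_rep {U : G → H →L[ℂ] H} (h0 : U 0 = 1)
    (hm : ∀ x y, U x * U y = phase (σ.form x y) • U (x + y)) (hs : ∀ x, star (U x) = U (-x)) :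
    ∃ π : WeylCStar σ →⋆ₐ[ℂ] (H →L[ℂ] H), ∀ x, π (WeylCStar.W σ x) = U x :=
  WeylCStar.exists_hom h0 hm hs

end

/-- The translation automorphisms. -/
def CCR.translation (e : ℝ) (x : Mink) : CCR e ≃⋆ₐ[ℂ] CCR e :=
  WeylCStar.equiv (LV.shift e x) (LV.shift e (-x)) (LV.form_shift e x) (LV.form_shift e (-x))
    (LV.shift_shift_neg e x) fun v => by
      conv_lhs => rw [← neg_neg x]
      rw [neg_neg (-x)]
      exact LV.shift_shift_neg e (-x) v

theorem CCR.translation_W (e : ℝ) (x : Mink) (v : LV e) :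
    CCR.translation e x (WeylCStar.W (symLV e) v) = WeylCStar.W (symLV e) (LV.shift e x v) :=
  WeylCStar.equiv_W ..

theorem CCR.isTranslationAction (e : ℝ) : IsTranslationAction (CCR.translation e) := fun x V =>
  ⟨TestV.shift x V, rfl, CCR.translation_W e x _⟩

/-! ### The representation of CCR -/

section
variable {X : Type} [MeasurableSpace X] {K H : Type} [NormedAddCommGroup K] [InnerProductSpace ℂ K]
  [NormedAddCommGroup H] [InnerProductSpace ℂ H] {J : X → K →ₗᵢ[ℂ] H} {μ : Measure X}

theorem FieldSpace.op_ext {A B : FieldSpace J μ →L[ℂ] FieldSpace J μ}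
    (h : ∀ Ψ, ∃ Φ, FieldSpace.Represents (A (FieldSpace.mk Ψ)) Φ ∧
      FieldSpace.Represents (B (FieldSpace.mk Ψ)) Φ) : A = B := by
  refine ContinuousLinearMap.ext fun φ => ?_
  obtain ⟨Ψ, rfl⟩ := FieldSpace.mk_surjective φ
  obtain ⟨Φ, h1, h2⟩ := h Ψ
  exact h1.unique h2

theorem FieldSpace.represents_of_eq {A B : FieldSpace J μ →L[ℂ] FieldSpace J μ} (h : A = B)
    {Ψ : SqField J μ} {Φ : X → H} (hB : FieldSpace.Represents (B (FieldSpace.mk Ψ)) Φ) :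
    FieldSpace.Represents (A (FieldSpace.mk Ψ)) Φ := h ▸ hB

end

section
variable {H : Type} [NormedAddCommGroup H] [InnerProductSpace ℂ H] [CompleteSpace H]

theorem WeylCStar.implements_of {e : ℝ} {π : CCR e →⋆ₐ[ℂ] (H →L[ℂ] H)} {U : Mink → H →L[ℂ] H}
    {R : Lhat → H →L[ℂ] H} (hπ : ∀ v, π (WeylCStar.W (symLV e) v) = R (LV.cls e v))
    (h : ∀ x v, U x * R (LV.cls e v) * U (-x) = R (shiftLhat x (LV.cls e v))) : Implements π U := by
  refine ⟨CCR.translation e, CCR.isTranslationAction e, fun x => WeylCStar.covariant fun v => ?_⟩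
  rw [CCR.translation_W, hπ, hπ, h, LV.cls_shift]

theorem CCR.exists_rep {e : ℝ} {R : Lhat → H →L[ℂ] H} (h0 : R 0 = 1)
    (hm : ∀ v w, IsSmoothIR (pIR v) → IsSmoothIR (pIR w) →
      R v * R w = phase (symLhat.form v w) • R (v + w))
    (hs : ∀ v, IsSmoothIR (pIR v) → star (R v) = R (-v)) :
    ∃ π : CCR e →⋆ₐ[ℂ] (H →L[ℂ] H), ∀ v, π (WeylCStar.W (symLV e) v) = R (LV.cls e v) := by
  refine WeylCStar.exists_rep (U := fun v => R (LV.cls e v)) ?_ (fun x y => ?_) fun x => ?_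
  · rw [map_zero, h0]
  · rw [← LV.form_cls, map_add]
    exact hm _ _ (LV.isSmoothIR_cls e x) (LV.isSmoothIR_cls e y)
  · rw [map_neg]
    exact hs _ (LV.isSmoothIR_cls e x)

theorem CCR.rep_ext {e : ℝ} {π ρ : CCR e →⋆ₐ[ℂ] (H →L[ℂ] H)}
    (h : ∀ V, π (CCR.W e V) = ρ (CCR.W e V)) : π = ρ :=
  WeylCStar.hom_ext fun v => by
    induction v using QuotientAddGroup.induction_on with
    | H V => exact h V

theorem CCR.forall_W {e : ℝ} {π : CCR e →⋆ₐ[ℂ] (H →L[ℂ] H)} {R : Lhat → H →L[ℂ] H}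
    (h : ∀ V, π (CCR.W e V) = R (TestV.cls V)) (v : LV e) :
    π (WeylCStar.W (symLV e) v) = R (LV.cls e v) := by
  induction v using QuotientAddGroup.induction_on with
  | H V => exact h V

end

section
variable {e : ℝ} (h : Profile) {μ : Measure HIR}

theorem ActsBy.represents {π : CCR e →⋆ₐ[ℂ] (DirectIntegral h μ →L[ℂ] DirectIntegral h μ)}
    (hπ : ActsBy h μ π) (V : TestV) (Ψ : SqField (dress h) μ) :
    FieldSpace.Represents (π (CCR.W e V) (FieldSpace.mk Ψ)) fun f =>
      ((√((translate μ (pIR (TestV.cls V))).rnDeriv μ f).toReal : ℝ) : ℂ) •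
        What (TestV.cls V) (Ψ.fn (f - pIR (TestV.cls V))) := by
  exact (hπ V).elim fun v hv => by
    have h6 := TestV.eq_cls hv.1
    subst h6
    exact hv.2.2 Ψ

theorem existsUnique_actsFibrewise :
    ∃! U : Mink → DirectIntegral h μ →L[ℂ] DirectIntegral h μ, ActsFibrewise h μ U :=
  ⟨Ur h μ, Ur_actsFibrewise h, fun _ hU => eq_Ur h hU⟩

variable [SigmaFinite μ] (hq : QuasiInvariant μ)

theorem ActsBy.eq {π : CCR e →⋆ₐ[ℂ] (DirectIntegral h μ →L[ℂ] DirectIntegral h μ)}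
    (hπ : ActsBy h μ π) (V : TestV) : π (CCR.W e V) = Rr h μ hq (TestV.cls V) :=
  FieldSpace.op_ext fun Ψ =>
    ⟨_, ActsBy.represents h hπ V Ψ, Rr_represents h hq (TestV.isSmoothIR_cls V) Ψ⟩

theorem actsBy_of {π : CCR e →⋆ₐ[ℂ] (DirectIntegral h μ →L[ℂ] DirectIntegral h μ)}
    (hπ : ∀ v, π (WeylCStar.W (symLV e) v) = Rr h μ hq (LV.cls e v)) : ActsBy h μ π := fun V =>
  ⟨TestV.cls V, TestV.isFieldClass_cls V, TestV.isSmoothIR_cls V, fun Ψ =>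
    FieldSpace.represents_of_eq (hπ (QuotientAddGroup.mk V))
      (Rr_represents h hq (TestV.isSmoothIR_cls V) Ψ)⟩

include hq in
theorem existsUnique_actsBy :
    ∃! π : CCR e →⋆ₐ[ℂ] (DirectIntegral h μ →L[ℂ] DirectIntegral h μ), ActsBy h μ π :=
  (CCR.exists_rep (e := e) (R := Rr h μ hq) (Rr_zero h hq) (fun _ _ => Rr_mul h hq)
    fun _ => Rr_star h hq).elim fun π hπ =>
      ⟨π, actsBy_of h hq hπ, fun _ hρ => CCR.rep_ext fun V =>
        (ActsBy.eq h hq hρ V).trans (ActsBy.eq h hq (actsBy_of h hq hπ) V).symm⟩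

include hq in
theorem implements_Ur {π : CCR e →⋆ₐ[ℂ] (DirectIntegral h μ →L[ℂ] DirectIntegral h μ)}
    (hπ : ActsBy h μ π) : Implements π (Ur h μ) :=
  WeylCStar.implements_of (R := Rr h μ hq) (CCR.forall_W fun V => ActsBy.eq h hq hπ V)
    fun x v => Ur_mul_Rr h hq x (LV.isSmoothIR_cls e v)

end

/-! ### The energy-momentum spectrum -/

open scoped FourierTransform in
theorem exists_bump (c : ℝ) {δ : ℝ} (hδ : 0 < δ) : ∃ (G : ℝ → ℂ) (χ : ℝ → ℝ),
    Continuous G ∧ Integrable G ∧ (∃ C, ∀ s, ‖G s‖ ≤ C / (1 + |s|) ^ 2) ∧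
      (∀ p : ℝ, ∫ x : ℝ, G x * Complex.exp (Complex.I * p * x) = χ p) ∧ (∀ p, 0 ≤ χ p) ∧
      (∀ p, |p - c| < δ → 0 < χ p) ∧ ∀ p, δ ≤ |p - c| → χ p = 0 := by
  let B : ContDiffBump c := ⟨δ / 2, δ, half_pos hδ, half_lt_self hδ⟩
  have hpi : (0 : ℝ) < 2 * Real.pi := by positivity
  let f : ℝ → ℂ := fun v => (B (2 * Real.pi * v) : ℂ)
  have hf : ContDiff ℝ ((⊤ : ℕ∞) : WithTop ℕ∞) f := by
    have h1 : ContDiff ℝ ((⊤ : ℕ∞) : WithTop ℕ∞) fun v : ℝ => B (2 * Real.pi * v) :=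
      B.contDiff.comp (contDiff_const.mul contDiff_id)
    exact Complex.ofRealCLM.contDiff.comp h1
  have hs : HasCompactSupport f := by
    have h1 : HasCompactSupport fun v : ℝ => B (2 * Real.pi * v) :=
      B.hasCompactSupport.comp_homeomorph (Homeomorph.mulLeft₀ (2 * Real.pi) hpi.ne')
    exact h1.comp_left (g := fun r : ℝ => (r : ℂ)) Complex.ofReal_zero
  let S : SchwartzMap ℝ ℂ := hs.toSchwartzMap hf
  let G : SchwartzMap ℝ ℂ := 𝓕 S
  have hinv : (𝓕⁻ G : SchwartzMap ℝ ℂ) = S := FourierTransform.fourierInv_fourier_eq S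
  refine ⟨G, fun p => B p, G.continuous, G.integrable, ?_, fun p => ?_, fun p => B.nonneg,
    fun p hp => B.pos_of_mem_ball hp, fun p hp => B.zero_of_le_dist hp⟩
  · obtain ⟨C0, h0⟩ := G.decay 0 0
    obtain ⟨C1, h1⟩ := G.decay 1 0
    obtain ⟨C2, h2⟩ := G.decay 2 0
    refine ⟨C0 + 2 * C1 + C2, fun s => ?_⟩
    have a0 := h0.2 s
    have a1 := h1.2 s
    have a2 := h2.2 s
    rw [norm_iteratedFDeriv_zero] at a0 a1 a2
    rw [Real.norm_eq_abs] at a0 a1 a2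
    rw [le_div_iff₀ (by positivity)]
    nlinarith
  · have h1 := congrArg (fun T : SchwartzMap ℝ ℂ => T (p / (2 * Real.pi))) hinv
    rw [SchwartzMap.fourierInv_coe, Real.fourierInv_eq'] at h1
    have h2 : S (p / (2 * Real.pi)) = (B p : ℂ) := by
      change ((B (2 * Real.pi * (p / (2 * Real.pi))) : ℝ) : ℂ) = B p
      rw [mul_div_cancel₀ _ hpi.ne']
    rw [h2] at h1
    rw [← h1]
    refine integral_congr_ae (ae_of_all _ fun x => ?_)
    simp only [smul_eq_mul]
    rw [mul_comm]
    congr 2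
    rw [real_inner_comm]
    simp only [RCLike.inner_apply, conj_trivial]
    push_cast
    field_simp

/-- The Fourier transform of a function on Minkowski space. -/
def mft (g : Mink → ℂ) (p : Mink) : ℂ := ∫ x, g x * Complex.exp (Complex.I * η p x)

def sgnη (a : Fin 4) : ℝ := if a = 0 then 1 else -1

theorem η_eq_sum (p x : Mink) : η p x = ∑ a, sgnη a * p a * x a := by
  rw [Fin.sum_univ_four, show sgnη 0 = 1 from if_pos rfl, show sgnη 1 = -1 from if_neg (by decide),
    show sgnη 2 = -1 from if_neg (by decide), show sgnη 3 = -1 from if_neg (by decide), η]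
  ring

theorem exists_mink_bump (q : Mink) {δ : ℝ} (hδ : 0 < δ) : ∃ g : Mink → ℂ, Integrable g ∧
    mft g q ≠ 0 ∧ ∀ p, δ ≤ dist p q → mft g p = 0 := by
  choose G χ _ hi _ hf _ hpos hz using fun a : Fin 4 => exists_bump (sgnη a * q a) hδ
  have key : ∀ p, mft (fun x => ∏ a, G a (x a)) p = ∏ a, (χ a (sgnη a * p a) : ℂ) := by
    intro p
    rw [mft]
    have h1 : ∀ x : Mink, (∏ a, G a (x a)) * Complex.exp (Complex.I * η p x) =
        ∏ a, (G a (x a) * Complex.exp (Complex.I * (sgnη a * p a : ℝ) * x a)) := by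
      intro x
      rw [Finset.prod_mul_distrib, ← Complex.exp_sum, η_eq_sum]
      push_cast
      rw [Finset.mul_sum]
      congr 2
      exact Finset.sum_congr rfl fun a _ => by ring
    simp only [h1]
    rw [integral_fintype_prod_volume_eq_prod fun a (y : ℝ) =>
      G a y * Complex.exp (Complex.I * (sgnη a * p a : ℝ) * y)]
    exact Finset.prod_congr rfl fun a _ => hf a _
  refine ⟨_, Integrable.fintype_prod hi, ?_, fun p hp => ?_⟩
  · rw [key, Finset.prod_ne_zero_iff]
    intro a _
    exact_mod_cast (hpos a _ (by simpa using hδ)).ne'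
  · have h2 : ∃ a, δ ≤ dist (p a) (q a) := by
      by_contra! hc
      exact absurd ((dist_pi_lt_iff hδ).2 hc) (not_lt.2 hp)
    obtain ⟨a, ha⟩ := h2
    rw [key]
    refine Finset.prod_eq_zero (Finset.mem_univ a) ?_
    rw [hz a _ ?_, Complex.ofReal_zero]
    rw [← mul_sub, abs_mul, ← Real.dist_eq]
    have : |sgnη a| = 1 := by unfold sgnη; split_ifs <;> simp
    rwa [this, one_mul]

theorem isClosed_closedForwardCone : IsClosed closedForwardCone :=
  (isClosed_le continuous_const (continuous_apply 0)).inter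
    (isClosed_le continuous_const (continuous_η.comp (continuous_id.prodMk continuous_id)))

theorem integrable_mul_exp_η {g : Mink → ℂ} (hg : Integrable g) (p : Mink) :
    Integrable fun x => g x * Complex.exp (Complex.I * η p x) := by
  have hc : Continuous fun x => Complex.exp (Complex.I * η p x) := by
    unfold η; fun_prop
  refine hg.mul_bdd (c := 1) hc.aestronglyMeasurable (ae_of_all _ fun x => ?_)
  rw [mul_comm, Complex.norm_exp_ofReal_mul_I]

theorem continuous_mft {g : Mink → ℂ} (hg : Integrable g) : Continuous (mft g) := by
  refine continuous_of_dominated (bound := fun x => ‖g x‖)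
    (fun p => (integrable_mul_exp_η hg p).aestronglyMeasurable) (fun p => ae_of_all _ fun x => ?_)
    hg.norm (ae_of_all _ fun x => ?_)
  · rw [norm_mul, mul_comm Complex.I, Complex.norm_exp_ofReal_mul_I, mul_one]
  · unfold η; fun_prop

theorem closedForwardCone_add {p q : Mink} (hp : p ∈ closedForwardCone)
    (hq : q ∈ closedForwardCone) : p + q ∈ closedForwardCone := by
  obtain ⟨p0, hp⟩ := hp
  obtain ⟨q0, hq⟩ := hq
  refine ⟨add_nonneg p0 q0, ?_⟩
  have h : 0 ≤ η p q := by
    simp only [η] at *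
    by_contra! hc
    have h1 : p 0 * q 0 < p 1 * q 1 + p 2 * q 2 + p 3 * q 3 := by linarith
    have h2 : (p 0 * q 0) ^ 2 < (p 1 * q 1 + p 2 * q 2 + p 3 * q 3) ^ 2 :=
      pow_lt_pow_left₀ h1 (mul_nonneg p0 q0) two_ne_zero
    have h3 : (p 1 * q 1 + p 2 * q 2 + p 3 * q 3) ^ 2 ≤
        (p 1 ^ 2 + p 2 ^ 2 + p 3 ^ 2) * (q 1 ^ 2 + q 2 ^ 2 + q 3 ^ 2) := by
      nlinarith [sq_nonneg (p 1 * q 2 - p 2 * q 1), sq_nonneg (p 1 * q 3 - p 3 * q 1),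
        sq_nonneg (p 2 * q 3 - p 3 * q 2)]
    have h4 : (p 1 ^ 2 + p 2 ^ 2 + p 3 ^ 2) * (q 1 ^ 2 + q 2 ^ 2 + q 3 ^ 2) ≤
        (p 0) ^ 2 * (q 0) ^ 2 := by
      refine mul_le_mul ?_ ?_ (by positivity) (by positivity) <;> nlinarith
    nlinarith
  rw [η_add_left, η_add_right, η_add_right, η_comm q p]
  linarith

/-- The bounded functions whose Fourier transform is carried by the closed forward cone. -/
structure IsForward (M : Mink → ℂ) : Prop where
  meas : Measurable M
  bdd : ∃ C : ℝ, ∀ x, ‖M x‖ ≤ C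
  zero : ∀ g : Mink → ℂ, Integrable g → (∀ p ∈ closedForwardCone, mft g p = 0) →
    ∫ x, g x * M x = 0

namespace IsForward

theorem integrable {M : Mink → ℂ} (hM : IsForward M) {g : Mink → ℂ} (hg : Integrable g) :
    Integrable fun x => g x * M x := by
  obtain ⟨C, hC⟩ := hM.bdd
  exact hg.mul_bdd (c := C) hM.meas.aestronglyMeasurable (ae_of_all _ hC)

theorem const (c : ℂ) : IsForward fun _ => c := by
  refine ⟨measurable_const, ⟨‖c‖, fun _ => le_rfl⟩, fun g _ h0 => ?_⟩
  have h := h0 0 ⟨le_rfl, by simp [η]⟩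
  rw [mft] at h
  simp only [η_comm 0, η_zero_right, Complex.ofReal_zero, mul_zero, Complex.exp_zero,
    mul_one] at h
  rw [integral_mul_const, h, zero_mul]

theorem add {M N : Mink → ℂ} (hM : IsForward M) (hN : IsForward N) :
    IsForward fun x => M x + N x := by
  obtain ⟨C, hC⟩ := hM.bdd
  obtain ⟨D, hD⟩ := hN.bdd
  refine ⟨hM.meas.add hN.meas, ⟨C + D, fun x => (norm_add_le _ _).trans
    (add_le_add (hC x) (hD x))⟩, fun g hg h0 => ?_⟩
  simp only [mul_add]
  rw [integral_add (hM.integrable hg) (hN.integrable hg), hM.zero g hg h0, hN.zero g hg h0,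
    add_zero]

theorem smul {M : Mink → ℂ} (hM : IsForward M) (c : ℂ) : IsForward fun x => c * M x := by
  obtain ⟨C, hC⟩ := hM.bdd
  refine ⟨hM.meas.const_mul c, ⟨‖c‖ * C, fun x => ?_⟩, fun g hg h0 => ?_⟩
  · rw [norm_mul]; exact mul_le_mul_of_nonneg_left (hC x) (norm_nonneg _)
  · simp only [mul_left_comm _ c]
    rw [integral_const_mul c, hM.zero g hg h0, mul_zero]

theorem limit {M : ℕ → Mink → ℂ} {N : Mink → ℂ} {C : ℝ} (hM : ∀ n, IsForward (M n))
    (hC : ∀ n x, ‖M n x‖ ≤ C) (h : ∀ x, Tendsto (fun n => M n x) atTop (𝓝 (N x))) :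
    IsForward N := by
  refine ⟨measurable_of_tendsto_metrizable (fun n => (hM n).meas) (tendsto_pi_nhds.2 h),
    ⟨C, fun x => le_of_tendsto (h x).norm (Eventually.of_forall fun n => hC n x)⟩,
    fun g hg h0 => ?_⟩
  have h1 : Tendsto (fun n => ∫ x, g x * M n x) atTop (𝓝 (∫ x, g x * N x)) := by
    refine tendsto_integral_of_dominated_convergence (fun x => ‖g x‖ * C)
      (fun n => ((hM n).integrable hg).aestronglyMeasurable) (hg.norm.mul_const C)
      (fun n => ae_of_all _ fun x => ?_) (ae_of_all _ fun x => (h x).const_mul _)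
    rw [norm_mul]
    exact mul_le_mul_of_nonneg_left (hC n x) (norm_nonneg _)
  simp only [fun n => (hM n).zero g hg h0] at h1
  exact (tendsto_nhds_unique h1 tendsto_const_nhds)

theorem mul_exp {M : Mink → ℂ} (hM : IsForward M) {p : Mink} (hp : p ∈ closedForwardCone) :
    IsForward fun x => Complex.exp (Complex.I * η p x) * M x := by
  obtain ⟨C, hC⟩ := hM.bdd
  have hc : Continuous fun x => Complex.exp (Complex.I * η p x) := by
    unfold η; fun_prop
  refine ⟨hc.measurable.mul hM.meas, ⟨C, fun x => ?_⟩, fun g hg h0 => ?_⟩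
  · rw [norm_mul, mul_comm Complex.I, Complex.norm_exp_ofReal_mul_I, one_mul]; exact hC x
  · simp only [← mul_assoc]
    refine hM.zero _ (integrable_mul_exp_η hg p) fun q hq => ?_
    have := h0 (p + q) (closedForwardCone_add hp hq)
    rw [mft] at this ⊢
    rw [← this]
    refine integral_congr_ae (ae_of_all _ fun x => ?_)
    simp only
    rw [mul_assoc, ← Complex.exp_add, η_add_left]
    push_cast
    ring_nf

theorem integral {X : Type} [MeasurableSpace X] {m : Measure X} [SFinite m] {K : X → Mink → ℂ}
    {D : X → ℝ} (hD : Integrable D m) (hm : Measurable (Function.uncurry K))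
    (hb : ∀ᵐ q ∂m, ∀ x, ‖K q x‖ ≤ D q) (hK : ∀ᵐ q ∂m, IsForward (K q)) :
    IsForward fun x => ∫ q, K q x ∂m := by
  refine ⟨?_, ⟨∫ q, D q ∂m, fun x => norm_integral_le_of_norm_le hD (hb.mono fun q h => h x)⟩,
    fun g hg h0 => ?_⟩
  · exact (StronglyMeasurable.integral_prod_right (f := fun x q => K q x)
      (hm.comp measurable_swap).stronglyMeasurable).measurable
  · simp only [← integral_const_mul]
    rw [integral_integral_swap]
    · rw [← integral_zero X ℂ (μ := m)]
      exact integral_congr_ae (hK.mono fun q h => h.zero g hg h0)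
    · have h1 : AEStronglyMeasurable (fun z : Mink × X => g z.1 * K z.2 z.1) (volume.prod m) :=
        hg.aestronglyMeasurable.comp_fst.mul (hm.comp measurable_swap).aestronglyMeasurable
      refine (hg.norm.mul_prod hD).mono' h1 ?_
      have h2 : ∀ᵐ z : Mink × X ∂(volume.prod m), ∀ x, ‖K z.2 x‖ ≤ D z.2 :=
        Measure.quasiMeasurePreserving_snd.ae hb
      filter_upwards [h2] with z hz
      change ‖g z.1 * K z.2 z.1‖ ≤ _
      rw [norm_mul]
      exact mul_le_mul_of_nonneg_left (hz z.1) (norm_nonneg _)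

end IsForward

namespace IsForward

variable {X : Type} [MeasurableSpace X] {m : Measure X} [SFinite m] {a : X → ℂ} {P : X → Mink}

theorem mul_integral (ha : Integrable a m) (ham : Measurable a) (hP : Measurable P)
    (hC : ∀ᵐ q ∂m, P q ∈ closedForwardCone) {M : Mink → ℂ} (hM : IsForward M) :
    IsForward fun x => (∫ q, a q * Complex.exp (Complex.I * η (P q) x) ∂m) * M x := by
  obtain ⟨C, hb⟩ := hM.bdd
  have hη : Measurable fun z : X × Mink => η (P z.1) z.2 :=
    continuous_η.measurable.comp ((hP.comp measurable_fst).prodMk measurable_snd)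
  have h := IsForward.integral (m := m) (D := fun q => ‖a q‖ * C)
    (K := fun q x => a q * (Complex.exp (Complex.I * η (P q) x) * M x)) (ha.norm.mul_const C) ?_
    (ae_of_all _ fun q x => ?_) (hC.mono fun q hq => (hM.mul_exp hq).smul (a q))
  · simpa only [← mul_assoc, integral_mul_const] using h
  · exact (ham.comp measurable_fst).mul ((Complex.measurable_exp.comp
      (measurable_const.mul (Complex.measurable_ofReal.comp hη))).mul
      (hM.meas.comp measurable_snd))
  · rw [norm_mul, norm_mul, mul_comm Complex.I, Complex.norm_exp_ofReal_mul_I, one_mul]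
    exact mul_le_mul_of_nonneg_left (hb x) (norm_nonneg _)

theorem exp_integral (ha : Integrable a m) (ham : Measurable a) (hP : Measurable P)
    (hC : ∀ᵐ q ∂m, P q ∈ closedForwardCone) :
    IsForward fun x => Complex.exp (∫ q, a q * Complex.exp (Complex.I * η (P q) x) ∂m) := by
  set K : Mink → ℂ := fun x => ∫ q, a q * Complex.exp (Complex.I * η (P q) x) ∂m with hK
  have hpow : ∀ k : ℕ, IsForward fun x => K x ^ k := by
    intro k
    induction k with
    | zero => simpa using IsForward.const 1
    | succ k ih =>
      refine (congrArg IsForward ?_).mp (mul_integral ha ham hP hC ih)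
      funext x
      rw [pow_succ']
  have hsum : ∀ n : ℕ, IsForward fun x => ∑ k ∈ Finset.range n, K x ^ k / (k.factorial : ℂ) := by
    intro n
    induction n with
    | zero => simpa using IsForward.const 0
    | succ n ih =>
      refine (congrArg IsForward ?_).mp (ih.add ((hpow n).smul ((n.factorial : ℂ)⁻¹)))
      funext x
      rw [Finset.sum_range_succ]
      ring
  have hbd : ∀ x, ‖K x‖ ≤ ∫ q, ‖a q‖ ∂m := fun x => by
    refine (norm_integral_le_integral_norm _).trans (le_of_eq ?_)
    refine integral_congr_ae (ae_of_all _ fun q => ?_)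
    simp only
    rw [norm_mul, mul_comm Complex.I, Complex.norm_exp_ofReal_mul_I, mul_one]
  refine IsForward.limit (C := Real.exp (∫ q, ‖a q‖ ∂m)) hsum (fun n x => ?_) fun x => ?_
  · refine (norm_sum_le _ _).trans (le_trans (Finset.sum_le_sum fun k _ => ?_)
      (Real.sum_le_exp_of_nonneg (integral_nonneg fun q => norm_nonneg (a q)) n))
    rw [norm_div, norm_pow, Complex.norm_natCast]
    gcongr
    exact hbd x
  · have := NormedSpace.expSeries_div_hasSum_exp (K x)
    rw [← Complex.exp_eq_exp_ℂ] at this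
    exact this.tendsto_sum_nat

end IsForward

theorem measurable_sec : Measurable fun n : S2 => (sec n).1 := by
  refine measurable_pi_lambda _ fun a => ?_
  have : Continuous fun n : S2 => (sec n).1 a := by
    fin_cases a <;> simp [sec] <;> fun_prop
  exact this.measurable

/-- The momentum `ω l`. -/
def mom (q : S2 × ℝ) : Mink := q.2 • (sec q.1).1

theorem measurable_mom : Measurable mom :=
  measurable_snd.smul (measurable_sec.comp measurable_fst)

theorem mom_mem : ∀ᵐ q ∂dlw, mom q ∈ closedForwardCone := by
  filter_upwards [ae_dlw_pos] with q hq
  refine ⟨mul_nonneg hq.le (sec q.1).2.1.le, ?_⟩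
  rw [mom, η_smul_left, η_smul_right, (sec q.1).2.2, mul_zero, mul_zero]

theorem FKer_shift (x : Mink) (u v : preT) (q : S2 × ℝ) :
    FKer u (shiftPre x v) q = FKer u v q * Complex.exp (Complex.I * η (mom q) x) := by
  have h : fourier (shiftPre x v) q.2 (sec q.1) =
      Complex.exp (Complex.I * η (mom q) x) • fourier v q.2 (sec q.1) := by
    funext a
    rw [fourier_shift, Pi.smul_apply, smul_eq_mul, mom, η_smul_left, η_comm x]
    push_cast
    ring_nf
  rw [FKer, FKer, h, ηC_smul_right]
  ring

theorem FKer_conj (u v : preT) (q : S2 × ℝ) : FKer u v q = conj (FKer v u q) := by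
  simp only [FKer, ηC, map_div₀, map_neg, map_sub, map_mul, Complex.conj_conj, Complex.conj_ofReal]
  ring_nf

theorem FKer_shift_self (x : Mink) (v : preT) (q : S2 × ℝ) :
    FKer (shiftPre x v) (shiftPre x v) q = FKer v v q := by
  rw [FKer_shift, FKer_conj, FKer_shift, map_mul, ← FKer_conj, mul_assoc, ← Complex.exp_conj,
    ← Complex.exp_add]
  simp

theorem FKer_sub_self (u v : preT) : ∀ᵐ q ∂dlw,
    FKer (v - u) (v - u) q = FKer u u q + FKer v v q - FKer u v q - FKer v u q := by
  filter_upwards [ae_dlw_of_ae (fourier_add v ((-1 : ℝ) • u))] with q hq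
  have h : fourier (v - u) q.2 (sec q.1) =
      fourier v q.2 (sec q.1) + (-1 : ℂ) • fourier u q.2 (sec q.1) := by
    have h1 : v - u = v + (-1 : ℝ) • u := by module
    rw [h1, hq q.2, fourier_smul]
    norm_num
  simp only [FKer, h, ηC_add_left, ηC_add_right, ηC_smul_left, ηC_smul_right, map_neg, map_one]
  ring

theorem FKer_self_nonneg (u : preT) : ∀ᵐ q ∂dlw, 0 ≤ (FKer u u q).re ∧ (FKer u u q).im = 0 := by
  filter_upwards [ae_dlw_pos, ae_dlw_of_ae (η_fourier u)] with q hq h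
  obtain ⟨h1, h2⟩ := neg_ηC_nonneg q.1 (h q.2)
  rw [FKer, Complex.div_ofReal_re, Complex.div_ofReal_im, h2, zero_div]
  exact ⟨div_nonneg h1 hq.le, rfl⟩

/-- The exponent of a matrix element of the translations is the integral of this function. -/
def vacExp (x : Mink) (u v : preT) (q : S2 × ℝ) : ℂ :=
  FKer u v q * Complex.exp (Complex.I * η (mom q) x) - 1 / 2 * FKer u u q - 1 / 2 * FKer v v q

theorem vacExp_eq (x : Mink) (u v : preT) : ∀ᵐ q ∂dlw, vacExp x u v q =
    Complex.I * ((FKer u (shiftPre x v) q).im : ℂ) -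
      1 / 2 * FKer (shiftPre x v - u) (shiftPre x v - u) q := by
  filter_upwards [FKer_sub_self u (shiftPre x v)] with q hq
  rw [hq, FKer_shift_self, vacExp, ← FKer_shift, FKer_conj (shiftPre x v) u]
  generalize FKer u (shiftPre x v) q = z
  have h' : conj z = z - 2 * (z.im : ℂ) * Complex.I := by
    apply Complex.ext <;> simp
    ring
  rw [h']
  ring

theorem vacExp_re_nonpos (x : Mink) (u v : preT) : ∀ᵐ q ∂dlw, (vacExp x u v q).re ≤ 0 := by
  filter_upwards [vacExp_eq x u v, FKer_self_nonneg (shiftPre x v - u)] with q h1 h2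
  rw [h1]
  simp
  linarith [h2.1]

theorem shift_sub_mem_kerP (x : Mink) {u v : preT} (h : p (T.mk u) = p (T.mk v)) :
    shiftPre x v - u ∈ kerP := by
  rw [mem_kerP, show T.mk (shiftPre x v - u) = shiftT x (T.mk v) - T.mk u from rfl, map_sub,
    p_shift, h, sub_self]

theorem vacExp_integrable (x : Mink) {u v : preT} (h : p (T.mk u) = p (T.mk v)) :
    Integrable (vacExp x u v) dlw := by
  have h1 := FKer_integrable (shift_sub_mem_kerP x h) (shift_sub_mem_kerP x h)
  have h2 : Integrable (fun q => ((FKer u (shiftPre x v) q).im : ℂ)) dlw :=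
    (FKer_im_integrable u (shiftPre x v)).ofReal
  refine ((h2.const_mul Complex.I).sub (h1.const_mul (1 / 2))).congr ?_
  exact (vacExp_eq x u v).mono fun q hq => hq.symm

theorem integral_mul_sub_mul {X : Type} [MeasurableSpace X] {m : Measure X} {f g : X → ℂ}
    (hf : Integrable f m) (hg : Integrable g m) (c d : ℂ) :
    ∫ q, (c * f q - d * g q) ∂m = c * ∫ q, f q ∂m - d * ∫ q, g q ∂m := by
  rw [integral_sub (f := fun q => c * f q) (g := fun q => d * g q) (hf.const_mul c)
    (hg.const_mul d), integral_const_mul c, integral_const_mul d]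

theorem exp_integral_vacExp (x : Mink) {u v : preT} (h : p (T.mk u) = p (T.mk v)) :
    Complex.exp (∫ q, vacExp x u v q ∂dlw) = phase (-symPre u (shiftPre x v)) *
      Complex.exp (-(1 / 2) * FPre (shiftPre x v - u) (shiftPre x v - u)) := by
  have h1 := FKer_integrable (shift_sub_mem_kerP x h) (shift_sub_mem_kerP x h)
  have h2 : Integrable (fun q => ((FKer u (shiftPre x v) q).im : ℂ)) dlw :=
    (FKer_im_integrable u (shiftPre x v)).ofReal
  rw [integral_congr_ae (vacExp_eq x u v), integral_mul_sub_mul h2 h1, integral_complex_ofReal,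
    integral_FKer_im, FPre_eq, phase, ← Complex.exp_add]
  congr 1
  push_cast
  ring

theorem FKer_invW_integrable (n : ℕ) (u v : preT) :
    Integrable (fun q => ((q.2 * invW n q.2 : ℝ) : ℂ) * FKer u v q) dlw := by
  have hm : Measurable fun q : S2 × ℝ => ((q.2 * invW n q.2 : ℝ) : ℂ) * FKer u v q :=
    (Complex.measurable_ofReal.comp (measurable_snd.mul
      ((measurable_invW n).comp measurable_snd))).mul (measurable_FKer u v)
  have hi : Integrable (fun q : S2 × ℝ => ((n : ℝ) + 1) * (4 * ∑ a, (
      ‖fourier u q.2 (sec q.1) a‖ ^ 2 + ‖fourier v q.2 (sec q.1) a‖ ^ 2))) dlw :=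
    ((integrable_finsetSum _ fun a _ => (preT.integrable_fourier_sq u a).add
      (preT.integrable_fourier_sq v a)).const_mul 4 |>.const_mul _).mono_measure dlw_le
  refine hi.mono' hm.aestronglyMeasurable ?_
  filter_upwards [ae_dlw_pos] with q hq
  have h1 : ((q.2 * invW n q.2 : ℝ) : ℂ) * FKer u v q =
      (invW n q.2 : ℂ) * -ηC (fourier u q.2 (sec q.1)) (fourier v q.2 (sec q.1)) := by
    rw [FKer]
    have : (q.2 : ℂ) ≠ 0 := by exact_mod_cast hq.ne'
    push_cast
    field_simp
  rw [h1, norm_mul, norm_neg, Complex.norm_real, Real.norm_of_nonneg (invW_nonneg n hq)]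
  refine mul_le_mul (invW_le n hq) (norm_ηC_le fun a => ?_) (norm_nonneg _) (by positivity)
  rw [norm_mul, RCLike.norm_conj]
  refine le_trans ?_ (Finset.single_le_sum (f := fun a => ‖fourier u q.2 (sec q.1) a‖ ^ 2 +
    ‖fourier v q.2 (sec q.1) a‖ ^ 2) (fun b _ => by positivity) (Finset.mem_univ a))
  nlinarith [sq_nonneg (‖fourier u q.2 (sec q.1) a‖ - ‖fourier v q.2 (sec q.1) a‖),
    sq_nonneg (‖fourier u q.2 (sec q.1) a‖ + ‖fourier v q.2 (sec q.1) a‖)]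

theorem isForward_exp_vacExp {u v : preT} (h : p (T.mk u) = p (T.mk v)) :
    IsForward fun x => Complex.exp (∫ q, vacExp x u v q ∂dlw) := by
  let κ : ℕ → S2 × ℝ → ℂ := fun n q => ((q.2 * invW n q.2 : ℝ) : ℂ)
  have hκm : ∀ n, Measurable (κ n) := fun n => Complex.measurable_ofReal.comp
    (measurable_snd.mul ((measurable_invW n).comp measurable_snd))
  have hκ : ∀ᵐ q ∂dlw, ∀ n, 0 ≤ q.2 * invW n q.2 ∧ q.2 * invW n q.2 ≤ 1 := by
    filter_upwards [ae_dlw_pos] with q hq n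
    refine ⟨mul_nonneg hq.le (invW_nonneg n hq), ?_⟩
    calc q.2 * invW n q.2 ≤ q.2 * q.2⁻¹ := mul_le_mul_of_nonneg_left (invW_le_inv n hq) hq.le
      _ = 1 := mul_inv_cancel₀ hq.ne'
  have hu : ∀ n, Integrable (fun q => κ n q * FKer u u q) dlw :=
    fun n => FKer_invW_integrable n u u
  have hv : ∀ n, Integrable (fun q => κ n q * FKer v v q) dlw :=
    fun n => FKer_invW_integrable n v v
  have huv : ∀ n, Integrable (fun q => κ n q * FKer u v q) dlw :=
    fun n => FKer_invW_integrable n u v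
  have hE : ∀ n x, ∫ q, κ n q * vacExp x u v q ∂dlw =
      (∫ q, (κ n q * FKer u v q) * Complex.exp (Complex.I * η (mom q) x) ∂dlw) +
        -(1 / 2 * (∫ q, κ n q * FKer u u q ∂dlw) + 1 / 2 * ∫ q, κ n q * FKer v v q ∂dlw) := by
    intro n x
    have h1 : Integrable (fun q => (κ n q * FKer u v q) *
        Complex.exp (Complex.I * η (mom q) x)) dlw := by
      refine ((huv n).mul_bdd (c := 1) ?_ (ae_of_all _ fun q => ?_))
      · exact (Complex.measurable_exp.comp (measurable_const.mul (Complex.measurable_ofReal.comp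
          (continuous_η.measurable.comp (measurable_mom.prodMk
            measurable_const))))).aestronglyMeasurable
      · rw [mul_comm, Complex.norm_exp_ofReal_mul_I]
    have h2 : ∀ q, κ n q * vacExp x u v q = (κ n q * FKer u v q) *
        Complex.exp (Complex.I * η (mom q) x) + (-(1 / 2) * (κ n q * FKer u u q) -
          1 / 2 * (κ n q * FKer v v q)) := fun q => by rw [vacExp]; ring
    simp only [h2]
    refine (integral_add h1
      (((hu n).const_mul (-(1 / 2))).sub ((hv n).const_mul (1 / 2)))).trans ?_
    refine congrArg _ ((integral_mul_sub_mul (hu n) (hv n) _ _).trans ?_)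
    ring
  refine IsForward.limit (C := 1) (M := fun n x =>
    Complex.exp (∫ q, κ n q * vacExp x u v q ∂dlw)) (fun n => ?_) (fun n x => ?_) fun x => ?_
  · simp only [hE, Complex.exp_add]
    simp only [mul_comm _ (Complex.exp (-_))]
    exact (IsForward.exp_integral (huv n) ((hκm n).mul (measurable_FKer u v)) measurable_mom
      mom_mem).smul _
  · rw [Complex.norm_exp, Real.exp_le_one_iff]
    have hre : ∀ᵐ q ∂dlw, RCLike.re (κ n q * vacExp x u v q) ≤ 0 := by
      filter_upwards [hκ, vacExp_re_nonpos x u v] with q h1 h2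
      change (((q.2 * invW n q.2 : ℝ) : ℂ) * _).re ≤ 0
      rw [Complex.re_ofReal_mul]
      exact mul_nonpos_of_nonneg_of_nonpos (h1 n).1 h2
    by_cases hi : Integrable (fun q => κ n q * vacExp x u v q) dlw
    · exact (integral_re hi).symm.trans_le (integral_nonpos_of_ae hre)
    · rw [integral_undef hi]; rfl
  · refine (Complex.continuous_exp.tendsto _).comp ?_
    have hx := vacExp_integrable x h
    refine tendsto_integral_of_dominated_convergence (fun q => ‖vacExp x u v q‖)
      (fun n => (hκm n).aestronglyMeasurable.mul hx.aestronglyMeasurable) hx.norm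
      (fun n => ?_) ?_
    · filter_upwards [hκ] with q hq
      rw [norm_mul, Complex.norm_real, Real.norm_of_nonneg (hq n).1]
      exact mul_le_of_le_one_left (norm_nonneg _) (hq n).2
    · filter_upwards [ae_dlw_pos] with q hq
      have h1 : Tendsto (fun n => κ n q) atTop (𝓝 1) := by
        have := (tendsto_invW hq).const_mul q.2
        rw [mul_inv_cancel₀ hq.ne'] at this
        exact_mod_cast (Complex.continuous_ofReal.tendsto _).comp this
      simpa using h1.mul_const (vacExp x u v q)

theorem isForward_inner_What (u v : Lhat) :
    IsForward fun x => inner ℂ (What u Ωhat) (Uhat x (What v Ωhat)) := by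
  simp only [Uhat_What_Ωhat, inner_What_Ωhat]
  by_cases hp : pIR u = pIR v
  · obtain ⟨⟨u', hu⟩, rfl⟩ : ∃ w : {w : preT // T.mk w ∈ LhatSub}, (⟨T.mk w.1, w.2⟩ : Lhat) = u := by
      obtain ⟨u0, hu⟩ := u
      induction u0 using T.ind with
      | _ w => exact ⟨⟨w, hu⟩, rfl⟩
    obtain ⟨⟨v', hv⟩, rfl⟩ : ∃ w : {w : preT // T.mk w ∈ LhatSub}, (⟨T.mk w.1, w.2⟩ : Lhat) = v := by
      obtain ⟨u0, hu⟩ := v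
      induction u0 using T.ind with
      | _ w => exact ⟨⟨w, hu⟩, rfl⟩
    have h : p (T.mk u') = p (T.mk v') := congrArg Subtype.val hp
    refine (congrArg IsForward ?_).mp (isForward_exp_vacExp h)
    funext x
    rw [exp_integral_vacExp x h, vacuum_of_zero (by rw [pIR_sub, pIR_shift, hp, sub_self])]
    congr 2
    rw [FL, ← F_mk]
    rfl
  · refine (congrArg IsForward ?_).mp (IsForward.const 0)
    funext x
    rw [vacuum_of_ne, mul_zero]
    rw [pIR_sub, pIR_shift]
    exact fun h => hp (sub_eq_zero.1 h).symm

theorem measurable_inner_Uhat (φ ψ : Hhat) : Measurable fun x => inner ℂ φ (Uhat x ψ) :=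
  (continuous_const.inner (continuous_Uhat ψ)).measurable

theorem norm_inner_Uhat_le (φ ψ : Hhat) (x : Mink) : ‖inner ℂ φ (Uhat x ψ)‖ ≤ ‖φ‖ * ‖ψ‖ :=
  (norm_inner_le_norm _ _).trans (by rw [norm_Uhat])

theorem integrable_mul_inner_Uhat {g : Mink → ℂ} (hg : Integrable g) (φ ψ : Hhat) :
    Integrable fun x => g x * inner ℂ φ (Uhat x ψ) :=
  hg.mul_bdd (c := ‖φ‖ * ‖ψ‖) (measurable_inner_Uhat φ ψ).aestronglyMeasurable
    (ae_of_all _ fun x => norm_inner_Uhat_le φ ψ x)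

theorem norm_integral_mul_inner_Uhat_le {g : Mink → ℂ} (hg : Integrable g) (φ ψ : Hhat) :
    ‖∫ x, g x * inner ℂ φ (Uhat x ψ)‖ ≤ (∫ x, ‖g x‖) * (‖φ‖ * ‖ψ‖) := by
  rw [← integral_mul_const]
  refine norm_integral_le_of_norm_le (hg.norm.mul_const _) (ae_of_all _ fun x => ?_)
  rw [norm_mul]
  exact mul_le_mul_of_nonneg_left (norm_inner_Uhat_le φ ψ x) (norm_nonneg _)

theorem integral_mul_inner_Uhat_eq_zero {g : Mink → ℂ} (hg : Integrable g)
    (h0 : ∀ p ∈ closedForwardCone, mft g p = 0) (φ ψ : Hhat) :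
    ∫ x, g x * inner ℂ φ (Uhat x ψ) = 0 := by
  have hi := integrable_mul_inner_Uhat hg
  have hb := norm_integral_mul_inner_Uhat_le hg
  have hψ : ∀ φ, Continuous fun ψ => ∫ x, g x * inner ℂ φ (Uhat x ψ) := by
    intro φ
    refine (LipschitzWith.of_dist_le_mul (K := ⟨(∫ x, ‖g x‖) * ‖φ‖, mul_nonneg
      (integral_nonneg fun x => norm_nonneg (g x)) (norm_nonneg _)⟩) fun ψ ψ' => ?_).continuous
    rw [dist_eq_norm, dist_eq_norm, ← integral_sub (hi φ ψ) (hi φ ψ')]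
    simp only [← mul_sub, ← inner_sub_right, ← map_sub]
    exact (hb φ (ψ - ψ')).trans (le_of_eq (mul_assoc _ _ _).symm)
  have hφ : Continuous fun φ => ∫ x, g x * inner ℂ φ (Uhat x ψ) := by
    refine (LipschitzWith.of_dist_le_mul (K := ⟨(∫ x, ‖g x‖) * ‖ψ‖, mul_nonneg
      (integral_nonneg fun x => norm_nonneg (g x)) (norm_nonneg _)⟩) fun φ φ' => ?_).continuous
    rw [dist_eq_norm, dist_eq_norm, ← integral_sub (hi φ ψ) (hi φ' ψ)]
    simp only [← mul_sub, ← inner_sub_left]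
    refine (hb (φ - φ') ψ).trans (le_of_eq ?_)
    rw [mul_comm ‖φ - φ'‖, ← mul_assoc]
    rfl
  refine Hhat_induction (P := fun φ => ∫ x, g x * inner ℂ φ (Uhat x ψ) = 0)
    (isClosed_eq hφ continuous_const) (by simp) (fun a b ha hb' => ?_) (fun c a ha => ?_)
    (fun u => ?_) φ
  · simp only [inner_add_left, mul_add]
    rw [integral_add (hi a ψ) (hi b ψ), ha, hb', add_zero]
  · simp only [inner_smul_left, mul_left_comm _ (conj c)]
    rw [integral_const_mul (conj c), ha, mul_zero]
  · refine Hhat_induction (P := fun ψ => ∫ x, g x * inner ℂ (What u Ωhat) (Uhat x ψ) = 0)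
      (isClosed_eq (hψ _) continuous_const) (by simp) (fun a b ha hb' => ?_) (fun c a ha => ?_)
      (fun v => ?_) ψ
    · simp only [map_add, inner_add_right, mul_add]
      rw [integral_add (hi _ a) (hi _ b), ha, hb', add_zero]
    · simp only [map_smul, inner_smul_right, mul_left_comm _ c]
      rw [integral_const_mul c, ha, mul_zero]
    · exact (isForward_inner_What u v).zero g hg h0

theorem aestronglyMeasurable_uncurry {X Y : Type} [TopologicalSpace X] [SecondCountableTopology X]
    [MeasurableSpace X] [BorelSpace X] [TopologicalSpace.MetrizableSpace X] [Nonempty X] [MeasurableSpace Y] {ν : Measure X} [SFinite ν] {μ : Measure Y} [SFinite μ]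
    {m : X → Y → ℂ} (hc : ∀ y, Continuous fun x => m x y)
    (hm : ∀ x, AEStronglyMeasurable (m x) μ) :
    AEStronglyMeasurable (fun z : X × Y => m z.1 z.2) (ν.prod μ) := by
  classical
  have h1 : ∀ᵐ y ∂μ, ∀ i, m (TopologicalSpace.denseSeq X i) y = (hm (TopologicalSpace.denseSeq X i)).mk _ y :=
    ae_all_iff.2 fun i => (hm (TopologicalSpace.denseSeq X i)).ae_eq_mk
  set N := toMeasurable μ {y | ¬ ∀ i, m (TopologicalSpace.denseSeq X i) y = (hm (TopologicalSpace.denseSeq X i)).mk _ y} with hN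
  have hN0 : μ N = 0 := by rw [hN, measure_toMeasurable]; exact h1
  have hNm : MeasurableSet N := measurableSet_toMeasurable _ _
  have hoff : ∀ y ∉ N, ∀ i, m (TopologicalSpace.denseSeq X i) y = (hm (TopologicalSpace.denseSeq X i)).mk _ y := fun y hy => by
    by_contra hcon
    exact hy (subset_toMeasurable _ _ hcon)
  let m' : X → Y → ℂ := fun x y => if y ∈ N then 0 else m x y
  have hd : ∀ i, StronglyMeasurable (m' (TopologicalSpace.denseSeq X i)) := fun i => by
    have : m' (TopologicalSpace.denseSeq X i) = fun y => if y ∈ N then 0 else (hm (TopologicalSpace.denseSeq X i)).mk _ y := by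
      funext y
      by_cases hy : y ∈ N
      · simp [m', hy]
      · simp [m', hy, hoff y hy i]
    rw [this]
    exact stronglyMeasurable_const.ite hNm (hm (TopologicalSpace.denseSeq X i)).stronglyMeasurable_mk
  have hc' : ∀ y, Continuous fun x => m' x y := fun y => by
    by_cases hy : y ∈ N
    · simp only [m', if_pos hy]; exact continuous_const
    · simp only [m', if_neg hy]; exact hc y
  have hs : ∀ x, StronglyMeasurable (m' x) := fun x => by
    obtain ⟨z, hz, hx⟩ := mem_closure_iff_seq_limit.1 (TopologicalSpace.denseRange_denseSeq X x)
    refine stronglyMeasurable_of_tendsto atTop (f := fun k => m' (z k)) (fun k => ?_)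
      (tendsto_pi_nhds.2 fun y => ((hc' y).tendsto x).comp hx)
    obtain ⟨i, hi⟩ := hz k
    rw [← hi]
    exact hd i
  refine ⟨Function.uncurry m', stronglyMeasurable_uncurry_of_continuous_of_stronglyMeasurable hc' hs, ?_⟩
  have h2 : ∀ᵐ y ∂μ, y ∉ N := measure_eq_zero_iff_ae_notMem.1 hN0
  filter_upwards [Measure.quasiMeasurePreserving_snd.ae h2] with z hz
  simp [Function.uncurry, m', hz]

variable (h : Profile) {μ : Measure HIR} [SigmaFinite μ]

theorem integrable_mul_inner_fields {g : Mink → ℂ} (hg : Integrable g)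
    (Ψ Φ : SqField (dress h) μ) :
    Integrable (fun z : Mink × HIR => g z.1 * inner ℂ (Ψ.fn z.2) (Uhat z.1 (Φ.fn z.2)))
      ((volume : Measure Mink).prod μ) := by
  have hm : AEStronglyMeasurable (fun z : Mink × HIR =>
      inner ℂ (Ψ.fn z.2) (Uhat z.1 (Φ.fn z.2))) ((volume : Measure Mink).prod μ) :=
    aestronglyMeasurable_uncurry (m := fun x f => inner ℂ (Ψ.fn f) (Uhat x (Φ.fn f)))
      (fun f => continuous_const.inner (continuous_Uhat _))
      fun x => (inner_mk_Ur h x Ψ Φ).1.aestronglyMeasurable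
  have hb : Integrable (fun f : HIR => ‖Ψ.fn f‖ ^ 2 + ‖Φ.fn f‖ ^ 2) μ := by
    have := fun Ψ : SqField (dress h) μ => (inner_mk_Ur h 0 Ψ Ψ).1.norm
    simp only [Uhat_zero, inner_self_eq_norm_sq_to_K, norm_pow, RCLike.norm_ofReal,
      abs_norm] at this
    exact (this Ψ).add (this Φ)
  refine (hg.norm.mul_prod hb).mono' (hg.aestronglyMeasurable.comp_fst.mul hm)
    (ae_of_all _ fun z => ?_)
  rw [norm_mul]
  refine mul_le_mul_of_nonneg_left ((norm_inner_Uhat_le _ _ _).trans ?_) (norm_nonneg _)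
  nlinarith [sq_nonneg (‖Ψ.fn z.2‖ - ‖Φ.fn z.2‖), sq_nonneg (‖Ψ.fn z.2‖ + ‖Φ.fn z.2‖)]

theorem integral_mul_inner_Ur {g : Mink → ℂ} (hg : Integrable g) (Ψ Φ : SqField (dress h) μ) :
    ∫ x, g x * inner ℂ (FieldSpace.mk Ψ) (Ur h μ x (FieldSpace.mk Φ)) =
      ∫ f, (∫ x, g x * inner ℂ (Ψ.fn f) (Uhat x (Φ.fn f))) ∂μ := by
  simp only [fun x => (inner_mk_Ur h x Ψ Φ).2, ← integral_const_mul]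
  exact integral_integral_swap (integrable_mul_inner_fields h hg Ψ Φ)

theorem spectrum_Ur_subset : energyMomentumSpectrum (Ur h μ) ⊆ closedForwardCone := by
  intro q hq
  by_contra hn
  obtain ⟨δ, hδ, hb⟩ := Metric.isOpen_iff.1 isClosed_closedForwardCone.isOpen_compl q hn
  obtain ⟨g, hg, hne, hz⟩ := exists_mink_bump q hδ
  refine hne (hq g hg fun φ ψ => ?_)
  refine (FieldSpace.mk_surjective φ).elim fun Ψ hΨ => (FieldSpace.mk_surjective ψ).elim fun Φ hΦ => ?_
  rw [← hΨ, ← hΦ]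
  refine (integral_mul_inner_Ur h hg Ψ Φ).trans ?_
  rw [← integral_zero HIR ℂ (μ := μ)]
  refine integral_congr_ae (ae_of_all _ fun f => ?_)
  refine integral_mul_inner_Uhat_eq_zero hg (fun p hp => hz p ?_) _ _
  by_contra! hlt
  exact hb hlt hp

namespace Kern

theorem integrable_mul_fn (f : PreH0) (v : preT) (a : Fin 4) :
    Integrable (fun q : S2 × ℝ => f.fn (sec q.1) a * v.1 q.2 (sec q.1) a) (dl.prod volume) := by
  obtain ⟨ε, hε, hv⟩ := v.2.2.2.2
  have h1 : Integrable (fun q : S2 × ℝ => f.fn (sec q.1) a ^ 2 * (weight ε q.2)⁻¹)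
      (dl.prod volume) := (f.2.2.2.2 a).integrable_sq.mul_prod (integrable_inv_weight hε)
  have hm : Measurable fun n => f.fn (sec n) a := (measurable_pi_apply a).comp f.2.2.1
  refine (h1.add (hv a)).mono' ((hm.comp measurable_fst).mul
    (measurable_comp_onSec (preT.measurable v) a)).aestronglyMeasurable (ae_of_all _ fun q => ?_)
  have hw := weight_pos ε q.2
  change ‖f.fn (sec q.1) a * v.1 q.2 (sec q.1) a‖ ≤ f.fn (sec q.1) a ^ 2 * (weight ε q.2)⁻¹ +
    v.1 q.2 (sec q.1) a ^ 2 * weight ε q.2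
  generalize f.fn (sec q.1) a = y
  generalize v.1 q.2 (sec q.1) a = z
  have h2 : y ^ 2 * (weight ε q.2)⁻¹ + z ^ 2 * weight ε q.2 =
      (y ^ 2 + (z * weight ε q.2) ^ 2) / weight ε q.2 := by field_simp
  rw [h2, le_div_iff₀ hw, norm_mul, Real.norm_eq_abs, Real.norm_eq_abs, ← sq_abs y,
    ← sq_abs (z * _), abs_mul z, abs_of_pos hw]
  nlinarith [sq_nonneg (|y| - |z| * weight ε q.2), sq_nonneg (|y| + |z| * weight ε q.2)]

theorem integrable_η_fn (f : PreH0) (v : preT) :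
    Integrable (fun q : S2 × ℝ => η (f.fn (sec q.1)) (v.1 q.2 (sec q.1))) (dl.prod volume) :=
  have h := integrable_mul_fn f v
  (((h 0).sub (h 1)).sub (h 2)).sub (h 3)

theorem symPre_smearPre_eq (k : Kern) (f : PreH0) (v : preT) :
    symPre (k.smearPre f) v = 1 / (4 * Real.pi) *
      ∫ q : S2 × ℝ, k.sgn q.2 (sec q.1) * η (f.fn (sec q.1)) (v.1 q.2 (sec q.1))
        ∂(dl.prod volume) := by
  obtain ⟨w, hw⟩ : ∃ w : preT, w = ⟨_, k.sgn_smul_mem v⟩ := ⟨_, rfl⟩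
  have hi := integrable_η_fn f w
  have e : ∀ q : S2 × ℝ, k.sgn q.2 (sec q.1) * η (f.fn (sec q.1)) (v.1 q.2 (sec q.1)) =
      η (f.fn (sec q.1)) (w.1 q.2 (sec q.1)) := fun q => by
    rw [hw]; exact (η_smul_right _ _ _).symm
  simp only [e]
  rw [symPre_smearPre, ← hw, PreH0.inner_def, integral_prod _ hi, ← integral_const_mul,
    ← integral_const_mul]
  refine integral_congr_ae ?_
  filter_upwards [preT.integrable_slice w] with n hg
  change -(1 / 2) * -η (f.fn (sec n)) ((1 / (2 * Real.pi)) • ∫ s, w.1 s (sec n)) = _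
  have hc := integral_comp_eval hg
  have j := fun a => (hg a).const_mul (f.fn (sec n) a)
  rw [η_smul_right]
  simp only [η]
  rw [integral_sub (by exact ((j 0).sub (j 1)).sub (j 2)) (j 3),
    integral_sub (by exact (j 0).sub (j 1)) (j 2), integral_sub (j 0) (j 1)]
  simp only [integral_const_mul]
  rw [hc 0, hc 1, hc 2, hc 3]
  field_simp
  ring

theorem scale_sgn (k : Kern) {r : ℝ} (hr : 0 < r) (s : ℝ) (l : Cone) :
    (k.scale r hr).sgn s l = k.sgn (r * s) l := by
  have h := Measure.integral_comp_mul_left (fun τ => k.k τ l * Real.sign (τ - r * s)) r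
  rw [sgn, sgn, ← mul_one (∫ τ, k.k τ l * Real.sign (τ - r * s)), ← mul_inv_cancel₀ hr.ne']
  rw [smul_eq_mul, abs_of_pos (inv_pos.2 hr)] at h
  rw [mul_comm _ (r * r⁻¹), mul_assoc, ← h, ← integral_const_mul]
  refine integral_congr_ae (ae_of_all _ fun τ => ?_)
  change r * k.k (r * τ) l * Real.sign (τ - s) = r * (k.k (r * τ) l * Real.sign (r * τ - r * s))
  have : Real.sign (r * τ - r * s) = Real.sign (τ - s) := by
    rw [← mul_sub]
    rcases lt_trichotomy (τ - s) 0 with h | h | h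
    · rw [Real.sign_of_neg h, Real.sign_of_neg (mul_neg_of_pos_of_neg hr h)]
    · rw [h, mul_zero]
    · rw [Real.sign_of_pos h, Real.sign_of_pos (mul_pos hr h)]
  rw [this, mul_assoc]

theorem continuous_sgn (k : Kern) (n : S2) : Continuous fun s => k.sgn s (sec n) := by
  refine continuous_iff_continuousAt.2 fun s => ?_
  refine tendsto_integral_mul_sign (D := fun s τ => τ - s) (E := fun τ => τ - s) (k.integrable n)
    (fun t => measurable_id.sub_const t) ?_
  filter_upwards [(Set.finite_singleton s).measure_zero volume |> measure_eq_zero_iff_ae_notMem.1]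
    with τ hτ
  exact ⟨tendsto_const_nhds.sub tendsto_id, sub_ne_zero.2 hτ⟩

theorem tendsto_symPre_scale (k : Kern) (f : PreH0) (v : preT) {r : ℕ → ℝ} (hr : ∀ i, 0 < r i)
    (h0 : Tendsto r atTop (𝓝 0)) :
    Tendsto (fun i => symPre ((k.scale (r i) (hr i)).smearPre f) v) atTop
      (𝓝 (1 / (4 * Real.pi) * ∫ q : S2 × ℝ, k.sgn 0 (sec q.1) *
        η (f.fn (sec q.1)) (v.1 q.2 (sec q.1)) ∂(dl.prod volume))) := by
  simp only [symPre_smearPre_eq, scale_sgn]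
  obtain ⟨C, hC⟩ := k.exists_sgn_le
  have hi := integrable_η_fn f v
  refine Tendsto.const_mul _ ?_
  refine tendsto_integral_of_dominated_convergence (fun q => C * ‖η (f.fn (sec q.1))
    (v.1 q.2 (sec q.1))‖) (fun i => ?_) (hi.norm.const_mul C) (fun i => ae_of_all _ fun q => ?_)
    (ae_of_all _ fun q => ?_)
  · exact (k.measurable_sgn.comp (measurable_fst.prodMk
      (measurable_const.mul measurable_snd))).aestronglyMeasurable.mul hi.aestronglyMeasurable
  · rw [norm_mul]
    exact mul_le_mul_of_nonneg_right (hC _ _) (norm_nonneg _)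
  · refine Tendsto.mul_const _ ?_
    have h1 : Tendsto (fun i => r i * q.2) atTop (𝓝 0) := by simpa using h0.mul_const q.2
    exact ((k.continuous_sgn q.1).tendsto 0).comp h1

theorem integral_shift_eq (k : Kern) (f : PreH0) (v : preT) (x : Mink) :
    ∫ q : S2 × ℝ, k.sgn 0 (sec q.1) * η (f.fn (sec q.1)) ((shiftPre x v).1 q.2 (sec q.1))
        ∂(dl.prod volume) =
      ∫ q : S2 × ℝ, k.sgn 0 (sec q.1) * η (f.fn (sec q.1)) (v.1 q.2 (sec q.1))
        ∂(dl.prod volume) := by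
  have hm : AEStronglyMeasurable (fun q : S2 × ℝ => k.sgn 0 (sec q.1) *
      η (f.fn (sec q.1)) (v.1 q.2 (sec q.1))) (dl.prod volume) :=
    (k.measurable_sgn.comp (measurable_fst.prodMk measurable_const)).aestronglyMeasurable.mul
      (integrable_η_fn f v).aestronglyMeasurable
  have h := (shear_mp x).map_eq
  conv_rhs => rw [← h]
  rw [integral_map (shear_mp x).measurable.aemeasurable (by rw [h]; exact hm)]
  rfl

theorem tendsto_symPre_scale_shift (k : Kern) (f : PreH0) (v : preT) (x : Mink) {r : ℕ → ℝ}
    (hr : ∀ i, 0 < r i) (h0 : Tendsto r atTop (𝓝 0)) :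
    Tendsto (fun i => symPre (shiftPre x ((k.scale (r i) (hr i)).smearPre f) -
      (k.scale (r i) (hr i)).smearPre f) v) atTop (𝓝 0) := by
  have h1 := k.tendsto_symPre_scale f (shiftPre (-x) v) hr h0
  have h2 := k.tendsto_symPre_scale f v hr h0
  rw [integral_shift_eq] at h1
  have h3 := h1.sub h2
  rw [sub_self] at h3
  refine h3.congr fun i => ?_
  have hs : shiftPre x (shiftPre (-x) v) = v := by
    apply Subtype.ext
    funext s l
    change v.1 (s - η x l.1 - η (-x) l.1) l = v.1 s l
    have : η (-x) l.1 = -η x l.1 := by simp only [η, Pi.neg_apply]; ring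
    rw [this, sub_neg_eq_add, sub_add_cancel]
  rw [map_sub, LinearMap.sub_apply, ← symPre_shift x _ (shiftPre (-x) v), hs]

theorem symPre_scale_shift (k : Kern) (f : PreH0) (x : Mink) {r : ℝ} (hr : 0 < r) :
    symPre ((k.scale r hr).smearPre f) (shiftPre x ((k.scale r hr).smearPre f)) =
      symPre (k.smearPre f) (shiftPre (r • x) (k.smearPre f)) := by
  rw [symPre_smearPre, symPre_smearPre]
  congr 2
  apply Subtype.ext
  funext l
  change (1 / (2 * Real.pi)) • ∫ s, (k.scale r hr).sgn s l •
      ((r * k.k (r * (s - η x l.1)) l) • f.fn l) =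
    (1 / (2 * Real.pi)) • ∫ s, k.sgn s l • (k.k (s - η (r • x) l.1) l • f.fn l)
  congr 1
  have h := Measure.integral_comp_mul_left (fun s => k.sgn s l •
    (k.k (s - η (r • x) l.1) l • f.fn l)) r
  rw [← one_smul ℝ (∫ s, k.sgn s l • (k.k (s - η (r • x) l.1) l • f.fn l)),
    ← mul_inv_cancel₀ hr.ne', mul_smul, ← abs_of_pos (inv_pos.2 hr), ← h, ← integral_smul r]
  refine integral_congr_ae (ae_of_all _ fun s => ?_)
  simp only [scale_sgn]
  rw [η_smul_left, mul_sub, smul_comm r, mul_smul]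

theorem integral_smearPre_scale_sq (k : Kern) (f : PreH0) {r : ℝ} (hr : 0 < r) (a : Fin 4) :
    ∫ q : S2 × ℝ, ((k.scale r hr).smearPre f).1 q.2 (sec q.1) a ^ 2 ∂(dl.prod volume) =
      r * ∫ q : S2 × ℝ, (k.smearPre f).1 q.2 (sec q.1) a ^ 2 ∂(dl.prod volume) := by
  rw [integral_prod _ (preT.integrable_sq _ a), integral_prod _ (preT.integrable_sq _ a),
    ← integral_const_mul]
  refine integral_congr_ae (ae_of_all _ fun n => ?_)
  change ∫ s, ((r * k.k (r * s) (sec n)) * f.fn (sec n) a) ^ 2 =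
    r * ∫ s, (k.k s (sec n) * f.fn (sec n) a) ^ 2
  have h := Measure.integral_comp_mul_left (fun s => (k.k s (sec n) * f.fn (sec n) a) ^ 2) r
  rw [smul_eq_mul, abs_of_pos (inv_pos.2 hr)] at h
  have h2 : ∫ s, (k.k s (sec n) * f.fn (sec n) a) ^ 2 =
      r * ∫ s, (k.k (r * s) (sec n) * f.fn (sec n) a) ^ 2 := by
    rw [h, mul_inv_cancel_left₀ hr.ne']
  rw [h2, ← integral_const_mul, ← integral_const_mul]
  refine integral_congr_ae (ae_of_all _ fun s => ?_)
  simp only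
  ring

end Kern

theorem inner_What_What (u v : Lhat) (φ ψ : Hhat) : inner ℂ (What u φ) (What v ψ) =
    phase (-symLhat.form u v) * inner ℂ φ (What (v - u) ψ) := by
  rw [← inner_What (-u), What_neg_What, What_What, inner_smul_right, map_neg, AddMonoidHom.neg_apply,
    neg_add_eq_sub]

theorem tendsto_inner_What_scale (k : Kern) (f : HIR) (x : Mink) {r : ℕ → ℝ} (hr : ∀ i, 0 < r i)
    (h0 : Tendsto r atTop (𝓝 0)) (φ ψ : Hhat) :
    Tendsto (fun i => inner ℂ (What ((k.scale (r i) (hr i)).smear f) φ)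
      (What (shiftLhat x ((k.scale (r i) (hr i)).smear f)) ψ)) atTop (𝓝 (inner ℂ φ ψ)) := by
  simp only [inner_What_What]
  have hp : ∀ i, pIR (shiftLhat x ((k.scale (r i) (hr i)).smear f) -
      (k.scale (r i) (hr i)).smear f) = 0 := fun i => by rw [pIR_sub, pIR_shift, sub_self]
  have h1 : Tendsto (fun i => phase (-symLhat.form ((k.scale (r i) (hr i)).smear f)
      (shiftLhat x ((k.scale (r i) (hr i)).smear f)))) atTop (𝓝 1) := by
    have h2 : Tendsto (fun i => symLhat.form ((k.scale (r i) (hr i)).smear f)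
        (shiftLhat x ((k.scale (r i) (hr i)).smear f))) atTop (𝓝 0) := by
      have h3 : Tendsto (fun i => r i • x) atTop (𝓝 0) := by simpa using h0.smul_const x
      have h4 := ((continuous_symT_shift (T.mk (k.smearPre f.rep))
        (T.mk (k.smearPre f.rep))).tendsto 0).comp h3
      have h5 : symT (T.mk (k.smearPre f.rep)) (shiftT 0 (T.mk (k.smearPre f.rep))) = 0 := by
        have : shiftT 0 (T.mk (k.smearPre f.rep)) = T.mk (k.smearPre f.rep) :=
          congrArg Subtype.val (shiftLhat_zero (k.smear f))
        rw [this, symT_self]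
      rw [h5] at h4
      exact h4.congr fun i => (k.symPre_scale_shift f.rep x (hr i)).symm
    have := (continuous_phase.tendsto 0).comp (by simpa using h2.neg)
    rwa [phase_zero] at this
  have h2 : Tendsto (fun i => What (shiftLhat x ((k.scale (r i) (hr i)).smear f) -
      (k.scale (r i) (hr i)).smear f) ψ) atTop (𝓝 ψ) := by
    have := tendsto_What (l := atTop) (w₀ := 0) (fun i => (hp i).trans pIR_zero.symm) ?_ (fun v => ?_) ψ
    · rwa [What_zero] at this
    · simp only [sub_zero]
      refine squeeze_zero (fun i => FL_self_nonneg (hp i)) (fun i =>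
        F_shift_sub_le x ((k.scale (r i) (hr i)).smearPre f.rep)) ?_
      simp only [Kern.integral_smearPre_scale_sq, ← Finset.mul_sum]
      simpa using (h0.mul_const (∑ a, ∫ q : S2 × ℝ, (k.smearPre f.rep).1 q.2 (sec q.1) a ^ 2
        ∂(dl.prod volume))).const_mul (4 * len x)
    · rw [map_zero, AddMonoidHom.zero_apply]
      obtain ⟨v, hv⟩ := v
      induction v using T.ind with
      | h v => exact k.tendsto_symPre_scale_shift f.rep v x hr h0
  simpa using h1.mul (tendsto_const_nhds.inner h2)

theorem exists_measurableSet_pos {X : Type} [MeasurableSpace X] {μ : Measure X} [SigmaFinite μ]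
    (hμ : μ ≠ 0) : ∃ B, MeasurableSet B ∧ μ B ≠ 0 ∧ μ B ≠ ⊤ := by
  by_contra! hc
  refine hμ (Measure.measure_univ_eq_zero.1 ?_)
  rw [← iUnion_spanningSets μ]
  refine measure_iUnion_null fun i => ?_
  by_contra hi
  exact (measure_spanningSets_lt_top μ i).ne (hc _ (measurableSet_spanningSets μ i) hi)

variable (h : Profile) {μ : Measure HIR}

/-- The vectors of the direct integral with dressings that tend to zero frequency. -/
theorem exists_soft_field (k : Kern) {B : Set HIR} (hB : MeasurableSet B) (hfin : μ B ≠ ⊤)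
    {u : Lhat} (hu : pIR u = 0) : ∃ Φ : SqField (dress h) μ, ∀ f, Φ.fn f =
      B.indicator (fun f => phase (symLhat.form (smear h f) (k.smear f - smear h f)) •
        What (k.smear f) (What u Ωhat)) f := by
  refine exists_sqField h (ξ := B.indicator fun f =>
    What (k.smear f - h.kern.smear f) (What u Ωhat)) ?_ (fun f => ?_) (fun f => ?_) ?_
  · exact (Kern.aestronglyMeasurable_What_smear_sub k h.kern aestronglyMeasurable_const).indicator hB
  · by_cases hf : f ∈ B
    · rw [Set.indicator_of_mem hf]
      have := What_Ωhat_mem u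
      rw [hu] at this
      exact What_mem_fiber_zero (Kern.pIR_smear_sub k h.kern f) this
    · rw [Set.indicator_of_notMem hf]; exact zero_mem _
  · by_cases hf : f ∈ B
    · rw [Set.indicator_of_mem hf, Set.indicator_of_mem hf, smear_eq,
        What_What (h.kern.smear f) (k.smear f - h.kern.smear f), add_sub_cancel]
    · rw [Set.indicator_of_notMem hf, Set.indicator_of_notMem hf, map_zero]
  · have : ∀ f, ‖B.indicator (fun f => phase (symLhat.form (smear h f) (k.smear f - smear h f)) •
        What (k.smear f) (What u Ωhat)) f‖ₑ ^ 2 = B.indicator (fun _ => 1) f := fun f => by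
      by_cases hf : f ∈ B
      · rw [Set.indicator_of_mem hf, Set.indicator_of_mem hf, enorm_smul, ← ofReal_norm,
          ← ofReal_norm, norm_phase, norm_What, norm_What_Ωhat]
        simp
      · rw [Set.indicator_of_notMem hf, Set.indicator_of_notMem hf]
        simp
    simp only [this]
    rw [lintegral_indicator hB, lintegral_one, Measure.restrict_apply_univ]
    exact hfin.lt_top

theorem inner_phase_smul (r : ℝ) (φ ψ : Hhat) (x : Mink) :
    inner ℂ (phase r • φ) (Uhat x (phase r • ψ)) = inner ℂ φ (Uhat x ψ) := by
  rw [map_smul, inner_smul_left, inner_smul_right, ← mul_assoc, ← Complex.normSq_eq_conj_mul_self,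
    Complex.normSq_eq_norm_sq, norm_phase]
  simp

variable [SigmaFinite μ]

theorem soft_relation {g : Mink → ℂ} (hg : Integrable g)
    (hz : ∀ φ ψ : DirectIntegral h μ, ∫ x, g x * inner ℂ φ (Ur h μ x ψ) = 0) (k : Kern)
    {B : Set HIR} (hB : MeasurableSet B) (hfin : μ B ≠ ⊤) {u v : Lhat} (hu : pIR u = 0)
    (hv : pIR v = 0) : AEStronglyMeasurable (fun f =>
      ∫ x, g x * inner ℂ (What (k.smear f) (What u Ωhat))
        (What (shiftLhat x (k.smear f)) (Uhat x (What v Ωhat)))) (μ.restrict B) ∧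
    ∫ f in B, (∫ x, g x * inner ℂ (What (k.smear f) (What u Ωhat))
      (What (shiftLhat x (k.smear f)) (Uhat x (What v Ωhat)))) ∂μ = 0 :=
  (exists_soft_field h k hB hfin hu).elim fun Ψ hΨ =>
  (exists_soft_field h k hB hfin hv).elim fun Φ hΦ => by
  have e : B.indicator (fun f => ∫ x, g x * inner ℂ (What (k.smear f) (What u Ωhat))
      (What (shiftLhat x (k.smear f)) (Uhat x (What v Ωhat)))) =
      fun f => ∫ x, g x * inner ℂ (Ψ.fn f) (Uhat x (Φ.fn f)) := by
    funext f
    simp only [hΨ, hΦ]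
    by_cases hf : f ∈ B
    · simp only [Set.indicator_of_mem hf, inner_phase_smul, Uhat_What]
    · simp only [Set.indicator_of_notMem hf, map_zero, inner_zero_left, mul_zero, integral_zero]
  refine ⟨?_, ?_⟩
  · rw [← aestronglyMeasurable_indicator_iff hB, e]
    exact (integrable_mul_inner_fields h hg Ψ Φ).integral_prod_right.aestronglyMeasurable
  · rw [← integral_indicator hB, e]
    exact (integral_mul_inner_Ur h hg Ψ Φ).symm.trans (hz _ _)

/-- A relation between the translations of the direct integral holds in the vacuum sector. -/
theorem vacuum_relation (hμ : μ ≠ 0) {g : Mink → ℂ} (hg : Integrable g)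
    (hz : ∀ φ ψ : DirectIntegral h μ, ∫ x, g x * inner ℂ φ (Ur h μ x ψ) = 0) {u v : Lhat}
    (hu : pIR u = 0) (hv : pIR v = 0) :
    ∫ x, g x * inner ℂ (What u Ωhat) (Uhat x (What v Ωhat)) = 0 := by
  obtain ⟨B, hB, h0, hfin⟩ := exists_measurableSet_pos hμ
  have hr : ∀ i : ℕ, 0 < 1 / ((i : ℝ) + 1) := fun i => by positivity
  obtain ⟨k, hk⟩ : ∃ k : ℕ → Kern, ∀ i, k i = h.kern.scale _ (hr i) := ⟨_, fun _ => rfl⟩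
  have hb : ∀ i f x, ‖inner ℂ (What ((k i).smear f) (What u Ωhat))
      (What (shiftLhat x ((k i).smear f)) (Uhat x (What v Ωhat)))‖ ≤ 1 := fun i f x => by
    refine (norm_inner_le_norm _ _).trans ?_
    simp only [norm_What, norm_Uhat]
    rw [← norm_What 0 Ωhat, norm_What_Ωhat, mul_one]
  have hx : ∀ f, Tendsto (fun i => ∫ x, g x * inner ℂ (What ((k i).smear f) (What u Ωhat))
      (What (shiftLhat x ((k i).smear f)) (Uhat x (What v Ωhat)))) atTop
      (𝓝 (∫ x, g x * inner ℂ (What u Ωhat) (Uhat x (What v Ωhat)))) := fun f => by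
    refine tendsto_integral_of_dominated_convergence (fun x => ‖g x‖) (fun i => ?_) hg.norm
      (fun i => ae_of_all _ fun x => ?_) (ae_of_all _ fun x => ?_)
    · simp only [← Uhat_What]
      exact (integrable_mul_inner_Uhat hg _ _).aestronglyMeasurable
    · rw [norm_mul]
      exact mul_le_of_le_one_right (norm_nonneg _) (hb i f x)
    · simp only [hk]
      exact (tendsto_inner_What_scale h.kern f x hr tendsto_one_div_add_atTop_nhds_zero_nat
        (What u Ωhat) (Uhat x (What v Ωhat))).const_mul (g x)
  have hfB : IsFiniteMeasure (μ.restrict B) := ⟨by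
    rw [Measure.restrict_apply_univ]; exact hfin.lt_top⟩
  have hlim : Tendsto (fun i => ∫ f in B, (∫ x, g x * inner ℂ (What ((k i).smear f) (What u Ωhat))
      (What (shiftLhat x ((k i).smear f)) (Uhat x (What v Ωhat)))) ∂μ) atTop
      (𝓝 (∫ f in B, (∫ x, g x * inner ℂ (What u Ωhat) (Uhat x (What v Ωhat))) ∂μ)) := by
    refine tendsto_integral_of_dominated_convergence (fun _ => ∫ x, ‖g x‖)
      (fun i => (soft_relation h hg hz (k i) hB hfin hu hv).1)
      (integrable_const _) (fun i => ae_of_all _ fun f => ?_) (ae_of_all _ fun f => hx f)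
    refine norm_integral_le_of_norm_le hg.norm (ae_of_all _ fun x => ?_)
    rw [norm_mul]
    exact mul_le_of_le_one_right (norm_nonneg _) (hb i f x)
  simp only [fun i => (soft_relation h hg hz (k i) hB hfin hu hv).2] at hlim
  have := tendsto_nhds_unique hlim tendsto_const_nhds
  rw [integral_const, smul_eq_zero] at this
  refine this.resolve_left ?_
  rw [Measure.real, Measure.restrict_apply_univ]
  exact ENNReal.toReal_ne_zero.2 ⟨h0, hfin⟩

theorem norm_cosh_sub_le {z : ℂ} (hz : ‖z‖ ≤ 1) :
    ‖z ^ 2 - (Complex.exp z + Complex.exp (-z) - 2)‖ ≤ 2 * ‖z‖ ^ 3 := by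
  have h1 := Complex.exp_bound hz (n := 3) (by norm_num)
  have h2 := Complex.exp_bound (x := -z) (by rwa [norm_neg]) (n := 3) (by norm_num)
  rw [norm_neg] at h2
  simp only [Finset.sum_range_succ, Finset.sum_range_zero, Nat.factorial] at h1 h2
  norm_num at h1 h2
  have h3 : z ^ 2 - (Complex.exp z + Complex.exp (-z) - 2) =
      -(Complex.exp z - (1 + z + z ^ 2 / 2)) - (Complex.exp (-z) - (1 + -z + z ^ 2 / 2)) := by ring
  rw [h3]
  refine (norm_sub_le _ _).trans ?_
  rw [norm_neg]
  have h4 : 0 ≤ ‖z‖ ^ 3 := by positivity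
  linarith

theorem integral_mul_sq_eq_zero {X : Type} [MeasurableSpace X] {ν : Measure X} {g A : X → ℂ}
    (hg : Integrable g ν) (hA : AEStronglyMeasurable A ν) {M : ℝ} (hM : ∀ x, ‖A x‖ ≤ M)
    (h : ∀ t : ℝ, ∫ x, g x * Complex.exp (t * A x) ∂ν = 0) : ∫ x, g x * A x ^ 2 ∂ν = 0 := by
  have hi : ∀ t : ℝ, Integrable (fun x => g x * Complex.exp (t * A x)) ν := fun t => by
    refine hg.mul_bdd (c := Real.exp (|t| * M))
      (Complex.continuous_exp.comp_aestronglyMeasurable (hA.const_mul _))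
      (ae_of_all _ fun x => ?_)
    refine (Complex.norm_exp_le_exp_norm _).trans (Real.exp_le_exp.2 ?_)
    rw [norm_mul, Complex.norm_real, Real.norm_eq_abs]
    exact mul_le_mul_of_nonneg_left (hM x) (abs_nonneg t)
  have h0 : ∫ x, g x ∂ν = 0 := by simpa using h 0
  have hA2 : Integrable (fun x => g x * A x ^ 2) ν := by
    refine hg.mul_bdd (c := M ^ 2) (hA.pow 2) (ae_of_all _ fun x => ?_)
    rw [norm_pow]
    exact pow_le_pow_left₀ (norm_nonneg _) (hM x) 2
  have key : ∀ t : ℝ, 0 < t → t * (|M| + 1) ≤ 1 →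
      ‖∫ x, g x * A x ^ 2 ∂ν‖ ≤ t * (2 * |M| ^ 3 * ∫ x, ‖g x‖ ∂ν) := by
    intro t ht ht1
    have hz : ∀ x, ‖(t : ℂ) * A x‖ ≤ t * |M| := fun x => by
      rw [norm_mul, Complex.norm_real, Real.norm_eq_abs, abs_of_pos ht]
      exact mul_le_mul_of_nonneg_left ((hM x).trans (le_abs_self M)) ht.le
    have h1 : ∫ x, g x * (((t : ℂ) * A x) ^ 2 - (Complex.exp (t * A x) +
        Complex.exp (-(t * A x)) - 2)) ∂ν = (t : ℂ) ^ 2 * ∫ x, g x * A x ^ 2 ∂ν := by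
      have e : ∀ x, g x * (((t : ℂ) * A x) ^ 2 - (Complex.exp (t * A x) +
          Complex.exp (-(t * A x)) - 2)) = ((t : ℂ) ^ 2 * (g x * A x ^ 2) + 2 * g x) -
            (g x * Complex.exp (t * A x) + g x * Complex.exp ((-t : ℝ) * A x)) := fun x => by
        push_cast
        rw [neg_mul]
        ring
      simp only [e]
      have i1 : Integrable (fun x => (t : ℂ) ^ 2 * (g x * A x ^ 2)) ν := hA2.const_mul _
      have i2 : Integrable (fun x => 2 * g x) ν := hg.const_mul _
      rw [integral_sub (f := fun x => (t : ℂ) ^ 2 * (g x * A x ^ 2) + 2 * g x)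
        (g := fun x => g x * Complex.exp (t * A x) + g x * Complex.exp ((-t : ℝ) * A x))
        (i1.add i2) ((hi t).add (hi (-t))), integral_add i1 i2, integral_add (hi t) (hi (-t)), h,
        h, integral_const_mul ((t : ℂ) ^ 2), integral_const_mul (2 : ℂ), h0]
      ring
    have h2 : ‖∫ x, g x * (((t : ℂ) * A x) ^ 2 - (Complex.exp (t * A x) +
        Complex.exp (-(t * A x)) - 2)) ∂ν‖ ≤ (∫ x, ‖g x‖ ∂ν) * (2 * (t * |M|) ^ 3) := by
      rw [← integral_mul_const]
      refine norm_integral_le_of_norm_le (hg.norm.mul_const _) (ae_of_all _ fun x => ?_)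
      rw [norm_mul]
      refine mul_le_mul_of_nonneg_left ((norm_cosh_sub_le ((hz x).trans ?_)).trans ?_)
        (norm_nonneg _)
      · nlinarith [abs_nonneg M]
      · exact mul_le_mul_of_nonneg_left (pow_le_pow_left₀ (norm_nonneg _) (hz x) 3) two_pos.le
    rw [h1, norm_mul, norm_pow, Complex.norm_real, Real.norm_eq_abs, abs_of_pos ht] at h2
    have h3 : 0 < t ^ 2 := by positivity
    refine le_of_mul_le_mul_left (h2.trans (le_of_eq ?_)) h3
    ring
  rw [← norm_le_zero_iff]
  have hlim : Tendsto (fun t : ℝ => t * (2 * |M| ^ 3 * ∫ x, ‖g x‖ ∂ν)) (𝓝[>] 0) (𝓝 0) := by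
    have : Tendsto (fun t : ℝ => t * (2 * |M| ^ 3 * ∫ x, ‖g x‖ ∂ν)) (𝓝 0)
        (𝓝 (0 * (2 * |M| ^ 3 * ∫ x, ‖g x‖ ∂ν))) := tendsto_id.mul_const _
    rw [zero_mul] at this
    exact this.mono_left nhdsWithin_le_nhds
  refine ge_of_tendsto hlim ?_
  have hM1 : 0 < |M| + 1 := by positivity
  filter_upwards [Ioo_mem_nhdsGT (one_div_pos.2 hM1)] with t ht
  refine key t ht.1 ?_
  have := ht.2.le
  rwa [le_div_iff₀ hM1] at this

theorem FPre_shift_eq (u v : preT) (x : Mink) : FPre u (shiftPre x v) =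
    ∫ q, FKer u v q * Complex.exp (Complex.I * η (mom q) x) ∂dlw := by
  rw [FPre_eq]
  simp only [FKer_shift]

theorem integrable_FKer_exp {u v : preT} (hu : u ∈ kerP) (hv : v ∈ kerP) (x : Mink) :
    Integrable (fun q => FKer u v q * Complex.exp (Complex.I * η (mom q) x)) dlw := by
  simp only [← FKer_shift]
  refine FKer_integrable hu ?_
  rw [mem_kerP] at hv ⊢
  exact (p_shift x (T.mk v)).trans hv

theorem continuous_FPre_shift {u v : preT} (hu : u ∈ kerP) (hv : v ∈ kerP) :
    Continuous fun x => FPre u (shiftPre x v) := by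
  simp only [FPre_shift_eq]
  refine continuous_of_dominated (bound := fun q => ‖FKer u v q‖)
    (fun x => (integrable_FKer_exp hu hv x).aestronglyMeasurable) (fun x => ae_of_all _ fun q => ?_)
    (FKer_integrable hu hv).norm (ae_of_all _ fun q => ?_)
  · rw [norm_mul, mul_comm Complex.I, Complex.norm_exp_ofReal_mul_I, mul_one]
  · unfold η; fun_prop

theorem norm_FPre_shift_le (u v : preT) (x : Mink) :
    ‖FPre u (shiftPre x v)‖ ≤ ∫ q, ‖FKer u v q‖ ∂dlw := by
  rw [FPre_shift_eq]
  refine (norm_integral_le_integral_norm _).trans (le_of_eq ?_)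
  refine integral_congr_ae (ae_of_all _ fun q => ?_)
  simp only
  rw [norm_mul, mul_comm Complex.I, Complex.norm_exp_ofReal_mul_I, mul_one]

theorem mft_mul_exp (g : Mink → ℂ) (p q : Mink) :
    mft (fun x => g x * Complex.exp (Complex.I * η p x)) q = mft g (p + q) := by
  rw [mft, mft]
  refine integral_congr_ae (ae_of_all _ fun x => ?_)
  simp only
  rw [mul_assoc, ← Complex.exp_add, η_add_left]
  push_cast
  ring_nf

theorem integral_mul_FPre_shift {u v : preT} (hu : u ∈ kerP) (hv : v ∈ kerP) {g : Mink → ℂ}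
    (hg : Integrable g) : ∫ x, g x * FPre u (shiftPre x v) =
      ∫ q, FKer u v q * mft g (mom q) ∂dlw := by
  have hm : Measurable fun z : Mink × (S2 × ℝ) =>
      Complex.exp (Complex.I * η (mom z.2) z.1) :=
    Complex.measurable_exp.comp (measurable_const.mul (Complex.measurable_ofReal.comp
      (continuous_η.measurable.comp ((measurable_mom.comp measurable_snd).prodMk measurable_fst))))
  have hi : Integrable (fun z : Mink × (S2 × ℝ) => g z.1 *
      (FKer u v z.2 * Complex.exp (Complex.I * η (mom z.2) z.1))) (volume.prod dlw) := by
    simp only [← mul_assoc]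
    refine (hg.mul_prod (FKer_integrable hu hv)).mul_bdd (c := 1) hm.aestronglyMeasurable
      (ae_of_all _ fun z => ?_)
    rw [mul_comm, Complex.norm_exp_ofReal_mul_I]
  simp only [FPre_shift_eq, ← integral_const_mul]
  rw [integral_integral_swap hi]
  refine integral_congr_ae (ae_of_all _ fun q => ?_)
  simp only
  rw [mft, ← integral_const_mul]
  refine integral_congr_ae (ae_of_all _ fun x => ?_)
  simp only
  ring

/-- The relations between the translations of the vacuum sector, as a property of the kernel. -/
def VacuumRelation (g : Mink → ℂ) : Prop := ∀ u v : Lhat, pIR u = 0 → pIR v = 0 →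
  ∫ x, g x * inner ℂ (What u Ωhat) (Uhat x (What v Ωhat)) = 0

namespace VacuumRelation

variable {g : Mink → ℂ}

theorem exp_eq_zero (h : VacuumRelation g) {u v : preT} (hu : u ∈ kerP) (hv : v ∈ kerP) :
    ∫ x, g x * Complex.exp (FPre u (shiftPre x v)) = 0 := by
  have hmem : ∀ w : preT, w ∈ kerP → T.mk w ∈ LhatSub := fun w hw => by
    change p (T.mk w) ∈ HIRsub
    rw [(mem_kerP w).1 hw]
    exact zero_mem _
  have hp : ∀ (w : preT) (hw : w ∈ kerP), pIR ⟨T.mk w, hmem w hw⟩ = 0 := fun w hw =>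
    Subtype.ext ((mem_kerP w).1 hw)
  have h1 := h ⟨T.mk u, hmem u hu⟩ ⟨T.mk v, hmem v hv⟩ (hp u hu) (hp v hv)
  obtain ⟨c, hc, hx⟩ : ∃ c : ℂ, c ≠ 0 ∧ ∀ x, inner ℂ (What ⟨T.mk u, hmem u hu⟩ Ωhat)
      (Uhat x (What ⟨T.mk v, hmem v hv⟩ Ωhat)) = c * Complex.exp (FPre u (shiftPre x v)) := by
    refine ⟨Complex.exp (-(1 / 2) * FPre u u) * Complex.exp (-(1 / 2) * FPre v v),
      mul_ne_zero (Complex.exp_ne_zero _) (Complex.exp_ne_zero _), fun x => ?_⟩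
    rw [Uhat_What_Ωhat, inner_What_Ωhat,
      phase_mul_vacuum_sub (hp u hu) ((pIR_shift x _).trans (hp v hv))]
    have e1 : FL (shiftLhat x ⟨T.mk v, hmem v hv⟩) (shiftLhat x ⟨T.mk v, hmem v hv⟩) = FPre v v :=
      (F_shift x (T.mk v) (T.mk v)).trans (F_mk v v)
    have e2 : FL ⟨T.mk u, hmem u hu⟩ ⟨T.mk u, hmem u hu⟩ = FPre u u := F_mk u u
    have e3 : FL ⟨T.mk u, hmem u hu⟩ (shiftLhat x ⟨T.mk v, hmem v hv⟩) =
        FPre u (shiftPre x v) := F_mk u (shiftPre x v)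
    rw [e1, e2, e3]
  simp only [hx, mul_left_comm _ c] at h1
  rw [integral_const_mul c] at h1
  exact (mul_eq_zero.1 h1).resolve_left hc

theorem sq_eq_zero (h : VacuumRelation g) (hg : Integrable g) {u v : preT} (hu : u ∈ kerP)
    (hv : v ∈ kerP) : ∫ x, g x * FPre u (shiftPre x v) ^ 2 = 0 := by
  refine integral_mul_sq_eq_zero hg (continuous_FPre_shift hu hv).aestronglyMeasurable
    (norm_FPre_shift_le u v) fun t => ?_
  have := h.exp_eq_zero (kerP.smul_mem t hu) hv
  simpa only [FPre_smul_left] using this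

theorem prod_eq_zero (h : VacuumRelation g) (hg : Integrable g) {u v : preT} (hu : u ∈ kerP)
    (hv : v ∈ kerP) (huv : ∀ q, FKer u v q = 0) :
    ∫ q, FKer u u q * ∫ q', FKer v v q' * mft g (mom q + mom q') ∂dlw ∂dlw = 0 := by
  have hs : ∀ {w : preT} (x : Mink), w ∈ kerP → shiftPre x w ∈ kerP := fun {w} x hw => by
    rw [mem_kerP] at hw ⊢
    exact (p_shift x (T.mk w)).trans hw
  have hsum : ∀ x, FPre (u + v) (shiftPre x (u + v)) =
      FPre u (shiftPre x u) + FPre v (shiftPre x v) := fun x => by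
    have h1 : FPre u (shiftPre x v) = 0 := by
      rw [FPre_shift_eq]; simp [huv]
    have h2 : FPre v (shiftPre x u) = 0 := by
      rw [FPre_shift_eq]; simp [FKer_conj v u, huv]
    have h3 : ∀ w, w ∈ kerP → FPre w (shiftPre x (u + v)) =
        FPre w (shiftPre x u) + FPre w (shiftPre x v) := fun w hw => by
      rw [map_add, FPre_conj, FPre_add_left (hs x hu) (hs x hv) hw, map_add, ← FPre_conj,
        ← FPre_conj]
    rw [FPre_add_left hu hv (hs x (kerP.add_mem hu hv)), h3 u hu, h3 v hv, h1, h2]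
    ring
  have hc := fun {w : preT} (hw : w ∈ kerP) => continuous_FPre_shift hw hw
  have hi : ∀ {a b : Mink → ℂ}, Continuous a → Continuous b → (∃ C, ∀ x, ‖a x‖ ≤ C) →
      (∃ C, ∀ x, ‖b x‖ ≤ C) → Integrable fun x => g x * a x * b x := by
    rintro a b ha hb ⟨C, hC⟩ ⟨D, hD⟩
    exact (hg.mul_bdd ha.aestronglyMeasurable (ae_of_all _ hC)).mul_bdd hb.aestronglyMeasurable
      (ae_of_all _ hD)
  have hbd := fun w : preT => (⟨_, norm_FPre_shift_le w w⟩ : ∃ C, ∀ x, ‖FPre w (shiftPre x w)‖ ≤ C)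
  have h1 : ∫ x, g x * FPre v (shiftPre x v) * FPre u (shiftPre x u) = 0 := by
    have e := h.sq_eq_zero hg (kerP.add_mem hu hv) (kerP.add_mem hu hv)
    have e1 : ∀ x, g x * FPre (u + v) (shiftPre x (u + v)) ^ 2 =
        (g x * FPre u (shiftPre x u) ^ 2 + g x * FPre v (shiftPre x v) ^ 2) +
          2 * (g x * FPre v (shiftPre x v) * FPre u (shiftPre x u)) := fun x => by
      rw [hsum]; ring
    simp only [e1] at e
    have i1 : Integrable fun x => g x * FPre u (shiftPre x u) ^ 2 :=
      (hi (hc hu) (hc hu) (hbd u) (hbd u)).congr (ae_of_all _ fun x => by simp only; ring)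
    have i2 : Integrable fun x => g x * FPre v (shiftPre x v) ^ 2 :=
      (hi (hc hv) (hc hv) (hbd v) (hbd v)).congr (ae_of_all _ fun x => by simp only; ring)
    have i3 := (hi (hc hv) (hc hu) (hbd v) (hbd u)).const_mul 2
    rw [integral_add (f := fun x => g x * FPre u (shiftPre x u) ^ 2 +
      g x * FPre v (shiftPre x v) ^ 2) (i1.add i2) i3, integral_add i1 i2, h.sq_eq_zero hg hu hu,
      h.sq_eq_zero hg hv hv, integral_const_mul (2 : ℂ)] at e
    simpa using e
  have hgv : Integrable fun x => g x * FPre v (shiftPre x v) :=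
    hg.mul_bdd (hc hv).aestronglyMeasurable (ae_of_all _ (norm_FPre_shift_le v v))
  rw [integral_mul_FPre_shift hu hu hgv] at h1
  rw [← h1]
  refine integral_congr_ae (ae_of_all _ fun q => ?_)
  simp only
  congr 1
  simp only [← mft_mul_exp]
  rw [← integral_mul_FPre_shift hv hv (integrable_mul_exp_η hg (mom q)), mft]
  refine integral_congr_ae (ae_of_all _ fun x => ?_)
  simp only
  ring

end VacuumRelation

/-- A real function whose Fourier transform is nonzero near `ω` only, among positive
frequencies. -/
theorem exists_frequency_bump {ω δ : ℝ} (hδ : 0 < δ) (hω : δ ≤ ω) : ∃ b : ℝ → ℝ, Continuous b ∧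
    (∃ C, ∀ s, |b s| ≤ C / (1 + |s|) ^ 2) ∧ (∫ s, b s = 0) ∧
      (∀ w, 0 < w → δ ≤ |w - ω| → ft b w = 0) ∧ ∀ w, 0 < w → |w - ω| < δ → ft b w ≠ 0 := by
  obtain ⟨G, χ, hG, hi, ⟨C, hC⟩, hχ, -, hpos, hz⟩ := exists_bump ω hδ
  have hft : ∀ w : ℝ, ∫ s, ((G s).re : ℂ) * Complex.exp (Complex.I * w * s) =
      ((χ w + χ (-w)) / 2 : ℝ) := fun w => by
    have i1 : ∀ p : ℝ, Integrable fun s : ℝ => G s * Complex.exp (Complex.I * p * s) := fun p =>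
      hi.mul_bdd (c := 1) (by fun_prop) (ae_of_all _ fun s => (norm_exp_I_mul p s).le)
    have h1 := hχ w
    have h2 : ∫ s : ℝ, conj (G s * Complex.exp (Complex.I * (-w : ℝ) * s)) = χ (-w) := by
      rw [integral_conj, hχ, Complex.conj_ofReal]
    have e : ∀ s : ℝ, ((G s).re : ℂ) * Complex.exp (Complex.I * w * s) =
        1 / 2 * (G s * Complex.exp (Complex.I * w * s) +
          conj (G s * Complex.exp (Complex.I * (-w : ℝ) * s))) := fun s => by
      have h3 : conj (Complex.I * (-w : ℝ) * (s : ℂ)) = Complex.I * w * s := by simp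
      rw [map_mul, ← Complex.exp_conj, h3, ← add_mul, Complex.add_conj]
      push_cast
      ring
    simp only [e]
    rw [integral_const_mul (1 / 2 : ℂ), integral_add (i1 w), h1, h2]
    · push_cast; ring
    · exact (LinearIsometryEquiv.integrable_comp_iff Complex.conjLIE).2 (i1 (-w))
  have hneg : ∀ w, 0 < w → χ (-w) = 0 := fun w hw => hz _ (by
    rw [abs_sub_comm, abs_of_pos (by linarith)]; linarith)
  have hpi : ((1 / (2 * Real.pi) : ℝ) : ℂ) ≠ 0 := by
    have : (1 / (2 * Real.pi) : ℝ) ≠ 0 := by positivity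
    exact_mod_cast this
  refine ⟨fun s => (G s).re, Complex.continuous_re.comp hG,
    ⟨C, fun s => (Complex.abs_re_le_norm _).trans (hC s)⟩, ?_, fun w hw h => ?_, fun w hw h => ?_⟩
  · have h0 := hft 0
    have h1 : χ 0 = 0 := hz 0 (by rw [abs_sub_comm, sub_zero, abs_of_pos (by linarith)]; exact hω)
    simp only [Complex.ofReal_zero, mul_zero, zero_mul, Complex.exp_zero, mul_one, neg_zero, h1,
      add_zero, zero_div] at h0
    rw [integral_complex_ofReal] at h0
    exact_mod_cast h0
  · rw [ft, hft, hz w h, hneg w hw]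
    simp
  · rw [ft, hft, hneg w hw]
    have := hpos w h
    refine mul_ne_zero (by exact_mod_cast hpi) (Complex.ofReal_ne_zero.2 ?_)
    positivity

/-- The rotation field about the third axis. -/
def rot (m : Mink) : Mink := ![0, -m 2, m 1, 0]

theorem η_rot (m : Mink) : η m (rot m) = 0 := by simp [η, rot]; ring

theorem η_rot_rot (m : Mink) : -η (rot m) (rot m) = m 1 ^ 2 + m 2 ^ 2 := by simp [η, rot]; ring

theorem measurable_rot : Measurable rot :=
  (by unfold rot; fun_prop : Continuous rot).measurable

/-- Wave packets: a profile in `s`, tangent to the cone, cut off in the angles. -/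
def packetFn (b : ℝ → ℝ) (N : Set Mink) (s : ℝ) (l : Cone) : Mink :=
  (l.1 0 ^ (-2 : ℤ) * b (s / l.1 0)) • N.indicator rot ((l.1 0)⁻¹ • l.1)

theorem packetFn_sec (b : ℝ → ℝ) (N : Set Mink) (s : ℝ) (n : S2) :
    packetFn b N s (sec n) = b s • N.indicator rot (sec n).1 := by
  rw [packetFn, sec_zero]; simp

theorem abs_indicator_rot_le (N : Set Mink) (n : S2) (a : Fin 4) :
    |N.indicator rot (sec n).1 a| ≤ 1 := by
  by_cases h : (sec n).1 ∈ N
  · rw [Set.indicator_of_mem h]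
    have h1 := abs_sec_le n 1
    have h2 := abs_sec_le n 2
    fin_cases a <;> simp [rot] <;> assumption
  · rw [Set.indicator_of_notMem h]; simp

theorem packetFn_mem {b : ℝ → ℝ} (hb : Continuous b) (hC : ∃ C, ∀ s, |b s| ≤ C / (1 + |s|) ^ 2)
    {N : Set Mink} (hN : MeasurableSet N) : packetFn b N ∈ preT := by
  have hm : Measurable (onSec (packetFn b N)) := by
    have : onSec (packetFn b N) = fun q : S2 × ℝ => b q.2 • N.indicator rot (sec q.1).1 :=
      funext fun q => packetFn_sec b N q.2 q.1
    rw [this]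
    exact (hb.measurable.comp measurable_snd).smul
      ((measurable_rot.indicator hN).comp (measurable_sec.comp measurable_fst))
  refine ⟨fun μ l l' hμ hl s => ?_, hm, fun s l => ?_, 1, one_pos, fun a => ?_⟩
  · have h0 := l.2.1.ne'
    have e : (μ * l.1 0)⁻¹ • μ • l.1 = (l.1 0)⁻¹ • l.1 := by
      rw [smul_smul]
      congr 1
      field_simp
    simp only [packetFn, hl, Pi.smul_apply, smul_eq_mul, e]
    rw [mul_div_mul_left _ _ hμ.ne', mul_zpow, mul_assoc, smul_smul]
  · rw [packetFn, η_smul_right]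
    by_cases h : (l.1 0)⁻¹ • l.1 ∈ N
    · have h0 := l.2.1.ne'
      have h1 := η_rot ((l.1 0)⁻¹ • l.1)
      rw [η_smul_left] at h1
      rw [Set.indicator_of_mem h, (mul_eq_zero.1 h1).resolve_left (inv_ne_zero h0), mul_zero]
    · rw [Set.indicator_of_notMem h, η_zero_right, mul_zero]
  · obtain ⟨C, hC⟩ := hC
    have hi : Integrable (fun q : S2 × ℝ => C ^ 2 * (weight 1 q.2)⁻¹) (dl.prod volume) :=
      ((integrable_inv_weight one_pos).comp_snd dl).const_mul _
    refine hi.mono' ?_ (ae_of_all _ fun q => ?_)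
    · exact (((measurable_comp_onSec hm a).pow_const 2).mul
        ((continuous_weight 1).measurable.comp measurable_snd)).aestronglyMeasurable
    · have hw : weight 1 q.2 = (1 + |q.2|) ^ 2 := by
        rw [weight, ← Real.rpow_natCast]; norm_num
      have hp : 0 < (1 + |q.2|) ^ 2 := by positivity
      have h1 := hC q.2
      have h2 : |b q.2 * N.indicator rot (sec q.1).1 a| ≤ C / (1 + |q.2|) ^ 2 := by
        rw [abs_mul]
        exact (mul_le_of_le_one_right (abs_nonneg _) (abs_indicator_rot_le N q.1 a)).trans h1
      rw [packetFn_sec, Pi.smul_apply, smul_eq_mul, hw, norm_mul, Real.norm_eq_abs,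
        Real.norm_eq_abs, abs_of_pos hp, abs_pow]
      calc _ ≤ (C / (1 + |q.2|) ^ 2) ^ 2 * (1 + |q.2|) ^ 2 := by gcongr
        _ = _ := by field_simp

/-- The wave packets as elements of the space of representatives. -/
def packet {b : ℝ → ℝ} (hb : Continuous b) (hC : ∃ C, ∀ s, |b s| ≤ C / (1 + |s|) ^ 2)
    {N : Set Mink} (hN : MeasurableSet N) : preT := ⟨packetFn b N, packetFn_mem hb hC hN⟩

section packet

variable {b : ℝ → ℝ} (hb : Continuous b) (hC : ∃ C, ∀ s, |b s| ≤ C / (1 + |s|) ^ 2)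
  {N : Set Mink} (hN : MeasurableSet N)

theorem fourier_packet (w : ℝ) (n : S2) (a : Fin 4) :
    fourier (packet hb hC hN) w (sec n) a = ft b w * (N.indicator rot (sec n).1 a : ℝ) := by
  rw [fourier_eq_ft, ft, ft]
  have : ∀ s : ℝ, (((packet hb hC hN).1 s (sec n) a : ℝ) : ℂ) * Complex.exp (Complex.I * w * s) =
      ((b s : ℝ) : ℂ) * Complex.exp (Complex.I * w * s) * (N.indicator rot (sec n).1 a : ℝ) :=
    fun s => by
    change ((packetFn b N s (sec n) a : ℝ) : ℂ) * _ = _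
    rw [packetFn_sec, Pi.smul_apply, smul_eq_mul]
    push_cast
    ring
  simp only [this]
  rw [integral_mul_const, mul_assoc]

theorem packet_mem_kerP (h0 : ∫ s, b s = 0) : packet hb hC hN ∈ kerP := by
  refine (mem_kerP _).2 (H0.mk_eq_zero_of_ae ?_)
  filter_upwards [preT.integrable_slice (packet hb hC hN)] with n hn
  refine ⟨0, ?_⟩
  rw [zero_smul]
  change (1 / (2 * Real.pi)) • ∫ s, packetFn b N s (sec n) = 0
  simp only [packetFn_sec]
  rw [integral_smul_const, h0, zero_smul, smul_zero]

theorem FKer_packet_self (q : S2 × ℝ) : FKer (packet hb hC hN) (packet hb hC hN) q =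
    ((N.indicator (fun m => m 1 ^ 2 + m 2 ^ 2) (sec q.1).1 * (‖ft b q.2‖ ^ 2 / q.2) : ℝ) : ℂ) := by
  have h1 : N.indicator (fun m => m 1 ^ 2 + m 2 ^ 2) (sec q.1).1 =
      -η (N.indicator rot (sec q.1).1) (N.indicator rot (sec q.1).1) := by
    by_cases h : (sec q.1).1 ∈ N
    · rw [Set.indicator_of_mem h, Set.indicator_of_mem h, η_rot_rot]
    · rw [Set.indicator_of_notMem h, Set.indicator_of_notMem h, η_zero_right, neg_zero]
  have h2 : ((‖ft b q.2‖ ^ 2 : ℝ) : ℂ) = conj (ft b q.2) * ft b q.2 := by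
    rw [← Complex.normSq_eq_conj_mul_self, Complex.normSq_eq_norm_sq]
  rw [h1, ← mul_div_assoc, Complex.ofReal_div, Complex.ofReal_mul, h2]
  simp only [FKer, ηC, fourier_packet, η, map_mul, Complex.conj_ofReal]
  push_cast
  ring

theorem FKer_packet_of_disjoint {b' : ℝ → ℝ} (hb' : Continuous b')
    (hC' : ∃ C, ∀ s, |b' s| ≤ C / (1 + |s|) ^ 2) {N' : Set Mink} (hN' : MeasurableSet N')
    (hd : Disjoint N N') (q : S2 × ℝ) : FKer (packet hb hC hN) (packet hb' hC' hN') q = 0 := by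
  simp only [FKer, ηC, fourier_packet]
  by_cases h : (sec q.1).1 ∈ N
  · rw [Set.indicator_of_notMem (Set.disjoint_left.1 hd h)]
    simp
  · rw [Set.indicator_of_notMem h]
    simp

theorem integral_norm_FKer_packet_pos (hz : ∫ s, b s = 0) (hO : IsOpen N) {n : S2}
    (hn : (sec n).1 ∈ N) (hn' : (sec n).1 1 ≠ 0 ∨ (sec n).1 2 ≠ 0) {ω δ : ℝ} (hδ : 0 < δ)
    (hω : δ ≤ ω) (hf : ∀ w, 0 < w → |w - ω| < δ → ft b w ≠ 0) :
    0 < ∫ q, ‖FKer (packet hb hC hN) (packet hb hC hN) q‖ ∂dlw := by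
  have hk := packet_mem_kerP hb hC hN hz
  rw [integral_pos_iff_support_of_nonneg (fun q => norm_nonneg _) (FKer_integrable hk hk).norm]
  let S : Set S2 := {m | (sec m).1 ∈ N ∧ (sec m).1 1 ^ 2 + (sec m).1 2 ^ 2 ≠ 0}
  have hS : IsOpen S := by
    have hc : Continuous fun m : S2 => (sec m).1 := continuous_subtype_val.comp continuous_sec
    refine (hO.preimage hc).inter (isOpen_ne_fun (f := fun m : S2 => (sec m).1 1 ^ 2 +
      (sec m).1 2 ^ 2) ?_ continuous_const)
    exact (((continuous_apply 1).comp hc).pow 2).add (((continuous_apply 2).comp hc).pow 2)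
  have hnS : n ∈ S := ⟨hn, by
    rcases hn' with h | h
    · have := sq_pos_of_ne_zero h; positivity
    · have := sq_pos_of_ne_zero h; positivity⟩
  have hsub : S ×ˢ Set.Ioo (ω - δ) (ω + δ) ⊆
      Function.support fun q => ‖FKer (packet hb hC hN) (packet hb hC hN) q‖ := by
    rintro ⟨m, w⟩ ⟨hm, hw⟩
    have hw0 : 0 < w := by linarith [hw.1]
    rw [Function.mem_support, norm_ne_zero_iff, FKer_packet_self, Set.indicator_of_mem hm.1,
      Complex.ofReal_ne_zero]
    refine mul_ne_zero hm.2 (div_ne_zero (pow_ne_zero _ (norm_ne_zero_iff.2 (hf w hw0 ?_))) hw0.ne')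
    rw [abs_sub_lt_iff]
    constructor <;> linarith [hw.1, hw.2]
  refine lt_of_lt_of_le ?_ (measure_mono hsub)
  rw [Measure.prod_prod, Measure.restrict_apply measurableSet_Ioo, Set.inter_eq_left.2
    (fun w hw => by change 0 < w; linarith [hw.1]), Real.volume_Ioo]
  have : (dl : Measure S2).IsOpenPosMeasure := by unfold dl; infer_instance
  refine ENNReal.mul_pos (hS.measure_pos _ ⟨n, hnS⟩).ne' ?_
  rw [ne_eq, ENNReal.ofReal_eq_zero, not_le]
  linarith

end packet

theorem eq_zero_of_integral_prod {X : Type} [MeasurableSpace X] {ν : Measure X} [SFinite ν]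
    {D D' : X → ℂ} (hD : Integrable D ν) (hD' : Integrable D' ν) {Φ : X → X → ℂ}
    (hΦ : Measurable (Function.uncurry Φ)) {C : ℝ} (hC : ∀ q q', ‖Φ q q'‖ ≤ C) {E : ℂ}
    (h : ∀ᵐ z ∂(ν.prod ν), D z.1 ≠ 0 → D' z.2 ≠ 0 → ‖E - Φ z.1 z.2‖ ≤ ‖E‖ / 2)
    (hz : ∫ q, D q * ∫ q', D' q' * Φ q q' ∂ν ∂ν = 0) (e : ∫ q, D q ∂ν = (∫ q, ‖D q‖ ∂ν : ℝ))
    (e' : ∫ q, D' q ∂ν = (∫ q, ‖D' q‖ ∂ν : ℝ)) (hp : 0 < ∫ q, ‖D q‖ ∂ν)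
    (hp' : 0 < ∫ q, ‖D' q‖ ∂ν) : E = 0 := by
  have i0 : Integrable (fun z : X × X => D z.1 * D' z.2) (ν.prod ν) := hD.mul_prod hD'
  have i1 : Integrable (fun z : X × X => D z.1 * D' z.2 * Φ z.1 z.2) (ν.prod ν) :=
    i0.mul_bdd hΦ.aestronglyMeasurable (ae_of_all _ fun z => hC z.1 z.2)
  have h1 : ∫ z, D z.1 * D' z.2 * Φ z.1 z.2 ∂(ν.prod ν) = 0 := by
    rw [integral_prod _ i1, ← hz]
    simp only [mul_assoc, integral_const_mul]
  have h2 : ∫ z, (D z.1 * D' z.2 * E - D z.1 * D' z.2 * Φ z.1 z.2) ∂(ν.prod ν) =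
      (∫ q, ‖D q‖ ∂ν : ℝ) * (∫ q, ‖D' q‖ ∂ν : ℝ) * E := by
    rw [integral_sub (i0.mul_const E) i1, h1, sub_zero, integral_mul_const, integral_prod_mul,
      e, e']
  have h3 : ‖∫ z, (D z.1 * D' z.2 * E - D z.1 * D' z.2 * Φ z.1 z.2) ∂(ν.prod ν)‖ ≤
      (∫ q, ‖D q‖ ∂ν) * (∫ q, ‖D' q‖ ∂ν) * (‖E‖ / 2) := by
    rw [← integral_prod_mul, ← integral_mul_const]
    refine norm_integral_le_of_norm_le ((hD.norm.mul_prod hD'.norm).mul_const _) ?_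
    filter_upwards [h] with z hz
    rw [← mul_sub, norm_mul, norm_mul]
    by_cases z1 : D z.1 = 0
    · simp [z1]
    by_cases z2 : D' z.2 = 0
    · simp [z2]
    exact mul_le_mul_of_nonneg_left (hz z1 z2) (by positivity)
  rw [h2, norm_mul, norm_mul, Complex.norm_real, Complex.norm_real, Real.norm_of_nonneg hp.le,
    Real.norm_of_nonneg hp'.le] at h3
  by_contra hE
  have := norm_pos_iff.2 hE
  have hpp := mul_pos hp hp'
  nlinarith [mul_pos hpp this]

theorem norm_mft_le (g : Mink → ℂ) (p : Mink) : ‖mft g p‖ ≤ ∫ x, ‖g x‖ := by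
  refine (norm_integral_le_integral_norm _).trans (le_of_eq ?_)
  refine integral_congr_ae (ae_of_all _ fun x => ?_)
  simp only
  rw [norm_mul, mul_comm Complex.I, Complex.norm_exp_ofReal_mul_I, mul_one]

theorem integral_FKer_self (u : preT) :
    ∫ q, FKer u u q ∂dlw = (∫ q, ‖FKer u u q‖ ∂dlw : ℝ) := by
  rw [← integral_complex_ofReal]
  refine integral_congr_ae ?_
  filter_upwards [FKer_self_nonneg u] with q hq
  have : FKer u u q = ((FKer u u q).re : ℂ) := Complex.ext rfl hq.2
  rw [this, Complex.norm_real, Real.norm_of_nonneg hq.1]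

/-- A sum of two different null momenta lies in the spectrum of the vacuum sector. -/
theorem VacuumRelation.mft_eq_zero {g : Mink → ℂ} (h : VacuumRelation g) (hg : Integrable g)
    {n n' : S2} (hnn : (sec n).1 ≠ (sec n').1) (hn : (sec n).1 1 ≠ 0 ∨ (sec n).1 2 ≠ 0)
    (hn' : (sec n').1 1 ≠ 0 ∨ (sec n').1 2 ≠ 0) {ω ω' : ℝ} (hω : 0 < ω) (hω' : 0 < ω') :
    mft g (ω • (sec n).1 + ω' • (sec n').1) = 0 := by
  by_contra hE
  set E := mft g (ω • (sec n).1 + ω' • (sec n').1) with hEdef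
  have hE2 : 0 < ‖E‖ / 2 := half_pos (norm_pos_iff.2 hE)
  have hc : Continuous fun z : (ℝ × Mink) × (ℝ × Mink) => mft g (z.1.1 • z.1.2 + z.2.1 • z.2.2) :=
    (continuous_mft hg).comp (by fun_prop)
  obtain ⟨ρ, hρ, hball⟩ := Metric.continuous_iff.1 hc ((ω, (sec n).1), (ω', (sec n').1)) _ hE2
  have hdist := dist_pos.2 hnn
  obtain ⟨δ, hδ, h1, h2, h3, h4⟩ : ∃ δ > 0, δ ≤ ρ ∧ δ ≤ ω ∧ δ ≤ ω' ∧
      δ + δ ≤ dist (sec n).1 (sec n').1 := by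
    refine ⟨min (min ρ (min ω ω')) (dist (sec n).1 (sec n').1 / 2), by positivity, ?_, ?_, ?_, ?_⟩
    · exact (min_le_left _ _).trans (min_le_left _ _)
    · exact (min_le_left _ _).trans ((min_le_right _ _).trans (min_le_left _ _))
    · exact (min_le_left _ _).trans ((min_le_right _ _).trans (min_le_right _ _))
    · linarith [min_le_right (min ρ (min ω ω')) (dist (sec n).1 (sec n').1 / 2)]
  obtain ⟨b, hb, hC, h0, hz, hne⟩ := exists_frequency_bump hδ h2
  obtain ⟨b', hb', hC', h0', hz', hne'⟩ := exists_frequency_bump hδ h3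
  have hB : MeasurableSet (Metric.ball (sec n).1 δ) := measurableSet_ball
  have hB' : MeasurableSet (Metric.ball (sec n').1 δ) := measurableSet_ball
  have hk := packet_mem_kerP hb hC hB h0
  have hk' := packet_mem_kerP hb' hC' hB' h0'
  have hprod := h.prod_eq_zero hg hk hk' (FKer_packet_of_disjoint hb hC hB hb' hC' hB'
    (Metric.ball_disjoint_ball h4))
  have hsupp : ∀ {b : ℝ → ℝ} (hb : Continuous b) (hC : ∃ C, ∀ s, |b s| ≤ C / (1 + |s|) ^ 2)
      {m : S2} {o : ℝ} (hB : MeasurableSet (Metric.ball (sec m).1 δ))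
      (_ : ∀ w, 0 < w → δ ≤ |w - o| → ft b w = 0) (q : S2 × ℝ), 0 < q.2 →
      FKer (packet hb hC hB) (packet hb hC hB) q ≠ 0 → dist (q.2, (sec q.1).1) (o, (sec m).1) < δ := by
    intro b hb hC m o hB hz q hq hF
    rw [FKer_packet_self, Complex.ofReal_ne_zero] at hF
    obtain ⟨hF1, hF2⟩ := mul_ne_zero_iff.1 hF
    rw [Prod.dist_eq]
    have hmem : (sec q.1).1 ∈ Metric.ball (sec m).1 δ := Set.mem_of_indicator_ne_zero hF1
    refine max_lt ?_ hmem
    by_contra! hlt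
    rw [hz q.2 hq hlt] at hF2
    simp at hF2
  refine hE (eq_zero_of_integral_prod (FKer_integrable hk hk) (FKer_integrable hk' hk')
    (Φ := fun q q' => mft g (mom q + mom q')) ?_ (fun q q' => norm_mft_le g _) ?_ hprod
    (integral_FKer_self _) (integral_FKer_self _)
    (integral_norm_FKer_packet_pos hb hC hB h0 Metric.isOpen_ball (Metric.mem_ball_self hδ) hn hδ
      h2 hne)
    (integral_norm_FKer_packet_pos hb' hC' hB' h0' Metric.isOpen_ball (Metric.mem_ball_self hδ) hn'
      hδ h3 hne'))
  · exact (continuous_mft hg).measurable.comp ((measurable_mom.comp measurable_fst).add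
      (measurable_mom.comp measurable_snd))
  · filter_upwards [Measure.quasiMeasurePreserving_fst.ae ae_dlw_pos,
      Measure.quasiMeasurePreserving_snd.ae ae_dlw_pos] with z hz1 hz2 hF hF'
    rw [← dist_eq_norm, dist_comm]
    refine (hball ((z.1.2, (sec z.1.1).1), (z.2.2, (sec z.2.1).1)) ?_).le
    rw [Prod.dist_eq]
    exact max_lt ((hsupp hb hC hB hz _ hz1 hF).trans_le h1)
      ((hsupp hb' hC' hB' hz' _ hz2 hF').trans_le h1)

theorem exists_eq_sum_null {q : Mink} (h0 : 0 < q 0) (hq : 0 < η q q) (h12 : q 1 ≠ 0 ∨ q 2 ≠ 0) :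
    ∃ (n n' : S2) (ω ω' : ℝ), 0 < ω ∧ 0 < ω' ∧ (sec n).1 ≠ (sec n').1 ∧
      ((sec n).1 1 ≠ 0 ∨ (sec n).1 2 ≠ 0) ∧ ((sec n').1 1 ≠ 0 ∨ (sec n').1 2 ≠ 0) ∧
      q = ω • (sec n).1 + ω' • (sec n').1 := by
  have hρ2 : 0 < q 1 ^ 2 + q 2 ^ 2 := by
    rcases h12 with h | h
    · have := sq_pos_of_ne_zero h; positivity
    · have := sq_pos_of_ne_zero h; positivity
  set ρ := √(q 1 ^ 2 + q 2 ^ 2) with hρdef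
  have hρ : 0 < ρ := Real.sqrt_pos.2 hρ2
  have hρs : ρ ^ 2 = q 1 ^ 2 + q 2 ^ 2 := Real.sq_sqrt hρ2.le
  have hη : η q q = q 0 ^ 2 - (q 1 ^ 2 + q 2 ^ 2) - q 3 ^ 2 := by rw [η]; ring
  obtain ⟨n, hn⟩ := exists_eq_smul_sec ⟨![ρ, -q 2, q 1, 0], by
    refine ⟨hρ, ?_⟩
    simp only [η, Matrix.cons_val]
    nlinarith⟩
  have n1 : -q 2 = ρ * (sec n).1 1 := congrFun hn 1
  have n2 : q 1 = ρ * (sec n).1 2 := congrFun hn 2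
  have n3 : 0 = ρ * (sec n).1 3 := congrFun hn 3
  have n0 := sec_zero n
  have nn := (sec n).2.2
  set s := (sec n).1 with hs
  have hperp : q 1 * s 1 + q 2 * s 2 = 0 := by
    have : ρ * (q 1 * s 1 + q 2 * s 2) = 0 := by
      calc _ = q 1 * (ρ * s 1) + q 2 * (ρ * s 2) := by ring
        _ = _ := by rw [← n1, ← n2]; ring
    exact (mul_eq_zero.1 this).resolve_left hρ.ne'
  have hqs : η q s = q 0 := by
    have h3 : s 3 = 0 := (mul_eq_zero.1 n3.symm).resolve_left hρ.ne'
    rw [η, n0, h3]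
    linarith
  set ω := η q q / (2 * q 0) with hωdef
  have hω : 0 < ω := by positivity
  have hω0 : 2 * q 0 * ω = η q q := by rw [hωdef]; field_simp
  have hωlt : ω < q 0 := by
    have : η q q ≤ q 0 ^ 2 := by rw [hη]; nlinarith [sq_nonneg (q 3)]
    nlinarith
  obtain ⟨n', hn'⟩ := exists_eq_smul_sec ⟨q - ω • s, by
    refine ⟨?_, ?_⟩
    · simp only [Pi.sub_apply, Pi.smul_apply, smul_eq_mul, n0]; linarith
    · have e : q - ω • s = q + (-ω) • s := by module
      rw [e]
      simp only [η_add_left, η_add_right, η_smul_left, η_smul_right, nn, hqs, η_comm s q]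
      linarith⟩
  have hω' : (q - ω • s) 0 = q 0 - ω := by simp [n0]
  simp only [hω'] at hn'
  have m1 : q 1 - ω * s 1 = (q 0 - ω) * (sec n').1 1 := congrFun hn' 1
  have m2 : q 2 - ω * s 2 = (q 0 - ω) * (sec n').1 2 := congrFun hn' 2
  have hdot : (q 0 - ω) * (q 1 * (sec n').1 1 + q 2 * (sec n').1 2) = q 1 ^ 2 + q 2 ^ 2 := by
    calc _ = q 1 * ((q 0 - ω) * (sec n').1 1) + q 2 * ((q 0 - ω) * (sec n').1 2) := by ring
      _ = q 1 ^ 2 + q 2 ^ 2 - ω * (q 1 * s 1 + q 2 * s 2) := by rw [← m1, ← m2]; ring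
      _ = _ := by rw [hperp, mul_zero, sub_zero]
  refine ⟨n, n', ω, q 0 - ω, hω, by linarith, fun h => ?_, ?_, ?_, ?_⟩
  · rw [← h, ← hs, hperp, mul_zero] at hdot
    exact hρ2.ne hdot
  · by_contra! hc
    rw [show s 1 = 0 from hc.1, mul_zero] at n1
    rw [show s 2 = 0 from hc.2, mul_zero] at n2
    rw [n2, neg_eq_zero.1 n1] at hρ2
    norm_num at hρ2
  · by_contra! hc
    rw [hc.1, hc.2, mul_zero, mul_zero, add_zero, mul_zero] at hdot
    exact hρ2.ne hdot
  · rw [← hn', add_sub_cancel]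

theorem VacuumRelation.mft_eq_zero_of_mem {g : Mink → ℂ} (h : VacuumRelation g)
    (hg : Integrable g) {q : Mink} (hq : q ∈ closedForwardCone) : mft g q = 0 := by
  obtain ⟨h0, hη⟩ := hq
  obtain ⟨σ, hσ, hσ1⟩ : ∃ σ : ℝ, 0 ≤ q 1 * σ ∧ σ ^ 2 = 1 := by
    rcases le_total 0 (q 1) with h | h
    · exact ⟨1, by linarith, by norm_num⟩
    · exact ⟨-1, by linarith, by norm_num⟩
  have hσq : q 1 * σ ≤ q 0 := by
    have h1 : (q 1 * σ) ^ 2 ≤ q 0 ^ 2 := by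
      rw [mul_pow, hσ1]
      have : η q q = q 0 ^ 2 - q 1 ^ 2 - q 2 ^ 2 - q 3 ^ 2 := by rw [η]; ring
      nlinarith [sq_nonneg (q 2), sq_nonneg (q 3)]
    exact le_of_sq_le_sq h1 h0
  let v : Mink := ![2, σ, 0, 0]
  have hv : ∀ ε : ℝ, 0 < ε → mft g (q + ε • v) = 0 := by
    intro ε hε
    have e0 : (q + ε • v) 0 = q 0 + ε * 2 := rfl
    have e1 : (q + ε • v) 1 = q 1 + ε * σ := rfl
    have hpos : 0 < η (q + ε • v) (q + ε • v) := by
      have hqv : η q v = 2 * q 0 - q 1 * σ := by simp [η, v]; ring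
      have hvv : η v v = 3 := by simp [η, v]; nlinarith
      simp only [η_add_left, η_add_right, η_smul_left, η_smul_right, hvv, hqv, η_comm v q]
      have : 0 ≤ ε * (2 * q 0 - q 1 * σ) := mul_nonneg hε.le (by linarith)
      nlinarith [mul_pos hε hε]
    obtain ⟨n, n', ω, ω', hω, hω', hnn, hn, hn', e⟩ := exists_eq_sum_null (by rw [e0]; linarith)
      hpos (Or.inl (by
        intro hc
        have : (q 1 + ε * σ) * σ = 0 := by rw [← e1, hc, zero_mul]
        nlinarith))
    rw [e]
    exact h.mft_eq_zero hg hnn hn hn' hω hω'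
  have hc : Continuous fun ε : ℝ => mft g (q + ε • v) := (continuous_mft hg).comp (by fun_prop)
  have hlim : Tendsto (fun ε : ℝ => mft g (q + ε • v)) (𝓝[>] 0) (𝓝 (mft g q)) := by
    have := hc.tendsto 0
    rw [zero_smul, add_zero] at this
    exact this.mono_left nhdsWithin_le_nhds
  refine tendsto_nhds_unique hlim (tendsto_const_nhds.congr' ?_)
  filter_upwards [self_mem_nhdsWithin] with ε hε
  exact (hv ε hε).symm

theorem spectrum_Ur (h : Profile) {μ : Measure HIR} [SigmaFinite μ] (hμ : μ ≠ 0) :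
    energyMomentumSpectrum (Ur h μ) = closedForwardCone := by
  refine Set.Subset.antisymm (spectrum_Ur_subset h) fun q hq g hg hz => ?_
  have hv : VacuumRelation g := fun u v hu hv => vacuum_relation h hμ hg hz hu hv
  exact hv.mft_eq_zero_of_mem hg hq

end IRQED
end

theorem mainTheorem3 (e : ℝ) (he : 0 < e) (h : Profile) (μ : MeasureTheory.Measure HIR)
    [MeasureTheory.SigmaFinite μ] (hμ : μ ≠ 0) (hq : QuasiInvariant μ) :
    (∃! π : CCR e →⋆ₐ[ℂ] (DirectIntegral h μ →L[ℂ] DirectIntegral h μ), ActsBy h μ π) ∧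
    (∃! U : Mink → DirectIntegral h μ →L[ℂ] DirectIntegral h μ, ActsFibrewise h μ U) ∧
    ∀ (π : CCR e →⋆ₐ[ℂ] (DirectIntegral h μ →L[ℂ] DirectIntegral h μ))
      (U : Mink → DirectIntegral h μ →L[ℂ] DirectIntegral h μ),
      ActsBy h μ π → ActsFibrewise h μ U →
        SatisfiesBorchers π ∧ IsTranslationRep U ∧ Implements π U ∧
          energyMomentumSpectrum U = closedForwardCone :=
  ⟨existsUnique_actsBy h hq, existsUnique_actsFibrewise h, fun _ _ hπ hU =>
    (eq_Ur h hU).symm ▸ ⟨⟨Ur h μ, Ur_isTranslationRep h, spectrum_Ur_subset h,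
      implements_Ur h hq hπ⟩, Ur_isTranslationRep h, implements_Ur h hq hπ, spectrum_Ur h hμ⟩⟩
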